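/- **Setting.** Let $s_1,s_2>0$ and let ${\bf y}_1(t),{\bf y}_2(t)$ be smooth trajectories in $\mathbb R^3$ with velocities ${\bf v}_1(t),{\bf v}_2(t)$. Let $\mathcal F$ be the class of functions $F({\bf x},t;{\bf y}_1,{\bf y}_2)$ that are smooth where ${\bf y}_1\neq{\bf y}_2$ and ${\bf x}\neq{\bf y}_1,{\bf y}_2$ and that have, with $r_j=|{\bf x}-{\bf y}_j|$ and ${\bf n}_j=({\bf x}-{\bf y}_j)/r_j$, for $j=1,2$ and every $N$, an expansion $F=\sum_{a_0\le a\le N}r_j^a\,{}_jf_a({\bf n}_j;t,{\bf y}_1,{\bf y}_2)+o(r_j^N)$ in integer powers of $r_j$ as $r_j\to0$, where ${}_jf_a$ is smooth and the expansion may be differentiated any number of times in all variables, locally uniformly in $(t,{\bf y}_1,{\bf y}_2)$: the $m$-th derivatives of the remainder are $o(r_j^{N-m})$. Put ${}_j\hat f_a^L=\frac{(2l+1)!!}{l!}\int\frac{d\Omega}{4\pi}\hat n^L{}_jf_a({\bf n})$ for $L=i_1\cdots i_l$, where $n^L=n^{i_1}\cdots n^{i_l}$ and $\hat n^L$ is its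 symmetric trace-free projection. Let $(F)_j=\int\frac{d\Omega}{4\pi}\,{}_jf_0({\bf n})$, let $\langle{\rm Pf}(H\delta_j),G\rangle=(HG)_j$, and let $\langle{\rm Pf}F,G\rangle={\rm Pf}_{s_1,s_2}\int d^3{\bf x}\,FG$ be the Hadamard partie finie, that is, the limit as $s\to0^+$ of $$\int_{r_1>s,\,r_2>s}d^3{\bf x}\,FG+\sum_{j=1,2}\Big[\sum_{a+3<0}\tfrac{s^{a+3}}{a+3}\int d\Omega\,{}_jh_a+\ln\big(\tfrac s{s_j}\big)\int d\Omega\,{}_jh_{-3}\Big],$$ ${}_jh_a$ being the coefficients of $H=FG$. Brackets $\langle{\rm Pf}F,G\rangle$ are taken for pairs $F,G\in\mathcal F$ such that all products of a derivative of $F$ and a derivative of $G$ are $O(|{\bf x}|^{-3-\epsilon})$ at infinity for some $\epsilon>0$, locally uniformly in $(t,{\bf y}_1,{\bf y}_2)$. Write $\partial_i=\partial/\partial x^i$, ${}_j\partial_i=\partial/\partial y_j^i$, and let $\partial_t$ be the total time derivative (explicit time derivative plus $v_1^i\,{}_1\partial_i+v_2^i\,{}_2\partial_i$). A family of distributional derivatives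 for a set of such elementary derivatives $\partial_a$ assigns to every word $L$ in them distributional terms ${\rm D}_L[F]$, with ${\rm D}_\emptyset=0$, and puts $\partial_L({\rm Pf}F)={\rm Pf}(\partial_LF)+{\rm D}_L[F]$. It satisfies the rule of integration by parts if for every word $L$ and every $a$ in the set $$\langle\partial_a\partial_L({\rm Pf}F),G\rangle+\langle\partial_L({\rm Pf}F),\partial_a({\rm Pf}G)\rangle=\partial_a\big[\langle\partial_L({\rm Pf}F),G\rangle\big],$$ where the bracket on the right is required to be differentiable (its derivative is zero for $\partial_a=\partial_i$), and $\langle\partial_L({\rm Pf}F),\partial_a({\rm Pf}G)\rangle={\rm Pf}\int d^3{\bf x}\,\partial_LF\,\partial_aG+\langle{\rm D}_L[F],\partial_aG\rangle+\langle{\rm D}_a[G],\partial_LF\rangle$. It commutes if ${\rm D}_L$ does not depend on the order of the letters of $L$. A first-order term is *of singular form* if $\langle{\rm D}_a[F],G\rangle$ is a sum over $j=1,2$ and $k\ge0$ of bilinear forms, which may depend on $(t,{\bf y}_1,{\bf y}_2)$, in the pairs $({}_jf_{-1-k},{}_jg_{k-1})$, that is, it depends only on the singular coefficients of $F$, is supported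 at the two points and has the correct dimension. A vectorial term ${\rm D}_i$ is *isotropic at the points of $J\subset\{1,2\}$* if $${\rm D}_i[F]=\sum_{j\in J}\sum_{k\ge0}\sum_{l\ge0}{\rm Pf}\Big(\big[\alpha^j_{k,l}\,\hat n_j^{iL}{}_j\hat f_{-1-k}^L+\beta^j_{k,l}\,n_j^L{}_j\hat f_{-1-k}^{iL}\big]r_j^{1-k}\delta_j\Big)$$ with purely numerical coefficients, the series over $l$ being summable against every $G\in\mathcal F$. Finally, with $C_l=(l+1)\big[K+\sum_{m=1}^l\frac1{m+1}\big]$, put $${}^{(j)}{\rm D}^K_i[F]=4\pi\sum_{l=0}^{\infty}{\rm Pf}\Big(C_l\big[n_j^{iL}{}_j\hat f_{-1}^L-n_j^L{}_j\hat f_{-1}^{iL}\big]r_j\delta_j+\sum_{k\ge0}\frac{n_j^{iL}}{r_j^k}{}_j\hat f_{-2-k}^L\,\delta_j\Big).$$ **Proposition 6.** For all $F,G\in\mathcal F$ the series over $l$ defining $\langle{}^{(j)}{\rm D}^K_i[F],G\rangle$ is summable, and the following hold. (a) Let $j\in\{1,2\}$. If a family of distributional derivatives for ${}_j\partial_1,{}_j\partial_2,{}_j\partial_3$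 has first-order terms ${}_j{\rm D}_i$ that are isotropic at the point $j$, satisfies the rule of integration by parts and commutes, then there is a constant $K$ with $${}_j\partial_i({\rm Pf}F)={\rm Pf}({}_j\partial_iF)+{}_j{\rm D}_i[F],\qquad{}_j{\rm D}_i[F]=-{}^{(j)}{\rm D}^K_i[F].$$ Conversely, for every $K$ there is such a family. (b) Suppose that a family of distributional derivatives for all of $\partial_i,{}_1\partial_i,{}_2\partial_i,\partial_t$ satisfies the rule of integration by parts and commutes (mixed derivatives included), that its terms ${\rm D}_i$ are isotropic at the points $1,2$, and that ${}_1{\rm D}_i,{}_2{\rm D}_i,{\rm D}_t$ are of singular form. Then there are constants $K_1,K_2$ with $${\rm D}_i={}^{(1)}{\rm D}_i^{K_1}+{}^{(2)}{\rm D}_i^{K_2},\qquad{}_1{\rm D}_i=-{}^{(1)}{\rm D}_i^{K_1},\qquad{}_2{\rm D}_i=-{}^{(2)}{\rm D}_i^{K_2},$$ so that ${}_j{\rm D}_i$ is minus the point-$j$ part of ${\rm D}_i$, and $$\partial_t({\rm Pf}F)={\rm Pf}(\partial_tF)+v_1^i\,{}_1{\rm D}_i[F]+v_2^i\,{}_2{\rm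 D}_i[F].$$ Conversely, for all constants $K_1,K_2$ there is such a family. -/

import Mathlib

open Set Filter Topology MeasureTheory Asymptotics
open scoped ContDiff Nat

noncomputable section

namespace Hadamard

/-- Three-dimensional Euclidean space. -/
abbrev E3 := EuclideanSpace ℝ (Fin 3)

/-- The unit sphere of directions. -/
abbrev S2 := Metric.sphere (0 : E3) 1

/-- The parameters `(t, y₁, y₂)`: the time and the two source points. -/
abbrev Param := ℝ × E3 × E3

/-- Functions `F(x, t; y₁, y₂)`.  The dependence on the velocities is carried by `t`. -/
abbrev Fun := E3 × Param → ℝ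

/-- The position of the source point number `j` (the index `0` is point 1, the index `1` is
point 2). -/
def pos (j : Fin 2) (p : Param) : E3 := if j = 0 then p.2.1 else p.2.2

/-- The parameters with distinct source points. -/
def Par : Set Param := {p | pos 0 p ≠ pos 1 p}

/-- The configurations with distinct source points and with the field point off both of them. -/
def Reg : Set (E3 × Param) := {c | c.2 ∈ Par ∧ ∀ j, c.1 ≠ pos j c.2}

/-- `r_j = |x - y_j|`. -/
def rad (j : Fin 2) (c : E3 × Param) : ℝ := ‖c.1 - pos j c.2‖

/-- `n_j = (x - y_j) / r_j`. -/
def dir (j : Fin 2) (c : E3 × Param) : E3 := (rad j c)⁻¹ • (c.1 - pos j c.2)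

/-! ### The class of singular functions -/

/-- The `f_a` are the coefficients of an expansion `F = ∑ r_j ^ a f_a(n_j) + o(r_j ^ N)` in integer
powers of `r_j`, bounded from below, when `r_j → 0`.  The coefficients are smooth in the direction
and in the parameters, and the expansion may be differentiated any number of times, locally
uniformly in the parameters. -/
def IsExpansion (j : Fin 2) (F : Fun) (f : ℤ → E3 × Param → ℝ) : Prop :=
  ∃ a₀ : ℤ, (∀ a < a₀, ∀ z, f a z = 0) ∧
    (∀ a, ContDiffOn ℝ ∞ (f a) ({0}ᶜ ×ˢ Par)) ∧
    ∀ (N : ℤ) (m : ℕ), ∀ p₀ ∈ Par,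
      (fun c => iteratedFDeriv ℝ m
          (fun c : E3 × Param =>
            F c - ∑ a ∈ Finset.Icc a₀ N, rad j c ^ a * f a (dir j c, c.2)) c)
        =o[𝓝[Reg] (pos j p₀, p₀)] fun c => rad j c ^ (N - m)

/-- The class `𝓕` of functions that are smooth off the two source points and have a singular
expansion at each of them. -/
def InF (F : Fun) : Prop := ContDiffOn ℝ ∞ F Reg ∧ ∀ j, ∃ f, IsExpansion j F f

open Classical in
/-- The coefficient of `r_j ^ a` in the expansion of `F` at the source point `j`, as a function of
the direction. -/
def coef (j : Fin 2) (F : Fun) (a : ℤ) (p : Param) (n : S2) : ℝ :=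
  if h : ∃ f, IsExpansion j F f then h.choose a (n, p) else 0

/-- Integral over the solid angle `∫ dΩ g(n)`. -/
def angInt (g : S2 → ℝ) : ℝ := ∫ n, g n ∂(volume : Measure E3).toSphere

/-- Angular average `∫ dΩ / 4π g(n)`. -/
def angMean (g : S2 → ℝ) : ℝ := (4 * Real.pi)⁻¹ * angInt g

/-- The Hadamard partie finie `(F)_j` of `F` at the source point `j`. -/
def pfValue (j : Fin 2) (F : Fun) (p : Param) : ℝ := angMean (coef j F 0 p)

/-- The Hadamard partie finie `Pf ∫ d³x F` with length scales `s₁`, `s₂`. -/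
def pfInt (s : Fin 2 → ℝ) (F : Fun) (p : Param) : ℝ :=
  limUnder (𝓝[>] (0 : ℝ)) fun ρ =>
    (∫ x in {x : E3 | ∀ j, ρ < rad j (x, p)}, F (x, p)) +
      ∑ j, ((∑ᶠ (a : ℤ) (_ : a + 3 < 0),
          ρ ^ (a + 3) / ((a : ℝ) + 3) * angInt (coef j F a p)) +
        Real.log (ρ / s j) * angInt (coef j F (-3) p))

/-- The bracket `⟨Pf (H δ_j), G⟩ = (H G)_j`. -/
def deltaPf (j : Fin 2) (H G : Fun) (p : Param) : ℝ := pfValue j (H * G) p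

/-! ### Ordinary derivatives -/

/-- The names of the elementary derivatives: `∂_i` with respect to the field point, `_j∂_i` with
respect to the source point `j`, and the total time derivative `∂_t`. -/
inductive Letter where
  | x (i : Fin 3)
  | y (j : Fin 2) (i : Fin 3)
  | t

/-- The standard basis of space. -/
def ex (i : Fin 3) : E3 := EuclideanSpace.single i 1

/-- How the field point moves under an elementary derivative. -/
def Letter.fieldDir : Letter → E3
  | .x i => ex i
  | .y _ _ => 0
  | .t => 0

/-- How the parameters move under an elementary derivative; `v j` is the velocity of the source
point `j` as a function of time.  In the case of `∂_t` this is the total derivative, in which the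
source points move with their velocities. -/
def Letter.paramDir (v : Fin 2 → ℝ → E3) : Letter → Param → Param
  | .x _, _ => 0
  | .y j i, _ => if j = 0 then (0, ex i, 0) else (0, 0, ex i)
  | .t, p => (1, v 0 p.1, v 1 p.1)

/-- The ordinary derivative `∂_a F`, off the source points. -/
def pd (v : Fin 2 → ℝ → E3) (a : Letter) (F : Fun) : Fun :=
  fun c => fderiv ℝ F c (a.fieldDir, a.paramDir v c.2)

/-- The ordinary multi-derivative `∂_{a₁} ∂_{a₂} ⋯ ∂_{a_l} F`. -/
def pds (v : Fin 2 → ℝ → E3) (L : List Letter) (F : Fun) : Fun := L.foldr (pd v) F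

/-- The derivative of a function of the time and of the source points only. -/
def pdParam (v : Fin 2 → ℝ → E3) (a : Letter) (g : Param → ℝ) : Param → ℝ :=
  fun p => fderiv ℝ g p (a.paramDir v p)

/-- The product `F G` and all products of derivatives of `F` and `G` decrease at infinity faster
than `|x| ^ (-3)`, locally uniformly in the parameters. -/
def DecayPair (v : Fin 2 → ℝ → E3) (F G : Fun) : Prop :=
  ∀ L M : List Letter, ∀ p₀ ∈ Par, ∃ ε > 0, ∃ C R : ℝ, ∀ᶠ p in 𝓝 p₀, ∀ x : E3, R ≤ ‖x‖ →
    |pds v L F (x, p) * pds v M G (x, p)| ≤ C * ‖x‖ ^ (-3 - ε : ℝ)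

/-! ### Derivatives of pseudo-functions

A family `D` of distributional terms gives the multi-derivatives
`∂_L (Pf F) = Pf (∂_L F) + D_L[F]`; the number `D L F G p` is `⟨D_L[F], G⟩` at the parameters `p`. -/

/-- Distributional terms, indexed by the multi-derivatives. -/
abbrev DistTerms := List Letter → Fun → Fun → Param → ℝ

/-- `⟨∂_L (Pf F), G⟩`, where `∂_L (Pf F) = Pf (∂_L F) + D_L[F]`. -/
def bracket (s : Fin 2 → ℝ) (v : Fin 2 → ℝ → E3) (D : DistTerms) (L : List Letter) (F G : Fun)
    (p : Param) : ℝ :=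
  pfInt s (pds v L F * G) p + D L F G p

/-- `⟨∂_L (Pf F), ∂_a (Pf G)⟩`; the bracket of two distributional terms is zero. -/
def bracket₂ (s : Fin 2 → ℝ) (v : Fin 2 → ℝ → E3) (D : DistTerms) (L : List Letter) (F : Fun)
    (a : Letter) (G : Fun) (p : Param) : ℝ :=
  pfInt s (pds v L F * pd v a G) p + D L F (pd v a G) p + D [a] G (pds v L F) p

/-- All multi-derivatives built from the elementary derivatives in `A` satisfy the rule of
integration by parts, and they commute. -/
structure IsDerivativeSystem (s : Fin 2 → ℝ) (v : Fin 2 → ℝ → E3) (A : Set Letter)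
    (D : DistTerms) : Prop where
  /-- The derivative of order zero of `Pf F` is `Pf F`. -/
  nil : ∀ F G p, D [] F G p = 0
  /-- `⟨∂_a ∂_L (Pf F), G⟩ + ⟨∂_L (Pf F), ∂_a (Pf G)⟩ = ∂_a [⟨∂_L (Pf F), G⟩]`. -/
  byParts : ∀ a ∈ A, ∀ L : List Letter, (∀ b ∈ L, b ∈ A) → ∀ F G, InF F → InF G →
    DecayPair v F G → ∀ p ∈ Par,
      DifferentiableAt ℝ (bracket s v D L F G) p ∧
        bracket s v D (a :: L) F G p + bracket₂ s v D L F a G p =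
          pdParam v a (bracket s v D L F G) p
  /-- The distributional terms do not depend on the order of the derivatives. -/
  comm : ∀ L L' : List Letter, (∀ b ∈ L, b ∈ A) → L.Perm L' → ∀ F G, InF F → InF G →
    DecayPair v F G → ∀ p ∈ Par, D L F G p = D L' F G p

/-! ### Symmetric trace-free tensors -/

/-- Tensors with `l` indices. -/
abbrev Tensor (l : ℕ) := EuclideanSpace ℝ (Fin l → Fin 3)

/-- The symmetric trace-free tensors. -/
def stf (l : ℕ) : Submodule ℝ (Tensor l) where
  carrier := {T | (∀ (σ : Equiv.Perm (Fin l)) (L : Fin l → Fin 3), T (L ∘ σ) = T L) ∧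
    ∀ a b : Fin l, a ≠ b → ∀ L : Fin l → Fin 3,
      ∑ i, T (Function.update (Function.update L a i) b i) = 0}
  add_mem' := by
    rintro S T ⟨h₁, h₂⟩ ⟨h₃, h₄⟩
    refine ⟨fun σ L => by simp [h₁ σ L, h₃ σ L], fun a b hab L => ?_⟩
    simp only [PiLp.add_apply, Finset.sum_add_distrib, h₂ a b hab L, h₄ a b hab L, add_zero]
  zero_mem' := by simp
  smul_mem' := by
    rintro r T ⟨h₁, h₂⟩
    refine ⟨fun σ L => by simp [h₁ σ L], fun a b hab L => ?_⟩
    simp only [PiLp.smul_apply, smul_eq_mul, ← Finset.mul_sum, h₂ a b hab L, mul_zero]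

/-- `n^L = n^{i₁} ⋯ n^{i_l}`. -/
def nTensor (l : ℕ) (n : E3) : Tensor l := WithLp.toLp 2 fun L => ∏ k, n (L k)

/-- The symmetric trace-free projection of `n^L`. -/
def nHat (l : ℕ) (n : E3) : Tensor l := (stf l).starProjection (nTensor l n)

/-- The symmetric trace-free components
`f̂_a^L = (2l+1)!!/l! ∫ dΩ/4π n̂^L f_a(n)` of the coefficient `f_a` at the source point `j`. -/
def fHat (j : Fin 2) (F : Fun) (a : ℤ) (p : Param) (l : ℕ) (L : Fin l → Fin 3) : ℝ :=
  ((2 * l + 1)‼ : ℝ) / (l ! : ℝ) * angMean fun n => nHat l n L * coef j F a p n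

/-! ### Dependence on the singular coefficients -/

/-- A first-order distributional term `F ↦ T[F]` depends only on the singular coefficients `f_{-1-k}`,
`k ≥ 0`, at each source point and has the correct dimension: it is linear, supported at the source
points, and `f_{-1-k}` comes with `r_j ^ (1-k) δ_j`, that is, it is paired with the coefficient
`g_{k-1}` of the function `G` on which the term acts. -/
def SingularForm (T : Fun → Fun → Param → ℝ) : Prop :=
  ∃ b : Fin 2 → ℕ → Param → (S2 → ℝ) →ₗ[ℝ] (S2 → ℝ) →ₗ[ℝ] ℝ,
    ∀ F G, InF F → InF G → ∀ p ∈ Par,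
      T F G p = ∑ j, ∑ᶠ k : ℕ, b j k p (coef j F (-1 - k) p) (coef j G (k - 1) p)

/-- `[α n̂^{iL} f̂_{-1-k}^L + β n^L f̂_{-1-k}^{iL}] r_j ^ (1-k)`. -/
def isoFun (α β : ℝ) (j : Fin 2) (i : Fin 3) (k l : ℕ) (F : Fun) : Fun := fun c =>
  (α * ∑ L : Fin l → Fin 3, nHat (l + 1) (dir j c) (Fin.cons i L) * fHat j F (-1 - k) c.2 l L +
    β * ∑ L : Fin l → Fin 3,
      nTensor l (dir j c) L * fHat j F (-1 - k) c.2 (l + 1) (Fin.cons i L)) *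
    rad j c ^ (1 - k : ℤ)

/-- The first-order distributional terms `T_i[F]` of a vectorial derivative operator are supported at
the source points in `J`, where they depend only on the singular coefficients, have the
correct dimension, and are built without any preferred direction or scale:
`T_i[F] = ∑_k ∑_l Pf ([α_{k,l} n̂^{iL} f̂_{-1-k}^L + β_{k,l} n^L f̂_{-1-k}^{iL}] r_j ^ (1-k) δ_j)`,
with purely numerical coefficients, summed over the points of `J`. -/
def IsotropicForm (J : Finset (Fin 2)) (T : Fin 3 → Fun → Fun → Param → ℝ) : Prop :=
  ∃ α β : Fin 2 → ℕ → ℕ → ℝ, ∀ i F G, InF F → InF G → ∀ p ∈ Par,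
    (∀ j ∈ J, ∀ k, Summable fun l =>
      deltaPf j (isoFun (α j k l) (β j k l) j i k l F) G p) ∧
    T i F G p = ∑ j ∈ J, ∑ᶠ k : ℕ, ∑' l,
      deltaPf j (isoFun (α j k l) (β j k l) j i k l F) G p

/-! ### The explicit distributional terms -/

/-- `C_l = (l+1) [K + ∑_{m=1}^l 1/(m+1)]`. -/
def Ccoef (K : ℝ) (l : ℕ) : ℝ := (l + 1) * (K + ∑ m ∈ Finset.Icc 1 l, 1 / ((m : ℝ) + 1))

/-- `C_l [n^{iL} f̂_{-1}^L - n^L f̂_{-1}^{iL}] r_j + ∑_{k ≥ 0} n^{iL} f̂_{-2-k}^L r_j ^ (-k)`. -/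
def pointFun (K : ℝ) (j : Fin 2) (i : Fin 3) (l : ℕ) (F : Fun) : Fun := fun c =>
  Ccoef K l *
      (∑ L : Fin l → Fin 3, nTensor (l + 1) (dir j c) (Fin.cons i L) * fHat j F (-1) c.2 l L -
        ∑ L : Fin l → Fin 3, nTensor l (dir j c) L * fHat j F (-1) c.2 (l + 1) (Fin.cons i L)) *
      rad j c +
    ∑ᶠ k : ℕ, (∑ L : Fin l → Fin 3,
      nTensor (l + 1) (dir j c) (Fin.cons i L) * fHat j F (-2 - k) c.2 l L) * rad j c ^ (-k : ℤ)

/-- The part of the distributional term `D_i[F]` at the source point `j`, acting on `G`, with the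
arbitrary constant `K`. -/
def pointTerm (K : ℝ) (j : Fin 2) (i : Fin 3) (F G : Fun) (p : Param) : ℝ :=
  4 * Real.pi * ∑' l, deltaPf j (pointFun K j i l F) G p

end Hadamard

end

open Hadamard
open scoped ContDiff

/-! Everything reduces to the algebra of the expansion coefficients on the unit sphere. Writing `r_j
^ a f_a(n_j)` as `u_a(x - y_j)` with `u_a` homogeneous of degree `a` (`HExp`), the class is closed
under products and derivatives. The order `m` of `∂_a F` is the parameter derivative of `u_m` plus
the derivative of `u_{m+1}` along the displacement `d_j` of the field point relative to `y_j`
(`HExp.pd`). This displacement is `e_i` for `∂_i`, `-e_i` at the point `j` and `0` at the other one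
for `_j∂_i`, and `-v_j` for `∂_t`. The letters enter the singular terms only through it and through
their action on the parameters, so all of them are treated at once.

Differentiating a partie finie integral produces surface terms: `∂_a Pf∫ H` equals `Pf∫ ∂_a H` plus
the sum over `j` of the flux `∫ dΩ (d_j · n) h_{-2}` (`fderiv_pfInt`). Applied to a product this
turns the rule of integration by parts into conditions on the distributional terms alone
(`byParts_iff`). The part of `⟨D_a[F], G⟩` symmetric in `F` and `G` is forced to be half the surface
term (`IsDerivativeSystem.add_swap`). The terms of higher order follow from those of first order by
a recursion (`IsDerivativeSystem.cons_eq`), and commutation of two letters is a condition on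
first-order terms (`IsDerivativeSystem.comm_two`).

Multiplication by `n_i` couples only harmonics of adjacent degrees. An isotropic term is therefore a
sum of `α_{k,l} X_l(f_{-1-k}, g_{k-1}) + β_{k,l} X_l(g_{k-1}, f_{-1-k})`, where `X_l(f, g)` is the
average of `n_i f_l g_{l+1}` (`deltaPf_isoFun`). In units of `4π` times the sign of the
displacement, the conditions determine the weights as follows (`IsDerivativeSystem.weights`). If `k
≥ 1`, the coefficient `g_{k-1}` is regular, the exchanged term is absent, and integration by parts
gives `α = β = 1`. If `k = 0`, it only gives `α_l + β_l = 1`. Commutation, tested on a regular `F`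
whose gradient has order `-1`, adds `(l+2) α_l + (l+1) β_{l+1} = 0`. Hence `α_{l+1} = (l+2)/(l+1)
α_l + 1`, which is the recursion of `C_l`, with `K = α_0` free.

Conversely, the same recursion makes the explicit terms commute (`Rap.Q_grad_comm`,
`tform_grads_symm`, `firstTerm_comm`), and their symmetric part is the surface term
(`firstTerm_add_swap`). Defining the higher terms by the recursion gives the required family
(`isDerivativeSystem_derivSystem`).

Once the space derivatives are known, let `T` be the difference between another first-order term of
singular form and its candidate. Surface terms cancel, so `T(F, G) = -T(G, F)`, and commutation with
`∂_i` gives `T(∂_i F, G) = -T(F, ∂_i G)`. As `T` sees only singular coefficients of its first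
argument, the exchange kills all `k ≥ 1`. For `k = 0` it suffices that a function `f` of degree `-1`
satisfies `2 f = ∑ ∂_i (x_i f)`, a sum of derivatives of regular functions
(`SingularWeights.eq_zero`).

On the analytic side, the coefficients are smooth on the sphere, so two powers of `1 - Δ` may be
extracted from their harmonic components, which beats weights of quadratic growth. This gives
convergence of the series and, through a bounded bilinear map, smoothness in the parameters
(`isBoundedBilinearMap_Wd`, `fderiv_W`). -/

noncomputable section
namespace Hadamard

/-! ### Local analysis at a source point: symbols, homogeneous coefficients, expansions. -/

/-! ### Geometry of the configuration space -/

/-- The position of the source point `j` as a continuous linear map. -/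
def posL (j : Fin 2) : Param →L[ℝ] E3 :=
  if j = 0 then (ContinuousLinearMap.fst ℝ E3 E3).comp (ContinuousLinearMap.snd ℝ ℝ (E3 × E3))
  else (ContinuousLinearMap.snd ℝ E3 E3).comp (ContinuousLinearMap.snd ℝ ℝ (E3 × E3))

@[simp] lemma posL_apply (j : Fin 2) (p : Param) : posL j p = pos j p := by
  unfold posL pos; split_ifs <;> rfl

/-- The change of variables `(x, p) ↦ (x - y_j, p)`. -/
def relL (j : Fin 2) : E3 × Param →L[ℝ] E3 × Param :=
  (ContinuousLinearMap.fst ℝ E3 Param - (posL j).comp (ContinuousLinearMap.snd ℝ E3 Param)).prod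
    (ContinuousLinearMap.snd ℝ E3 Param)

@[simp] lemma relL_apply (j : Fin 2) (c : E3 × Param) : relL j c = (c.1 - pos j c.2, c.2) := by
  simp [relL]

/-- Nonzero vectors and admissible parameters. -/
def Dom : Set (E3 × Param) := {0}ᶜ ×ˢ Par

lemma mem_Dom {z : E3} {p : Param} : (z, p) ∈ Dom ↔ z ≠ 0 ∧ p ∈ Par := by simp [Dom]

lemma isOpen_Par : IsOpen Par := by
  have : Par = {p | posL 0 p ≠ posL 1 p} := by ext; simp [Par]
  rw [this]
  exact isOpen_ne_fun (posL 0).continuous (posL 1).continuous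

lemma isOpen_Dom : IsOpen Dom := isOpen_compl_singleton.prod isOpen_Par

lemma isOpen_Reg : IsOpen Reg := by
  have : Reg = (Prod.snd ⁻¹' Par) ∩ ⋂ j : Fin 2, {c : E3 × Param | c.1 ≠ posL j c.2} := by
    ext; simp [Reg]
  rw [this]
  refine (isOpen_Par.preimage continuous_snd).inter (isOpen_iInter_of_finite fun j => ?_)
  exact isOpen_ne_fun continuous_fst ((posL j).continuous.comp continuous_snd)

lemma relL_mem_Dom {j : Fin 2} {c : E3 × Param} (hc : c ∈ Reg) : relL j c ∈ Dom := by
  rw [relL_apply, mem_Dom]; exact ⟨sub_ne_zero.2 (hc.2 j), hc.1⟩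

lemma rad_pos {j : Fin 2} {c : E3 × Param} (hc : c ∈ Reg) : 0 < rad j c :=
  norm_pos_iff.2 (sub_ne_zero.2 (hc.2 j))

lemma continuous_rad (j : Fin 2) : Continuous (rad j) := by
  have : rad j = fun c => ‖(relL j c).1‖ := by ext; simp [rad]
  rw [this]; exact ((relL j).continuous.fst).norm

/-- The filter of the regular configurations close to the collision of the field point with the
source point `j`. -/
abbrev nh (j : Fin 2) (p : Param) : Filter (E3 × Param) := 𝓝[Reg] (pos j p, p)

lemma eventually_nh_mem (j : Fin 2) (p : Param) : ∀ᶠ c in nh j p, c ∈ Reg := self_mem_nhdsWithin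

lemma tendsto_rad (j : Fin 2) (p : Param) : Tendsto (rad j) (nh j p) (𝓝 0) := by
  have h : Tendsto (rad j) (𝓝 (pos j p, p)) (𝓝 (rad j (pos j p, p))) := (continuous_rad j).tendsto _
  rw [show rad j (pos j p, p) = 0 by simp [rad]] at h
  exact h.mono_left nhdsWithin_le_nhds

lemma eventually_rad_lt (j : Fin 2) (p : Param) {δ : ℝ} (hδ : 0 < δ) :
    ∀ᶠ c in nh j p, rad j c < δ := (tendsto_rad j p).eventually_lt_const hδ

lemma zpow_rad_isBigO (j : Fin 2) (p : Param) {k l : ℤ} (h : k ≤ l) :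
    (fun c => rad j c ^ l) =O[nh j p] fun c => rad j c ^ k := by
  refine IsBigO.of_bound 1 ?_
  filter_upwards [eventually_nh_mem j p, eventually_rad_lt j p one_pos] with c hc h1
  have h0 := rad_pos (j := j) hc
  rw [one_mul, Real.norm_of_nonneg (zpow_pos h0 _).le, Real.norm_of_nonneg (zpow_pos h0 _).le]
  exact zpow_le_zpow_right_of_le_one₀ h0 h1.le h

lemma zpow_rad_isLittleO (j : Fin 2) (p : Param) {k l : ℤ} (h : k < l) :
    (fun c => rad j c ^ l) =o[nh j p] fun c => rad j c ^ k := by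
  have h1 : (fun c => rad j c ^ (k + 1)) =o[nh j p] fun c => rad j c ^ k := by
    have h2 : (fun c => rad j c) =o[nh j p] fun _ => (1 : ℝ) :=
      (isLittleO_one_iff ℝ).2 (tendsto_rad j p)
    have h3 := h2.mul_isBigO (isBigO_refl (fun c => rad j c ^ k) (nh j p))
    refine h3.congr' ?_ (by filter_upwards with c using by simp)
    filter_upwards [eventually_nh_mem j p] with c hc
    rw [zpow_add_one₀ (rad_pos hc).ne', mul_comm]
  exact (zpow_rad_isBigO j p (by omega)).trans_isLittleO h1

/-- Rays reach the collision from every direction and stay regular near it, because the other source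
is at a positive distance. They convert an estimate along `nh` into a statement about one direction,
which is how `HExp.unique` isolates a coefficient. -/
lemma tendsto_ray (j : Fin 2) {z : E3} (hz : z ≠ 0) {p : Param} (hp : p ∈ Par) :
    Tendsto (fun ε : ℝ => (pos j p + ε • z, p)) (𝓝[>] 0) (nh j p) := by
  have hcont : Continuous fun ε : ℝ => (pos j p + ε • z, p) := by fun_prop
  have h0 : Tendsto (fun ε : ℝ => (pos j p + ε • z, p)) (𝓝[>] 0) (𝓝 (pos j p, p)) := by
    have := hcont.tendsto 0
    simp only [zero_smul, add_zero] at this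
    exact this.mono_left nhdsWithin_le_nhds
  refine tendsto_nhdsWithin_iff.2 ⟨h0, ?_⟩
  have hne : ∀ i, i ≠ j → pos j p ≠ pos i p := by
    intro i hi
    have : pos 0 p ≠ pos 1 p := hp
    fin_cases i <;> fin_cases j <;> simp_all [this.symm]
  have hev : ∀ i, i ≠ j → ∀ᶠ ε : ℝ in 𝓝[>] 0, pos j p + ε • z ≠ pos i p := by
    intro i hi
    have := (h0.fst_nhds).eventually_ne (hne i hi)
    exact this
  have hall : ∀ᶠ ε : ℝ in 𝓝[>] 0, ∀ i, i ≠ j → pos j p + ε • z ≠ pos i p := by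
    rw [eventually_all]; intro i
    by_cases hi : i = j
    · simp [hi]
    · filter_upwards [hev i hi] with ε h _ using h
  filter_upwards [hall, self_mem_nhdsWithin] with ε h hε
  refine ⟨hp, fun i => ?_⟩
  by_cases hi : i = j
  · subst hi
    have : ε • z ≠ 0 := smul_ne_zero (ne_of_gt hε) hz
    simpa using this
  · exact h i hi

/-! ### Symbol classes -/

section Symb
variable {V W U : Type} [NormedAddCommGroup V] [NormedSpace ℝ V] [NormedAddCommGroup W]
  [NormedSpace ℝ W] [NormedAddCommGroup U] [NormedSpace ℝ U]

/-- The functions that are smooth off the source points and whose `m`-th derivatives are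
`O(r_j ^ (k - m))`. -/
def Symb (j : Fin 2) (k : ℤ) (R : E3 × Param → V) : Prop :=
  ContDiffOn ℝ ∞ R Reg ∧ ∀ m : ℕ, ∀ p ∈ Par,
    (fun c => iteratedFDeriv ℝ m R c) =O[nh j p] fun c => rad j c ^ (k - m)

lemma contDiffAt_of_Reg {R : E3 × Param → V} (h : ContDiffOn ℝ ∞ R Reg) {c : E3 × Param}
    (hc : c ∈ Reg) (m : ℕ) : ContDiffAt ℝ m R c :=
  (h.contDiffAt (isOpen_Reg.mem_nhds hc)).of_le (by exact_mod_cast le_top)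

variable {j : Fin 2} {k l : ℤ} {R S : E3 × Param → V}

lemma Symb.mono (h : Symb j l R) (hk : k ≤ l) : Symb j k R :=
  ⟨h.1, fun m p hp => (h.2 m p hp).trans (zpow_rad_isBigO j p (by omega))⟩

lemma Symb.congr (h : Symb j k R) (hs : ∀ c ∈ Reg, S c = R c) : Symb j k S := by
  refine ⟨h.1.congr hs, fun m p hp => (h.2 m p hp).congr' ?_ EventuallyEq.rfl⟩
  filter_upwards [eventually_nh_mem j p] with c hc
  have : R =ᶠ[𝓝 c] S := by
    filter_upwards [isOpen_Reg.mem_nhds hc] with x hx using (hs x hx).symm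
  exact this.iteratedFDeriv (𝕜 := ℝ) m |>.eq_of_nhds

lemma Symb.add (h : Symb j k R) (h' : Symb j k S) : Symb j k (fun c => R c + S c) := by
  refine ⟨h.1.add h'.1, fun m p hp => ?_⟩
  refine ((h.2 m p hp).add (h'.2 m p hp)).congr' ?_ EventuallyEq.rfl
  filter_upwards [eventually_nh_mem j p] with c hc
  exact (iteratedFDeriv_add_apply (contDiffAt_of_Reg h.1 hc m) (contDiffAt_of_Reg h'.1 hc m)).symm

lemma Symb.neg (h : Symb j k R) : Symb j k (fun c => -R c) := by
  refine ⟨h.1.neg, fun m p hp => ?_⟩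
  refine ((h.2 m p hp).neg_left).congr' ?_ EventuallyEq.rfl
  filter_upwards with c
  exact (iteratedFDeriv_neg_apply (𝕜 := ℝ) (f := R) (x := c) (i := m)).symm

lemma Symb.sub (h : Symb j k R) (h' : Symb j k S) : Symb j k (fun c => R c - S c) := by
  simpa [sub_eq_add_neg] using h.add h'.neg

lemma Symb.zero : Symb j k (fun _ => (0 : V)) := by
  refine ⟨contDiffOn_const, fun m p _ => ?_⟩
  have : (fun c : E3 × Param => iteratedFDeriv ℝ m (fun _ => (0 : V)) c) = fun _ => 0 := by
    ext1 c; simp [iteratedFDeriv_fun_zero (𝕜 := ℝ)]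
  rw [this]; exact isBigO_zero _ _

lemma Symb.sum {ι : Type*} (s : Finset ι) {R : ι → E3 × Param → V}
    (h : ∀ i ∈ s, Symb j k (R i)) : Symb j k (fun c => ∑ i ∈ s, R i c) := by
  classical
  induction s using Finset.induction_on with
  | empty => simpa using Symb.zero
  | insert a s ha ih =>
    simp only [Finset.sum_insert ha]
    exact (h a (by simp)).add (ih fun i hi => h i (by simp [hi]))

/-- Leibniz rule: each of its terms has order `(k - i) + (l - (m - i))`, which is always `k + l -
m`. -/
lemma Symb.bilin (B : V →L[ℝ] W →L[ℝ] U) {f : E3 × Param → V} {g : E3 × Param → W}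
    (hf : Symb j k f) (hg : Symb j l g) : Symb j (k + l) (fun c => B (f c) (g c)) := by
  refine ⟨?_, fun m p hp => ?_⟩
  · exact B.isBoundedBilinearMap.contDiff.comp_contDiffOn (hf.1.prodMk hg.1)
  have key : (fun c => ‖B‖ * ∑ i ∈ Finset.range (m + 1),
      (m.choose i : ℝ) * ‖iteratedFDeriv ℝ i f c‖ * ‖iteratedFDeriv ℝ (m - i) g c‖)
      =O[nh j p] fun c => rad j c ^ (k + l - m) := by
    refine IsBigO.const_mul_left (IsBigO.fun_sum fun i hi => ?_) _
    have hi' : i ≤ m := by simpa [Nat.lt_succ_iff] using hi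
    have := ((hf.2 i p hp).norm_left.const_mul_left (m.choose i : ℝ)).mul
      (hg.2 (m - i) p hp).norm_left
    refine this.congr' EventuallyEq.rfl ?_
    filter_upwards [eventually_nh_mem j p] with c hc
    rw [← zpow_add₀ (rad_pos hc).ne']
    congr 1; push_cast [hi']; ring
  refine IsBigO.trans (IsBigO.of_bound 1 ?_) key
  filter_upwards [eventually_nh_mem j p] with c hc
  have := B.norm_iteratedFDerivWithin_le_of_bilinear hf.1 hg.1 isOpen_Reg.uniqueDiffOn hc
    (n := m) (by exact_mod_cast le_top)
  simp only [iteratedFDerivWithin_of_isOpen _ isOpen_Reg hc] at this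
  rw [one_mul]
  exact this.trans (le_abs_self _)

lemma Symb.mul {f g : Fun} (hf : Symb j k f) (hg : Symb j l g) :
    Symb j (k + l) (fun c => f c * g c) :=
  Symb.bilin (ContinuousLinearMap.mul ℝ ℝ) hf hg

/-- All derivatives stay bounded at the collision, and bounded functions are `O(r ^ (-m))`. The
class is thus weaker than smoothness, which is harmless for the vector fields of the letters. -/
lemma Symb.of_contDiff {g : E3 × Param → V} (hg : ContDiff ℝ ∞ g) : Symb j 0 g := by
  refine ⟨hg.contDiffOn, fun m p _ => ?_⟩
  have hc : Continuous (iteratedFDeriv ℝ m g) :=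
    hg.continuous_iteratedFDeriv (by exact_mod_cast le_top)
  have h1 : (fun c => iteratedFDeriv ℝ m g c) =O[nh j p] fun _ => (1 : ℝ) :=
    ((hc.tendsto _).isBigO_one ℝ).mono nhdsWithin_le_nhds
  refine h1.trans ?_
  simpa using zpow_rad_isBigO j p (show (0 : ℤ) - m ≤ 0 by omega)

lemma Symb.fderiv (h : Symb j k R) : Symb j (k - 1) (fun c => fderiv ℝ R c) := by
  refine ⟨?_, fun m p hp => ?_⟩
  · exact h.1.fderiv_of_isOpen isOpen_Reg (by simp)
  refine IsBigO.trans (IsBigO.of_bound 1 ?_) ((h.2 (m + 1) p hp).trans_eventuallyEq ?_)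
  · filter_upwards with c
    rw [one_mul]; exact (norm_iteratedFDeriv_fderiv (𝕜 := ℝ)).le
  · filter_upwards with c; congr 1; push_cast; ring

lemma Symb.clm_apply {f : E3 × Param → (V →L[ℝ] W)} {g : E3 × Param → V}
    (hf : Symb j k f) (hg : Symb j l g) : Symb j (k + l) (fun c => f c (g c)) :=
  Symb.bilin (ContinuousLinearMap.id ℝ (V →L[ℝ] W)) hf hg

end Symb

/-! ### Homogeneous families -/

section Homog
variable {V W U : Type} [NormedAddCommGroup V] [NormedSpace ℝ V] [NormedAddCommGroup W]
  [NormedSpace ℝ W] [NormedAddCommGroup U] [NormedSpace ℝ U]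

/-- Smooth functions of a nonzero vector and of the parameters, homogeneous of degree `a` in the
vector. -/
structure Homog (a : ℤ) (u : E3 × Param → V) : Prop where
  smooth : ContDiffOn ℝ ∞ u Dom
  hom : ∀ r : ℝ, 0 < r → ∀ z : E3, z ≠ 0 → ∀ p ∈ Par, u (r • z, p) = r ^ a • u (z, p)

lemma contDiffAt_of_Dom {u : E3 × Param → V} (h : ContDiffOn ℝ ∞ u Dom) {c : E3 × Param}
    (hc : c ∈ Dom) : ContDiffAt ℝ ∞ u c := h.contDiffAt (isOpen_Dom.mem_nhds hc)

lemma differentiableAt_of_Dom {u : E3 × Param → V} (h : ContDiffOn ℝ ∞ u Dom) {c : E3 × Param}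
    (hc : c ∈ Dom) : DifferentiableAt ℝ u c := (contDiffAt_of_Dom h hc).differentiableAt (by simp)

lemma contDiffOn_fderiv_Dom {u : E3 × Param → V} (h : ContDiffOn ℝ ∞ u Dom) :
    ContDiffOn ℝ ∞ (fderiv ℝ u) Dom := h.fderiv_of_isOpen isOpen_Dom (by simp)

/-- Dilation of the vector by the factor `r`. -/
def dilL (r : ℝ) : E3 × Param →L[ℝ] E3 × Param :=
  (r • ContinuousLinearMap.fst ℝ E3 Param).prod (ContinuousLinearMap.snd ℝ E3 Param)

@[simp] lemma dilL_apply (r : ℝ) (c : E3 × Param) : dilL r c = (r • c.1, c.2) := rfl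

variable {a b : ℤ} {u w : E3 × Param → V}

/-- The homogeneity relation is differentiated by the chain rule. Splitting `e` shows that a
derivative in the vector lowers the degree by one and a derivative in the parameters keeps it. -/
lemma Homog.fderiv_dil (h : Homog a u) {r : ℝ} (hr : 0 < r) {z : E3} (hz : z ≠ 0) {p : Param}
    (hp : p ∈ Par) (e : E3 × Param) :
    fderiv ℝ u (r • z, p) (r • e.1, e.2) = r ^ a • fderiv ℝ u (z, p) e := by
  have hmem : (z, p) ∈ Dom := mem_Dom.2 ⟨hz, hp⟩
  have hmem' : dilL r (z, p) ∈ Dom := mem_Dom.2 ⟨smul_ne_zero hr.ne' hz, hp⟩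
  have h1 : HasFDerivAt (fun c => u (dilL r c))
      ((fderiv ℝ u (dilL r (z, p))).comp (dilL r)) (z, p) :=
    (differentiableAt_of_Dom h.smooth hmem').hasFDerivAt.comp (z, p) (dilL r).hasFDerivAt
  have h2 : HasFDerivAt (fun c => u (dilL r c)) (r ^ a • fderiv ℝ u (z, p)) (z, p) := by
    refine HasFDerivAt.congr_of_eventuallyEq
      ((differentiableAt_of_Dom h.smooth hmem).hasFDerivAt.const_smul (r ^ a)) ?_
    filter_upwards [isOpen_Dom.mem_nhds hmem] with c hc
    exact h.hom r hr c.1 (mem_Dom.1 hc).1 c.2 (mem_Dom.1 hc).2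
  simpa using congrArg (fun L => L e) (h1.unique h2)

/-- The derivative with respect to the vector. -/
def dz (u : E3 × Param → V) (c : E3 × Param) : E3 →L[ℝ] V :=
  (fderiv ℝ u c).comp (ContinuousLinearMap.inl ℝ E3 Param)

/-- The derivative with respect to the parameters. -/
def dp (u : E3 × Param → V) (c : E3 × Param) : Param →L[ℝ] V :=
  (fderiv ℝ u c).comp (ContinuousLinearMap.inr ℝ E3 Param)

lemma dz_apply (u : E3 × Param → V) (c : E3 × Param) (e : E3) :
    dz u c e = fderiv ℝ u c (e, 0) := rfl

lemma dp_apply (u : E3 × Param → V) (c : E3 × Param) (e : Param) :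
    dp u c e = fderiv ℝ u c (0, e) := rfl

lemma fderiv_eq_dz_add_dp (u : E3 × Param → V) (c e : E3 × Param) :
    fderiv ℝ u c e = dz u c e.1 + dp u c e.2 := by
  rw [dz_apply, dp_apply, ← map_add]; simp

lemma Homog.dz (h : Homog a u) : Homog (a - 1) (dz u) := by
  refine ⟨(contDiffOn_fderiv_Dom h.smooth).clm_comp contDiffOn_const, fun r hr z hz p hp => ?_⟩
  refine ContinuousLinearMap.ext fun e => ?_
  have := h.fderiv_dil hr hz hp (r⁻¹ • e, 0)
  rw [smul_inv_smul₀ hr.ne'] at this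
  rw [dz_apply, this, _root_.smul_apply, dz_apply,
    show ((r⁻¹ • e, 0) : E3 × Param) = r⁻¹ • (e, 0) by simp, map_smul, smul_smul,
    zpow_sub_one₀ hr.ne']

lemma Homog.dp (h : Homog a u) : Homog a (dp u) := by
  refine ⟨(contDiffOn_fderiv_Dom h.smooth).clm_comp contDiffOn_const, fun r hr z hz p hp => ?_⟩
  refine ContinuousLinearMap.ext fun e => ?_
  have := h.fderiv_dil hr hz hp (0, e)
  simpa [dp_apply] using this

lemma Homog.clm (L : V →L[ℝ] W) (h : Homog a u) : Homog a (fun c => L (u c)) :=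
  ⟨L.contDiff.comp_contDiffOn h.smooth, fun r hr z hz p hp => by
    simp only [h.hom r hr z hz p hp, map_smul]⟩

lemma Homog.bilin (B : V →L[ℝ] W →L[ℝ] U) {g : E3 × Param → W} (h : Homog a u) (hg : Homog b g) :
    Homog (a + b) (fun c => B (u c) (g c)) :=
  ⟨B.isBoundedBilinearMap.contDiff.comp_contDiffOn (h.smooth.prodMk hg.smooth),
    fun r hr z hz p hp => by
      simp only [h.hom r hr z hz p hp, hg.hom r hr z hz p hp, map_smul,
        _root_.smul_apply, smul_smul, zpow_add₀ hr.ne']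
      rw [mul_comm]⟩

lemma Homog.mul {f g : Fun} (hf : Homog a f) (hg : Homog b g) :
    Homog (a + b) (fun c => f c * g c) := hf.bilin (ContinuousLinearMap.mul ℝ ℝ) hg

lemma Homog.add (h : Homog a u) (h' : Homog a w) : Homog a (fun c => u c + w c) :=
  ⟨h.smooth.add h'.smooth, fun r hr z hz p hp => by
    simp only [h.hom r hr z hz p hp, h'.hom r hr z hz p hp, smul_add]⟩

lemma Homog.neg (h : Homog a u) : Homog a (fun c => -u c) :=
  ⟨h.smooth.neg, fun r hr z hz p hp => by simp only [h.hom r hr z hz p hp, smul_neg]⟩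

lemma Homog.zero : Homog a (fun _ => (0 : V)) := ⟨contDiffOn_const, by simp⟩

lemma Homog.sum {ι : Type*} (s : Finset ι) {u : ι → E3 × Param → V}
    (h : ∀ i ∈ s, Homog a (u i)) : Homog a (fun c => ∑ i ∈ s, u i c) := by
  classical
  induction s using Finset.induction_on with
  | empty => simpa using Homog.zero
  | insert i s hi ih =>
    simp only [Finset.sum_insert hi]
    exact (h i (by simp)).add (ih fun i hi => h i (by simp [hi]))

lemma Homog.of_param {g : Param → V} (hg : ContDiffOn ℝ ∞ g Par) :
    Homog 0 (fun c : E3 × Param => g c.2) :=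
  ⟨hg.comp contDiffOn_snd fun _ hc => hc.2, by simp⟩

lemma Homog.clm_apply {f : E3 × Param → (V →L[ℝ] W)} (hf : Homog a f) (hu : Homog b u) :
    Homog (a + b) (fun c => f c (u c)) :=
  hf.bilin (ContinuousLinearMap.id ℝ (V →L[ℝ] W)) hu

lemma Homog.congr (h : Homog a u) (hs : ∀ c ∈ Dom, w c = u c) : Homog a w :=
  ⟨h.smooth.congr hs, fun r hr z hz p hp => by
    rw [hs _ (mem_Dom.2 ⟨hz, hp⟩), hs _ (mem_Dom.2 ⟨smul_ne_zero hr.ne' hz, hp⟩),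
      h.hom r hr z hz p hp]⟩

lemma Homog.cast (h : Homog a u) (hb : a = b) : Homog b u := hb ▸ h

/-- The bound holds on the sphere times a closed ball of parameters by compactness and spreads by
homogeneity. Higher derivatives are handled by induction, since `dz` and `dp` of a homogeneous
family are homogeneous. -/
lemma Homog.norm_le (h : Homog a u) (m : ℕ) {p₀ : Param} (hp₀ : p₀ ∈ Par) :
    ∃ C : ℝ, ∀ᶠ p in 𝓝 p₀, ∀ z : E3, z ≠ 0 → ‖z‖ ≤ 1 →
      ‖iteratedFDeriv ℝ m u (z, p)‖ ≤ C * ‖z‖ ^ (a - m) := by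
  induction m generalizing V a with
  | zero =>
    obtain ⟨ε, hε, hball⟩ := Metric.isOpen_iff.1 isOpen_Par p₀ hp₀
    have hsub : Metric.closedBall p₀ (ε / 2) ⊆ Par :=
      (Metric.closedBall_subset_ball (by linarith)).trans hball
    have hK : IsCompact (Metric.sphere (0 : E3) 1 ×ˢ Metric.closedBall p₀ (ε / 2)) :=
      (isCompact_sphere _ _).prod (isCompact_closedBall _ _)
    have hKD : Metric.sphere (0 : E3) 1 ×ˢ Metric.closedBall p₀ (ε / 2) ⊆ Dom := by
      rintro ⟨z, p⟩ ⟨hz, hp⟩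
      refine mem_Dom.2 ⟨?_, hsub hp⟩
      rintro rfl; simp at hz
    obtain ⟨C, hC⟩ := hK.exists_bound_of_continuousOn (h.smooth.continuousOn.mono hKD)
    refine ⟨C, ?_⟩
    filter_upwards [Metric.closedBall_mem_nhds p₀ (half_pos hε)] with p hp z hz _
    have hz' : 0 < ‖z‖ := norm_pos_iff.2 hz
    have hn : ‖‖z‖⁻¹ • z‖ = 1 := by
      rw [norm_smul, norm_inv, norm_norm, inv_mul_cancel₀ hz'.ne']
    have h1 := h.hom ‖z‖ hz' (‖z‖⁻¹ • z) (smul_ne_zero (inv_ne_zero hz'.ne') hz) p (hsub hp)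
    rw [smul_inv_smul₀ hz'.ne'] at h1
    have h2 := hC (‖z‖⁻¹ • z, p) ⟨by simp [hn], hp⟩
    rw [norm_iteratedFDeriv_zero, h1, norm_smul, Real.norm_of_nonneg (zpow_pos hz' _).le, mul_comm]
    simpa using mul_le_mul_of_nonneg_right h2 (zpow_pos hz' a).le
  | succ m ih =>
    obtain ⟨C₁, h₁⟩ := ih (h.dz.clm
      ((ContinuousLinearMap.compL ℝ (E3 × Param) E3 V).flip (ContinuousLinearMap.fst ℝ E3 Param)))
    obtain ⟨C₂, h₂⟩ := ih (h.dp.clm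
      ((ContinuousLinearMap.compL ℝ (E3 × Param) Param V).flip
        (ContinuousLinearMap.snd ℝ E3 Param)))
    refine ⟨C₁ + |C₂|, ?_⟩
    filter_upwards [h₁, h₂, isOpen_Par.mem_nhds hp₀] with p hp1 hp2 hp z hz hz1
    have hz' : 0 < ‖z‖ := norm_pos_iff.2 hz
    have hmem : (z, p) ∈ Dom := mem_Dom.2 ⟨hz, hp⟩
    have hfd : _root_.fderiv ℝ u = fun c =>
        ((ContinuousLinearMap.compL ℝ (E3 × Param) E3 V).flip
          (ContinuousLinearMap.fst ℝ E3 Param)) (Hadamard.dz u c) +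
        ((ContinuousLinearMap.compL ℝ (E3 × Param) Param V).flip
          (ContinuousLinearMap.snd ℝ E3 Param)) (Hadamard.dp u c) := by
      ext1 c
      refine ContinuousLinearMap.ext fun e => ?_
      simpa using fderiv_eq_dz_add_dp u c e
    rw [← norm_iteratedFDeriv_fderiv, hfd]
    rw [fun_iteratedFDeriv_add_apply
      ((contDiffAt_of_Dom (h.dz.clm _).smooth hmem).of_le (by exact_mod_cast le_top))
      ((contDiffAt_of_Dom (h.dp.clm _).smooth hmem).of_le (by exact_mod_cast le_top))]
    refine (norm_add_le _ _).trans ?_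
    have e1 := hp1 z hz hz1
    have e2 := hp2 z hz hz1
    -- The parameter derivative loses no power of `‖z‖`, so its bound is better than required; this
    -- is where `‖z‖ ≤ 1` is needed.
    have e3 : ‖z‖ ^ (a - m) ≤ ‖z‖ ^ (a - (m + 1 : ℕ)) :=
      zpow_le_zpow_right_of_le_one₀ hz' hz1 (by push_cast; omega)
    rw [show a - 1 - (m : ℤ) = a - (m + 1 : ℕ) by push_cast; ring] at e1
    have e4 : C₂ * ‖z‖ ^ (a - m) ≤ |C₂| * ‖z‖ ^ (a - (m + 1 : ℕ)) :=
      (mul_le_mul_of_nonneg_right (le_abs_self _) (zpow_pos hz' _).le).trans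
        (mul_le_mul_of_nonneg_left e3 (abs_nonneg _))
    rw [add_mul]
    exact add_le_add e1 (e2.trans e4)

/-- Composition with the linear map `relL j` multiplies the `m`-th derivative by at most `‖relL j‖ ^
m`. -/
lemma Homog.symb (h : Homog a u) (j : Fin 2) : Symb j a (fun c => u (relL j c)) := by
  have hpre : relL j ⁻¹' Dom ⊇ Reg := fun c hc => relL_mem_Dom hc
  refine ⟨h.smooth.comp (relL j).contDiff.contDiffOn hpre, fun m p hp => ?_⟩
  obtain ⟨C, hC⟩ := h.norm_le m hp
  refine IsBigO.of_bound (C * ‖relL j‖ ^ m) ?_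
  have hC' : ∀ᶠ c : E3 × Param in nh j p, ∀ z : E3, z ≠ 0 → ‖z‖ ≤ 1 →
      ‖iteratedFDeriv ℝ m u (z, c.2)‖ ≤ C * ‖z‖ ^ (a - m) :=
    ((continuous_snd.tendsto (pos j p, p)).eventually hC).filter_mono nhdsWithin_le_nhds
  filter_upwards [hC', eventually_nh_mem j p, eventually_rad_lt j p one_pos] with c h1 hc h2
  have hopen : IsOpen (relL j ⁻¹' Dom) := isOpen_Dom.preimage (relL j).continuous
  have h3 := (relL j).iteratedFDerivWithin_comp_right h.smooth isOpen_Dom.uniqueDiffOn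
    hopen.uniqueDiffOn (x := c) (relL_mem_Dom hc) (i := m) (by exact_mod_cast le_top)
  rw [iteratedFDerivWithin_of_isOpen _ isOpen_Dom (relL_mem_Dom hc),
    iteratedFDerivWithin_of_isOpen _ hopen (relL_mem_Dom hc)] at h3
  change ‖iteratedFDeriv ℝ m (u ∘ relL j) c‖ ≤ _
  rw [h3]
  refine (ContinuousMultilinearMap.norm_compContinuousLinearMap_le _ _).trans ?_
  have h4 := h1 (c.1 - pos j c.2) (sub_ne_zero.2 (hc.2 j)) h2.le
  rw [relL_apply, Finset.prod_const, Finset.card_univ, Fintype.card_fin,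
    Real.norm_of_nonneg (zpow_pos (rad_pos hc) _).le]
  calc _ ≤ C * ‖c.1 - pos j c.2‖ ^ (a - m) * ‖relL j‖ ^ m := by gcongr
    _ = _ := by rw [rad]; ring

end Homog

end Hadamard
end

noncomputable section
namespace Hadamard

/-! ### Expansions with homogeneous coefficients -/

lemma sum_Icc_lower {M : Type*} [AddCommMonoid M] {g : ℤ → M} {b b' : ℤ}
    (hg : ∀ a < b, g a = 0) (hb : b' ≤ b) (N : ℤ) :
    ∑ a ∈ Finset.Icc b' N, g a = ∑ a ∈ Finset.Icc b N, g a := by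
  symm
  refine Finset.sum_subset (Finset.Icc_subset_Icc_left hb) fun a h1 h2 => hg a ?_
  rw [Finset.mem_Icc] at h1 h2; omega

/-- Vanishing below `b` covers the case `N + 1 < b`, in which both intervals are empty and the extra
term must be zero. -/
lemma sum_Icc_top {M : Type*} [AddCommMonoid M] {g : ℤ → M} {b : ℤ}
    (hg : ∀ a < b, g a = 0) (N : ℤ) :
    ∑ a ∈ Finset.Icc b (N + 1), g a = ∑ a ∈ Finset.Icc b N, g a + g (N + 1) := by
  by_cases h : b ≤ N + 1
  · rw [← Finset.insert_Icc_right_eq_Icc_add_one h, Finset.sum_insert (by simp), add_comm]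
  · rw [Finset.Icc_eq_empty (by omega), Finset.Icc_eq_empty (by omega), hg (N + 1) (by omega)]
    simp

lemma sum_Icc_shift {M : Type*} [AddCommMonoid M] (g : ℤ → M) (b N : ℤ) :
    ∑ a ∈ Finset.Icc b (N + 1), g a = ∑ a ∈ Finset.Icc (b - 1) N, g (a + 1) := by
  refine Finset.sum_bij' (fun a _ => a - 1) (fun a _ => a + 1) ?_ ?_ ?_ ?_ ?_ <;> simp

/-- `F = ∑ u_a (x - y_j)` near the source point `j`, with `u_a` homogeneous of degree `a`. -/
structure HExp (j : Fin 2) (F : Fun) (u : ℤ → E3 × Param → ℝ) : Prop where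
  homog : ∀ a, Homog a (u a)
  bdd : ∃ b, ∀ a < b, ∀ c, u a c = 0
  -- Any admissible lower bound may be used, so two expansions can share one. Asking for `O(r ^
  -- (N+1))` instead of `o(r ^ N)` costs nothing, as `N` is arbitrary.
  rem : ∀ b, (∀ a < b, ∀ c, u a c = 0) → ∀ N,
    Symb j (N + 1) fun c => F c - ∑ a ∈ Finset.Icc b N, u a (relL j c)

lemma HExp.mk' {j : Fin 2} {F : Fun} {u : ℤ → E3 × Param → ℝ} (h : ∀ a, Homog a (u a)) {b : ℤ}
    (hb : ∀ a < b, ∀ c, u a c = 0)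
    (hr : ∀ N, Symb j (N + 1) fun c => F c - ∑ a ∈ Finset.Icc b N, u a (relL j c)) :
    HExp j F u := by
  refine ⟨h, ⟨b, hb⟩, fun b' hb' N => ?_⟩
  have : ∀ c, ∑ a ∈ Finset.Icc b' N, u a (relL j c) = ∑ a ∈ Finset.Icc b N, u a (relL j c) := by
    intro c
    rcases le_total b b' with hbb | hbb
    · exact (sum_Icc_lower (fun a ha => hb' a ha _) hbb N).symm
    · exact sum_Icc_lower (fun a ha => hb a ha _) hbb N
  simpa only [this] using hr N

variable {j : Fin 2} {F G : Fun} {u w : ℤ → E3 × Param → ℝ}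

lemma HExp.smooth (h : HExp j F u) : ContDiffOn ℝ ∞ F Reg := by
  obtain ⟨b, hb⟩ := h.bdd
  have := (h.rem b hb (b - 1)).1
  simpa using this

lemma HExp.symb (h : HExp j F u) {b : ℤ} (hb : ∀ a < b, ∀ c, u a c = 0) : Symb j b F := by
  simpa using h.rem b hb (b - 1)

/-- Induction on the order. If all lower coefficients agree, the difference of the coefficients of
order `N` is the difference of two remainders, hence `O(r ^ (N+1))`. Being homogeneous of degree
`N`, it vanishes, as division by `ε ^ N` along a ray shows. -/
lemma HExp.unique (h : HExp j F u) (h' : HExp j F w) (a : ℤ) {c : E3 × Param} (hc : c ∈ Dom) :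
    u a c = w a c := by
  obtain ⟨b₁, hb₁⟩ := h.bdd
  obtain ⟨b₂, hb₂⟩ := h'.bdd
  set b := min b₁ b₂
  have hu : ∀ a < b, ∀ c, u a c = 0 := fun a ha => hb₁ a (ha.trans_le (min_le_left _ _))
  have hw : ∀ a < b, ∀ c, w a c = 0 := fun a ha => hb₂ a (ha.trans_le (min_le_right _ _))
  have main : ∀ n : ℕ, ∀ a < b + n, ∀ c ∈ Dom, u a c = w a c := by
    intro n
    induction n with
    | zero => intro a ha c _; rw [hu a (by simpa using ha), hw a (by simpa using ha)]
    | succ n ih =>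
      intro a ha c hc
      rcases lt_or_eq_of_le (show a ≤ b + n by push_cast at ha; omega) with h1 | rfl
      · exact ih a h1 c hc
      set N : ℤ := b + n
      obtain ⟨z, p⟩ := c
      obtain ⟨hz, hp⟩ := mem_Dom.1 hc
      have hS : Symb j (N + 1) fun c => u N (relL j c) - w N (relL j c) := by
        refine ((h'.rem b hw N).sub (h.rem b hu N)).congr fun c hc => ?_
        have e1 : ∀ g : ℤ → E3 × Param → ℝ, ∑ a ∈ Finset.Icc b N, g a (relL j c) =
            ∑ a ∈ Finset.Icc b (N - 1), g a (relL j c) + g N (relL j c) := by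
          intro g
          have hN : b ≤ N := by omega
          rw [show Finset.Icc b N = insert N (Finset.Icc b (N - 1)) by
            ext; simp only [Finset.mem_insert, Finset.mem_Icc]; omega,
            Finset.sum_insert (by simp), add_comm]
        have e2 : ∑ a ∈ Finset.Icc b (N - 1), u a (relL j c) =
            ∑ a ∈ Finset.Icc b (N - 1), w a (relL j c) :=
          Finset.sum_congr rfl fun a ha => ih a (by simp at ha; omega) _ (relL_mem_Dom hc)
        rw [e1, e1, e2]; ring
      have hO := (hS.2 0 p hp).norm_left
      simp only [norm_iteratedFDeriv_zero] at hO
      have hO2 := hO.comp_tendsto (tendsto_ray j hz hp)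
      have hO3 : (fun ε : ℝ => ε ^ N * (u N (z, p) - w N (z, p))) =O[𝓝[>] 0]
          fun ε : ℝ => ε ^ (N + 1) := by
        refine IsBigO.trans (IsBigO.of_bound 1 ?_)
          ((hO2.trans_eventuallyEq (g₂ := fun ε : ℝ => ε ^ (N + 1) * ‖z‖ ^ (N + 1)) ?_).trans ?_)
        · filter_upwards [self_mem_nhdsWithin] with ε hε
          simp only [Function.comp, relL_apply, add_sub_cancel_left, norm_norm, one_mul]
          rw [(h.homog N).hom ε hε z hz p hp, (h'.homog N).hom ε hε z hz p hp]
          simp only [smul_eq_mul, ← mul_sub]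
          exact le_rfl
        · filter_upwards [self_mem_nhdsWithin] with ε hε
          simp [Function.comp, rad, norm_smul, mul_zpow, abs_of_pos (show (0 : ℝ) < ε from hε)]
        · simpa [mul_comm] using (isBigO_refl (fun ε : ℝ => ε ^ (N + 1)) (𝓝[>] 0)).const_mul_left
            (‖z‖ ^ (N + 1))
      have hO4 : (fun _ : ℝ => u N (z, p) - w N (z, p)) =O[𝓝[>] 0] fun ε : ℝ => ε := by
        have := (isBigO_refl (fun ε : ℝ => ε ^ (-N)) (𝓝[>] 0)).mul hO3
        refine this.congr' ?_ ?_
        · filter_upwards [self_mem_nhdsWithin] with ε hε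
          rw [← mul_assoc, ← zpow_add₀ (ne_of_gt hε)]; simp
        · filter_upwards [self_mem_nhdsWithin] with ε hε
          rw [← zpow_add₀ (ne_of_gt hε)]; simp
      have ht : Tendsto (fun _ : ℝ => u N (z, p) - w N (z, p)) (𝓝[>] 0) (𝓝 0) :=
        hO4.trans_tendsto (tendsto_id.mono_left nhdsWithin_le_nhds)
      exact sub_eq_zero.1 (tendsto_nhds_unique tendsto_const_nhds ht)
  refine main (a - b + 1).toNat a ?_ c hc
  have := Int.self_le_toNat (a - b + 1)
  omega

lemma HExp.congr (h : HExp j F u) (hs : ∀ c ∈ Reg, G c = F c) : HExp j G u :=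
  ⟨h.homog, h.bdd, fun b hb N => (h.rem b hb N).congr fun c hc => by rw [hs c hc]⟩

lemma HExp.add (h : HExp j F u) (h' : HExp j G w) :
    HExp j (fun c => F c + G c) (fun a c => u a c + w a c) := by
  obtain ⟨b₁, hb₁⟩ := h.bdd
  obtain ⟨b₂, hb₂⟩ := h'.bdd
  have hu : ∀ a < min b₁ b₂, ∀ c, u a c = 0 := fun a ha => hb₁ a (ha.trans_le (min_le_left _ _))
  have hw : ∀ a < min b₁ b₂, ∀ c, w a c = 0 := fun a ha => hb₂ a (ha.trans_le (min_le_right _ _))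
  refine HExp.mk' (fun a => (h.homog a).add (h'.homog a)) (b := min b₁ b₂)
    (fun a ha c => by rw [hu a ha, hw a ha, add_zero]) fun N => ?_
  refine ((h.rem _ hu N).add (h'.rem _ hw N)).congr fun c _ => ?_
  rw [Finset.sum_add_distrib]; ring

/-- Coefficients of a product. -/
def cmul (u w : ℤ → E3 × Param → ℝ) (m : ℤ) (c : E3 × Param) : ℝ := ∑ᶠ a : ℤ, u a c * w (m - a) c

lemma cmul_eq_sum {b b' : ℤ} (hu : ∀ a < b, ∀ c, u a c = 0) (hw : ∀ a < b', ∀ c, w a c = 0)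
    (m : ℤ) (c : E3 × Param) {N : ℤ} (hN : m - b' ≤ N) :
    cmul u w m c = ∑ a ∈ Finset.Icc b N, u a c * w (m - a) c := by
  refine finsum_eq_sum_of_support_subset _ fun a ha => ?_
  simp only [Function.mem_support, ne_eq, mul_eq_zero, not_or] at ha
  have h1 : ¬ a < b := fun h => ha.1 (hu a h c)
  have h2 : ¬ m - a < b' := fun h => ha.2 (hw _ h c)
  simp only [Finset.coe_Icc, Set.mem_Icc]; omega

/-- The error splits as `(F - F_{N-b'}) G + ∑ u_a (G - G_{N-a})`. The truncations are adapted to `G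
= O(r ^ b')` and `u_a = O(r ^ a)`, so that every piece has order `N + 1`. -/
lemma HExp.mul (h : HExp j F u) (h' : HExp j G w) : HExp j (fun c => F c * G c) (cmul u w) := by
  obtain ⟨b, hb⟩ := h.bdd
  obtain ⟨b', hb'⟩ := h'.bdd
  refine HExp.mk' (b := b + b') (fun m => ?_) (fun m hm c => ?_) fun N => ?_
  · refine (Homog.sum (Finset.Icc b (m - b')) (u := fun a c => u a c * w (m - a) c) fun a _ =>
      ((h.homog a).mul (h'.homog (m - a))).cast (by ring)).congr fun c _ => ?_
    exact cmul_eq_sum hb hb' m c le_rfl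
  · rw [cmul_eq_sum hb hb' m c le_rfl, Finset.Icc_eq_empty (by omega), Finset.sum_empty]
  have s1 : Symb j (N + 1) fun c =>
      (F c - ∑ a ∈ Finset.Icc b (N - b'), u a (relL j c)) * G c :=
    ((h.rem b hb (N - b')).mul (h'.symb hb')).mono (by omega)
  have s2 : Symb j (N + 1) fun c => ∑ a ∈ Finset.Icc b (N - b'), u a (relL j c) *
      (G c - ∑ d ∈ Finset.Icc b' (N - a), w d (relL j c)) :=
    Symb.sum _ fun a _ => (((h.homog a).symb j).mul (h'.rem b' hb' (N - a))).mono (by omega)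
  refine (s1.add s2).congr fun c _ => ?_
  have e : ∑ m ∈ Finset.Icc (b + b') N, cmul u w m (relL j c) =
      ∑ a ∈ Finset.Icc b (N - b'), u a (relL j c) *
        ∑ d ∈ Finset.Icc b' (N - a), w d (relL j c) := by
    have e1 : ∀ m ∈ Finset.Icc (b + b') N, cmul u w m (relL j c) =
        ∑ a ∈ Finset.Icc b (N - b'), u a (relL j c) * w (m - a) (relL j c) := fun m hm =>
      cmul_eq_sum hb hb' m _ (by simp at hm; omega)
    rw [Finset.sum_congr rfl e1, Finset.sum_comm]
    refine Finset.sum_congr rfl fun a ha => ?_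
    rw [← Finset.mul_sum]
    congr 1
    have e2 : ∑ m ∈ Finset.Icc (b + b') N, w (m - a) (relL j c) =
        ∑ d ∈ Finset.Icc (b + b' - a) (N - a), w d (relL j c) := by
      refine Finset.sum_bij' (fun m _ => m - a) (fun d _ => d + a) ?_ ?_ ?_ ?_ ?_ <;>
        simp only [Finset.mem_Icc, sub_add_cancel, add_sub_cancel_right, implies_true] <;>
        intros <;> omega
    rw [e2]
    exact sum_Icc_lower (fun d hd => hb' d hd _) (by simp at ha; omega) _
  rw [e]
  simp only [mul_sub, Finset.sum_sub_distrib, sub_mul, ← Finset.sum_mul]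
  ring

/-- The coefficients of a function that is exactly homogeneous. -/
lemma HExp.of_homog {h : E3 × Param → ℝ} {m : ℤ} (hh : Homog m h) :
    HExp j (fun c => h (relL j c)) (fun a c => if a = m then h c else 0) := by
  refine HExp.mk' (b := m) (fun a => ?_) (fun a ha c => by simp [ha.ne]) fun N => ?_
  · by_cases ha : a = m
    · subst ha; simpa using hh
    · simpa [ha] using Homog.zero
  · by_cases hN : m ≤ N
    · refine Symb.zero.congr fun c _ => ?_
      simp [hN]
    · refine ((hh.symb j).mono (show N + 1 ≤ m by omega)).congr fun c _ => ?_
      simp [hN]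

/-- Locally around the point `j`, expansions only depend on the germ. -/
lemma HExp.congr_near (h : HExp j F u) (hG : ContDiffOn ℝ ∞ G Reg)
    (hs : ∀ p ∈ Par, ∀ᶠ c in 𝓝 (pos j p, p), c ∈ Reg → G c = F c) : HExp j G u := by
  refine ⟨h.homog, h.bdd, fun b hb N => ?_⟩
  have h1 := h.rem b hb N
  refine ⟨?_, fun m p hp => (h1.2 m p hp).congr' ?_ EventuallyEq.rfl⟩
  · exact hG.sub (ContDiffOn.sum fun a _ => ((h.homog a).symb j).1)
  · filter_upwards [(hs p hp).eventually_nhds.filter_mono nhdsWithin_le_nhds,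
      eventually_nh_mem j p] with c hc hcR
    refine (Filter.EventuallyEq.iteratedFDeriv (𝕜 := ℝ) ?_ m).eq_of_nhds
    filter_upwards [hc, isOpen_Reg.mem_nhds hcR] with x hx hxR
    rw [hx hxR]

lemma HExp.zero_near (hG : ContDiffOn ℝ ∞ G Reg)
    (hs : ∀ p ∈ Par, ∀ᶠ c in 𝓝 (pos j p, p), c ∈ Reg → G c = 0) : HExp j G (fun _ _ => 0) := by
  refine HExp.congr_near (F := fun _ => 0) ?_ hG hs
  exact HExp.mk' (b := 0) (fun _ => Homog.zero) (by simp) fun N => by simpa using Symb.zero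

/-! ### Derivatives of expansions -/

lemma paramDir_contDiff {v : Fin 2 → ℝ → E3} (hv : ∀ j, ContDiff ℝ ∞ (v j)) (a : Letter) :
    ContDiff ℝ ∞ (a.paramDir v) := by
  cases a with
  | x i => exact contDiff_const
  | y j i =>
    have : (Letter.y j i).paramDir v = fun _ => if j = 0 then (0, ex i, 0) else (0, 0, ex i) := rfl
    rw [this]; exact contDiff_const
  | t =>
    have h0 := hv 0
    have h1 := hv 1
    unfold Letter.paramDir; fun_prop

/-- The displacement of the field point relative to the source point `j`. -/
def Letter.disp (v : Fin 2 → ℝ → E3) (a : Letter) (j : Fin 2) (p : Param) : E3 :=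
  a.fieldDir - pos j (a.paramDir v p)

lemma disp_contDiff {v : Fin 2 → ℝ → E3} (hv : ∀ j, ContDiff ℝ ∞ (v j)) (a : Letter) (j : Fin 2) :
    ContDiff ℝ ∞ (a.disp v j) := by
  have : a.disp v j = fun p => a.fieldDir - posL j (a.paramDir v p) := by
    ext1 p; simp [Letter.disp]
  rw [this]
  exact contDiff_const.sub ((posL j).contDiff.comp (paramDir_contDiff hv a))

/-- The coefficients of `∂_a F`. -/
def cpd (v : Fin 2 → ℝ → E3) (a : Letter) (j : Fin 2) (u : ℤ → E3 × Param → ℝ) (m : ℤ)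
    (c : E3 × Param) : ℝ :=
  dp (u m) c (a.paramDir v c.2) + dz (u (m + 1)) c (a.disp v j c.2)

lemma Homog.dp_apply {h : E3 × Param → ℝ} {m : ℤ} (hh : Homog m h) {X : Param → Param}
    (hX : ContDiff ℝ ∞ X) : Homog m (fun c => Hadamard.dp h c (X c.2)) :=
  (hh.dp.clm_apply (Homog.of_param hX.contDiffOn)).cast (by ring)

lemma Homog.dz_apply {h : E3 × Param → ℝ} {m : ℤ} (hh : Homog m h) {X : Param → E3}
    (hX : ContDiffOn ℝ ∞ X Par) : Homog (m - 1) (fun c => Hadamard.dz h c (X c.2)) :=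
  (hh.dz.clm_apply (Homog.of_param hX)).cast (by ring)

lemma pd_comp_relL {v : Fin 2 → ℝ → E3} (a : Letter) {h : E3 × Param → ℝ}
    (hh : ContDiffOn ℝ ∞ h Dom) {c : E3 × Param} (hc : c ∈ Reg) :
    pd v a (fun c => h (relL j c)) c =
      dp h (relL j c) (a.paramDir v c.2) + dz h (relL j c) (a.disp v j c.2) := by
  have h1 : HasFDerivAt (fun c => h (relL j c)) ((fderiv ℝ h (relL j c)).comp (relL j)) c :=
    (differentiableAt_of_Dom hh (relL_mem_Dom hc)).hasFDerivAt.comp c (relL j).hasFDerivAt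
  rw [pd, h1.fderiv, ContinuousLinearMap.comp_apply, fderiv_eq_dz_add_dp, add_comm]
  simp [Letter.disp]

lemma Symb.pd {v : Fin 2 → ℝ → E3} (hv : ∀ j, ContDiff ℝ ∞ (v j)) (a : Letter) {R : Fun} {k : ℤ}
    (h : Symb j k R) : Symb j (k - 1) (pd v a R) := by
  have h1 : Symb j 0 (fun c : E3 × Param => (a.fieldDir, a.paramDir v c.2)) :=
    Symb.of_contDiff (contDiff_const.prodMk ((paramDir_contDiff hv a).comp contDiff_snd))
  exact (h.fderiv.clm_apply h1).mono (by omega)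

lemma differentiableAt_of_Reg (h : ContDiffOn ℝ ∞ F Reg) {c : E3 × Param} (hc : c ∈ Reg) :
    DifferentiableAt ℝ F c := (h.contDiffAt (isOpen_Reg.mem_nhds hc)).differentiableAt (by simp)

/-- A letter acts on `u_m(x - y_j, p)` through the parameters, keeping the degree, and through the
relative displacement, lowering it by one. The order `m` of the derivative thus collects `u_m` and
`u_{m+1}`. -/
lemma HExp.pd {v : Fin 2 → ℝ → E3} (hv : ∀ j, ContDiff ℝ ∞ (v j)) (a : Letter) (h : HExp j F u) :
    HExp j (pd v a F) (cpd v a j u) := by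
  obtain ⟨b, hb⟩ := h.bdd
  have hb0 : ∀ m < b, u m = fun _ => 0 := fun m hm => funext (hb m hm)
  refine HExp.mk' (b := b - 1) (fun m => ?_) (fun m hm c => ?_) fun N => ?_
  · refine ((h.homog m).dp_apply (paramDir_contDiff hv a)).add
      (((h.homog (m + 1)).dz_apply (disp_contDiff hv a j).contDiffOn).cast (by ring))
  · rw [cpd, hb0 m (by omega), hb0 (m + 1) (by omega)]
    simp [dp, dz]
  -- A derivative costs one power of `r_j`, so `F` is expanded to order `N + 1`. The parameter
  -- derivative of the top coefficient has no partner in the sum to order `N`, but is itself of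
  -- order `N + 1`.
  · have s1 := ((h.rem b hb (N + 1)).pd hv a).mono (show N + 1 ≤ N + 1 + 1 - 1 by omega)
    have s2 : Symb j (N + 1) fun c => dp (u (N + 1)) (relL j c) (a.paramDir v c.2) := by
      simpa using ((h.homog (N + 1)).dp_apply (paramDir_contDiff hv a)).symb j
    refine (s1.add s2).congr fun c hc => ?_
    have d1 : ∀ m, DifferentiableAt ℝ (fun c => u m (relL j c)) c := fun m =>
      differentiableAt_of_Reg ((h.homog m).symb j).1 hc
    have e1 : Hadamard.pd v a (fun c => F c - ∑ m ∈ Finset.Icc b (N + 1), u m (relL j c)) c =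
        Hadamard.pd v a F c - ∑ m ∈ Finset.Icc b (N + 1),
          (dp (u m) (relL j c) (a.paramDir v c.2) + dz (u m) (relL j c) (a.disp v j c.2)) := by
      simp only [← pd_comp_relL a (h.homog _).smooth hc]
      simp only [Hadamard.pd]
      rw [fderiv_fun_sub (differentiableAt_of_Reg h.smooth hc)
        (DifferentiableAt.fun_sum fun m _ => d1 m), fderiv_fun_sum fun m _ => d1 m]
      simp
    have z1 : ∀ m < b, dp (u m) (relL j c) (a.paramDir v c.2) = 0 := fun m hm => by
      rw [hb0 m hm]; simp [dp]
    rw [e1]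
    simp only [cpd, Finset.sum_add_distrib]
    rw [sum_Icc_top z1, sum_Icc_shift (fun m => dz (u m) (relL j c) (a.disp v j c.2)),
      sum_Icc_lower (b' := b - 1) (b := b)
        (g := fun m => dp (u m) (relL j c) (a.paramDir v (relL j c).2)) z1 (by omega)]
    simp only [relL_apply]
    ring

/-! ### Relation with the definitions -/

lemma HExp.isExpansion (h : HExp j F u) : IsExpansion j F u := by
  obtain ⟨b, hb⟩ := h.bdd
  refine ⟨b, hb, fun a => (h.homog a).smooth, fun N m p hp => ?_⟩
  refine (((h.rem b hb N).2 m p hp).trans_isLittleO (zpow_rad_isLittleO j p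
    (show N - m < N + 1 - m by omega))).congr' ?_ EventuallyEq.rfl
  filter_upwards [eventually_nh_mem j p] with c hc
  refine (Filter.EventuallyEq.iteratedFDeriv (𝕜 := ℝ) ?_ m).eq_of_nhds
  filter_upwards [isOpen_Reg.mem_nhds hc] with x hx
  congr 1
  refine Finset.sum_congr rfl fun a _ => ?_
  have hx0 : rad j x ≠ 0 := (rad_pos hx).ne'
  have h1 := (h.homog a).hom (rad j x) (rad_pos hx) (dir j x)
    (smul_ne_zero (inv_ne_zero hx0) (sub_ne_zero.2 (hx.2 j))) x.2 hx.1
  rw [smul_eq_mul] at h1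
  rw [← h1, relL_apply, dir, smul_inv_smul₀ hx0]

/-- The homogeneous functions attached to functions of the direction. -/
def homogExt (f : ℤ → E3 × Param → ℝ) (a : ℤ) (c : E3 × Param) : ℝ :=
  ‖c.1‖ ^ a * f a (‖c.1‖⁻¹ • c.1, c.2)

lemma homog_homogExt {f : E3 × Param → ℝ} (a : ℤ) (hf : ContDiffOn ℝ ∞ f Dom) :
    Homog a (fun c : E3 × Param => ‖c.1‖ ^ a * f (‖c.1‖⁻¹ • c.1, c.2)) := by
  have hne : ∀ c ∈ Dom, c.1 ≠ 0 := fun c hc => (mem_Dom.1 hc).1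
  have hn : ContDiffOn ℝ ∞ (fun c : E3 × Param => ‖c.1‖) Dom := fun c hc =>
    (contDiffAt_fst.norm ℝ (hne c hc)).contDiffWithinAt
  refine ⟨?_, fun r hr z hz p hp => ?_⟩
  · have hz : ContDiffOn ℝ ∞ (fun c : E3 × Param => ‖c.1‖ ^ a) Dom := by
      cases a with
      | ofNat n => simpa using hn.pow n
      | negSucc n =>
        simp only [zpow_negSucc]
        exact (hn.pow (n + 1)).inv fun c hc => pow_ne_zero _ (norm_ne_zero_iff.2 (hne c hc))
    refine hz.mul (hf.comp ?_ fun c hc => ?_)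
    · exact ((hn.inv fun c hc => norm_ne_zero_iff.2 (hne c hc)).smul contDiffOn_fst).prodMk
        contDiffOn_snd
    · exact mem_Dom.2 ⟨smul_ne_zero (inv_ne_zero (norm_ne_zero_iff.2 (hne c hc))) (hne c hc), hc.2⟩
  · simp only [norm_smul, Real.norm_of_nonneg hr.le, mul_zpow, smul_eq_mul, mul_inv, smul_smul]
    rw [show r⁻¹ * ‖z‖⁻¹ * r = ‖z‖⁻¹ by field_simp]
    ring

/-- The estimate `o(r ^ (N+1))` at the next order is in particular `O(r ^ (N+1))`, and the
additional term of the expansion is a symbol of that same order. -/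
lemma hExp_of_isExpansion (hF : ContDiffOn ℝ ∞ F Reg) {f : ℤ → E3 × Param → ℝ}
    (h : IsExpansion j F f) : HExp j F (homogExt f) := by
  obtain ⟨b, hb, hf, hr⟩ := h
  have hh : ∀ a, Homog a (homogExt f a) := fun a => homog_homogExt a (hf a)
  have hz : ∀ a < b, ∀ c, homogExt f a c = 0 := fun a ha c => by simp [homogExt, hb a ha]
  have hsm : ∀ N, ContDiffOn ℝ ∞
      (fun c => F c - ∑ a ∈ Finset.Icc b N, homogExt f a (relL j c)) Reg := fun N =>
    hF.sub (ContDiffOn.sum fun a _ => ((hh a).symb j).1)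
  refine HExp.mk' (b := b) hh hz fun N => ?_
  have s1 : Symb j (N + 1) fun c => F c - ∑ a ∈ Finset.Icc b (N + 1), homogExt f a (relL j c) :=
    ⟨hsm _, fun m p hp => (hr (N + 1) m p hp).isBigO.congr (fun c => by
      simp [homogExt, rad, dir]) fun c => rfl⟩
  refine (s1.add ((hh (N + 1)).symb j)).congr fun c _ => ?_
  rw [sum_Icc_top fun a ha => hz a ha (relL j c)]; ring

open Classical in
/-- The homogeneous coefficients of a function of the class. -/
def hcoef (j : Fin 2) (F : Fun) : ℤ → E3 × Param → ℝ :=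
  if h : ∃ f, IsExpansion j F f then homogExt h.choose else fun _ _ => 0

lemma norm_S2 (n : S2) : ‖(n : E3)‖ = 1 := by simp

lemma S2_ne_zero (n : S2) : (n : E3) ≠ 0 := by
  intro h; simpa [h] using norm_S2 n

lemma coef_eq_hcoef (j : Fin 2) (F : Fun) (a : ℤ) (p : Param) (n : S2) :
    coef j F a p n = hcoef j F a (n, p) := by
  unfold coef hcoef
  split_ifs <;> simp [homogExt]

lemma hExp_hcoef (h : HExp j F u) : HExp j F (hcoef j F) := by
  have h1 : ∃ f, IsExpansion j F f := ⟨u, h.isExpansion⟩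
  unfold hcoef
  rw [dif_pos h1]
  exact hExp_of_isExpansion h.smooth h1.choose_spec

lemma InF.hExp (h : InF F) (j : Fin 2) : HExp j F (hcoef j F) := by
  obtain ⟨f, hf⟩ := h.2 j
  exact hExp_hcoef (hExp_of_isExpansion h.1 hf)

lemma InF.of_hExp {u : Fin 2 → ℤ → E3 × Param → ℝ} (h : ∀ j, HExp j F (u j)) : InF F :=
  ⟨(h 0).smooth, fun j => ⟨_, (h j).isExpansion⟩⟩

/-- `coef` picks an expansion by choice; uniqueness makes the choice irrelevant. Coefficients of
products and derivatives are computed through this lemma. -/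
lemma coef_eq (h : HExp j F u) (a : ℤ) {p : Param} (hp : p ∈ Par) (n : S2) :
    coef j F a p n = u a (n, p) := by
  rw [coef_eq_hcoef]
  exact (hExp_hcoef h).unique h a (mem_Dom.2 ⟨S2_ne_zero n, hp⟩)

end Hadamard
end

/-! ### Integration and harmonic analysis on the unit sphere. -/

noncomputable section
namespace Hadamard

/-! ### Polar coordinates -/

lemma finrank_E3 : Module.finrank ℝ E3 = 3 := by simp

lemma sphere_real_univ : (volume : Measure E3).toSphere.real univ = 4 * Real.pi := by
  rw [Measure.toSphere_real_apply_univ, finrank_E3, measureReal_def,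
    EuclideanSpace.volume_ball_fin_three]
  rw [ENNReal.toReal_mul, ENNReal.toReal_ofReal (by positivity)]
  simp; ring

lemma integral_volumeIoiPow (n : ℕ) (g : ℝ → ℝ) :
    ∫ r, g r ∂(Measure.volumeIoiPow n) = ∫ r in Ioi (0 : ℝ), r ^ n * g r := by
  simp only [Measure.volumeIoiPow, ENNReal.ofReal]
  rw [integral_withDensity_eq_integral_smul,
    integral_subtype_comap measurableSet_Ioi fun a ↦ Real.toNNReal (a ^ n) • g a,
    setIntegral_congr_fun measurableSet_Ioi fun x hx ↦ ?_]
  · simp only [NNReal.smul_def, Real.coe_toNNReal _ (pow_nonneg (le_of_lt hx) _), smul_eq_mul]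
  · exact (measurable_subtype_coe.pow_const _).real_toNNReal

/-- The unit vector along `x`, with an arbitrary value at the origin. -/
def udir (x : E3) : E3 := ‖x‖⁻¹ • x

/-- Space off the origin is the product of the sphere and the half line, with density `r ^ 2`. For a
product function Fubini holds unconditionally, so no integrability is asked for. -/
lemma integral_polar (g : ℝ → ℝ) (h : E3 → ℝ) :
    ∫ x : E3, g ‖x‖ * h (udir x) = (∫ r in Ioi (0 : ℝ), r ^ 2 * g r) * angInt fun n => h n := by
  have h1 : ∫ x : E3, g ‖x‖ * h (udir x) =
      ∫ x : ({(0)}ᶜ : Set E3), g ‖x.1‖ * h (udir x.1) ∂((volume : Measure E3).comap Subtype.val) := by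
    rw [integral_subtype_comap (measurableSet_singleton _).compl
      fun x : E3 => g ‖x‖ * h (udir x), restrict_compl_singleton]
  have h2 := (volume : Measure E3).measurePreserving_homeomorphUnitSphereProd.integral_comp
    (Homeomorph.measurableEmbedding _) (fun q : S2 × Ioi (0 : ℝ) => h q.1 * g q.2)
  have h3 := integral_prod_mul (μ := (volume : Measure E3).toSphere)
    (ν := Measure.volumeIoiPow (Module.finrank ℝ E3 - 1)) (fun n : S2 => h n) fun r => g r
  rw [h1, angInt, mul_comm, ← integral_volumeIoiPow 2 g,
    show 2 = Module.finrank ℝ E3 - 1 by rw [finrank_E3], ← h3, ← h2]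
  refine integral_congr_ae (Eventually.of_forall fun x => ?_)
  simp [udir, mul_comm]

lemma integrable_polar {g : ℝ → ℝ} {h : E3 → ℝ}
    (hg : IntegrableOn (fun r => r ^ 2 * g r) (Ioi 0))
    (hh : Integrable (fun n : S2 => h n) (volume : Measure E3).toSphere) :
    Integrable fun x : E3 => g ‖x‖ * h (udir x) := by
  have hg' : Integrable (fun r : Ioi (0 : ℝ) => g r)
      (Measure.volumeIoiPow (Module.finrank ℝ E3 - 1)) := by
    rw [Measure.volumeIoiPow, integrable_withDensity_iff_integrable_smul' (by fun_prop) (by simp)]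
    rw [IntegrableOn, ← map_comap_subtype_coe measurableSet_Ioi,
      (MeasurableEmbedding.subtype_coe measurableSet_Ioi).integrable_map_iff] at hg
    refine hg.congr (Eventually.of_forall fun r => ?_)
    have hr : (0 : ℝ) < r := r.2
    simp [ENNReal.toReal_ofReal (sq_nonneg (r : ℝ))]
  have h1 : Integrable (fun q : S2 × Ioi (0 : ℝ) => h q.1 * g q.2)
      ((volume : Measure E3).toSphere.prod (Measure.volumeIoiPow (Module.finrank ℝ E3 - 1))) :=
    Integrable.mul_prod hh hg'
  have h2 := ((volume : Measure E3).measurePreserving_homeomorphUnitSphereProd.integrable_comp_emb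
    (Homeomorph.measurableEmbedding _)).2 h1
  rw [← restrict_compl_singleton (μ := (volume : Measure E3)) 0, ← IntegrableOn,
    integrableOn_iff_comap_subtypeVal (by measurability)]
  refine h2.congr (Eventually.of_forall fun x => ?_)
  simp [udir, mul_comm]

lemma integrable_sphere {h : S2 → ℝ} (hh : Continuous h) :
    Integrable h (volume : Measure E3).toSphere :=
  hh.integrable_of_hasCompactSupport (HasCompactSupport.of_compactSpace h)

lemma integral_Ioi_deriv {q q' : ℝ → ℝ} {ε M : ℝ} (hd : ∀ r ∈ Ici ε, HasDerivAt q (q' r) r)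
    (hi : IntegrableOn q' (Ioi ε)) (hM : ∀ r ≥ M, q r = 0) : ∫ r in Ioi ε, q' r = -q ε := by
  have ht : Tendsto q atTop (𝓝 0) :=
    tendsto_const_nhds.congr' (by filter_upwards [eventually_ge_atTop M] with r hr using (hM r hr).symm)
  rw [integral_Ioi_of_hasDerivAt_of_tendsto' hd hi ht, zero_sub]

lemma integrableOn_Ioi_of_zero {q : ℝ → ℝ} {ε M : ℝ} (hc : ContinuousOn q (Ici ε))
    (hM : ∀ r > M, q r = 0) : IntegrableOn q (Ioi ε) := by
  have h1 : IntegrableOn q (Icc ε M) := (hc.mono Icc_subset_Ici_self).integrableOn_Icc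
  have h2 : IntegrableOn q (Ioi M) := by
    refine (integrableOn_congr_fun (g := fun _ => (0 : ℝ)) (fun r hr => hM r hr)
      measurableSet_Ioi).2 integrableOn_zero
  refine (h1.union h2).mono_set fun r hr => ?_
  by_cases h : r ≤ M
  · exact Or.inl ⟨le_of_lt hr, h⟩
  · exact Or.inr (not_le.1 h)

lemma integral_Ioi_restrict {q : ℝ → ℝ} {ε : ℝ} (hε : 0 ≤ ε) (h0 : ∀ r ≤ ε, q r = 0) :
    ∫ r in Ioi 0, q r = ∫ r in Ioi ε, q r := by
  refine (setIntegral_eq_of_subset_of_forall_sdiff_eq_zero measurableSet_Ioi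
    (Ioi_subset_Ioi hε) fun r hr => h0 r ?_)
  simpa using hr.2

/-! ### The divergence formula on the sphere -/

/-- Functions that are smooth off the origin and homogeneous of degree `a`. -/
structure Hom1 (a : ℤ) (h : E3 → ℝ) : Prop where
  smooth : ContDiffOn ℝ ∞ h {0}ᶜ
  hom : ∀ r : ℝ, 0 < r → ∀ z : E3, z ≠ 0 → h (r • z) = r ^ a * h z

/-- The partial derivative of a function of space. -/
def pdx (i : Fin 3) (h : E3 → ℝ) (z : E3) : ℝ := fderiv ℝ h z (ex i)

lemma hom1_const (r : ℝ) : Hom1 0 (fun _ => r) := ⟨contDiffOn_const, by simp⟩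

lemma ne_zero_of_S2 (n : S2) : (n : E3) ∈ ({0}ᶜ : Set E3) := S2_ne_zero n

section Hom1
variable {a b : ℤ} {h g : E3 → ℝ}

lemma Hom1.contDiffAt (hh : Hom1 a h) {z : E3} (hz : z ≠ 0) : ContDiffAt ℝ ∞ h z :=
  hh.smooth.contDiffAt (isOpen_compl_singleton.mem_nhds hz)

lemma Hom1.differentiableAt (hh : Hom1 a h) {z : E3} (hz : z ≠ 0) : DifferentiableAt ℝ h z :=
  (hh.contDiffAt hz).differentiableAt (by simp)

lemma Hom1.continuous (hh : Hom1 a h) : Continuous fun n : S2 => h n :=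
  hh.smooth.continuousOn.comp_continuous continuous_subtype_val ne_zero_of_S2

lemma Hom1.homog (hh : Hom1 a h) : Homog a (fun c : E3 × Param => h c.1) :=
  ⟨hh.smooth.comp contDiffOn_fst fun _ hc => (mem_Dom.1 hc).1,
    fun r hr z hz _ _ => hh.hom r hr z hz⟩

lemma Homog.slice {u : E3 × Param → ℝ} (hu : Homog a u) {p : Param} (hp : p ∈ Par) :
    Hom1 a (fun z => u (z, p)) :=
  ⟨hu.smooth.comp (contDiff_id.prodMk contDiff_const).contDiffOn fun _ hz => mem_Dom.2 ⟨hz, hp⟩,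
    fun r hr z hz => hu.hom r hr z hz p hp⟩

lemma Hom1.sub (hh : Hom1 a h) (hg : Hom1 a g) : Hom1 a (fun z => h z - g z) :=
  ⟨hh.smooth.sub hg.smooth, fun r hr z hz => by rw [hh.hom r hr z hz, hg.hom r hr z hz]; ring⟩

lemma Hom1.mul (hh : Hom1 a h) (hg : Hom1 b g) : Hom1 (a + b) (fun z => h z * g z) :=
  ⟨hh.smooth.mul hg.smooth, fun r hr z hz => by
    rw [hh.hom r hr z hz, hg.hom r hr z hz, zpow_add₀ hr.ne']; ring⟩

lemma Hom1.const_mul (r : ℝ) (hh : Hom1 a h) : Hom1 a (fun z => r * h z) := by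
  simpa using (hom1_const r).mul hh

lemma Hom1.cast (hh : Hom1 a h) (hb : a = b) : Hom1 b h := hb ▸ hh

lemma Hom1.sum {ι : Type*} (s : Finset ι) {h : ι → E3 → ℝ} (hh : ∀ i ∈ s, Hom1 a (h i)) :
    Hom1 a (fun z => ∑ i ∈ s, h i z) :=
  ⟨ContDiffOn.sum fun i hi => (hh i hi).smooth, fun r hr z hz => by
    rw [Finset.mul_sum]; exact Finset.sum_congr rfl fun i hi => (hh i hi).hom r hr z hz⟩

lemma hom1_coord (i : Fin 3) : Hom1 1 (fun z => z i) :=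
  ⟨by fun_prop, fun r _ z _ => by simp⟩

lemma Hom1.pdx (hh : Hom1 a h) (i : Fin 3) : Hom1 (a - 1) (pdx i h) := by
  refine ⟨?_, fun r hr z hz => ?_⟩
  · exact (hh.smooth.fderiv_of_isOpen isOpen_compl_singleton (by simp)).clm_apply contDiffOn_const
  have hrz : r • z ≠ 0 := smul_ne_zero hr.ne' hz
  have h1 : HasFDerivAt (fun z => h (r • z))
      ((fderiv ℝ h (r • z)).comp (r • ContinuousLinearMap.id ℝ E3)) z :=
    (hh.differentiableAt hrz).hasFDerivAt.comp z ((hasFDerivAt_id z).const_smul r)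
  have h2 : HasFDerivAt (fun z => h (r • z)) (r ^ a • fderiv ℝ h z) z := by
    refine ((hh.differentiableAt hz).hasFDerivAt.const_smul (r ^ a)).congr_of_eventuallyEq ?_
    filter_upwards [isOpen_compl_singleton.mem_nhds hz] with w hw using hh.hom r hr w hw
  have h3 := congrArg (fun L => L (ex i)) (h1.unique h2)
  simp only [ContinuousLinearMap.comp_apply, _root_.smul_apply, ContinuousLinearMap.id_apply,
    map_smul, smul_eq_mul] at h3
  rw [Hadamard.pdx, Hadamard.pdx, zpow_sub_one₀ hr.ne', mul_right_comm, ← h3]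
  field_simp

lemma Hom1.euler (hh : Hom1 a h) {z : E3} (hz : z ≠ 0) :
    ∑ i, z i * Hadamard.pdx i h z = a * h z := by
  have h1 : HasDerivAt (fun r : ℝ => h (r • z)) (fderiv ℝ h z z) 1 := by
    have h0 : HasFDerivAt h (fderiv ℝ h z) ((1 : ℝ) • z) := by
      rw [one_smul]; exact (hh.differentiableAt hz).hasFDerivAt
    have h3 := h0.comp_hasDerivAt (1 : ℝ) ((hasDerivAt_id (1 : ℝ)).smul_const z)
    rw [one_smul] at h3
    exact h3
  have h2 : HasDerivAt (fun r : ℝ => h (r • z)) (a * h z) 1 := by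
    have := (hasDerivAt_zpow a (1 : ℝ) (Or.inl one_ne_zero)).mul_const (h z)
    simp only [one_zpow, mul_one] at this
    refine this.congr_of_eventuallyEq ?_
    filter_upwards [Ioi_mem_nhds (show (0 : ℝ) < 1 by norm_num)] with r hr using hh.hom r hr z hz
  rw [← h1.unique h2]
  have hzz : z = ∑ i, z i • ex i := by
    ext k; simp [ex, Pi.single_apply]
  have h3 := congrArg (fderiv ℝ h z) hzz
  rw [map_sum] at h3
  rw [h3]
  simp [Hadamard.pdx]

lemma pdx_mul {z : E3} (hh : DifferentiableAt ℝ h z) (hg : DifferentiableAt ℝ g z) (i : Fin 3) :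
    pdx i (fun z => h z * g z) z = pdx i h z * g z + h z * pdx i g z := by
  simp only [pdx]; rw [fderiv_fun_mul hh hg]; simp; ring

lemma pdx_coord (i k : Fin 3) (z : E3) : pdx i (fun z => z k) z = if k = i then 1 else 0 := by
  have : (fun z : E3 => z k) = fun z => EuclideanSpace.proj (𝕜 := ℝ) k z := rfl
  rw [pdx, this, ContinuousLinearMap.fderiv]
  simp [ex]

lemma pdx_norm {z : E3} (hz : z ≠ 0) (i : Fin 3) : pdx i (fun z => ‖z‖) z = z i / ‖z‖ := by
  have h0 : ‖z‖ ≠ 0 := norm_ne_zero_iff.2 hz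
  have h1 : DifferentiableAt ℝ (fun z : E3 => ‖z‖) z :=
    (contDiffAt_norm ℝ (n := 1) hz).differentiableAt (by simp)
  have h2 := pdx_mul h1 h1 i
  have h3 : (fun z : E3 => ‖z‖ * ‖z‖) = fun z => z 0 * z 0 + z 1 * z 1 + z 2 * z 2 := by
    ext z; rw [← sq, EuclideanSpace.norm_sq_eq]; simp [Fin.sum_univ_three]; ring
  have hd : ∀ k : Fin 3, DifferentiableAt ℝ (fun z : E3 => z k) z := fun k => by fun_prop
  have h4 : pdx i (fun z : E3 => z 0 * z 0 + z 1 * z 1 + z 2 * z 2) z = 2 * z i := by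
    have hm : ∀ k : Fin 3, DifferentiableAt ℝ (fun z : E3 => z k * z k) z := fun k => by fun_prop
    have : pdx i (fun z : E3 => z 0 * z 0 + z 1 * z 1 + z 2 * z 2) z =
        pdx i (fun z : E3 => z 0 * z 0) z + pdx i (fun z : E3 => z 1 * z 1) z
          + pdx i (fun z : E3 => z 2 * z 2) z := by
      have hm01 : DifferentiableAt ℝ (fun z : E3 => z 0 * z 0 + z 1 * z 1) z := by fun_prop
      simp only [pdx]
      rw [fderiv_fun_add hm01 (hm 2), fderiv_fun_add (hm 0) (hm 1)]; rfl
    rw [this]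
    simp only [pdx_mul (hd _) (hd _), pdx_coord]
    fin_cases i <;> simp <;> ring
  rw [h3, h4] at h2
  field_simp; linarith

/-- Integration by parts against a radial cutoff. -/
lemma integral_pdx_eq_zero {f : E3 → ℝ} (hf : ContDiff ℝ 1 f) (hc : HasCompactSupport f)
    (i : Fin 3) : ∫ x, pdx i f x = 0 := by
  have hcont : Continuous (fun x => fderiv ℝ f x (ex i)) :=
    (hf.continuous_fderiv (by simp)).clm_apply continuous_const
  have hcs : HasCompactSupport (fun x => fderiv ℝ f x (ex i)) := hc.fderiv_apply (𝕜 := ℝ) (ex i)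
  have := integral_mul_fderiv_eq_neg_fderiv_mul_of_integrable (μ := (volume : Measure E3))
    (f := fun _ : E3 => (1 : ℝ)) (g := f) (v := ex i) (by simp)
    (by simpa using hcont.integrable_of_hasCompactSupport hcs)
    (by simpa using hf.continuous.integrable_of_hasCompactSupport hc)
    (by simp) (fun x _ => hf.differentiable (by simp) x)
  simpa [pdx] using this

lemma Hom1.eq_udir (hh : Hom1 a h) {x : E3} (hx : x ≠ 0) : h x = ‖x‖ ^ a * h (udir x) := by
  have h0 : ‖x‖ ≠ 0 := norm_ne_zero_iff.2 hx
  have := hh.hom ‖x‖ (norm_pos_iff.2 hx) (udir x) (smul_ne_zero (inv_ne_zero h0) hx)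
  rwa [udir, smul_inv_smul₀ h0] at this

/-- The integral of a radial function times a homogeneous function. -/
lemma integral_radial_mul (hh : Hom1 a h) (g : ℝ → ℝ) :
    ∫ x : E3, g ‖x‖ * h x =
      (∫ r in Ioi (0 : ℝ), g r * r ^ (a + 2)) * angInt fun n => h n := by
  have h1 : ∫ x : E3, g ‖x‖ * h x = ∫ x : E3, (fun r => g r * r ^ a) ‖x‖ * h (udir x) := by
    refine integral_congr_ae ?_
    have : ({0}ᶜ : Set E3) ∈ ae (volume : Measure E3) := by
      rw [mem_ae_iff, compl_compl]; exact measure_singleton _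
    filter_upwards [this] with x hx
    rw [hh.eq_udir hx]; ring
  rw [h1, integral_polar (fun r => g r * r ^ a) h]
  congr 1
  refine setIntegral_congr_fun measurableSet_Ioi fun r hr => ?_
  rw [zpow_add₀ (ne_of_gt hr)]; simp; ring

lemma integrable_radial_mul (hh : Hom1 a h) {g : ℝ → ℝ}
    (hg : IntegrableOn (fun r => g r * r ^ (a + 2)) (Ioi 0)) :
    Integrable fun x : E3 => g ‖x‖ * h x := by
  have h1 : IntegrableOn (fun r : ℝ => r ^ 2 * (g r * r ^ a)) (Ioi 0) := by
    refine hg.congr_fun (fun r hr => ?_) measurableSet_Ioi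
    change g r * r ^ (a + 2) = _
    rw [zpow_add₀ (ne_of_gt hr)]; simp; ring
  refine (integrable_polar (g := fun r => g r * r ^ a) h1 (integrable_sphere hh.continuous)).congr ?_
  have : ({0}ᶜ : Set E3) ∈ ae (volume : Measure E3) := by
    rw [mem_ae_iff, compl_compl]; exact measure_singleton _
  filter_upwards [this] with x hx
  rw [hh.eq_udir hx]; ring

/-- The divergence formula on the sphere. -/
lemma Hom1.divergence (hh : Hom1 a h) (i : Fin 3) :
    angInt (fun n => Hadamard.pdx i h n) = (a + 2) * angInt (fun n => (n : E3) i * h n) := by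
  -- The bump lives on radii between 1 and 2, so `η(|x|) h(x)` extends by zero to a `C¹` function of
  -- compact support and its derivative has integral zero. In polar coordinates this becomes a
  -- relation between the two angular integrals.
  let η : ContDiffBump (3 / 2 : ℝ) := ⟨1 / 4, 1 / 2, by norm_num, by norm_num⟩
  have hη0 : ∀ r, r ≤ 1 → η r = 0 := fun r hr => η.zero_of_le_dist (by
    rw [Real.dist_eq, abs_of_nonpos (by linarith)]; change (1 / 2 : ℝ) ≤ _; linarith)
  have hη1 : ∀ r, 2 ≤ r → η r = 0 := fun r hr => η.zero_of_le_dist (by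
    rw [Real.dist_eq, abs_of_nonneg (by linarith)]; change (1 / 2 : ℝ) ≤ _; linarith)
  have hηs : ContDiff ℝ ∞ η := η.contDiff
  have hηd : ∀ r, HasDerivAt η (deriv η r) r := fun r =>
    (hηs.differentiable (by simp) r).hasDerivAt
  have hηc : Continuous (deriv η) := hηs.continuous_deriv (by simp)
  have hd0 : ∀ r, r ≤ 1 → deriv η r = 0 := by
    intro r hr
    have h1 : HasDerivWithinAt η 0 (Iic r) r := by
      refine (hasDerivWithinAt_const r (Iic r) (0 : ℝ)).congr (fun y hy => ?_) (hη0 r hr)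
      exact hη0 y (le_trans hy hr)
    exact (uniqueDiffOn_Iic r r self_mem_Iic).eq_deriv _ (hηd r).hasDerivWithinAt h1
  have hd1 : ∀ r, 2 ≤ r → deriv η r = 0 := by
    intro r hr
    have h1 : HasDerivWithinAt η 0 (Ici r) r := by
      refine (hasDerivWithinAt_const r (Ici r) (0 : ℝ)).congr (fun y hy => ?_) (hη1 r hr)
      exact hη1 y (le_trans hr hy)
    exact (uniqueDiffOn_Ici r r self_mem_Ici).eq_deriv _ (hηd r).hasDerivWithinAt h1
  set f : E3 → ℝ := fun x => η ‖x‖ * h x with hf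
  have hfs : ContDiff ℝ 1 f := by
    rw [contDiff_iff_contDiffAt]
    intro x
    by_cases hx : x = 0
    · subst hx
      refine (contDiffAt_const (c := (0 : ℝ))).congr_of_eventuallyEq ?_
      filter_upwards [Metric.ball_mem_nhds (0 : E3) one_pos] with y hy
      rw [hf]; simp only
      rw [hη0 _ (by simpa using (mem_ball_zero_iff.1 hy).le), zero_mul]
    · exact ((hηs.contDiffAt.comp x (contDiffAt_norm ℝ hx)).mul (hh.contDiffAt hx)).of_le
        (by exact_mod_cast le_top)
  have hfc : HasCompactSupport f := by
    refine HasCompactSupport.intro (isCompact_closedBall (0 : E3) 2) fun x hx => ?_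
    have : 2 < ‖x‖ := by simpa using hx
    rw [hf]; simp only; rw [hη1 _ this.le, zero_mul]
  have h0 := integral_pdx_eq_zero hfs hfc i
  have hn : Hom1 0 (fun z : E3 => z i / ‖z‖) := by
    refine ⟨fun z hz => ?_, fun r hr z hz => ?_⟩
    · have : ContDiffAt ℝ ∞ (fun z : E3 => z i / ‖z‖) z :=
        (by fun_prop : ContDiffAt ℝ ∞ (fun z : E3 => z i) z).div (contDiffAt_norm ℝ hz)
          (norm_ne_zero_iff.2 hz)
      exact this.contDiffWithinAt
    · have : ‖z‖ ≠ 0 := norm_ne_zero_iff.2 hz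
      simp [norm_smul, abs_of_pos hr]; field_simp
  have hA : Hom1 a (fun z : E3 => z i / ‖z‖ * h z) := (hn.mul hh).cast (by ring)
  have hB := hh.pdx i
  have e1 : ∀ᵐ x : E3, Hadamard.pdx i f x =
      (deriv η) ‖x‖ * (x i / ‖x‖ * h x) + η ‖x‖ * Hadamard.pdx i h x := by
    have : ({0}ᶜ : Set E3) ∈ ae (volume : Measure E3) := by
      rw [mem_ae_iff, compl_compl]; exact measure_singleton _
    filter_upwards [this] with x hx
    have hnd : HasFDerivAt (fun z : E3 => ‖z‖) (fderiv ℝ (fun z : E3 => ‖z‖) x) x :=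
      ((contDiffAt_norm ℝ (n := 1) hx).differentiableAt (by simp)).hasFDerivAt
    have hηn : HasFDerivAt (fun z : E3 => η ‖z‖)
        (deriv η ‖x‖ • fderiv ℝ (fun z : E3 => ‖z‖) x) x :=
      (hηd ‖x‖).comp_hasFDerivAt x hnd
    rw [hf, pdx_mul hηn.differentiableAt (hh.differentiableAt hx)]
    have : Hadamard.pdx i (fun z : E3 => η ‖z‖) x = deriv η ‖x‖ * (x i / ‖x‖) := by
      rw [← pdx_norm hx, Hadamard.pdx, hηn.fderiv]; simp [Hadamard.pdx]
    rw [this]; ring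
  have cz : ∀ m : ℤ, ContinuousOn (fun r : ℝ => r ^ m) (Ici 1) := fun m r hr =>
    (continuousAt_zpow₀ r m (Or.inl (by have : (1 : ℝ) ≤ r := hr; positivity))).continuousWithinAt
  have i1 : IntegrableOn (fun r => deriv η r * r ^ (a + 2)) (Ioi 1) :=
    integrableOn_Ioi_of_zero (M := 2) (hηc.continuousOn.mul (cz _)) fun r hr => by
      rw [hd1 r (le_of_lt hr), zero_mul]
  have i2 : ∀ m : ℤ, IntegrableOn (fun r => η r * r ^ m) (Ioi 1) := fun m =>
    integrableOn_Ioi_of_zero (M := 2) (hηs.continuous.continuousOn.mul (cz _)) fun r hr => by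
      rw [hη1 r (le_of_lt hr), zero_mul]
  have ext0 : ∀ {q : ℝ → ℝ}, (∀ r ≤ 1, q r = 0) → IntegrableOn q (Ioi 1) → IntegrableOn q (Ioi 0) := by
    intro q hq hi
    have h2 : IntegrableOn q (Ioc 0 1) := (integrableOn_congr_fun (g := fun _ => (0 : ℝ))
      (fun r hr => hq r hr.2) measurableSet_Ioc).2 integrableOn_zero
    refine (h2.union hi).mono_set fun r hr => ?_
    by_cases h : r ≤ 1
    · exact Or.inl ⟨hr, h⟩
    · exact Or.inr (not_le.1 h)
  have j1 := ext0 (fun r hr => by simp [hd0 r hr]) i1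
  have j2 := ext0 (fun r hr => by simp [hη0 r hr]) (i2 (a - 1 + 2))
  rw [integral_congr_ae e1, integral_add (integrable_radial_mul hA j1)
    (integrable_radial_mul hB j2), integral_radial_mul hA, integral_radial_mul hB] at h0
  -- Radial integration by parts, which produces the factor `a + 2`.
  have e2 : ∫ r in Ioi (0 : ℝ), deriv η r * r ^ (a + 2) =
      -((a + 2) * ∫ r in Ioi (0 : ℝ), η r * r ^ (a - 1 + 2)) := by
    rw [integral_Ioi_restrict zero_le_one (fun r hr => by simp [hd0 r hr]),
      integral_Ioi_restrict zero_le_one (fun r hr => by simp [hη0 r hr]), ← integral_const_mul]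
    have hsum := integral_Ioi_deriv (q := fun r => η r * r ^ (a + 2))
      (q' := fun r => deriv η r * r ^ (a + 2) + (a + 2) * (η r * r ^ (a - 1 + 2)))
      (ε := 1) (M := 2) (fun r hr => ?_) (i1.add ((i2 _).const_mul _)) fun r hr => by simp [hη1 r hr]
    · rw [integral_add i1 ((i2 _).const_mul _)] at hsum
      simp only [hη0 1 le_rfl, zero_mul, neg_zero] at hsum
      linarith
    · have hr0 : r ≠ 0 := by have : (1 : ℝ) ≤ r := hr; positivity
      refine ((hηd r).mul (hasDerivAt_zpow (a + 2) r (Or.inl hr0))).congr_deriv ?_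
      push_cast
      rw [show a + 2 - 1 = a - 1 + 2 by ring]; ring
  -- The remaining radial integral is a common factor of both sides and must be nonzero in order to
  -- be cancelled; `η = 1` between `5/4` and `7/4`.
  have hpos : 0 < ∫ r in Ioi (0 : ℝ), η r * r ^ (a - 1 + 2) := by
    rw [setIntegral_pos_iff_support_of_nonneg_ae _ j2]
    · refine lt_of_lt_of_le ?_ (measure_mono (show Ioo (5 / 4 : ℝ) (7 / 4) ⊆ _ from ?_))
      · simp; norm_num
      · intro r hr
        have hr0 : (0 : ℝ) < r := by linarith [hr.1]
        refine ⟨mul_ne_zero ?_ (zpow_pos hr0 _).ne', hr0⟩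
        rw [η.one_of_mem_closedBall]
        · exact one_ne_zero
        · rw [Metric.mem_closedBall, Real.dist_eq, abs_le]
          change -(1 / 4 : ℝ) ≤ _ ∧ _ ≤ (1 / 4 : ℝ)
          constructor <;> linarith [hr.1, hr.2]
    · refine (ae_restrict_iff' measurableSet_Ioi).2 (Eventually.of_forall fun r hr => ?_)
      exact mul_nonneg η.nonneg (zpow_pos hr _).le
  have e3 : angInt (fun n => (n : E3) i / ‖(n : E3)‖ * h n) = angInt (fun n => (n : E3) i * h n) := by
    simp [angInt]
  rw [e2, e3] at h0
  have h1 : (∫ r in Ioi (0 : ℝ), η r * r ^ (a - 1 + 2)) *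
      (angInt (fun n => Hadamard.pdx i h n) - (a + 2) * angInt (fun n => (n : E3) i * h n)) = 0 := by
    linarith
  rcases mul_eq_zero.1 h1 with h2 | h2
  · exact absurd h2 hpos.ne'
  · linarith

end Hom1

end Hadamard
end

noncomputable section
namespace Hadamard

/-! ### Continuous functions on the sphere -/

/-- Continuous functions on the sphere. -/
abbrev CS := C(S2, ℝ)

open Classical in
/-- A continuous function on the sphere as an element of `CS`. -/
def toC (f : S2 → ℝ) : CS := if h : Continuous f then ⟨f, h⟩ else 0

lemma toC_apply {f : S2 → ℝ} (hf : Continuous f) (n : S2) : toC f n = f n := by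
  simp [toC, hf]

lemma angMean_add {f g : S2 → ℝ} (hf : Continuous f) (hg : Continuous g) :
    angMean (fun n => f n + g n) = angMean f + angMean g := by
  simp only [angMean, angInt]
  rw [integral_add (integrable_sphere hf) (integrable_sphere hg)]; ring

lemma angMean_mul (r : ℝ) (f : S2 → ℝ) : angMean (fun n => r * f n) = r * angMean f := by
  simp only [angMean, angInt]
  rw [integral_const_mul]; ring

lemma angMean_sum {ι : Type*} (s : Finset ι) {f : ι → S2 → ℝ} (hf : ∀ i ∈ s, Continuous (f i)) :
    angMean (fun n => ∑ i ∈ s, f i n) = ∑ i ∈ s, angMean (f i) := by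
  simp only [angMean, angInt]
  rw [integral_finsetSum _ fun i hi => integrable_sphere (hf i hi), Finset.mul_sum]

lemma angMean_const (r : ℝ) : angMean (fun _ => r) = r := by
  have : angInt (fun _ => r) = 4 * Real.pi * r := by
    rw [angInt, integral_const, sphere_real_univ, smul_eq_mul]
  rw [angMean, this]; field_simp

/-- The angular average as a continuous linear form. -/
def avg : CS →L[ℝ] ℝ :=
  LinearMap.mkContinuous
    { toFun := fun f => angMean f
      map_add' := fun f g => angMean_add f.continuous g.continuous
      map_smul' := fun r f => angMean_mul r f } 1 fun f => by
    change ‖angMean f‖ ≤ 1 * ‖f‖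
    have h1 : ‖angInt f‖ ≤ ‖f‖ * (4 * Real.pi) := by
      rw [← sphere_real_univ]
      exact norm_integral_le_of_norm_le_const (Eventually.of_forall fun n => f.norm_coe_le_norm n)
    rw [angMean, norm_mul, Real.norm_of_nonneg (by positivity), one_mul]
    calc (4 * Real.pi)⁻¹ * ‖angInt f‖ ≤ (4 * Real.pi)⁻¹ * (‖f‖ * (4 * Real.pi)) := by gcongr
      _ = ‖f‖ := by field_simp

lemma avg_apply (f : CS) : avg f = angMean f := rfl

lemma abs_avg_le (f : CS) : |avg f| ≤ ‖f‖ := by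
  have := avg.le_of_opNorm_le (c := 1)
    (LinearMap.mkContinuous_norm_le _ zero_le_one _) f
  simpa using this

/-! ### Smooth families -/

/-- The restriction of a family to the sphere. -/
def fam (u : E3 × Param → ℝ) (p : Param) : CS := toC fun n => u (n, p)

lemma continuous_slice {V : Type*} [TopologicalSpace V] {u : E3 × Param → V}
    (hu : ContinuousOn u Dom) {p : Param} (hp : p ∈ Par) : Continuous fun n : S2 => u (n, p) :=
  hu.comp_continuous (by fun_prop) fun n => mem_Dom.2 ⟨S2_ne_zero n, hp⟩

lemma fam_apply {u : E3 × Param → ℝ} (hu : ContinuousOn u Dom) {p : Param} (hp : p ∈ Par) (n : S2) :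
    fam u p n = u (n, p) := toC_apply (continuous_slice hu hp) n

lemma contDiffOn_dp {u : E3 × Param → ℝ} (hu : ContDiffOn ℝ ∞ u Dom) :
    ContDiffOn ℝ ∞ (dp u) Dom := (contDiffOn_fderiv_Dom hu).clm_comp contDiffOn_const

lemma contDiffOn_dp_apply {u : E3 × Param → ℝ} (hu : ContDiffOn ℝ ∞ u Dom) (w : Param) :
    ContDiffOn ℝ ∞ (fun c => dp u c w) Dom := (contDiffOn_dp hu).clm_apply contDiffOn_const

lemma hasFDerivAt_slice {u : E3 × Param → ℝ} (hu : ContDiffOn ℝ ∞ u Dom) {z : E3} (hz : z ≠ 0)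
    {p : Param} (hp : p ∈ Par) : HasFDerivAt (fun p => u (z, p)) (dp u (z, p)) p := by
  have h1 := (differentiableAt_of_Dom hu (mem_Dom.2 ⟨hz, hp⟩)).hasFDerivAt
  exact h1.comp p (hasFDerivAt_prodMk_right z p)

/-- The derivative of a family with respect to the parameters. -/
def famDeriv {u : E3 × Param → ℝ} (hu : ContDiffOn ℝ ∞ u Dom) {p : Param} (hp : p ∈ Par) :
    Param →L[ℝ] CS :=
  LinearMap.toContinuousLinearMap
    { toFun := fun w => fam (fun c => dp u c w) p
      map_add' := fun w w' => by
        ext n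
        have h1 := fam_apply (contDiffOn_dp_apply hu w).continuousOn hp n
        have h2 := fam_apply (contDiffOn_dp_apply hu w').continuousOn hp n
        have h3 := fam_apply (contDiffOn_dp_apply hu (w + w')).continuousOn hp n
        rw [ContinuousMap.add_apply, h1, h2, h3, map_add]
      map_smul' := fun r w => by
        ext n
        have h1 := fam_apply (contDiffOn_dp_apply hu w).continuousOn hp n
        have h3 := fam_apply (contDiffOn_dp_apply hu (r • w)).continuousOn hp n
        rw [RingHom.id_apply, ContinuousMap.smul_apply, h1, h3, map_smul] }

lemma famDeriv_apply {u : E3 × Param → ℝ} (hu : ContDiffOn ℝ ∞ u Dom) {p : Param} (hp : p ∈ Par)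
    (w : Param) : famDeriv hu hp w = fam (fun c => dp u c w) p := rfl

/-- The pointwise derivative in `p` is uniformly close to its value at `p` over the compact sphere,
so the mean value inequality is uniform in the direction. Differentiability in the sup norm is what
lets averages and multipole series be differentiated by the chain rule. -/
lemma hasFDerivAt_fam {u : E3 × Param → ℝ} (hu : ContDiffOn ℝ ∞ u Dom) {p : Param} (hp : p ∈ Par) :
    HasFDerivAt (fam u) (famDeriv hu hp) p := by
  rw [hasFDerivAt_iff_isLittleO, isLittleO_iff]
  intro ε hε
  have hcont : ContinuousOn (Function.uncurry fun (p : Param) (n : S2) => dp u (n, p))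
      (Par ×ˢ univ) :=
    (contDiffOn_dp hu).continuousOn.comp (by fun_prop) fun q hq => mem_Dom.2 ⟨S2_ne_zero q.2, hq.1⟩
  obtain ⟨s, hs, hsu⟩ := isCompact_univ.mem_uniformity_of_prod hcont hp (Metric.dist_mem_uniformity hε)
  rw [nhdsWithin_eq_nhds.2 (isOpen_Par.mem_nhds hp)] at hs
  obtain ⟨δ, hδ, hball⟩ := Metric.mem_nhds_iff.1 (inter_mem hs (isOpen_Par.mem_nhds hp))
  filter_upwards [Metric.ball_mem_nhds p hδ] with q hq
  rw [ContinuousMap.norm_le _ (by positivity)]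
  intro n
  have hqP : q ∈ Par := (hball hq).2
  have hbd : ∀ x ∈ Metric.ball p δ, ‖dp u ((n : E3), x) - dp u ((n : E3), p)‖ ≤ ε := fun x hx => by
    have h1 := hsu x (hball hx).1 n (mem_univ _)
    have h2 : dist (dp u ((n : E3), x)) (dp u ((n : E3), p)) < ε := h1
    rw [← dist_eq_norm]; exact h2.le
  have := Convex.norm_image_sub_le_of_norm_hasFDerivWithin_le' (f := fun p => u ((n : E3), p))
    (fun x hx => (hasFDerivAt_slice hu (S2_ne_zero n) (hball hx).2).hasFDerivWithinAt) hbd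
    (convex_ball p δ) (Metric.mem_ball_self hδ) hq
  have h1 := fam_apply (contDiffOn_dp_apply hu (q - p)).continuousOn hp n
  rw [ContinuousMap.sub_apply, ContinuousMap.sub_apply, famDeriv_apply, h1,
    fam_apply hu.continuousOn hp, fam_apply hu.continuousOn hqP]
  exact this

/-- The derivative in a fixed parameter direction is again a smooth family, so the order can be
raised by induction. -/
lemma contDiffOn_fam {u : E3 × Param → ℝ} (hu : ContDiffOn ℝ ∞ u Dom) :
    ContDiffOn ℝ ∞ (fam u) Par := by
  rw [contDiffOn_infty]
  intro m
  induction m generalizing u with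
  | zero =>
    rw [Nat.cast_zero, contDiffOn_zero]
    exact fun p hp => (hasFDerivAt_fam hu hp).continuousAt.continuousWithinAt
  | succ m ih =>
    rw [Nat.cast_succ, contDiffOn_succ_iff_fderiv_of_isOpen isOpen_Par]
    refine ⟨fun p hp => (hasFDerivAt_fam hu hp).differentiableAt.differentiableWithinAt,
      by simp, contDiffOn_clm_apply.2 fun w => ?_⟩
    refine (ih (contDiffOn_dp_apply hu w)).congr fun p hp => ?_
    rw [(hasFDerivAt_fam hu hp).fderiv, famDeriv_apply]

end Hadamard
end

noncomputable section
namespace Hadamard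

/-! ### Harmonic polynomials attached to trace-free tensors -/

/-- The homogeneous polynomial `T_L x^L`. -/
def uT (l : ℕ) (T : Tensor l) (x : E3) : ℝ := ∑ L : Fin l → Fin 3, T L * ∏ k, x (L k)

/-- Contraction of the first index with a basis vector. -/
def contr {l : ℕ} (a : Fin 3) (T : Tensor (l + 1)) : Tensor l :=
  WithLp.toLp 2 fun L => T (Fin.cons a L)

/-- The scalar product of two tensors. -/
def dotT {l : ℕ} (S T : Tensor l) : ℝ := ∑ L, S L * T L

lemma sum_cons {M : Type*} [AddCommMonoid M] {l : ℕ} (f : (Fin (l + 1) → Fin 3) → M) :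
    ∑ L, f L = ∑ a : Fin 3, ∑ L : Fin l → Fin 3, f (Fin.cons a L) := by
  rw [← (Fin.consEquiv fun _ : Fin (l + 1) => Fin 3).sum_comp, Fintype.sum_prod_type]
  rfl

lemma uT_succ (l : ℕ) (T : Tensor (l + 1)) (x : E3) :
    uT (l + 1) T x = ∑ a, x a * uT l (contr a T) x := by
  rw [uT, sum_cons]
  refine Finset.sum_congr rfl fun a _ => ?_
  rw [uT, Finset.mul_sum]
  refine Finset.sum_congr rfl fun L _ => ?_
  rw [Fin.prod_univ_succ]; simp [contr]; ring

lemma dotT_succ {l : ℕ} (S T : Tensor (l + 1)) :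
    dotT S T = ∑ a, dotT (contr a S) (contr a T) := sum_cons _

lemma uT_zero (T : Tensor 0) (x : E3) : uT 0 T x = T default := by
  rw [uT, Fintype.sum_unique]
  simpa using congrArg (fun M => T M) (Subsingleton.elim _ _)

lemma hom1_uT (l : ℕ) (T : Tensor l) : Hom1 l (uT l T) := by
  induction l with
  | zero =>
    have : uT 0 T = fun _ => T default := funext (uT_zero T)
    rw [this]; exact hom1_const _
  | succ l ih =>
    have : uT (l + 1) T = fun x => ∑ a, x a * uT l (contr a T) x := funext (uT_succ l T)
    rw [this]
    exact Hom1.sum _ fun a _ => ((hom1_coord a).mul (ih _)).cast (by push_cast; ring)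

lemma contDiff_uT (l : ℕ) (T : Tensor l) : ContDiff ℝ ∞ (uT l T) := by
  induction l with
  | zero =>
    have : uT 0 T = fun _ => T default := funext (uT_zero T)
    rw [this]; exact contDiff_const
  | succ l ih =>
    have : uT (l + 1) T = fun x => ∑ a, x a * uT l (contr a T) x := funext (uT_succ l T)
    rw [this]
    exact ContDiff.sum fun a _ => (by fun_prop : ContDiff ℝ ∞ fun x : E3 => x a).mul (ih _)

lemma contr_mem_stf {l : ℕ} {T : Tensor (l + 1)} (hT : T ∈ stf (l + 1)) (a : Fin 3) :
    contr a T ∈ stf l := by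
  refine ⟨fun σ L => ?_, fun b c hbc L => ?_⟩
  · change T (Fin.cons a (L ∘ σ)) = T (Fin.cons a L)
    rw [← hT.1 (Equiv.Perm.decomposeFin.symm (0, σ)) (Fin.cons a L)]
    refine congrArg (fun M => T M) (funext fun k => ?_)
    refine Fin.cases ?_ (fun k => ?_) k <;> simp
  · change ∑ i, T (Fin.cons a (Function.update (Function.update L b i) c i)) = 0
    have := hT.2 b.succ c.succ (by simpa using hbc) (Fin.cons a L)
    simpa only [← Fin.cons_update] using this

lemma contr_comm {l : ℕ} {T : Tensor (l + 2)} (hT : T ∈ stf (l + 2)) (a b : Fin 3) :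
    contr a (contr b T) = contr b (contr a T) := by
  ext L
  change T (Fin.cons b (Fin.cons a L)) = T (Fin.cons a (Fin.cons b L))
  rw [← hT.1 (Equiv.swap 0 1) (Fin.cons a (Fin.cons b L))]
  refine congrArg (fun M => T M) (funext fun k => ?_)
  refine Fin.cases ?_ (fun k => ?_) k
  · change b = (Fin.cons a (Fin.cons b L) : Fin (l + 2) → Fin 3) (Equiv.swap 0 1 0)
    rw [Equiv.swap_apply_left]; rfl
  · refine Fin.cases ?_ (fun k => ?_) k
    · change a = (Fin.cons a (Fin.cons b L) : Fin (l + 2) → Fin 3) (Equiv.swap 0 1 1)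
      rw [Equiv.swap_apply_right]; rfl
    · have h1 : Equiv.swap (0 : Fin (l + 2)) 1 k.succ.succ = k.succ.succ :=
        Equiv.swap_apply_of_ne_of_ne (Fin.succ_ne_zero _) (by
          rw [show (1 : Fin (l + 2)) = Fin.succ 0 from rfl]
          exact fun h => Fin.succ_ne_zero k (Fin.succ_injective _ h))
      simp [h1]

lemma sum_contr_contr {l : ℕ} {T : Tensor (l + 2)} (hT : T ∈ stf (l + 2)) (L : Fin l → Fin 3) :
    ∑ b, contr b (contr b T) L = 0 := by
  have := hT.2 0 1 (by simp) (Fin.cons 0 (Fin.cons 0 L))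
  rw [← this]
  refine Finset.sum_congr rfl fun b _ => ?_
  change T (Fin.cons b (Fin.cons b L)) = _
  rw [Fin.update_cons_zero, show (1 : Fin (l + 2)) = Fin.succ 0 from rfl, ← Fin.cons_update,
    Fin.update_cons_zero]

lemma differentiableAt_uT (l : ℕ) (T : Tensor l) (x : E3) : DifferentiableAt ℝ (uT l T) x :=
  (contDiff_uT l T).differentiable (by simp) x

lemma pdx_sum {ι : Type*} (s : Finset ι) {f : ι → E3 → ℝ} {x : E3}
    (hf : ∀ i ∈ s, DifferentiableAt ℝ (f i) x) (b : Fin 3) :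
    pdx b (fun z => ∑ i ∈ s, f i z) x = ∑ i ∈ s, pdx b (f i) x := by
  simp only [pdx]
  rw [fderiv_fun_sum hf]; simp

lemma pdx_const_mul {f : E3 → ℝ} {x : E3} (r : ℝ) (hf : DifferentiableAt ℝ f x) (b : Fin 3) :
    pdx b (fun z => r * f z) x = r * pdx b f x := by
  simp only [pdx]
  rw [fderiv_const_mul hf]; simp

/-- Product rule for `x_a T_{aL} x^L` and induction on the rank: since the first two indices of `T`
commute, the differentiated terms regroup into `l` more copies of the contraction. -/
lemma pdx_uT {l : ℕ} {T : Tensor (l + 1)} (hT : T ∈ stf (l + 1)) (b : Fin 3) (x : E3) :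
    pdx b (uT (l + 1) T) x = (l + 1) * uT l (contr b T) x := by
  have h1 : pdx b (uT (l + 1) T) x =
      uT l (contr b T) x + ∑ a, x a * pdx b (uT l (contr a T)) x := by
    have e : uT (l + 1) T = fun x => ∑ a, x a * uT l (contr a T) x := funext (uT_succ l T)
    have hc : ∀ a : Fin 3, DifferentiableAt ℝ (fun z : E3 => z a) x := fun a => by fun_prop
    have hm : ∀ a ∈ Finset.univ,
        DifferentiableAt ℝ (fun z : E3 => z a * uT l (contr a T) z) x := fun a _ =>
      (hc a).mul (differentiableAt_uT _ _ _)
    rw [e, pdx_sum _ hm]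
    simp only [pdx_mul (hc _) (differentiableAt_uT _ _ _), pdx_coord, Finset.sum_add_distrib]
    simp
  rw [h1]
  cases l with
  | zero =>
    have : ∀ a, pdx b (uT 0 (contr a T)) x = 0 := fun a => by
      have e : uT 0 (contr a T) = fun _ => (contr a T) default := funext (uT_zero _)
      rw [e]; simp [pdx]
    simp [this]
  | succ l =>
    have h2 : ∀ a, pdx b (uT (l + 1) (contr a T)) x = (l + 1) * uT l (contr a (contr b T)) x := by
      intro a
      rw [pdx_uT (contr_mem_stf hT a), contr_comm hT]
    simp only [h2]
    rw [uT_succ l (contr b T) x, ← Finset.sum_add_distrib, Finset.mul_sum]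
    refine Finset.sum_congr rfl fun a _ => ?_
    push_cast; ring

/-- Functions without Laplacian off the origin. -/
def Harm1 (h : E3 → ℝ) : Prop := ∀ z, z ≠ 0 → ∑ b, pdx b (pdx b h) z = 0

/-- Two derivatives of the polynomial contract `T` twice, so the Laplacian contains the trace over
two indices. -/
lemma harm1_uT {l : ℕ} {T : Tensor l} (hT : T ∈ stf l) : Harm1 (uT l T) := by
  intro z _
  match l with
  | 0 =>
    have e : uT 0 T = fun _ => T default := funext (uT_zero _)
    have : ∀ b, pdx b (uT 0 T) = fun _ => 0 := fun b => by
      ext1 x; rw [e]; simp [pdx]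
    simp only [this]; simp [pdx]
  | 1 =>
    have : ∀ b, pdx b (uT 1 T) = fun _ => 1 * contr b T default := fun b => by
      ext1 x; rw [pdx_uT hT, uT_zero]; simp
    simp only [this]; simp [pdx]
  | l + 2 =>
    have : ∀ b, pdx b (uT (l + 2) T) = fun x => ((l + 1 : ℕ) + 1 : ℝ) * uT (l + 1) (contr b T) x :=
      fun b => by ext1 x; rw [pdx_uT hT]
    simp only [this]
    have h2 : ∀ b, pdx b (fun x => ((l + 1 : ℕ) + 1 : ℝ) * uT (l + 1) (contr b T) x) z =
        ((l + 1 : ℕ) + 1 : ℝ) * ((l + 1) * uT l (contr b (contr b T)) z) := fun b => by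
      rw [pdx_const_mul _ (differentiableAt_uT _ _ _), pdx_uT (contr_mem_stf hT b)]
    simp only [h2, ← Finset.mul_sum]
    have h3 : ∑ b, uT l (contr b (contr b T)) z = 0 := by
      simp only [uT]
      rw [Finset.sum_comm]
      refine Finset.sum_eq_zero fun L _ => ?_
      rw [← Finset.sum_mul, sum_contr_contr hT L, zero_mul]
    rw [h3]; simp

/-! ### Averages of products of homogeneous functions -/

/-- The average on the sphere of a function of space. -/
def mean (h : E3 → ℝ) : ℝ := angMean fun n : S2 => h n

lemma Hom1.mean_pdx {a : ℤ} {h : E3 → ℝ} (hh : Hom1 a h) (i : Fin 3) :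
    mean (Hadamard.pdx i h) = (a + 2) * mean (fun z => z i * h z) := by
  simp only [mean, angMean]
  rw [hh.divergence]; ring

lemma mean_congr {f g : E3 → ℝ} (h : ∀ z, ‖z‖ = 1 → f z = g z) : mean f = mean g := by
  unfold mean; congr 1; ext n; exact h _ (norm_S2 n)

lemma mean_sum {ι : Type*} (s : Finset ι) {f : ι → E3 → ℝ}
    (hf : ∀ i ∈ s, Continuous fun n : S2 => f i n) :
    mean (fun z => ∑ i ∈ s, f i z) = ∑ i ∈ s, mean (f i) := angMean_sum s hf

lemma mean_add {f g : E3 → ℝ} (hf : Continuous fun n : S2 => f n)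
    (hg : Continuous fun n : S2 => g n) : mean (fun z => f z + g z) = mean f + mean g :=
  angMean_add hf hg

lemma mean_mul (r : ℝ) (f : E3 → ℝ) : mean (fun z => r * f z) = r * mean f := angMean_mul r _

lemma ne_zero_of_norm_eq_one {z : E3} (h : ‖z‖ = 1) : z ≠ 0 := by
  rintro rfl; simp at h

/-- Integration by parts on the sphere. -/
lemma mean_grad_mul {a b : ℤ} {u v : E3 → ℝ} (hu : Hom1 a u) (hv : Hom1 b v) :
    ∑ i, mean (fun z => pdx i u z * pdx i v z) + mean (fun z => u z * ∑ i, pdx i (pdx i v) z) =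
      (a + b + 1) * b * mean (fun z => u z * v z) := by
  have h1 : ∀ i, mean (fun z => pdx i u z * pdx i v z) + mean (fun z => u z * pdx i (pdx i v) z) =
      (a + b + 1) * mean (fun z => z i * (u z * pdx i v z)) := by
    intro i
    -- The product `u ∂_i v` has degree `a + b - 1`, whence the factor `a + b + 1`. Euler's identity
    -- then turns `∑ z_i ∂_i v` into `b v`.
    have e := (hu.mul (hv.pdx i)).mean_pdx i
    rw [show ((a + (b - 1) : ℤ) : ℝ) + 2 = a + b + 1 by push_cast; ring] at e
    rw [← e, ← mean_add ((hu.pdx i).mul (hv.pdx i)).continuous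
      (hu.mul ((hv.pdx i).pdx i)).continuous]
    refine mean_congr fun z hz => ?_
    have hz0 := ne_zero_of_norm_eq_one hz
    rw [pdx_mul (hu.differentiableAt hz0) ((hv.pdx i).differentiableAt hz0)]
  have h2 : mean (fun z => u z * ∑ i, pdx i (pdx i v) z) =
      ∑ i, mean (fun z => u z * pdx i (pdx i v) z) := by
    rw [← mean_sum _ fun i _ => (hu.mul ((hv.pdx i).pdx i)).continuous]
    simp only [Finset.mul_sum]
  rw [h2, ← Finset.sum_add_distrib, Finset.sum_congr rfl fun i _ => h1 i, ← Finset.mul_sum,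
    ← mean_sum _ fun i _ => ((hom1_coord i).mul (hu.mul (hv.pdx i))).continuous, mul_assoc,
    ← mean_mul b]
  congr 1
  refine mean_congr fun z hz => ?_
  have := hv.euler (ne_zero_of_norm_eq_one hz)
  calc ∑ i, z i * (u z * pdx i v z) = u z * ∑ i, z i * pdx i v z := by
        rw [Finset.mul_sum]; exact Finset.sum_congr rfl fun i _ => by ring
    _ = _ := by rw [this]; ring

lemma mean_grad_harm {a b : ℤ} {u v : E3 → ℝ} (hu : Hom1 a u) (hv : Hom1 b v) (hh : Harm1 v) :
    ∑ i, mean (fun z => pdx i u z * pdx i v z) = (a + b + 1) * b * mean (fun z => u z * v z) := by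
  have h2 : mean (fun z => u z * ∑ i, pdx i (pdx i v) z) = 0 := by
    rw [mean_congr (g := fun _ => 0) fun z hz => by rw [hh z (ne_zero_of_norm_eq_one hz), mul_zero]]
    exact angMean_const 0
  rw [← mean_grad_mul hu hv, h2, add_zero]

lemma mean_mul_comm (u v : E3 → ℝ) : mean (fun z => u z * v z) = mean (fun z => v z * u z) := by
  congr 1; ext z; ring

/-- The average of the product of gradients is symmetric; evaluating it both ways gives `(a + b +
1)(b - a)⟨u v⟩ = 0`. The excluded value `a + b + 1 = 0` is the case of a harmonic function and its
inversion, which agree on the sphere. -/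
lemma mean_harm_orth {a b : ℤ} {u v : E3 → ℝ} (hu : Hom1 a u) (hv : Hom1 b v) (hhu : Harm1 u)
    (hhv : Harm1 v) (hab : a ≠ b) (hab' : a + b + 1 ≠ 0) : mean (fun z => u z * v z) = 0 := by
  have h1 := mean_grad_harm hu hv hhv
  have h2 := mean_grad_harm hv hu hhu
  have h3 : ∑ i, mean (fun z => pdx i v z * pdx i u z) =
      ∑ i, mean (fun z => pdx i u z * pdx i v z) :=
    Finset.sum_congr rfl fun i _ => mean_mul_comm _ _
  rw [h3, h1, mean_mul_comm v u] at h2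
  have h4 : ((a : ℝ) + b + 1) * ((b : ℝ) - a) * mean (fun z => u z * v z) = 0 := by linarith
  have h5 : ((a : ℝ) + b + 1) ≠ 0 := by exact_mod_cast hab'
  have h6 : ((b : ℝ) - a) ≠ 0 := sub_ne_zero.2 (by exact_mod_cast hab.symm)
  simpa [h5, h6] using h4

lemma mean_uT_orth {l m : ℕ} {S : Tensor l} {T : Tensor m} (hS : S ∈ stf l) (hT : T ∈ stf m)
    (hlm : l ≠ m) : mean (fun z => uT l S z * uT m T z) = 0 :=
  mean_harm_orth (hom1_uT l S) (hom1_uT m T) (harm1_uT hS) (harm1_uT hT)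
    (by exact_mod_cast hlm) (by positivity)

/-- Induction by Green's formula: in degree `l + 1` it reads `(2l+3)(l+1)⟨S T⟩ = (l+1)² ∑ ⟨∂S ∂T⟩`
up to normalization, and the gradients are the contractions, of degree `l`. The constant is the
reciprocal of the one in `f̂^L`. -/
lemma mean_uT_mul {l : ℕ} {S T : Tensor l} (hS : S ∈ stf l) (hT : T ∈ stf l) :
    mean (fun z => uT l S z * uT l T z) = (l ! : ℝ) / ((2 * l + 1)‼ : ℝ) * dotT S T := by
  induction l with
  | zero =>
    simp only [uT_zero]
    rw [mean, angMean_const, dotT, Fintype.sum_unique]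
    simp only [Nat.factorial_zero, Nat.cast_one, Nat.doubleFactorial, div_one, one_mul]
    congr 1 <;> exact congrArg _ (Subsingleton.elim _ _)
  | succ l ih =>
    have h1 := mean_grad_harm (hom1_uT _ S) (hom1_uT _ T) (harm1_uT hT)
    have h2 : ∀ i, mean (fun z => pdx i (uT (l + 1) S) z * pdx i (uT (l + 1) T) z) =
        (l + 1) ^ 2 * ((l ! : ℝ) / ((2 * l + 1)‼ : ℝ) * dotT (contr i S) (contr i T)) := by
      intro i
      rw [← ih (contr_mem_stf hS i) (contr_mem_stf hT i), ← mean_mul]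
      refine mean_congr fun z _ => ?_
      rw [pdx_uT hS, pdx_uT hT]; ring
    rw [Finset.sum_congr rfl fun i _ => h2 i, ← Finset.mul_sum, ← Finset.mul_sum, ← dotT_succ] at h1
    push_cast at h1
    have h3 : ((2 * (l + 1) + 1)‼ : ℝ) = (2 * l + 3) * (2 * l + 1)‼ := by
      rw [show 2 * (l + 1) + 1 = (2 * l + 1) + 2 by ring, Nat.doubleFactorial_add_two]
      push_cast; ring
    have h4 : ((2 * l + 1)‼ : ℝ) ≠ 0 := by exact_mod_cast (Nat.doubleFactorial_pos _).ne'
    rw [h3, Nat.factorial_succ]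
    push_cast
    have h5 : ((l : ℝ) + 1) ≠ 0 := by positivity
    have h6 : (2 * (l : ℝ) + 3) ≠ 0 := by positivity
    field_simp at h1 ⊢
    linear_combination -h1

/-! ### Spherical harmonics as continuous functions -/

/-- The spherical harmonic attached to a tensor. -/
def harm (l : ℕ) (T : Tensor l) : CS := ⟨fun n => uT l T n, (hom1_uT l T).continuous⟩

@[simp] lemma harm_apply (l : ℕ) (T : Tensor l) (n : S2) : harm l T n = uT l T n := rfl

lemma avg_harm_orth {l m : ℕ} {S : Tensor l} {T : Tensor m} (hS : S ∈ stf l) (hT : T ∈ stf m)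
    (hlm : l ≠ m) : avg (harm l S * harm m T) = 0 := mean_uT_orth hS hT hlm

lemma continuous_nTensor (l : ℕ) : Continuous (nTensor l) := by
  unfold nTensor
  refine (PiLp.continuous_toLp 2 _).comp (continuous_pi fun L => ?_)
  fun_prop

lemma continuous_nHat (l : ℕ) : Continuous fun n : S2 => nHat l n :=
  ((stf l).starProjection.continuous.comp (continuous_nTensor l)).comp continuous_subtype_val

lemma continuous_nHat_apply (l : ℕ) (L : Fin l → Fin 3) : Continuous fun n : S2 => nHat l n L := by
  have := continuous_nHat l
  fun_prop

lemma nHat_mem (l : ℕ) (n : E3) : nHat l n ∈ stf l := Submodule.starProjection_apply_mem _ _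

lemma dotT_eq_inner {l : ℕ} (S T : Tensor l) : dotT S T = inner ℝ T S := by
  simp [dotT, PiLp.inner_apply]

lemma dotT_nTensor {l : ℕ} (T : Tensor l) (n : E3) : dotT T (nTensor l n) = uT l T n := rfl

lemma dotT_nHat_of_mem {l : ℕ} {T : Tensor l} (hT : T ∈ stf l) (n : E3) :
    dotT T (nHat l n) = uT l T n := by
  rw [← dotT_nTensor, dotT_eq_inner, dotT_eq_inner, nHat,
    Submodule.inner_starProjection_left_eq_right, Submodule.starProjection_eq_self_iff.2 hT]

lemma dotT_nHat {l : ℕ} (T : Tensor l) (n : E3) :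
    dotT T (nHat l n) = uT l ((stf l).starProjection T) n := by
  rw [← dotT_nTensor, dotT_eq_inner, dotT_eq_inner, nHat,
    Submodule.inner_starProjection_left_eq_right]

/-- The symmetric trace-free moments of a function on the sphere. -/
def hat (l : ℕ) (f : CS) : Tensor l := WithLp.toLp 2 fun L =>
  ((2 * l + 1)‼ : ℝ) / (l ! : ℝ) * angMean fun n => nHat l n L * f n

lemma dotT_hat {l : ℕ} (T : Tensor l) (f : CS) : dotT T (hat l f) =
    ((2 * l + 1)‼ : ℝ) / (l ! : ℝ) * angMean fun n => dotT T (nHat l n) * f n := by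
  simp only [dotT, hat, Finset.sum_mul]
  have hc : ∀ L ∈ Finset.univ, Continuous fun n : S2 => T L * nHat l n L * f n := fun L _ =>
    ((continuous_nHat_apply l L).const_mul (T L)).mul f.continuous
  rw [angMean_sum _ hc, Finset.mul_sum]
  refine Finset.sum_congr rfl fun L _ => ?_
  have : (fun n : S2 => T L * nHat l n L * f n) = fun n : S2 => T L * (nHat l n L * f n) := by
    ext n; ring
  rw [this, angMean_mul]; ring

lemma hat_mem (l : ℕ) (f : CS) : hat l f ∈ stf l := by
  refine ⟨fun σ L => ?_, fun a b hab L => ?_⟩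
  · simp only [hat]
    congr 2; ext n; rw [(nHat_mem l n).1 σ L]
  · simp only [hat, ← Finset.mul_sum]
    have hc : ∀ i ∈ Finset.univ, Continuous fun n : S2 =>
        nHat l n (Function.update (Function.update L a i) b i) * f n := fun i _ =>
      (continuous_nHat_apply l _).mul f.continuous
    rw [← angMean_sum _ hc]
    have : (fun n : S2 => ∑ i, nHat l n (Function.update (Function.update L a i) b i) * f n) =
        fun _ => 0 := by
      ext n; rw [← Finset.sum_mul, (nHat_mem l n).2 a b hab L, zero_mul]
    rw [this, angMean_const, mul_zero]

/-- The component of degree `l` of a function on the sphere. -/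
def pr (l : ℕ) (f : CS) : CS := harm l (hat l f)

/-- The normalization of the moments cancels that of the product of two harmonics, so `pr l` is the
orthogonal projection on the harmonics of degree `l`. -/
lemma avg_harm_mul_pr {l : ℕ} {T : Tensor l} (hT : T ∈ stf l) (f : CS) :
    avg (harm l T * pr l f) = avg (harm l T * f) := by
  have h1 : avg (harm l T * pr l f) = _ := mean_uT_mul hT (hat_mem l f)
  rw [h1, dotT_hat]
  simp only [dotT_nHat_of_mem hT]
  have h4 : ((2 * l + 1)‼ : ℝ) ≠ 0 := by exact_mod_cast (Nat.doubleFactorial_pos _).ne'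
  have h5 : ((l ! : ℕ) : ℝ) ≠ 0 := by exact_mod_cast (Nat.factorial_pos _).ne'
  rw [← mul_assoc]
  have : ((l ! : ℕ) : ℝ) / ((2 * l + 1)‼ : ℝ) * (((2 * l + 1)‼ : ℝ) / ((l ! : ℕ) : ℝ)) = 1 := by
    field_simp
  rw [this, one_mul]; rfl

lemma avg_pr_mul_pr (l : ℕ) (f g : CS) : avg (pr l f * pr l g) = avg (pr l f * g) :=
  avg_harm_mul_pr (hat_mem l f) g

lemma avg_self_nonneg (f : CS) : 0 ≤ avg (f * f) := by
  rw [avg_apply, angMean, angInt]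
  exact mul_nonneg (by positivity) (integral_nonneg fun n => mul_self_nonneg _)

lemma avg_cauchy_schwarz (f g : CS) : avg (f * g) ^ 2 ≤ avg (f * f) * avg (g * g) := by
  have h : ∀ t : ℝ, 0 ≤ avg (g * g) * (t * t) + (2 * avg (f * g)) * t + avg (f * f) := by
    intro t
    have := avg_self_nonneg (f + t • g)
    have e : (f + t • g) * (f + t • g) =
        f * f + (2 * t) • (f * g) + (t * t) • (g * g) := by
      ext n; simp; ring
    rw [e, map_add, map_add, map_smul, map_smul, smul_eq_mul, smul_eq_mul] at this
    linarith
  have := discrim_le_zero h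
  rw [discrim] at this
  nlinarith

lemma avg_pr_self_le (l : ℕ) (f : CS) : avg (pr l f * pr l f) ≤ avg (f * f) := by
  have := avg_self_nonneg (f - pr l f)
  have e : (f - pr l f) * (f - pr l f) = f * f - (2 : ℝ) • (pr l f * f) + pr l f * pr l f := by
    ext n; simp; ring
  rw [e, map_add, map_sub, map_smul, ← avg_pr_mul_pr, smul_eq_mul] at this
  linarith

lemma avg_self_le (f : CS) : avg (f * f) ≤ ‖f‖ ^ 2 := by
  refine (le_abs_self _).trans ((abs_avg_le _).trans ?_)
  rw [sq]; exact norm_mul_le f f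

end Hadamard
end

noncomputable section
namespace Hadamard

/-! ### Completeness of the spherical harmonics -/

/-- Square-integrable functions on the sphere. -/
abbrev L2S := Lp ℝ 2 (volume : Measure E3).toSphere

/-- The inclusion of continuous functions. -/
def toL2 : CS →L[ℝ] L2S := ContinuousMap.toLp (E := ℝ) 2 (volume : Measure E3).toSphere ℝ

lemma inner_toL2 (f g : CS) : inner ℝ (toL2 f) (toL2 g) = 4 * Real.pi * avg (f * g) := by
  have h := ContinuousMap.inner_toLp (𝕜 := ℝ) (μ := (volume : Measure E3).toSphere) f g
  have h2 : inner ℝ (toL2 f) (toL2 g) = angInt (f * g : CS) := by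
    rw [toL2, h, angInt]
    refine integral_congr_ae (Eventually.of_forall fun n => ?_)
    simp [mul_comm]
  rw [h2, avg_apply, angMean]; field_simp

/-- The harmonic attached to a tensor, as a linear map. -/
def harmL (l : ℕ) : Tensor l →ₗ[ℝ] CS where
  toFun := harm l
  map_add' S T := by ext n; simp [uT, add_mul, Finset.sum_add_distrib]
  map_smul' r T := by ext n; simp [uT, Finset.mul_sum, mul_assoc]

/-- The spherical harmonics of degree `l`. -/
def Hl (l : ℕ) : Submodule ℝ L2S := (stf l).map (toL2.toLinearMap.comp (harmL l))

lemma toL2_harm_mem {l : ℕ} {T : Tensor l} (hT : T ∈ stf l) : toL2 (harm l T) ∈ Hl l :=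
  ⟨T, hT, rfl⟩

instance (l : ℕ) : FiniteDimensional ℝ (Hl l) := by
  unfold Hl; infer_instance

lemma orthogonalFamily_Hl : OrthogonalFamily ℝ (fun l => Hl l) fun l => (Hl l).subtypeₗᵢ := by
  intro l m hlm v w
  obtain ⟨_, S, hS, rfl⟩ := v
  obtain ⟨_, T, hT, rfl⟩ := w
  change inner ℝ (toL2 (harm l S)) (toL2 (harm m T)) = 0
  rw [inner_toL2, avg_harm_orth hS hT hlm, mul_zero]

/-- The coordinates as functions on the sphere. -/
def coordC (i : Fin 3) : CS := ⟨fun n => (n : E3) i, by fun_prop⟩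

@[simp] lemma coordC_apply (i : Fin 3) (n : S2) : coordC i n = (n : E3) i := rfl

lemma sum_sq_S2 (n : S2) : ∑ i, (n : E3) i * (n : E3) i = 1 := by
  have := EuclideanSpace.norm_sq_eq (n : E3)
  rw [norm_S2 n] at this
  simp only [Real.norm_eq_abs, sq_abs] at this
  rw [one_pow] at this
  rw [this]; exact Finset.sum_congr rfl fun i _ => (sq _).symm

lemma sum_coordC_sq : ∑ i, coordC i * coordC i = 1 := by
  ext n
  simpa using sum_sq_S2 n

/-- The moments of `g` of degree `l` form a symmetric tensor `T`, whose traces are moments of degree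
`l - 2` because `n · n = 1`. By strong induction `T` is trace-free, so `T · T` is the pairing of `g`
with a harmonic, which vanishes. -/
lemma moment_eq_zero {g : L2S} (hg : ∀ l, ∀ v ∈ Hl l, inner ℝ v g = 0) (m : Multiset (Fin 3)) :
    inner ℝ (toL2 (m.map coordC).prod) g = 0 := by
  induction hc : m.card using Nat.strong_induction_on generalizing m with
  | _ l ih =>
    let Φ : CS →ₗ[ℝ] ℝ := ((innerSL ℝ g).comp toL2).toLinearMap
    have hΦ : ∀ f, Φ f = inner ℝ (toL2 f) g := fun f => real_inner_comm (toL2 f) g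
    set T : Tensor l := WithLp.toLp 2 fun L => Φ (∏ k, coordC (L k)) with hTdef
    have hT : T ∈ stf l := by
      refine ⟨fun σ L => ?_, fun a b hab L => ?_⟩
      · simp only [hTdef]
        congr 1
        exact Equiv.prod_comp σ fun k => coordC (L k)
      · simp only [hTdef]
        rw [← map_sum]
        have e : ∀ i, ∏ k, coordC (Function.update (Function.update L a i) b i k) =
            (coordC i * coordC i) * ∏ k ∈ (Finset.univ.erase a).erase b, coordC (L k) := by
          intro i
          rw [← Finset.mul_prod_erase Finset.univ _ (Finset.mem_univ a),
            ← Finset.mul_prod_erase (Finset.univ.erase a) _ (Finset.mem_erase.2 ⟨hab.symm, Finset.mem_univ b⟩)]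
          rw [← mul_assoc]
          congr 1
          · rw [Function.update_self, Function.update_of_ne hab, Function.update_self]
          · refine Finset.prod_congr rfl fun k hk => ?_
            simp only [Finset.mem_erase] at hk
            rw [Function.update_of_ne hk.1, Function.update_of_ne hk.2.1]
        simp only [e]
        -- Summing over the two repeated indices replaces two factors by 1 and leaves a monomial
        -- with two factors fewer.
        rw [← Finset.sum_mul, sum_coordC_sq, one_mul, hΦ]
        have hcard : (((Finset.univ.erase a).erase b).val.map L).card < l := by
          rw [Multiset.card_map, Finset.card_val,
            Finset.card_erase_of_mem (Finset.mem_erase.2 ⟨hab.symm, Finset.mem_univ b⟩),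
            Finset.card_erase_of_mem (Finset.mem_univ a), Finset.card_univ, Fintype.card_fin]
          have := a.pos
          omega
        have := ih _ hcard (((Finset.univ.erase a).erase b).val.map L) rfl
        rw [Multiset.map_map] at this
        exact this
    have h0 : dotT T T = 0 := by
      have h1 : Φ (harm l T) = 0 := by rw [hΦ]; exact hg l _ (toL2_harm_mem hT)
      have h2 : harm l T = ∑ L, T L • ∏ k, coordC (L k) := by
        ext n; simp [uT, ContinuousMap.sum_apply]
      rw [h2, map_sum] at h1
      simpa only [map_smul, smul_eq_mul, dotT] using h1
    have h3 : ∀ L, T L = 0 := by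
      intro L
      have := (Finset.sum_eq_zero_iff_of_nonneg fun L _ => mul_self_nonneg (T L)).1 h0 L (Finset.mem_univ L)
      exact mul_self_eq_zero.1 this
    have hlen : m.toList.length = l := by rw [Multiset.length_toList, hc]
    have h4 := h3 fun k => m.toList.get (Fin.cast hlen.symm k)
    rw [hTdef] at h4
    simp only at h4
    rw [← hΦ, ← h4]
    congr 1
    conv_lhs => rw [← Multiset.coe_toList m]
    rw [Multiset.map_coe, Multiset.prod_coe, ← List.prod_ofFn]
    congr 1
    apply List.ext_get
    · simp [hlen]
    · intro k h1 h2; simp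

/-- All monomials in the coordinates are orthogonal to `g`. By Stone–Weierstrass they span a dense
subspace of the continuous functions, and these are dense in `L²`. -/
lemma eq_zero_of_orth {g : L2S} (hg : ∀ l, ∀ v ∈ Hl l, inner ℝ v g = 0) : g = 0 := by
  let Φ : CS →L[ℝ] ℝ := (innerSL ℝ g).comp toL2
  have hΦ : ∀ f, Φ f = inner ℝ (toL2 f) g := fun f => real_inner_comm (toL2 f) g
  let A : Subalgebra ℝ CS := Algebra.adjoin ℝ (range coordC)
  have hA : A.SeparatesPoints := by
    intro n m hnm
    have : ∃ i, (n : E3) i ≠ (m : E3) i := by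
      by_contra! h
      exact hnm (Subtype.ext (by ext i; exact h i))
    obtain ⟨i, hi⟩ := this
    exact ⟨coordC i, ⟨coordC i, Algebra.subset_adjoin ⟨i, rfl⟩, rfl⟩, hi⟩
  have hdense := ContinuousMap.subalgebra_topologicalClosure_eq_top_of_separatesPoints A hA
  have h0 : ∀ f ∈ A, Φ f = 0 := by
    intro f hf
    have hf' : f ∈ Submodule.span ℝ (Submonoid.closure (range coordC) : Set CS) := by
      rw [← Algebra.adjoin_eq_span]; exact hf
    refine Submodule.span_induction (p := fun f _ => Φ f = 0) ?_ (map_zero _) ?_ ?_ hf'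
    · intro f hf
      obtain ⟨t, ht, rfl⟩ := Submonoid.exists_multiset_of_mem_closure hf
      have : ∃ m : Multiset (Fin 3), t = m.map coordC := by
        clear hf
        induction t using Multiset.induction_on with
        | empty => exact ⟨0, rfl⟩
        | cons a t iht =>
          obtain ⟨m, hm⟩ := iht fun y hy => ht y (Multiset.mem_cons_of_mem hy)
          obtain ⟨i, hi⟩ := ht a (Multiset.mem_cons_self a t)
          exact ⟨i ::ₘ m, by rw [Multiset.map_cons, hm, hi]⟩
      obtain ⟨m, rfl⟩ := this
      rw [hΦ]; exact moment_eq_zero hg m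
    · intro x y _ _ hx hy; rw [map_add, hx, hy, add_zero]
    · intro r x _ hx; rw [map_smul, hx, smul_zero]
  have h1 : ∀ f, Φ f = 0 := by
    intro f
    have hf : f ∈ A.topologicalClosure := by rw [hdense]; trivial
    have hcl : IsClosed {f : CS | Φ f = 0} := isClosed_eq Φ.continuous continuous_const
    exact closure_minimal (fun f hf => h0 f hf) hcl hf
  have hd : DenseRange toL2 := by
    have := ContinuousMap.toLp_denseRange (p := 2) ℝ (volume : Measure E3).toSphere ℝ
      (by simp)
    exact this
  have h2 : ∀ f : L2S, inner ℝ f g = 0 := by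
    intro f
    have hcl : IsClosed {f : L2S | inner ℝ f g = 0} :=
      isClosed_eq (continuous_id.inner continuous_const) continuous_const
    exact hd.induction_on f hcl fun a => by
      change inner ℝ (toL2 a) g = 0
      rw [← hΦ, h1]
  exact inner_self_eq_zero.1 (h2 g)

lemma isHilbertSum_Hl : IsHilbertSum ℝ (fun l => Hl l) fun l => (Hl l).subtypeₗᵢ := by
  refine IsHilbertSum.mkInternal Hl orthogonalFamily_Hl ?_
  rw [top_le_iff, Submodule.topologicalClosure_eq_top_iff, Submodule.eq_bot_iff]
  intro g hg
  refine eq_zero_of_orth fun l v hv => ?_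
  exact (Submodule.mem_orthogonal _ _).1 hg v (Submodule.mem_iSup_of_mem l hv)

/-- Parseval's identity on the sphere. -/
lemma hasSum_avg_pr (f g : CS) : HasSum (fun l => avg (pr l f * g)) (avg (f * g)) := by
  have hV := isHilbertSum_Hl
  set w := hV.linearIsometryEquiv (toL2 f)
  have hs : HasSum (fun l => ((w l : Hl l) : L2S)) (toL2 f) := by
    have := hV.hasSum_linearIsometryEquiv_symm w
    rwa [LinearIsometryEquiv.symm_apply_apply] at this
  -- The component of the Hilbert sum in degree `l` is determined by its products with the harmonics
  -- of that degree, and `pr l f` has the same ones.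
  have hw : ∀ l, ((w l : Hl l) : L2S) = toL2 (pr l f) := by
    intro l
    have hmem : ((w l : Hl l) : L2S) - toL2 (pr l f) ∈ Hl l :=
      (Hl l).sub_mem (w l).2 (toL2_harm_mem (hat_mem l f))
    have horth : ∀ v ∈ Hl l, inner ℝ v (((w l : Hl l) : L2S) - toL2 (pr l f)) = 0 := by
      intro v hv
      have h1 : HasSum (fun k => inner ℝ v ((w k : Hl k) : L2S)) (inner ℝ v (toL2 f)) :=
        hs.mapL (innerSL ℝ v)
      have h2 : HasSum (fun k => inner ℝ v ((w k : Hl k) : L2S)) (inner ℝ v ((w l : Hl l) : L2S)) := by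
        refine hasSum_single l fun k hk => ?_
        exact orthogonalFamily_Hl hk.symm ⟨v, hv⟩ (w k)
      obtain ⟨T, hT, rfl⟩ := hv
      change inner ℝ (toL2 (harm l T)) _ = 0
      rw [inner_sub_right]
      have h3 := h2.unique h1
      change inner ℝ (toL2 (harm l T)) _ = inner ℝ (toL2 (harm l T)) _ at h3
      rw [h3, inner_toL2, inner_toL2, avg_harm_mul_pr hT, sub_self]
    exact sub_eq_zero.1 (inner_self_eq_zero.1 (horth _ hmem))
  have h4 : HasSum (fun l => inner ℝ (toL2 g) (toL2 (pr l f))) (inner ℝ (toL2 g) (toL2 f)) := by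
    simp only [← hw]
    exact hs.mapL (innerSL ℝ (toL2 g))
  simp only [inner_toL2] at h4
  have h5 := h4.mul_left (4 * Real.pi)⁻¹
  have hpi : (4 * Real.pi) ≠ 0 := by positivity
  simpa only [← mul_assoc, inv_mul_cancel₀ hpi, one_mul, mul_comm g] using h5

end Hadamard
end

/-! ### The bilinear forms of isotropic terms: weights, convergence, recursion. -/

noncomputable section
namespace Hadamard

/-! ### Multiplication of spherical harmonics by a coordinate -/

lemma pdx_add {f g : E3 → ℝ} {z : E3} (hf : DifferentiableAt ℝ f z) (hg : DifferentiableAt ℝ g z)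
    (i : Fin 3) : pdx i (fun z => f z + g z) z = pdx i f z + pdx i g z := by
  simp only [pdx]; rw [fderiv_fun_add hf hg]; simp

lemma pdx_sub {f g : E3 → ℝ} {z : E3} (hf : DifferentiableAt ℝ f z) (hg : DifferentiableAt ℝ g z)
    (i : Fin 3) : pdx i (fun z => f z - g z) z = pdx i f z - pdx i g z := by
  simp only [pdx]; rw [fderiv_fun_sub hf hg]; simp

lemma contDiff_pdx {f : E3 → ℝ} (hf : ContDiff ℝ ∞ f) (i : Fin 3) : ContDiff ℝ ∞ (pdx i f) :=
  (hf.fderiv_right (m := ∞) (by simp)).clm_apply contDiff_const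

/-- The square of the norm. -/
def nsq (z : E3) : ℝ := ∑ k, z k * z k

lemma contDiff_coord (i : Fin 3) : ContDiff ℝ ∞ fun z : E3 => z i := by fun_prop

lemma contDiff_nsq : ContDiff ℝ ∞ nsq := by unfold nsq; fun_prop

lemma nsq_eq (z : E3) : nsq z = ‖z‖ ^ 2 := by
  rw [EuclideanSpace.norm_sq_eq, nsq]
  exact Finset.sum_congr rfl fun i _ => by rw [Real.norm_eq_abs, sq_abs, sq]

lemma hom1_nsq : Hom1 2 nsq := by
  unfold nsq
  exact Hom1.sum _ fun i _ => ((hom1_coord i).mul (hom1_coord i)).cast (by norm_num)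

lemma pdx_nsq (i : Fin 3) (z : E3) : pdx i nsq z = 2 * z i := by
  have hc : ∀ a : Fin 3, DifferentiableAt ℝ (fun z : E3 => z a) z := fun a => by fun_prop
  have hm : ∀ k ∈ Finset.univ, DifferentiableAt ℝ (fun z : E3 => z k * z k) z := fun k _ =>
    (hc k).mul (hc k)
  have e : nsq = fun z : E3 => ∑ k, z k * z k := rfl
  rw [e, pdx_sum _ hm]
  simp only [pdx_mul (hc _) (hc _), pdx_coord]
  simp [Finset.sum_add_distrib]; ring

lemma diff_of_smooth {f : E3 → ℝ} (hf : ContDiff ℝ ∞ f) (z : E3) : DifferentiableAt ℝ f z :=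
  hf.differentiable (by simp) z

lemma lap_coord_mul {u : E3 → ℝ} (hu : ContDiff ℝ ∞ u) (b : Fin 3) (z : E3) :
    ∑ i, pdx i (pdx i fun z => z b * u z) z =
      2 * pdx b u z + z b * ∑ i, pdx i (pdx i u) z := by
  have e1 : ∀ i, (pdx i fun z => z b * u z) =
      fun z => (if b = i then 1 else 0) * u z + z b * pdx i u z := fun i => by
    ext1 x
    rw [pdx_mul (diff_of_smooth (contDiff_coord b) x) (diff_of_smooth hu x), pdx_coord]
  have e2 : ∀ i, pdx i (pdx i fun z => z b * u z) z =
      2 * ((if b = i then 1 else 0) * pdx i u z) + z b * pdx i (pdx i u) z := fun i => by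
    have hp := contDiff_pdx hu i
    rw [e1 i, pdx_add (diff_of_smooth (contDiff_const.mul hu) z)
      (diff_of_smooth ((contDiff_coord b).mul hp) z), pdx_const_mul _ (diff_of_smooth hu z),
      pdx_mul (diff_of_smooth (contDiff_coord b) z) (diff_of_smooth hp z), pdx_coord]
    ring
  simp only [e2, Finset.sum_add_distrib, ← Finset.mul_sum]
  simp

lemma lap_nsq_mul {w : E3 → ℝ} (hw : ContDiff ℝ ∞ w) (z : E3) :
    ∑ i, pdx i (pdx i fun z => nsq z * w z) z =
      6 * w z + 4 * ∑ i, z i * pdx i w z + nsq z * ∑ i, pdx i (pdx i w) z := by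
  have e1 : ∀ i, (pdx i fun z => nsq z * w z) =
      fun z => 2 * (z i * w z) + nsq z * pdx i w z := fun i => by
    ext1 x
    rw [pdx_mul (diff_of_smooth contDiff_nsq x) (diff_of_smooth hw x), pdx_nsq]; ring
  have e2 : ∀ i, pdx i (pdx i fun z => nsq z * w z) z =
      2 * w z + 4 * (z i * pdx i w z) + nsq z * pdx i (pdx i w) z := fun i => by
    have hp := contDiff_pdx hw i
    have hcw := (contDiff_coord i).mul hw
    rw [e1 i, pdx_add (diff_of_smooth (contDiff_const.mul hcw) z)
      (diff_of_smooth (contDiff_nsq.mul hp) z), pdx_const_mul _ (diff_of_smooth hcw z),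
      pdx_mul (diff_of_smooth (contDiff_coord i) z) (diff_of_smooth hw z), pdx_coord,
      pdx_mul (diff_of_smooth contDiff_nsq z) (diff_of_smooth hp z), pdx_nsq]
    simp; ring
  simp only [e2, Finset.sum_add_distrib, ← Finset.mul_sum]
  simp; ring

/-- The harmonic part of higher degree of `x_b u`. -/
def raise (b : Fin 3) (l : ℕ) (T : Tensor (l + 1)) (z : E3) : ℝ :=
  z b * uT (l + 1) T z - (l + 1) / (2 * l + 3) * (nsq z * uT l (contr b T) z)

lemma hom1_raise (b : Fin 3) (l : ℕ) (T : Tensor (l + 1)) : Hom1 (l + 2 : ℕ) (raise b l T) := by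
  unfold raise
  refine Hom1.sub (((hom1_coord b).mul (hom1_uT _ T)).cast (by push_cast; ring))
    (((hom1_nsq.mul (hom1_uT _ _)).const_mul _).cast (by push_cast; ring))

/-- With `w` the contraction of `T`, `Δ(x_b u) = 2 ∂_b u = 2(l+1) w` and `Δ(|x|² w) = (4l+6) w`; the
coefficient in `raise` is the ratio of the two. -/
lemma harm1_raise (b : Fin 3) {l : ℕ} {T : Tensor (l + 1)} (hT : T ∈ stf (l + 1)) :
    Harm1 (raise b l T) := by
  intro z hz
  have s1 := (contDiff_coord b).mul (contDiff_uT (l + 1) T)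
  have s2 := contDiff_nsq.mul (contDiff_uT l (contr b T))
  have e1 : ∀ i, pdx i (raise b l T) = fun z => pdx i (fun z => z b * uT (l + 1) T z) z -
      (l + 1) / (2 * l + 3) * pdx i (fun z => nsq z * uT l (contr b T) z) z := fun i => by
    ext1 x
    unfold raise
    rw [pdx_sub (diff_of_smooth s1 x) (diff_of_smooth (contDiff_const.mul s2) x),
      pdx_const_mul _ (diff_of_smooth s2 x)]
  have e2 : ∀ i, pdx i (pdx i (raise b l T)) z = pdx i (pdx i (fun z => z b * uT (l + 1) T z)) z -
      (l + 1) / (2 * l + 3) * pdx i (pdx i (fun z => nsq z * uT l (contr b T) z)) z := fun i => by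
    rw [e1 i, pdx_sub (diff_of_smooth (contDiff_pdx s1 i) z)
      (diff_of_smooth (contDiff_const.mul (contDiff_pdx s2 i)) z),
      pdx_const_mul _ (diff_of_smooth (contDiff_pdx s2 i) z)]
  simp only [e2, Finset.sum_sub_distrib, ← Finset.mul_sum]
  rw [lap_coord_mul (contDiff_uT _ T), lap_nsq_mul (contDiff_uT _ _), harm1_uT hT z hz,
    harm1_uT (contr_mem_stf hT b) z hz, (hom1_uT l (contr b T)).euler hz, pdx_uT hT]
  have : (2 * (l : ℝ) + 3) ≠ 0 := by positivity
  push_cast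
  field_simp; ring

lemma mean_sub {f g : E3 → ℝ} (hf : Continuous fun n : S2 => f n)
    (hg : Continuous fun n : S2 => g n) : mean (fun z => f z - g z) = mean f - mean g := by
  have := mean_add hf (g := fun z => (-1) * g z) (continuous_const.mul hg)
  rw [mean_mul] at this
  rw [sub_eq_add_neg, ← neg_one_mul, ← this]
  congr 1; ext z; ring

/-- Product of a coordinate and two functions on the sphere: the degrees must be adjacent. -/
lemma mean_coord_mul_raise (b : Fin 3) {l : ℕ} {T : Tensor (l + 1)} (hT : T ∈ stf (l + 1))
    {k : ℕ} {V : Tensor k} (hV : V ∈ stf k) (hk : k ≠ l + 2) :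
    mean (fun z => z b * uT (l + 1) T z * uT k V z) =
      (l + 1) / (2 * l + 3) * mean (fun z => uT l (contr b T) z * uT k V z) := by
  -- The raised part is harmonic of degree `l + 2`, hence orthogonal to `V`; only the part of degree
  -- `l` of `x_b u` is left.
  have h1 := mean_harm_orth (hom1_raise b l T) (hom1_uT k V) (harm1_raise b hT) (harm1_uT hV)
    (by exact_mod_cast hk.symm) (by positivity)
  have h2 : mean (fun z => raise b l T z * uT k V z) =
      mean (fun z => z b * uT (l + 1) T z * uT k V z) -
        mean (fun z => (l + 1) / (2 * l + 3) * (uT l (contr b T) z * uT k V z)) := by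
    rw [← mean_sub (((hom1_coord b).mul (hom1_uT _ T)).mul (hom1_uT k V)).continuous
      (((hom1_uT l _).mul (hom1_uT k V)).const_mul _).continuous]
    refine mean_congr fun z hz => ?_
    rw [raise, nsq_eq, hz]; ring
  rw [h2, mean_mul] at h1
  linarith

lemma avg_coord_lower (b : Fin 3) {l : ℕ} {T : Tensor (l + 1)} (hT : T ∈ stf (l + 1))
    {S : Tensor l} (hS : S ∈ stf l) :
    avg (coordC b * harm (l + 1) T * harm l S) =
      (l + 1) / (2 * l + 3) * avg (harm l (contr b T) * harm l S) :=
  mean_coord_mul_raise b hT hS (by omega)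

lemma avg_coord_orth (b : Fin 3) {l k : ℕ} {T : Tensor l} (hT : T ∈ stf l) {V : Tensor k}
    (hV : V ∈ stf k) (h1 : k ≠ l + 1) (h2 : l ≠ k + 1) :
    avg (coordC b * harm l T * harm k V) = 0 := by
  cases l with
  | zero =>
    change mean (fun z => z b * uT 0 T z * uT k V z) = 0
    have hh : Harm1 (fun z => z b) := by
      intro z _
      have := lap_coord_mul (u := fun _ => 1) contDiff_const b z
      have e1 : ∀ i, pdx i (fun _ : E3 => (1 : ℝ)) = fun _ => 0 := fun i => by ext1; simp [pdx]
      simp only [e1, mul_one] at this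
      simpa [pdx] using this
    have h3 := mean_harm_orth (hom1_coord b) (hom1_uT k V) hh (harm1_uT hV)
      (by exact_mod_cast h1.symm) (by positivity)
    have : mean (fun z => z b * uT 0 T z * uT k V z) =
        mean (fun z => T default * (z b * uT k V z)) := mean_congr fun z _ => by
      rw [uT_zero]; ring
    rw [this, mean_mul, h3, mul_zero]
  | succ l =>
    have := mean_coord_mul_raise b hT hV h1
    change mean (fun z => z b * uT (l + 1) T z * uT k V z) = 0
    rw [this, mean_uT_orth (contr_mem_stf hT b) hV (by omega), mul_zero]

/-! ### The elementary bilinear forms -/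

lemma hat_add (l : ℕ) (f g : CS) : hat l (f + g) = hat l f + hat l g := by
  ext L
  simp only [hat, PiLp.add_apply]
  have hc : ∀ f : CS, Continuous fun n : S2 => nHat l n L * f n := fun f =>
    (continuous_nHat_apply l L).mul f.continuous
  rw [← mul_add, ← angMean_add (hc f) (hc g)]
  congr 2; ext n; simp; ring

lemma hat_smul (l : ℕ) (r : ℝ) (f : CS) : hat l (r • f) = r • hat l f := by
  ext L
  simp only [hat, PiLp.smul_apply, smul_eq_mul]
  have : (fun n : S2 => nHat l n L * (r • f) n) = fun n : S2 => r * (nHat l n L * f n) := by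
    ext n; simp; ring
  rw [this, angMean_mul]; ring

/-- The component of degree `l`, as a linear map. -/
def prL (l : ℕ) : CS →ₗ[ℝ] CS where
  toFun := pr l
  map_add' f g := by
    change harmL l (hat l (f + g)) = harmL l (hat l f) + harmL l (hat l g)
    rw [hat_add, map_add]
  map_smul' r f := by
    change harmL l (hat l (r • f)) = r • harmL l (hat l f)
    rw [hat_smul, map_smul]

lemma pr_add (l : ℕ) (f g : CS) : pr l (f + g) = pr l f + pr l g := (prL l).map_add f g

lemma pr_smul (l : ℕ) (r : ℝ) (f : CS) : pr l (r • f) = r • pr l f := (prL l).map_smul r f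

/-- `⟨n_b f_l g_{l+1}⟩`. -/
def X (b : Fin 3) (l : ℕ) (f g : CS) : ℝ := avg (coordC b * pr l f * pr (l + 1) g)

lemma avg_coord_sq_le (b : Fin 3) (u : CS) :
    avg ((coordC b * u) * (coordC b * u)) ≤ avg (u * u) := by
  have h : avg (u * u) - avg ((coordC b * u) * (coordC b * u)) =
      avg (u * u - (coordC b * u) * (coordC b * u)) := (map_sub _ _ _).symm
  rw [← sub_nonneg, h, avg_apply, angMean, angInt]
  refine mul_nonneg (by positivity) (integral_nonneg fun n => ?_)
  have h1 : (n : E3) b * (n : E3) b ≤ 1 := by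
    refine le_of_le_of_eq ?_ (sum_sq_S2 n)
    exact Finset.single_le_sum (f := fun i => (n : E3) i * (n : E3) i)
      (fun i _ => mul_self_nonneg _) (Finset.mem_univ b)
  have h2 := mul_self_nonneg (u n)
  simp only [ContinuousMap.sub_apply, ContinuousMap.mul_apply, coordC_apply, Pi.zero_apply]
  nlinarith

/-- Cauchy–Schwarz, `|n_b| ≤ 1` and Bessel. The bound is uniform in `l`, so all growth of a weighted
series comes from its weights. -/
lemma abs_X_le (b : Fin 3) (l : ℕ) (f g : CS) : |X b l f g| ≤ ‖f‖ * ‖g‖ := by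
  refine abs_le_of_sq_le_sq ?_ (by positivity)
  have h1 := avg_cauchy_schwarz (coordC b * pr l f) (pr (l + 1) g)
  have h2 := (avg_coord_sq_le b (pr l f)).trans ((avg_pr_self_le l f).trans (avg_self_le f))
  have h3 := (avg_pr_self_le (l + 1) g).trans (avg_self_le g)
  calc X b l f g ^ 2 ≤ _ := h1
    _ ≤ ‖f‖ ^ 2 * ‖g‖ ^ 2 := mul_le_mul h2 h3 (avg_self_nonneg _) (by positivity)
    _ = _ := by ring

lemma X_add_left (b : Fin 3) (l : ℕ) (f f' g : CS) :
    X b l (f + f') g = X b l f g + X b l f' g := by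
  simp only [X]; rw [pr_add, ← map_add]; congr 1; ring

lemma X_add_right (b : Fin 3) (l : ℕ) (f g g' : CS) :
    X b l f (g + g') = X b l f g + X b l f g' := by
  simp only [X]; rw [pr_add, ← map_add]; congr 1; ring

lemma X_smul_left (b : Fin 3) (l : ℕ) (r : ℝ) (f g : CS) : X b l (r • f) g = r * X b l f g := by
  simp only [X]; rw [pr_smul, mul_smul_comm, smul_mul_assoc, map_smul, smul_eq_mul]

lemma X_smul_right (b : Fin 3) (l : ℕ) (r : ℝ) (f g : CS) : X b l f (r • g) = r * X b l f g := by
  simp only [X]; rw [pr_smul, mul_smul_comm, map_smul, smul_eq_mul]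

/-- `⟨n_b f_0 g⟩`. -/
lemma avg_coord_pr_zero (b : Fin 3) (f g : CS) :
    avg (coordC b * pr 0 f * g) = X b 0 f g := by
  have h := hasSum_avg_pr g (coordC b * pr 0 f)
  rw [mul_comm g] at h
  refine h.unique ?_
  have e : X b 0 f g = avg (pr 1 g * (coordC b * pr 0 f)) := by rw [X, mul_comm]
  rw [e]
  refine hasSum_single 1 fun k hk => ?_
  rw [mul_comm]
  exact avg_coord_orth b (hat_mem 0 f) (hat_mem k g) (by omega) (by omega)

/-- `⟨n_b f_{l+1} g⟩`. -/
lemma avg_coord_pr_succ (b : Fin 3) (l : ℕ) (f g : CS) :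
    avg (coordC b * pr (l + 1) f * g) = X b (l + 1) f g + X b l g f := by
  have h := hasSum_avg_pr g (coordC b * pr (l + 1) f)
  rw [mul_comm g] at h
  refine h.unique ?_
  have e : X b (l + 1) f g + X b l g f =
      ∑ k ∈ {l + 2, l}, avg (pr k g * (coordC b * pr (l + 1) f)) := by
    rw [Finset.sum_pair (by omega), X, X]
    congr 2
    · rw [mul_comm]
    · ring
  rw [e]
  refine hasSum_sum_of_ne_finset_zero fun k hk => ?_
  simp only [Finset.mem_insert, Finset.mem_singleton, not_or] at hk
  rw [mul_comm]
  exact avg_coord_orth b (hat_mem _ f) (hat_mem k g) (by omega) (by omega)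

/-- The form of the terms `n^L f̂^{bL}`: contraction of `f̂` is, up to a factor, the component of
degree `l` of `n_b f_{l+1}`. These terms thus pair `f_{l+1}` with `g_l`. -/
lemma avg_contr (b : Fin 3) (l : ℕ) (f g : CS) :
    avg (harm l (contr b (hat (l + 1) f)) * g) = (2 * l + 3) / (l + 1) * X b l g f := by
  rw [← avg_harm_mul_pr (contr_mem_stf (hat_mem _ f) b)]
  have h := avg_coord_lower b (hat_mem (l + 1) f) (hat_mem l g)
  have e : X b l g f = avg (coordC b * harm (l + 1) (hat (l + 1) f) * harm l (hat l g)) := by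
    rw [X]; congr 1; simp only [pr]; ring
  rw [e, h]
  have h1 : (2 * (l : ℝ) + 3) ≠ 0 := by positivity
  have h2 : ((l : ℝ) + 1) ≠ 0 := by positivity
  simp only [pr]
  field_simp

/-- The tensor product of a basis vector and a tensor. -/
def consT {l : ℕ} (b : Fin 3) (T : Tensor l) : Tensor (l + 1) :=
  WithLp.toLp 2 fun M => (if M 0 = b then 1 else 0) * T (Fin.tail M)

lemma dotT_consT {l : ℕ} (b : Fin 3) (T : Tensor l) (V : Tensor (l + 1)) :
    dotT (consT b T) V = ∑ L, V (Fin.cons b L) * T L := by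
  rw [dotT, sum_cons, Finset.sum_eq_single b]
  · refine Finset.sum_congr rfl fun L _ => ?_
    simp [consT, mul_comm]
  · intro a _ hab
    refine Finset.sum_eq_zero fun L _ => ?_
    simp [consT, hab]
  · simp

/-- The symmetric trace-free projection. -/
def stfProj (l : ℕ) (T : Tensor l) : Tensor l := (stf l).starProjection T

lemma stfProj_mem (l : ℕ) (T : Tensor l) : stfProj l T ∈ stf l :=
  Submodule.starProjection_apply_mem _ _

lemma dotT_stfProj {l : ℕ} (T : Tensor l) {V : Tensor l} (hV : V ∈ stf l) :
    dotT (stfProj l T) V = dotT T V := by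
  rw [dotT_eq_inner, dotT_eq_inner, stfProj, ← Submodule.inner_starProjection_left_eq_right,
    Submodule.starProjection_eq_self_iff.2 hV]

/-- `⟨n̂^{bL} T_L g⟩`. -/
lemma angMean_nHat_cons (b : Fin 3) {l : ℕ} {T : Tensor l} (hT : T ∈ stf l) (g : CS) :
    (angMean fun n => (∑ L, nHat (l + 1) n (Fin.cons b L) * T L) * g n) =
      avg (coordC b * harm l T * pr (l + 1) g) := by
  set S := stfProj (l + 1) (consT b T) with hSdef
  have hS : S ∈ stf (l + 1) := stfProj_mem _ _
  -- The trace-free projection is moved from `n^{bL}` to the tensor `δ_b T`, which makes the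
  -- integrand a single harmonic of degree `l + 1` times `g`.
  have e1 : (angMean fun n => (∑ L, nHat (l + 1) n (Fin.cons b L) * T L) * g n) =
      avg (harm (l + 1) S * g) := by
    rw [avg_apply]; congr 1; ext n
    rw [← dotT_consT, dotT_nHat]; rfl
  rw [e1, ← avg_harm_mul_pr hS]
  have e2 : avg (harm (l + 1) S * pr (l + 1) g) = _ := mean_uT_mul hS (hat_mem (l + 1) g)
  have e3 : dotT S (hat (l + 1) g) = dotT (contr b (hat (l + 1) g)) T := by
    rw [hSdef, dotT_stfProj _ (hat_mem (l + 1) g), dotT_consT]; rfl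
  have e4 := avg_coord_lower b (hat_mem (l + 1) g) hT
  have e5 : avg (harm l (contr b (hat (l + 1) g)) * harm l T) = _ :=
    mean_uT_mul (contr_mem_stf (hat_mem (l + 1) g) b) hT
  have e6 : avg (coordC b * harm l T * pr (l + 1) g) =
      avg (coordC b * harm (l + 1) (hat (l + 1) g) * harm l T) := by
    congr 1; simp only [pr]; ring
  rw [e2, e3, e6, e4, e5]
  have h3 : ((2 * (l + 1) + 1)‼ : ℝ) = (2 * l + 3) * (2 * l + 1)‼ := by
    rw [show 2 * (l + 1) + 1 = (2 * l + 1) + 2 by ring, Nat.doubleFactorial_add_two]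
    push_cast; ring
  have h4 : ((2 * l + 1)‼ : ℝ) ≠ 0 := by exact_mod_cast (Nat.doubleFactorial_pos _).ne'
  have h5 : (2 * (l : ℝ) + 3) ≠ 0 := by positivity
  rw [h3, Nat.factorial_succ]
  push_cast
  field_simp

end Hadamard
end

noncomputable section
namespace Hadamard

/-! ### Decay of the harmonic components of smooth functions -/

lemma hat_apply_eq (l : ℕ) (f : CS) (L : Fin l → Fin 3) : hat l f L =
    ((2 * l + 1)‼ : ℝ) / (l ! : ℝ) *
      avg (harm l (stfProj l (EuclideanSpace.single L 1)) * f) := by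
  rw [avg_apply]
  change _ * _ = _ * _
  congr 2; ext n
  have h := dotT_nHat (EuclideanSpace.single L (1 : ℝ)) (n : E3)
  have h2 : dotT (EuclideanSpace.single L (1 : ℝ)) (nHat l n) = nHat l n L := by
    rw [dotT, Finset.sum_eq_single L] <;> simp +contextual
  change _ = uT l ((stf l).starProjection (EuclideanSpace.single L 1)) n * f n
  rw [← h, h2]

lemma pr_eq_smul {l : ℕ} {f g : CS} {r : ℝ}
    (h : ∀ T ∈ stf l, avg (harm l T * g) = r * avg (harm l T * f)) : pr l g = r • pr l f := by
  have e : hat l g = r • hat l f := by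
    ext L
    rw [PiLp.smul_apply, smul_eq_mul, hat_apply_eq, hat_apply_eq, h _ (stfProj_mem _ _)]; ring
  change harmL l (hat l g) = r • harmL l (hat l f)
  rw [e, map_smul]

/-- The eigenvalues of `1 - Δ` on the sphere. -/
def nu (l : ℕ) : ℝ := 1 + l * (l + 1)

lemma nu_pos (l : ℕ) : 0 < nu l := by unfold nu; positivity

/-- For `h` of degree zero one of the two Green formulas has right side zero and the other gives
`l(l+1)`: on such functions the Laplacian restricts to that of the sphere. -/
lemma mean_uT_lap {l : ℕ} {T : Tensor l} (hT : T ∈ stf l) {h : E3 → ℝ} (hh : Hom1 0 h) :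
    mean (fun z => uT l T z * ∑ i, pdx i (pdx i h) z) =
      -(l * (l + 1)) * mean (fun z => uT l T z * h z) := by
  have h1 := mean_grad_mul (hom1_uT l T) hh
  have h2 := mean_grad_harm hh (hom1_uT l T) (harm1_uT hT)
  have h3 : ∑ i, mean (fun z => pdx i (uT l T) z * pdx i h z) =
      ∑ i, mean (fun z => pdx i h z * pdx i (uT l T) z) :=
    Finset.sum_congr rfl fun i _ => mean_mul_comm _ _
  rw [h3, h2, mean_mul_comm h] at h1
  push_cast at h1
  linarith

/-- The operator `1 - Δ` on the sphere, for families of homogeneous functions of degree zero. -/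
def Mop (u : E3 × Param → ℝ) (c : E3 × Param) : ℝ :=
  -- The factor `|z|²` restores degree zero after two derivatives, so that the operator can be
  -- iterated.
  u c - nsq c.1 * ∑ b, dz (fun c => dz u c (ex b)) c (ex b)

lemma homog_Mop {u : E3 × Param → ℝ} (hu : Homog 0 u) : Homog 0 (Mop u) := by
  have h1 : ∀ b, Homog (0 - 1 - 1) fun c => dz (fun c => dz u c (ex b)) c (ex b) := fun b =>
    (hu.dz_apply (X := fun _ => ex b) contDiffOn_const).dz_apply (X := fun _ => ex b)
      contDiffOn_const
  have h2 := ((hom1_nsq.homog).mul (Homog.sum Finset.univ fun b _ => h1 b)).neg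
  exact (hu.add (h2.cast (by norm_num))).congr fun c _ => by simp [Mop, sub_eq_add_neg]

lemma dz_eq_pdx {u : E3 × Param → ℝ} (hu : ContDiffOn ℝ ∞ u Dom) {z : E3} (hz : z ≠ 0) {p : Param}
    (hp : p ∈ Par) (b : Fin 3) : dz u (z, p) (ex b) = pdx b (fun z => u (z, p)) z := by
  have h1 := (differentiableAt_of_Dom hu (mem_Dom.2 ⟨hz, hp⟩)).hasFDerivAt
  have h2 : HasFDerivAt (fun z => u (z, p))
      ((fderiv ℝ u (z, p)).comp (ContinuousLinearMap.inl ℝ E3 Param)) z :=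
    h1.comp z (hasFDerivAt_prodMk_left z p)
  rw [pdx, h2.fderiv]; rfl

lemma pdx_congr {f g : E3 → ℝ} {z : E3} (h : f =ᶠ[𝓝 z] g) (b : Fin 3) : pdx b f z = pdx b g z := by
  rw [pdx, h.fderiv_eq, pdx]

lemma pr_Mop {u : E3 × Param → ℝ} (hu : Homog 0 u) {p : Param} (hp : p ∈ Par) (l : ℕ) :
    pr l (fam (Mop u) p) = nu l • pr l (fam u p) := by
  refine pr_eq_smul fun T hT => ?_
  set h : E3 → ℝ := fun z => u (z, p)
  have hh : Hom1 0 h := hu.slice hp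
  have e0 : avg (harm l T * fam u p) = mean (fun z => uT l T z * h z) := by
    rw [avg_apply, mean]; congr 1; ext n
    simp [fam_apply hu.smooth.continuousOn hp n, h]
  have e1 : avg (harm l T * fam (Mop u) p) =
      mean (fun z => uT l T z * h z - uT l T z * ∑ i, pdx i (pdx i h) z) := by
    rw [avg_apply, mean]; congr 1; ext n
    have hn := S2_ne_zero n
    have e2 : ∀ b, dz (fun c => dz u c (ex b)) ((n : E3), p) (ex b) = pdx b (pdx b h) n := by
      intro b
      have h1 : Homog (0 - 1) fun c => dz u c (ex b) :=
        hu.dz_apply (X := fun _ => ex b) contDiffOn_const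
      rw [dz_eq_pdx h1.smooth hn hp]
      refine pdx_congr ?_ b
      filter_upwards [isOpen_compl_singleton.mem_nhds hn] with z hz
      exact dz_eq_pdx hu.smooth hz hp b
    rw [ContinuousMap.mul_apply, fam_apply (homog_Mop hu).smooth.continuousOn hp n, Mop, nsq_eq,
      norm_S2]
    simp only [e2, harm_apply]
    ring
  have c1 := ((hom1_uT l T).mul hh).continuous
  have c2 := ((hom1_uT l T).mul
    (Hom1.sum Finset.univ fun i _ => (hh.pdx i).pdx i)).continuous
  rw [e1, mean_sub c1 c2, mean_uT_lap hT hh, e0, nu]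
  ring

/-- Functions on the sphere whose harmonic components decrease fast enough. -/
def Rap (f : CS) : Prop := ∃ f₂ : CS, ∀ l, pr l f₂ = (nu l) ^ 2 • pr l f

/-- Two powers of `1 - Δ` suffice: they gain `l ^ (-4)` against weights of growth `l ^ 2`, which
leaves a summable series. -/
lemma rap_fam_zero {u : E3 × Param → ℝ} (hu : Homog 0 u) {p : Param} (hp : p ∈ Par) :
    Rap (fam u p) :=
  ⟨fam (Mop (Mop u)) p, fun l => by
    rw [pr_Mop (homog_Mop hu) hp, pr_Mop hu hp, smul_smul, sq]⟩

/-- The function of degree zero with the same restriction to the sphere. -/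
def norm0 (u : E3 × Param → ℝ) (c : E3 × Param) : ℝ := u (‖c.1‖⁻¹ • c.1, c.2)

lemma homog_norm0 {u : E3 × Param → ℝ} (hu : ContDiffOn ℝ ∞ u Dom) : Homog 0 (norm0 u) := by
  have := homog_homogExt 0 hu
  simp only [zpow_zero, one_mul] at this
  exact this

lemma fam_norm0 (u : E3 × Param → ℝ) (p : Param) : fam (norm0 u) p = fam u p := by
  unfold fam norm0; congr 1; ext n; simp

lemma rap_fam {u : E3 × Param → ℝ} (hu : ContDiffOn ℝ ∞ u Dom) {p : Param} (hp : p ∈ Par) :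
    Rap (fam u p) := by
  rw [← fam_norm0]; exact rap_fam_zero (homog_norm0 hu) hp

/-! ### Weighted sums of the elementary forms -/

/-- `∑ A_l X_l(f, g) + B_l X_l(g, f)`. -/
def W (A B : ℕ → ℝ) (b : Fin 3) (f g : CS) : ℝ := ∑' l, (A l * X b l f g + B l * X b l g f)

/-- Weights of at most quadratic growth. -/
def Quad (A : ℕ → ℝ) : Prop := ∃ c : ℝ, ∀ l, |A l| ≤ c * (l + 1) ^ 2

lemma Quad.nonneg {A : ℕ → ℝ} (hA : Quad A) : ∃ c : ℝ, 0 ≤ c ∧ ∀ l, |A l| ≤ c * (l + 1) ^ 2 := by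
  obtain ⟨c, hc⟩ := hA
  refine ⟨c, ?_, hc⟩
  have := (abs_nonneg _).trans (hc 0)
  simpa using this

lemma half_sq_le_nu (l : ℕ) : ((l : ℝ) + 1) ^ 2 / 2 ≤ nu l := by
  unfold nu; nlinarith [sq_nonneg (l : ℝ)]

lemma nu_le_succ (l : ℕ) : nu l ≤ nu (l + 1) := by
  unfold nu; push_cast; nlinarith [(Nat.cast_nonneg l : (0 : ℝ) ≤ l)]

/-- From `ν_l ≥ (l+1)²/2`, so `(l+1)² / ν² ≤ 4 / (l+1)²`. Allowing any `ν ≥ ν_l` covers both `ν_l`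
and `ν_{l+1}`, as the second slot of `X_l` has degree `l + 1`. -/
lemma weight_le {a c : ℝ} (hc : 0 ≤ c) {l : ℕ} (ha : |a| ≤ c * (l + 1) ^ 2) {ν : ℝ}
    (hν : nu l ≤ ν) : |a / ν ^ 2| ≤ 4 * c * (1 / ((l : ℝ) + 1) ^ 2) := by
  have h1 : (0 : ℝ) < ((l : ℝ) + 1) ^ 2 := by positivity
  have h2 := (half_sq_le_nu l).trans hν
  have h3 : 0 < ν := lt_of_lt_of_le (by positivity) h2
  rw [abs_div, abs_of_pos (show 0 < ν ^ 2 by positivity), div_le_iff₀ (by positivity)]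
  have h4 : (((l : ℝ) + 1) ^ 2 / 2) ^ 2 ≤ ν ^ 2 := by gcongr
  calc |a| ≤ c * (l + 1) ^ 2 := ha
    _ = 4 * c * (1 / ((l : ℝ) + 1) ^ 2) * (((l : ℝ) + 1) ^ 2 / 2) ^ 2 := by field_simp; ring
    _ ≤ _ := by gcongr

lemma summable_inv_sq : Summable fun l : ℕ => 1 / ((l : ℝ) + 1) ^ 2 := by
  have := (summable_nat_add_iff 1).2 (Real.summable_one_div_nat_pow.2 (one_lt_two))
  simpa using this

lemma weighted_left_le {A : ℕ → ℝ} {c : ℝ} (hc : 0 ≤ c) (h : ∀ l, |A l| ≤ c * (l + 1) ^ 2)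
    (b : Fin 3) (f g : CS) (l : ℕ) :
    ‖A l / nu l ^ 2 * X b l f g‖ ≤ 4 * c * (1 / ((l : ℝ) + 1) ^ 2) * (‖f‖ * ‖g‖) := by
  rw [Real.norm_eq_abs, abs_mul]
  exact mul_le_mul (weight_le hc (h l) le_rfl) (abs_X_le b l f g) (abs_nonneg _) (by positivity)

lemma weighted_right_le {A : ℕ → ℝ} {c : ℝ} (hc : 0 ≤ c) (h : ∀ l, |A l| ≤ c * (l + 1) ^ 2)
    (b : Fin 3) (f g : CS) (l : ℕ) :
    ‖A l / nu (l + 1) ^ 2 * X b l f g‖ ≤ 4 * c * (1 / ((l : ℝ) + 1) ^ 2) * (‖f‖ * ‖g‖) := by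
  rw [Real.norm_eq_abs, abs_mul]
  exact mul_le_mul (weight_le hc (h l) (nu_le_succ l)) (abs_X_le b l f g) (abs_nonneg _)
    (by positivity)

lemma X_smul_pr_left {f f₂ : CS} (h : ∀ l, pr l f₂ = (nu l) ^ 2 • pr l f) (b : Fin 3) (l : ℕ)
    (g : CS) : X b l f g = X b l f₂ g / nu l ^ 2 := by
  have := nu_pos l
  have e : X b l f₂ g = nu l ^ 2 * X b l f g := by
    simp only [X]; rw [h, mul_smul_comm, smul_mul_assoc, map_smul, smul_eq_mul]
  rw [e]; field_simp

lemma X_smul_pr_right {f f₂ : CS} (h : ∀ l, pr l f₂ = (nu l) ^ 2 • pr l f) (b : Fin 3) (l : ℕ)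
    (g : CS) : X b l g f = X b l g f₂ / nu (l + 1) ^ 2 := by
  have := nu_pos (l + 1)
  have e : X b l g f₂ = nu (l + 1) ^ 2 * X b l g f := by
    simp only [X]; rw [h, mul_smul_comm, map_smul, smul_eq_mul]
  rw [e]; field_simp

lemma Rap.summable_left {f : CS} (hf : Rap f) {A : ℕ → ℝ} (hA : Quad A) (b : Fin 3) (g : CS) :
    Summable fun l => A l * X b l f g := by
  obtain ⟨f₂, h⟩ := hf
  obtain ⟨c, hc, hA⟩ := hA.nonneg
  refine Summable.of_norm_bounded ((summable_inv_sq.mul_left (4 * c)).mul_right (‖f₂‖ * ‖g‖))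
    fun l => ?_
  rw [X_smul_pr_left h, mul_div_assoc', mul_div_right_comm]
  exact weighted_left_le hc hA b f₂ g l

lemma Rap.summable_right {f : CS} (hf : Rap f) {A : ℕ → ℝ} (hA : Quad A) (b : Fin 3) (g : CS) :
    Summable fun l => A l * X b l g f := by
  obtain ⟨f₂, h⟩ := hf
  obtain ⟨c, hc, hA⟩ := hA.nonneg
  refine Summable.of_norm_bounded ((summable_inv_sq.mul_left (4 * c)).mul_right (‖g‖ * ‖f₂‖))
    fun l => ?_
  rw [X_smul_pr_right h, mul_div_assoc', mul_div_right_comm]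
  exact weighted_right_le hc hA b g f₂ l

/-- The weighted form in terms of `(1 - Δ)² f`. -/
def Wd (A B : ℕ → ℝ) (b : Fin 3) (f g : CS) : ℝ :=
  ∑' l, (A l / nu l ^ 2 * X b l f g + B l / nu (l + 1) ^ 2 * X b l g f)

lemma W_eq_Wd {f f₂ : CS} (h : ∀ l, pr l f₂ = (nu l) ^ 2 • pr l f) (A B : ℕ → ℝ) (b : Fin 3)
    (g : CS) : W A B b f g = Wd A B b f₂ g := by
  unfold W Wd
  congr 1; ext l
  rw [X_smul_pr_left h, X_smul_pr_right h]; ring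

/-- Division by `ν²` makes the series absolutely convergent for all continuous `f` and `g`, with a
norm bound. Smoothness of `W` in the parameters follows by inserting `(1 - Δ)² f`. -/
lemma isBoundedBilinearMap_Wd {A B : ℕ → ℝ} (hA : Quad A) (hB : Quad B) (b : Fin 3) :
    IsBoundedBilinearMap ℝ fun q : CS × CS => Wd A B b q.1 q.2 := by
  obtain ⟨c, hc, hA⟩ := hA.nonneg
  obtain ⟨d, hd, hB⟩ := hB.nonneg
  have sA : ∀ f g, Summable fun l => A l / nu l ^ 2 * X b l f g := fun f g =>
    Summable.of_norm_bounded ((summable_inv_sq.mul_left (4 * c)).mul_right (‖f‖ * ‖g‖))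
      (weighted_left_le hc hA b f g)
  have sB : ∀ f g, Summable fun l => B l / nu (l + 1) ^ 2 * X b l f g := fun f g =>
    Summable.of_norm_bounded ((summable_inv_sq.mul_left (4 * d)).mul_right (‖f‖ * ‖g‖))
      (weighted_right_le hd hB b f g)
  have s : ∀ f g, Summable fun l =>
      A l / nu l ^ 2 * X b l f g + B l / nu (l + 1) ^ 2 * X b l g f := fun f g =>
    (sA f g).add (sB g f)
  refine ⟨fun f f' g => ?_, fun r f g => ?_, fun f g g' => ?_, fun r f g => ?_,
    4 * c * (∑' l : ℕ, 1 / ((l : ℝ) + 1) ^ 2) + 4 * d * (∑' l : ℕ, 1 / ((l : ℝ) + 1) ^ 2) + 1,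
    ?_, fun f g => ?_⟩
  · simp only [Wd]
    rw [← (s f g).tsum_add (s f' g)]
    congr 1; ext l; rw [X_add_left, X_add_right]; ring
  · simp only [Wd]
    rw [smul_eq_mul, ← tsum_mul_left]
    congr 1; ext l; rw [X_smul_left, X_smul_right]; ring
  · simp only [Wd]
    rw [← (s f g).tsum_add (s f g')]
    congr 1; ext l; rw [X_add_left, X_add_right]; ring
  · simp only [Wd]
    rw [smul_eq_mul, ← tsum_mul_left]
    congr 1; ext l; rw [X_smul_left, X_smul_right]; ring
  · have : 0 ≤ ∑' l : ℕ, 1 / ((l : ℝ) + 1) ^ 2 := tsum_nonneg fun l => by positivity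
    positivity
  · have h1 := summable_inv_sq.mul_left (4 * c) |>.mul_right (‖f‖ * ‖g‖)
    have h2 := summable_inv_sq.mul_left (4 * d) |>.mul_right (‖g‖ * ‖f‖)
    have h3 := tsum_of_norm_bounded (h1.add h2).hasSum fun l =>
      (norm_add_le _ _).trans (add_le_add (weighted_left_le hc hA b f g l)
        (weighted_right_le hd hB b g f l))
    refine h3.trans ?_
    rw [h1.tsum_add h2, tsum_mul_right, tsum_mul_right, tsum_mul_left, tsum_mul_left]
    nlinarith [mul_nonneg (norm_nonneg f) (norm_nonneg g)]

lemma continuousLinear_X_left (b : Fin 3) (l : ℕ) (g : CS) :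
    ∃ Λ : CS →L[ℝ] ℝ, ∀ f, Λ f = X b l f g :=
  ⟨LinearMap.mkContinuous
    { toFun := fun f => X b l f g
      map_add' := fun f f' => X_add_left b l f f' g
      map_smul' := fun r f => X_smul_left b l r f g } ‖g‖ fun f => by
        rw [mul_comm]; exact abs_X_le b l f g, fun _ => rfl⟩

lemma continuousLinear_X_right (b : Fin 3) (l : ℕ) (g : CS) :
    ∃ Λ : CS →L[ℝ] ℝ, ∀ f, Λ f = X b l g f :=
  ⟨LinearMap.mkContinuous
    { toFun := fun f => X b l g f
      map_add' := fun f f' => X_add_right b l g f f'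
      map_smul' := fun r f => X_smul_right b l r g f } ‖g‖ fun f => abs_X_le b l g f, fun _ => rfl⟩

/-- Linear relations between smooth families hold for their derivatives. -/
lemma famDeriv_rel {u w : E3 × Param → ℝ} (hu : ContDiffOn ℝ ∞ u Dom) (hw : ContDiffOn ℝ ∞ w Dom)
    (Λ : CS →L[ℝ] ℝ) (r : ℝ) (h : ∀ p ∈ Par, Λ (fam w p) = r * Λ (fam u p)) {p : Param}
    (hp : p ∈ Par) (e : Param) :
    Λ (fam (fun c => dp w c e) p) = r * Λ (fam (fun c => dp u c e) p) := by
  have h1 := Λ.hasFDerivAt.comp p (hasFDerivAt_fam hw hp)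
  have h2 := (Λ.hasFDerivAt.comp p (hasFDerivAt_fam hu hp)).const_mul r
  have h3 := h2.congr_of_eventuallyEq (f₁ := Λ ∘ fam w) (by
    filter_upwards [isOpen_Par.mem_nhds hp] with q hq using h q hq)
  exact congrArg (fun L => L e) (h1.unique h3)

lemma contDiffOn_W {A B : ℕ → ℝ} (hA : Quad A) (hB : Quad B) (b : Fin 3) {u w : E3 × Param → ℝ}
    (hu : ContDiffOn ℝ ∞ u Dom) (hw : ContDiffOn ℝ ∞ w Dom) :
    ContDiffOn ℝ ∞ (fun p => W A B b (fam u p) (fam w p)) Par := by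
  have h2 := homog_Mop (homog_Mop (homog_norm0 hu))
  refine ((isBoundedBilinearMap_Wd hA hB b).contDiff.comp_contDiffOn
    ((contDiffOn_fam h2.smooth).prodMk (contDiffOn_fam hw))).congr fun p hp => ?_
  refine W_eq_Wd (fun l => ?_) _ _ _ _
  rw [pr_Mop (homog_Mop (homog_norm0 hu)) hp, pr_Mop (homog_norm0 hu) hp, fam_norm0, smul_smul, sq]

/-- Leibniz rule for the bounded form `Wd` with `(1 - Δ)² u` in the first slot. The powers of `ν`
are then removed degree by degree, because the proportionality of components is inherited by the
parameter derivatives (`famDeriv_rel`). -/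
lemma fderiv_W {A B : ℕ → ℝ} (hA : Quad A) (hB : Quad B) (b : Fin 3) {u w : E3 × Param → ℝ}
    (hu : ContDiffOn ℝ ∞ u Dom) (hw : ContDiffOn ℝ ∞ w Dom) {p : Param} (hp : p ∈ Par)
    (e : Param) :
    fderiv ℝ (fun p => W A B b (fam u p) (fam w p)) p e =
      W A B b (fam (fun c => dp u c e) p) (fam w p) +
        W A B b (fam u p) (fam (fun c => dp w c e) p) := by
  have h0 := homog_norm0 hu
  have h2 := homog_Mop (homog_Mop h0)
  have hpr : ∀ q ∈ Par, ∀ l, pr l (fam (Mop (Mop (norm0 u))) q) = nu l ^ 2 • pr l (fam u q) :=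
    fun q hq l => by
      rw [pr_Mop (homog_Mop h0) hq, pr_Mop h0 hq, fam_norm0, smul_smul, sq]
  have hbil := isBoundedBilinearMap_Wd hA hB b
  have hd := (hbil.hasFDerivAt (fam (Mop (Mop (norm0 u))) p, fam w p)).comp p
    ((hasFDerivAt_fam h2.smooth hp).prodMk (hasFDerivAt_fam hw hp))
  have hd2 := hd.congr_of_eventuallyEq (f₁ := fun p => W A B b (fam u p) (fam w p)) (by
    filter_upwards [isOpen_Par.mem_nhds hp] with q hq using W_eq_Wd (hpr q hq) _ _ _ _)
  rw [hd2.fderiv]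
  change Wd A B b (fam (Mop (Mop (norm0 u))) p) (fam (fun c => dp w c e) p) +
    Wd A B b (fam (fun c => dp (Mop (Mop (norm0 u))) c e) p) (fam w p) = _
  rw [W_eq_Wd (hpr p hp), add_comm]
  congr 1
  unfold W Wd
  congr 1; ext l
  have := nu_pos l
  have := nu_pos (l + 1)
  congr 1
  · obtain ⟨Λ, hΛ⟩ := continuousLinear_X_left b l (fam w p)
    have hrel := famDeriv_rel hu h2.smooth Λ (nu l ^ 2) (fun q hq => by
      rw [hΛ, hΛ]; simp only [X]
      rw [hpr q hq, mul_smul_comm, smul_mul_assoc, map_smul, smul_eq_mul]) hp e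
    rw [hΛ, hΛ] at hrel
    rw [hrel]; field_simp
  · obtain ⟨Λ, hΛ⟩ := continuousLinear_X_right b l (fam w p)
    have hrel := famDeriv_rel hu h2.smooth Λ (nu (l + 1) ^ 2) (fun q hq => by
      rw [hΛ, hΛ]; simp only [X]
      rw [hpr q hq, mul_smul_comm, map_smul, smul_eq_mul]) hp e
    rw [hΛ, hΛ] at hrel
    rw [hrel]; field_simp

end Hadamard
end

noncomputable section
namespace Hadamard

/-! ### The bilinear form of the explicit distributional terms -/

lemma Ccoef_le (K : ℝ) (l : ℕ) : |Ccoef K l| ≤ (|K| + 1) * (l + 1) ^ 2 := by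
  have h1 : |∑ m ∈ Finset.Icc 1 l, 1 / ((m : ℝ) + 1)| ≤ l := by
    refine (Finset.abs_sum_le_sum_abs _ _).trans ?_
    have : ∀ m ∈ Finset.Icc 1 l, |1 / ((m : ℝ) + 1)| ≤ 1 := fun m _ => by
      rw [abs_of_pos (by positivity), div_le_one (by positivity)]
      have := (Nat.cast_nonneg m : (0 : ℝ) ≤ m); linarith
    refine (Finset.sum_le_sum this).trans ?_
    simp
  have h2 : |K + ∑ m ∈ Finset.Icc 1 l, 1 / ((m : ℝ) + 1)| ≤ |K| + l :=
    (abs_add_le _ _).trans (by linarith)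
  have hl : (0 : ℝ) ≤ l := Nat.cast_nonneg l
  rw [Ccoef, abs_mul, abs_of_pos (by positivity)]
  calc ((l : ℝ) + 1) * _ ≤ (l + 1) * (|K| + l) := by gcongr
    _ ≤ (|K| + 1) * (l + 1) ^ 2 := by
      nlinarith [abs_nonneg K, mul_nonneg (abs_nonneg K) hl,
        mul_nonneg hl hl, mul_nonneg (mul_nonneg (abs_nonneg K) hl) hl, abs_nonneg K]

lemma quad_Ccoef (K : ℝ) : Quad (Ccoef K) := ⟨_, Ccoef_le K⟩

lemma Quad.one_sub {A : ℕ → ℝ} (hA : Quad A) : Quad fun l => 1 - A l := by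
  obtain ⟨c, hc⟩ := hA
  refine ⟨c + 1, fun l => ?_⟩
  have h1 : (1 : ℝ) ≤ (l + 1) ^ 2 := one_le_pow₀ (by have := (Nat.cast_nonneg l : (0 : ℝ) ≤ l); linarith)
  calc |1 - A l| ≤ |1| + |A l| := abs_sub _ _
    _ ≤ 1 + c * (l + 1) ^ 2 := by rw [abs_one]; gcongr; exact hc l
    _ ≤ _ := by linarith

lemma quad_one : Quad fun _ => 1 := ⟨1, fun l => by
  rw [abs_one, one_mul]
  exact one_le_pow₀ (by have := (Nat.cast_nonneg l : (0 : ℝ) ≤ l); linarith)⟩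

/-- `∑ C_l X_l(f, g) + (1 - C_l) X_l(g, f)`. -/
def Q (K : ℝ) (b : Fin 3) (f g : CS) : ℝ := W (Ccoef K) (fun l => 1 - Ccoef K l) b f g

lemma Rap.smul {f : CS} (hf : Rap f) (r : ℝ) : Rap (r • f) := by
  obtain ⟨f₂, h⟩ := hf
  exact ⟨r • f₂, fun l => by rw [pr_smul, pr_smul, h, smul_comm]⟩

lemma Rap.add {f g : CS} (hf : Rap f) (hg : Rap g) : Rap (f + g) := by
  obtain ⟨f₂, h⟩ := hf
  obtain ⟨g₂, h'⟩ := hg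
  exact ⟨f₂ + g₂, fun l => by rw [pr_add, pr_add, h, h', smul_add]⟩

lemma Rap.summable_W {f : CS} (hf : Rap f) {A B : ℕ → ℝ} (hA : Quad A) (hB : Quad B) (b : Fin 3)
    (g : CS) : Summable fun l => A l * X b l f g + B l * X b l g f :=
  (hf.summable_left hA b g).add (hf.summable_right hB b g)

lemma Rap.W_add_right {f : CS} (hf : Rap f) {A B : ℕ → ℝ} (hA : Quad A) (hB : Quad B) (b : Fin 3)
    (g g' : CS) : W A B b f (g + g') = W A B b f g + W A B b f g' := by
  simp only [W]
  rw [← (hf.summable_W hA hB b g).tsum_add (hf.summable_W hA hB b g')]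
  congr 1; ext l; rw [X_add_left, X_add_right]; ring

lemma W_swap (A B : ℕ → ℝ) (b : Fin 3) (f g : CS) : W A B b f g = W B A b g f := by
  unfold W; congr 1; ext l; ring

lemma W_smul_right (A B : ℕ → ℝ) (b : Fin 3) (r : ℝ) (f g : CS) :
    W A B b f (r • g) = r * W A B b f g := by
  simp only [W]
  rw [← tsum_mul_left]
  congr 1; ext l; rw [X_smul_left, X_smul_right]; ring

lemma W_smul_left (A B : ℕ → ℝ) (b : Fin 3) (r : ℝ) (f g : CS) :
    W A B b (r • f) g = r * W A B b f g := by
  rw [W_swap, W_smul_right, W_swap]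

lemma Rap.W_add_left {g : CS} (hg : Rap g) {A B : ℕ → ℝ} (hA : Quad A) (hB : Quad B) (b : Fin 3)
    (f f' : CS) : W A B b (f + f') g = W A B b f g + W A B b f' g := by
  rw [W_swap, hg.W_add_right hB hA, W_swap, W_swap B A b g f']

/-- `⟨n_b f g⟩` in terms of the elementary forms. -/
lemma Rap.avg_coord_mul {f : CS} (hf : Rap f) (b : Fin 3) (g : CS) :
    avg (coordC b * f * g) = ∑' l, X b l f g + ∑' l, X b l g f := by
  have h := hasSum_avg_pr f (coordC b * g)
  have e : avg (f * (coordC b * g)) = avg (coordC b * f * g) := by congr 1; ring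
  have e2 : ∀ l, avg (pr l f * (coordC b * g)) = avg (coordC b * pr l f * g) := fun l => by
    congr 1; ring
  rw [e] at h
  simp only [e2] at h
  have s1 : Summable fun l => X b l f g := by simpa using hf.summable_left quad_one b g
  have s2 : Summable fun l => X b l g f := by simpa using hf.summable_right quad_one b g
  have s3 := (summable_nat_add_iff 1).2 s1
  rw [← h.tsum_eq, h.summable.tsum_eq_zero_add, avg_coord_pr_zero]
  simp only [avg_coord_pr_succ]
  rw [s3.tsum_add s2, s1.tsum_eq_zero_add]; ring

/-- The rule of integration by parts for the regular part. -/
lemma Rap.Q_add_swap {f : CS} (hf : Rap f) (K : ℝ) (b : Fin 3) (g : CS) :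
    Q K b f g + Q K b g f = avg (coordC b * f * g) := by
  have s1 : Summable fun l => X b l f g := by simpa using hf.summable_left quad_one b g
  have s2 : Summable fun l => X b l g f := by simpa using hf.summable_right quad_one b g
  have h1 := hf.summable_W (quad_Ccoef K) (quad_Ccoef K).one_sub b g
  have h2 := hf.summable_W (quad_Ccoef K).one_sub (quad_Ccoef K) b g
  rw [hf.avg_coord_mul, ← s1.tsum_add s2]
  unfold Q
  -- After the exchange both `X_l(f, g)` and `X_l(g, f)` carry the weight `C_l + (1 - C_l) = 1`.
  rw [W_swap _ _ b g f]
  simp only [W]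
  rw [← h1.tsum_add h2]
  congr 1; ext l; ring

lemma Ccoef_zero (K : ℝ) : Ccoef K 0 = K := by simp [Ccoef]

/-- This recursion carries both directions of the proof: it makes the explicit terms commute, and
commutation imposes it on isotropic weights. The harmonic sum in `C_l` is its solution, with `K` as
initial value. -/
lemma Ccoef_succ (K : ℝ) (l : ℕ) : Ccoef K (l + 1) = (l + 2) / (l + 1) * Ccoef K l + 1 := by
  have h1 : (l : ℝ) + 1 ≠ 0 := by positivity
  have h2 : (l : ℝ) + 2 ≠ 0 := by positivity
  have h3 : ((l + 1 : ℕ) : ℝ) + 1 = l + 2 := by push_cast; ring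
  rw [Ccoef, Ccoef, Finset.sum_Icc_succ_top (by omega), h3]
  field_simp
  ring

/-- The form `Q(ψ, f)` as a sum over the components of `ψ`. -/
lemma Rap.hasSum_Q {ψ : CS} (hψ : Rap ψ) (K : ℝ) (b : Fin 3) (f : CS) :
    HasSum (fun l => Ccoef K (l + 1) * avg (coordC b * pr (l + 1) ψ * f) -
      Ccoef K l * avg (harm l (contr b (hat (l + 1) ψ)) * f))
      (Q K b ψ f - Ccoef K 0 * avg (coordC b * pr 0 ψ * f)) := by
  have s1 := hψ.summable_left (quad_Ccoef K) b f
  have s2 := hψ.summable_right (quad_Ccoef K).one_sub b f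
  have s3 := (summable_nat_add_iff 1).2 s1
  have e : Q K b ψ f - Ccoef K 0 * avg (coordC b * pr 0 ψ * f) =
      ∑' l, (Ccoef K (l + 1) * X b (l + 1) ψ f + (1 - Ccoef K l) * X b l f ψ) := by
    rw [Q, W, s1.tsum_add s2, s1.tsum_eq_zero_add, s3.tsum_add s2, avg_coord_pr_zero]; ring
  rw [e]
  -- Regrouping by components of `ψ`: the weight of `X_l(f, ψ)` becomes `C_{l+1} - (2l+3)/(l+1)
  -- C_l`, which the recursion turns into `1 - C_l`.
  have e2 : (fun l => Ccoef K (l + 1) * avg (coordC b * pr (l + 1) ψ * f) -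
      Ccoef K l * avg (harm l (contr b (hat (l + 1) ψ)) * f)) =
      fun l => Ccoef K (l + 1) * X b (l + 1) ψ f + (1 - Ccoef K l) * X b l f ψ := by
    ext l
    have h1 : (l : ℝ) + 1 ≠ 0 := by positivity
    rw [avg_coord_pr_succ, avg_contr, Ccoef_succ]
    field_simp
    ring
  rw [e2]
  exact (s3.add s2).hasSum

lemma pdx_uT_contr_comm {l : ℕ} {T : Tensor (l + 1)} (hT : T ∈ stf (l + 1)) (a b : Fin 3) (z : E3) :
    pdx a (uT l (contr b T)) z = pdx b (uT l (contr a T)) z := by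
  cases l with
  | zero =>
    have : ∀ a b, pdx a (uT 0 (contr b T)) z = 0 := fun a b => by
      have e : uT 0 (contr b T) = fun _ => (contr b T) default := funext (uT_zero _)
      rw [e]; simp [pdx]
    rw [this, this]
  | succ l =>
    rw [pdx_uT (contr_mem_stf hT b), pdx_uT (contr_mem_stf hT a), contr_comm hT]

/-- Leibniz rule under the angular average. -/
lemma mean_pdx_mul {m n : ℤ} {u v : E3 → ℝ} (hu : Hom1 m u) (hv : Hom1 n v) (i : Fin 3) :
    mean (fun z => pdx i u z * v z) + mean (fun z => u z * pdx i v z) =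
      (m + n + 2) * mean (fun z => z i * (u z * v z)) := by
  have e := (hu.mul hv).mean_pdx i
  push_cast at e
  rw [← e, ← mean_add ((hu.pdx i).mul hv).continuous (hu.mul (hv.pdx i)).continuous]
  refine mean_congr fun z hz => ?_
  have hz0 := ne_zero_of_norm_eq_one hz
  rw [pdx_mul (hu.differentiableAt hz0) (hv.differentiableAt hz0)]

lemma mean_coord_pdx_mul {m n : ℤ} {u v : E3 → ℝ} (hu : Hom1 m u) (hv : Hom1 n v) (a b : Fin 3) :
    mean (fun z => (z b * u z) * pdx a v z) + mean (fun z => (z b * pdx a u z) * v z) +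
      (if b = a then 1 else 0) * mean (fun z => u z * v z) =
      (m + n + 3) * mean (fun z => z a * (z b * u z * v z)) := by
  have e := mean_pdx_mul ((hom1_coord b).mul hu) hv a
  have h1 : mean (fun z => pdx a (fun z => z b * u z) z * v z) =
      (if b = a then 1 else 0) * mean (fun z => u z * v z) +
        mean (fun z => (z b * pdx a u z) * v z) := by
    rw [← mean_mul, ← mean_add ((hu.mul hv).const_mul _).continuous
      (((hom1_coord b).mul (hu.pdx a)).mul hv).continuous]
    refine mean_congr fun z hz => ?_
    have hc : DifferentiableAt ℝ (fun z : E3 => z b) z := by fun_prop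
    rw [pdx_mul hc (hu.differentiableAt (ne_zero_of_norm_eq_one hz)), pdx_coord]; ring
  rw [h1] at e
  push_cast at e
  rw [show (m : ℝ) + n + 3 = 1 + m + n + 2 by ring, ← e]; ring

/-- In the Leibniz rule for `z_b u v` the radial term `⟨z_a z_b u v⟩` and the term in `δ_ab` are
symmetric. Antisymmetrizing in `a` and `b` moves the derivative from `v` to `u` without any
remainder, whatever the degrees. -/
lemma mean_coord_pdx_antisymm {m n : ℤ} {u v : E3 → ℝ} (hu : Hom1 m u) (hv : Hom1 n v)
    (a b : Fin 3) :
    mean (fun z => (z b * u z) * pdx a v z) - mean (fun z => (z a * u z) * pdx b v z) =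
      mean (fun z => (z a * pdx b u z) * v z) - mean (fun z => (z b * pdx a u z) * v z) := by
  have h1 := mean_coord_pdx_mul hu hv a b
  have h2 := mean_coord_pdx_mul hu hv b a
  have h3 : mean (fun z => z a * (z b * u z * v z)) = mean (fun z => z b * (z a * u z * v z)) := by
    congr 1; ext z; ring
  have h4 : (if a = b then (1 : ℝ) else 0) = if b = a then 1 else 0 := by simp only [eq_comm]
  rw [h4] at h2
  rw [h3] at h1
  linarith

/-- Against the gradient of a function of degree zero, the two building blocks `n^L T_{bL}` and `n_b
n^M T_M` have proportional antisymmetric parts. Their ratio `(l+2)/(l+1)` is the one in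
`Ccoef_succ`. -/
lemma mean_contr_pdx_antisymm {l : ℕ} {T : Tensor (l + 1)} (hT : T ∈ stf (l + 1)) {h : E3 → ℝ}
    (hh : Hom1 0 h) (a b : Fin 3) :
    (l + 1) * (mean (fun z => uT l (contr b T) z * pdx a h z) -
      mean (fun z => uT l (contr a T) z * pdx b h z)) =
    (l + 2) * (mean (fun z => (z b * uT (l + 1) T z) * pdx a h z) -
      mean (fun z => (z a * uT (l + 1) T z) * pdx b h z)) := by
  have h0 := mean_coord_pdx_antisymm (hom1_uT (l + 1) T) hh a b
  have e : ∀ a b, mean (fun z => (z a * pdx b (uT (l + 1) T) z) * h z) =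
      (l + 1) * mean (fun z => z a * (uT l (contr b T) z * h z)) := fun a b => by
    rw [← mean_mul]
    refine mean_congr fun z _ => ?_
    rw [pdx_uT hT]; ring
  rw [h0, e, e]
  have h1 := mean_pdx_mul (hom1_uT l (contr b T)) hh a
  have h2 := mean_pdx_mul (hom1_uT l (contr a T)) hh b
  have h3 : mean (fun z => pdx a (uT l (contr b T)) z * h z) =
      mean (fun z => pdx b (uT l (contr a T)) z * h z) := by
    congr 1; ext z; rw [pdx_uT_contr_comm hT]
  push_cast at h1 h2
  rw [h3] at h1
  linear_combination ((l : ℝ) + 1) * (h1 - h2)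

/-- The restriction of the gradient of a homogeneous function to the sphere. -/
def gradC (a : Fin 3) (h : E3 → ℝ) : CS := toC fun n => pdx a h n

lemma gradC_apply {m : ℤ} {h : E3 → ℝ} (hh : Hom1 m h) (a : Fin 3) (n : S2) :
    gradC a h n = pdx a h n := toC_apply (hh.pdx a).continuous n

lemma avg_harm_gradC {m : ℤ} {h : E3 → ℝ} (hh : Hom1 m h) (a : Fin 3) (l : ℕ) (T : Tensor l) :
    avg (harm l T * gradC a h) = mean (fun z => uT l T z * pdx a h z) := by
  rw [avg_apply, mean]; congr 1; ext n
  rw [ContinuousMap.mul_apply, gradC_apply hh, harm_apply]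

lemma avg_coord_harm_gradC {m : ℤ} {h : E3 → ℝ} (hh : Hom1 m h) (a b : Fin 3) (l : ℕ)
    (T : Tensor l) :
    avg (coordC b * harm l T * gradC a h) = mean (fun z => (z b * uT l T z) * pdx a h z) := by
  rw [avg_apply, mean]; congr 1; ext n
  rw [ContinuousMap.mul_apply, ContinuousMap.mul_apply, gradC_apply hh, harm_apply, coordC_apply]

/-- The identity behind the commutation of derivatives. -/
lemma Rap.Q_grad_comm {ψ : CS} (hψ : Rap ψ) (K : ℝ) {h : E3 → ℝ} (hh : Hom1 0 h) (a b : Fin 3) :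
    Q K b ψ (gradC a h) - Q K a ψ (gradC b h) =
      avg (coordC b * ψ * gradC a h) - avg (coordC a * ψ * gradC b h) := by
  set D : ℕ → ℝ := fun l => avg (coordC b * pr l ψ * gradC a h) -
    avg (coordC a * pr l ψ * gradC b h) with hD
  have hP : HasSum D (avg (coordC b * ψ * gradC a h) - avg (coordC a * ψ * gradC b h)) := by
    have h1 := hasSum_avg_pr ψ (coordC b * gradC a h - coordC a * gradC b h)
    have e : ∀ f : CS, avg (f * (coordC b * gradC a h - coordC a * gradC b h)) =
        avg (coordC b * f * gradC a h) - avg (coordC a * f * gradC b h) := fun f => by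
      rw [← map_sub]; congr 1; ring
    simpa only [e] using h1
  -- The component of degree zero is constant, so moving the derivative onto it gives zero. This is
  -- why `C_0 = K` remains free.
  have hD0 : D 0 = 0 := by
    have h1 := mean_coord_pdx_antisymm (hom1_uT 0 (hat 0 ψ)) hh a b
    have e : ∀ c, pdx c (uT 0 (hat 0 ψ)) = fun _ => 0 := fun c => by
      have e : uT 0 (hat 0 ψ) = fun _ => (hat 0 ψ) default := funext (uT_zero _)
      ext1 z; rw [e]; simp [pdx]
    simp only [e, mul_zero, zero_mul, sub_self] at h1
    rw [hD]
    simp only [pr]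
    rw [avg_coord_harm_gradC hh, avg_coord_harm_gradC hh, h1]
  have hQ := (hψ.hasSum_Q K b (gradC a h)).sub (hψ.hasSum_Q K a (gradC b h))
  -- Each component of degree `l + 1` enters with the factor `C_{l+1} - (l+2)/(l+1) C_l = 1`: all
  -- constants disappear from the antisymmetric part.
  have hterm : (fun l => (Ccoef K (l + 1) * avg (coordC b * pr (l + 1) ψ * gradC a h) -
      Ccoef K l * avg (harm l (contr b (hat (l + 1) ψ)) * gradC a h)) -
      (Ccoef K (l + 1) * avg (coordC a * pr (l + 1) ψ * gradC b h) -
      Ccoef K l * avg (harm l (contr a (hat (l + 1) ψ)) * gradC b h))) = fun l => D (l + 1) := by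
    ext l
    have h1 := mean_contr_pdx_antisymm (hat_mem (l + 1) ψ) hh a b
    rw [← avg_harm_gradC hh, ← avg_harm_gradC hh, ← avg_coord_harm_gradC hh,
      ← avg_coord_harm_gradC hh] at h1
    have h2 : (l : ℝ) + 1 ≠ 0 := by positivity
    rw [Ccoef_succ, hD]
    simp only [pr]
    field_simp
    linear_combination -Ccoef K l * h1
  rw [hterm] at hQ
  have h2 := (hasSum_nat_add_iff' 1).2 hP
  rw [Finset.sum_range_one, hD0, sub_zero] at h2
  have h3 := hQ.unique h2
  have h4 : Ccoef K 0 * avg (coordC b * pr 0 ψ * gradC a h) -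
      Ccoef K 0 * avg (coordC a * pr 0 ψ * gradC b h) = Ccoef K 0 * D 0 := by rw [hD]; ring
  rw [hD0, mul_zero] at h4
  linarith

/-- The exchange rule `Rap.Q_add_swap` moves the gradient to the first slot. In this form the
identity applies to coefficients of order 0, whose gradients have the order `-1` on which `Q` acts.
-/
lemma Rap.Q_grad_symm {ψ : CS} (hψ : Rap ψ) (K : ℝ) {h : E3 → ℝ} (hh : Hom1 0 h) (a b : Fin 3) :
    Q K b (gradC a h) ψ = Q K a (gradC b h) ψ := by
  have h1 := hψ.Q_grad_comm K hh a b
  have h2 := hψ.Q_add_swap K b (gradC a h)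
  have h3 := hψ.Q_add_swap K a (gradC b h)
  linarith

end Hadamard
end

/-! ### Differentiability of the partie finie integral and its surface terms. -/

set_option linter.unusedSectionVars false
noncomputable section
namespace Hadamard

/-! ### Decay at infinity -/

section Decays
variable {V W : Type} [NormedAddCommGroup V] [NormedSpace ℝ V] [NormedAddCommGroup W]
  [NormedSpace ℝ W]

/-- Decrease at infinity faster than `|x| ^ (-3)`, locally uniformly in the parameters. -/
def Decays (f : E3 × Param → V) : Prop :=
  ∀ p₀ ∈ Par, ∃ ε > 0, ∃ C R : ℝ, ∀ᶠ p in 𝓝 p₀, ∀ x : E3, R ≤ ‖x‖ →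
    ‖f (x, p)‖ ≤ C * ‖x‖ ^ (-3 - ε : ℝ)

/-- Comparison on regular configurations suffices: beyond a radius exceeding the norms of both
source points, locally uniformly, every point of space is regular. -/
lemma Decays.mono {f : E3 × Param → V} {g : E3 × Param → W} (hf : Decays f)
    (h : ∀ c ∈ Reg, ‖g c‖ ≤ ‖f c‖) : Decays g := by
  intro p₀ hp₀
  obtain ⟨ε, hε, C, R, h1⟩ := hf p₀ hp₀
  refine ⟨ε, hε, C, max R (max (‖pos 0 p₀‖ + 1) (‖pos 1 p₀‖ + 1)), ?_⟩
  have hlt : ∀ j, ∀ᶠ p in 𝓝 p₀, ‖pos j p‖ < ‖pos j p₀‖ + 1 := fun j => by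
    have hc : Continuous fun p => ‖pos j p‖ := by
      simp only [← posL_apply]; exact (posL j).continuous.norm
    exact hc.continuousAt.eventually_lt continuousAt_const (by simp)
  filter_upwards [h1, isOpen_Par.mem_nhds hp₀, hlt 0, hlt 1] with p hp hP h2 h3 x hx
  refine (h (x, p) ⟨hP, fun j hj => ?_⟩).trans (hp x ((le_max_left _ _).trans hx))
  have h4 := (le_max_right _ _).trans hx
  change x = pos j p at hj
  subst hj
  fin_cases j
  · exact absurd ((le_max_left _ _).trans h4) (not_le.2 h2)
  · exact absurd ((le_max_right _ _).trans h4) (not_le.2 h3)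

lemma Decays.add {f g : E3 × Param → V} (hf : Decays f) (hg : Decays g) :
    Decays fun c => f c + g c := by
  intro p₀ hp₀
  obtain ⟨ε, hε, C, R, h1⟩ := hf p₀ hp₀
  obtain ⟨δ, hδ, D, S, h2⟩ := hg p₀ hp₀
  refine ⟨min ε δ, lt_min hε hδ, |C| + |D|, max 1 (max R S), ?_⟩
  filter_upwards [h1, h2] with p h1 h2 x hx
  have hx1 : 1 ≤ ‖x‖ := (le_max_left _ _).trans hx
  have hx2 := (le_max_right _ _).trans hx
  have e1 := h1 x ((le_max_left _ _).trans hx2)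
  have e2 := h2 x ((le_max_right _ _).trans hx2)
  have m1 : ‖x‖ ^ (-3 - ε : ℝ) ≤ ‖x‖ ^ (-3 - min ε δ : ℝ) :=
    Real.rpow_le_rpow_of_exponent_le hx1 (by linarith [min_le_left ε δ])
  have m2 : ‖x‖ ^ (-3 - δ : ℝ) ≤ ‖x‖ ^ (-3 - min ε δ : ℝ) :=
    Real.rpow_le_rpow_of_exponent_le hx1 (by linarith [min_le_right ε δ])
  have p1 : 0 ≤ ‖x‖ ^ (-3 - ε : ℝ) := by positivity
  have p2 : 0 ≤ ‖x‖ ^ (-3 - δ : ℝ) := by positivity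
  calc ‖f (x, p) + g (x, p)‖ ≤ ‖f (x, p)‖ + ‖g (x, p)‖ := norm_add_le _ _
    _ ≤ |C| * ‖x‖ ^ (-3 - ε : ℝ) + |D| * ‖x‖ ^ (-3 - δ : ℝ) := by
        gcongr
        · exact e1.trans (mul_le_mul_of_nonneg_right (le_abs_self _) p1)
        · exact e2.trans (mul_le_mul_of_nonneg_right (le_abs_self _) p2)
    _ ≤ |C| * ‖x‖ ^ (-3 - min ε δ : ℝ) + |D| * ‖x‖ ^ (-3 - min ε δ : ℝ) := by gcongr
    _ = _ := by ring

lemma Decays.zero : Decays fun _ => (0 : V) := fun p₀ _ =>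
  ⟨1, one_pos, 0, 0, Eventually.of_forall fun p x _ => by simp⟩

lemma Decays.sum {ι : Type*} (s : Finset ι) {f : ι → E3 × Param → V}
    (h : ∀ i ∈ s, Decays (f i)) : Decays fun c => ∑ i ∈ s, f i c := by
  classical
  induction s using Finset.induction_on with
  | empty => simpa using Decays.zero
  | insert a s ha ih =>
    simp only [Finset.sum_insert ha]
    exact (h a (by simp)).add (ih fun i hi => h i (by simp [hi]))

lemma Decays.smul_param {f : E3 × Param → V} (hf : Decays f) {g : Param → ℝ} (hg : Continuous g) :
    Decays fun c => g c.2 • f c := by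
  intro p₀ hp₀
  obtain ⟨ε, hε, C, R, h1⟩ := hf p₀ hp₀
  refine ⟨ε, hε, (|g p₀| + 1) * |C|, R, ?_⟩
  have h2 : ∀ᶠ p in 𝓝 p₀, |g p| < |g p₀| + 1 :=
    hg.abs.continuousAt.eventually_lt continuousAt_const (by simp)
  filter_upwards [h1, h2] with p hp h2 x hx
  have p1 : 0 ≤ ‖x‖ ^ (-3 - ε : ℝ) := by positivity
  rw [norm_smul, Real.norm_eq_abs, mul_assoc]
  exact mul_le_mul h2.le ((hp x hx).trans (mul_le_mul_of_nonneg_right (le_abs_self _) p1))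
    (norm_nonneg _) (by positivity)

lemma exists_uniform_bound {f : E3 × Param → V} {K : Set Param} (hK : IsCompact K)
    (hc : ContinuousOn f (univ ×ˢ K)) {δ C R : ℝ} (hδ : 0 < δ)
    (h : ∀ p ∈ K, ∀ x : E3, R ≤ ‖x‖ → ‖f (x, p)‖ ≤ C * ‖x‖ ^ (-3 - δ : ℝ)) :
    ∃ B, ∀ p ∈ K, ∀ x, ‖f (x, p)‖ ≤ B * (1 + ‖x‖) ^ (-(3 + δ) : ℝ) := by
  set R' := max R 1
  have hR' : 1 ≤ R' := le_max_right _ _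
  obtain ⟨B₀, hB₀⟩ := ((isCompact_closedBall (0 : E3) R').prod hK).exists_bound_of_continuousOn
    (hc.mono (prod_mono_left (subset_univ _)))
  refine ⟨|B₀| * (1 + R') ^ (3 + δ : ℝ) + |C| * 2 ^ (3 + δ : ℝ), fun p hp x => ?_⟩
  have hpos : 0 < 1 + ‖x‖ := by positivity
  by_cases hx : ‖x‖ ≤ R'
  · have h1 := hB₀ (x, p) ⟨by simpa using hx, hp⟩
    have h2 : 1 ≤ (1 + R') ^ (3 + δ : ℝ) * (1 + ‖x‖) ^ (-(3 + δ) : ℝ) := by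
      rw [Real.rpow_neg hpos.le, ← div_eq_mul_inv, one_le_div (by positivity)]
      gcongr
    calc ‖f (x, p)‖ ≤ |B₀| * 1 := by rw [mul_one]; exact h1.trans (le_abs_self _)
      _ ≤ |B₀| * ((1 + R') ^ (3 + δ : ℝ) * (1 + ‖x‖) ^ (-(3 + δ) : ℝ)) := by gcongr
      _ ≤ _ := by
        rw [add_mul, mul_assoc]
        exact le_add_of_nonneg_right (by positivity)
  · push Not at hx
    have h1 := h p hp x ((le_max_left _ _).trans hx.le)
    have hx1 : 1 ≤ ‖x‖ := hR'.trans hx.le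
    have h2 : ‖x‖ ^ (-3 - δ : ℝ) ≤ 2 ^ (3 + δ : ℝ) * (1 + ‖x‖) ^ (-(3 + δ) : ℝ) := by
      rw [Real.rpow_neg hpos.le, ← div_eq_mul_inv, show (-3 - δ : ℝ) = -(3 + δ) by ring,
        Real.rpow_neg (by positivity), ← Real.div_rpow (by norm_num) hpos.le,
        ← Real.inv_rpow (by positivity)]
      gcongr
      rw [inv_eq_one_div, div_le_div_iff₀ (by positivity) hpos]
      linarith
    calc ‖f (x, p)‖ ≤ |C| * ‖x‖ ^ (-3 - δ : ℝ) :=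
          h1.trans (mul_le_mul_of_nonneg_right (le_abs_self _) (by positivity))
      _ ≤ |C| * (2 ^ (3 + δ : ℝ) * (1 + ‖x‖) ^ (-(3 + δ) : ℝ)) := by gcongr
      _ ≤ _ := by
        rw [add_mul, ← mul_assoc |C|]
        exact le_add_of_nonneg_left (by positivity)

lemma integrable_bound (B : ℝ) {δ : ℝ} (hδ : 0 < δ) :
    Integrable fun x : E3 => B * (1 + ‖x‖) ^ (-(3 + δ) : ℝ) :=
  (integrable_one_add_norm (by rw [finrank_E3]; push_cast; linarith)).const_mul B

lemma Decays.exists_bound {f : E3 × Param → V} (hf : Decays f) {U : Set Param} (hU : IsOpen U)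
    (hUP : U ⊆ Par) (hc : ContinuousOn f (univ ×ˢ U)) {p₀ : Param} (hp₀ : p₀ ∈ U) :
    ∃ r > 0, Metric.closedBall p₀ r ⊆ U ∧ ∃ bound : E3 → ℝ, Integrable bound ∧
      ∀ p ∈ Metric.closedBall p₀ r, ∀ x, ‖f (x, p)‖ ≤ bound x := by
  obtain ⟨δ, hδ, C, R, h⟩ := hf p₀ (hUP hp₀)
  obtain ⟨r, hr, hball⟩ := Metric.nhds_basis_closedBall.mem_iff.1
    (inter_mem h (hU.mem_nhds hp₀))
  obtain ⟨B, hB⟩ := exists_uniform_bound (isCompact_closedBall p₀ r)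
    (hc.mono (prod_mono_right fun p hp => (hball hp).2)) hδ fun p hp x hx => (hball hp).1 x hx
  exact ⟨r, hr, fun p hp => (hball hp).2, _, integrable_bound B hδ, hB⟩

lemma continuous_slice_fst {f : E3 × Param → V} {U : Set Param} (hc : ContinuousOn f (univ ×ˢ U))
    {p : Param} (hp : p ∈ U) : Continuous fun x => f (x, p) :=
  hc.comp_continuous (by fun_prop) fun x => ⟨mem_univ _, hp⟩

lemma Decays.integrable {f : E3 × Param → V} (hf : Decays f) {U : Set Param} (hU : IsOpen U)
    (hUP : U ⊆ Par) (hc : ContinuousOn f (univ ×ˢ U)) {p : Param} (hp : p ∈ U) :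
    Integrable fun x => f (x, p) := by
  obtain ⟨r, hr, -, bound, hb, h⟩ := hf.exists_bound hU hUP hc hp
  exact hb.mono' (continuous_slice_fst hc hp).aestronglyMeasurable
    (Eventually.of_forall fun x => h p (Metric.mem_closedBall_self hr.le) x)

end Decays

/-! ### Differentiation under the integral sign -/

/-- The integral over space of a decreasing family of class `C¹`. -/
lemma hasFDerivAt_integral {f : E3 × Param → ℝ} {f' : E3 × Param → (E3 × Param →L[ℝ] ℝ)}
    {U : Set Param} (hU : IsOpen U) (hUP : U ⊆ Par)
    (hf : ∀ c : E3 × Param, c.2 ∈ U → HasFDerivAt f (f' c) c) (hc : ContinuousOn f' (univ ×ˢ U))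
    (hd : Decays f) (hd' : Decays f') {p : Param} (hp : p ∈ U) :
    HasFDerivAt (fun p => ∫ x, f (x, p))
      (∫ x, (f' (x, p)).comp (ContinuousLinearMap.inr ℝ E3 Param)) p := by
  have hcf : ContinuousOn f (univ ×ˢ U) := fun c hc =>
    (hf c hc.2).continuousAt.continuousWithinAt
  set g' : E3 × Param → (Param →L[ℝ] ℝ) := fun c =>
    (f' c).comp (ContinuousLinearMap.inr ℝ E3 Param) with hg'
  have hcg : ContinuousOn g' (univ ×ˢ U) := hc.clm_comp continuousOn_const
  have hdg : Decays g' := by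
    refine hd'.mono fun c _ => ?_
    refine (ContinuousLinearMap.opNorm_comp_le _ _).trans ?_
    exact mul_le_of_le_one_right (norm_nonneg _) (ContinuousLinearMap.norm_inr_le_one ℝ E3 Param)
  obtain ⟨r, hr, hball, bound, hb, h⟩ := hdg.exists_bound hU hUP hcg hp
  refine hasFDerivAt_integral_of_dominated_of_fderiv_le (F := fun p x => f (x, p))
    (F' := fun p x => g' (x, p)) (Metric.closedBall_mem_nhds p hr) ?_
    (hd.integrable hU hUP hcf hp) (continuous_slice_fst hcg hp).aestronglyMeasurable
    (Eventually.of_forall fun x q hq => h q hq x) hb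
    (Eventually.of_forall fun x q hq => ?_)
  · filter_upwards [hU.mem_nhds hp] with q hq
    exact (continuous_slice_fst hcf hq).aestronglyMeasurable
  · exact (hf (x, q) (hball hq)).comp q (hasFDerivAt_prodMk_right x q)

/-- Derivative of the integral in the direction `e`; the field point may be moved at will. -/
lemma fderiv_integral {f : E3 × Param → ℝ} {f' : E3 × Param → (E3 × Param →L[ℝ] ℝ)}
    {U : Set Param} (hU : IsOpen U) (hUP : U ⊆ Par)
    (hf : ∀ c : E3 × Param, c.2 ∈ U → HasFDerivAt f (f' c) c) (hc : ContinuousOn f' (univ ×ˢ U))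
    (hd : Decays f) (hd' : Decays f') {p : Param} (hp : p ∈ U) (e : E3 × Param) :
    fderiv ℝ (fun p => ∫ x, f (x, p)) p e.2 = ∫ x, f' (x, p) e := by
  have hcf : ContinuousOn f (univ ×ˢ U) := fun c hc =>
    (hf c hc.2).continuousAt.continuousWithinAt
  have hi := hd'.integrable hU hUP hc hp
  have hL : ∀ w : E3 × Param, Integrable fun x => f' (x, p) w := fun w =>
    ((ContinuousLinearMap.apply ℝ ℝ w).integrable_comp hi)
  -- A displacement of the field point contributes the integral of a derivative, which vanishes by
  -- decay. It can be added freely to that of the parameters, so that every letter is covered.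
  have h0 : ∫ x, f' (x, p) (e.1, 0) = 0 := by
    have h1 : ∀ x, HasFDerivAt (fun x => f (x, p))
        ((f' (x, p)).comp (ContinuousLinearMap.inl ℝ E3 Param)) x := fun x =>
      (hf (x, p) hp).comp x (hasFDerivAt_prodMk_left x p)
    have h2 : ∀ x, fderiv ℝ (fun x => f (x, p)) x e.1 = f' (x, p) (e.1, 0) := fun x => by
      rw [(h1 x).fderiv]; rfl
    have := integral_mul_fderiv_eq_neg_fderiv_mul_of_integrable (μ := (volume : Measure E3))
      (f := fun _ : E3 => (1 : ℝ)) (g := fun x => f (x, p)) (v := e.1) (by simp)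
      (by simpa only [one_mul, h2] using hL (e.1, 0))
      (by simpa only [one_mul] using hd.integrable hU hUP hcf hp)
      (by simp) (fun x _ => (h1 x).differentiableAt)
    simpa [h2] using this
  have hg : Integrable fun x => (f' (x, p)).comp (ContinuousLinearMap.inr ℝ E3 Param) :=
    ((ContinuousLinearMap.compL ℝ Param (E3 × Param) ℝ).flip
      (ContinuousLinearMap.inr ℝ E3 Param)).integrable_comp hi
  rw [(hasFDerivAt_integral hU hUP hf hc hd hd' hp).fderiv,
    ContinuousLinearMap.integral_apply hg]
  have h3 : ∀ x, f' (x, p) e = f' (x, p) (e.1, 0) + f' (x, p) (0, e.2) := fun x => by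
    rw [← map_add]; simp
  simp only [h3]
  rw [integral_add (hL _) (hL _), h0, zero_add]
  rfl

/-! ### Extension through the source points -/

/-- Extension by zero to the source points. -/
def ext0 {V : Type} [Zero V] (R : E3 × Param → V) : E3 × Param → V := Reg.indicator R

lemma rad_le (j : Fin 2) (p : Param) :
    ∃ C, 0 < C ∧ ∀ c : E3 × Param, rad j c ≤ C * ‖c - (pos j p, p)‖ := by
  refine ⟨‖relL j‖ + 1, by positivity, fun c => ?_⟩
  have h1 : (relL j (c - (pos j p, p))).1 = c.1 - pos j c.2 := by
    rw [map_sub, Prod.fst_sub]; simp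
  calc rad j c = ‖(relL j (c - (pos j p, p))).1‖ := by rw [h1]; rfl
    _ ≤ ‖relL j (c - (pos j p, p))‖ := norm_fst_le _
    _ ≤ ‖relL j‖ * ‖c - (pos j p, p)‖ := (relL j).le_opNorm _
    _ ≤ _ := by gcongr; linarith

section ext0
variable {V : Type} [NormedAddCommGroup V] [NormedSpace ℝ V]

lemma ext0_isBigO {R : E3 × Param → V} {j : Fin 2} {p : Param} {k : ℕ}
    (h : R =O[nh j p] fun c => rad j c ^ k) :
    ext0 R =O[𝓝 (pos j p, p)] fun c => ‖c - (pos j p, p)‖ ^ k := by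
  obtain ⟨C, hC⟩ := h.bound
  obtain ⟨D, hD, hrad⟩ := rad_le j p
  refine IsBigO.of_bound (|C| * D ^ k) ?_
  filter_upwards [eventually_nhdsWithin_iff.1 hC] with c hc
  by_cases hR : c ∈ Reg
  · rw [ext0, indicator_of_mem hR]
    have h0 : 0 ≤ rad j c := norm_nonneg _
    calc ‖R c‖ ≤ C * ‖rad j c ^ k‖ := hc hR
      _ ≤ |C| * rad j c ^ k := by
        rw [Real.norm_of_nonneg (by positivity)]
        exact mul_le_mul_of_nonneg_right (le_abs_self _) (by positivity)
      _ ≤ |C| * (D * ‖c - (pos j p, p)‖) ^ k := by gcongr; exact hrad c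
      _ = _ := by rw [norm_pow, norm_norm, mul_pow]; ring
  · rw [ext0, indicator_of_notMem hR, norm_zero]; positivity

lemma ext0_eventuallyEq {R : E3 × Param → V} {c : E3 × Param} (hc : c ∈ Reg) :
    ext0 R =ᶠ[𝓝 c] R := by
  filter_upwards [isOpen_Reg.mem_nhds hc] with x hx using indicator_of_mem hx R

lemma exists_of_notMem_Reg {c : E3 × Param} (hP : c.2 ∈ Par) (hc : c ∉ Reg) :
    ∃ j, c = (pos j c.2, c.2) := by
  by_contra! h
  exact hc ⟨hP, fun j hj => h j (Prod.ext hj rfl)⟩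

lemma continuousAt_ext0 {R : E3 × Param → V} (hR : ContinuousOn R Reg) {c : E3 × Param}
    (hP : c.2 ∈ Par) (h : ∀ j, R =O[nh j c.2] fun c => rad j c ^ 1) : ContinuousAt (ext0 R) c := by
  by_cases hc : c ∈ Reg
  · exact (hR.continuousAt (isOpen_Reg.mem_nhds hc)).congr (ext0_eventuallyEq hc).symm
  · obtain ⟨j, hj⟩ := exists_of_notMem_Reg hP hc
    have h0 : ext0 R c = 0 := indicator_of_notMem hc R
    have h1 := ext0_isBigO (h j)
    rw [← hj] at h1
    rw [ContinuousAt, h0]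
    refine h1.trans_tendsto ?_
    have hcont : Continuous fun x : E3 × Param => ‖x - c‖ ^ 1 := by fun_prop
    simpa using hcont.tendsto c

/-- A function that is `O(r²)` at a source point extends by zero with zero derivative there. This is
why singular parts are subtracted up to order 1 before differentiating under the integral. -/
lemma hasFDerivAt_ext0 {R : E3 × Param → V} (hR : ContDiffOn ℝ ∞ R Reg) {c : E3 × Param}
    (hP : c.2 ∈ Par) (h : ∀ j, R =O[nh j c.2] fun c => rad j c ^ 2) :
    HasFDerivAt (ext0 R) (ext0 (fderiv ℝ R) c) c := by
  by_cases hc : c ∈ Reg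
  · rw [show ext0 (fderiv ℝ R) c = fderiv ℝ R c from indicator_of_mem hc _]
    have h1 : DifferentiableAt ℝ R c :=
      (hR.contDiffAt (isOpen_Reg.mem_nhds hc)).differentiableAt (by simp)
    exact h1.hasFDerivAt.congr_of_eventuallyEq (ext0_eventuallyEq hc)
  · obtain ⟨j, hj⟩ := exists_of_notMem_Reg hP hc
    have h0 : ext0 R c = 0 := indicator_of_notMem hc R
    have h1 := ext0_isBigO (h j)
    rw [← hj] at h1
    rw [show ext0 (fderiv ℝ R) c = 0 from indicator_of_notMem hc _, hasFDerivAt_iff_isLittleO]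
    simp only [h0, sub_zero, _root_.zero_apply]
    refine h1.trans_isLittleO ?_
    have h2 : (fun x : E3 × Param => ‖x - c‖ ^ 2) = fun x => ‖x - c‖ ^ 1 * ‖x - c‖ := by
      ext x; ring
    rw [h2]
    have h3 : (fun x : E3 × Param => ‖x - c‖ ^ 1) =o[𝓝 c] fun _ => (1 : ℝ) := by
      rw [isLittleO_one_iff]
      have hcont : Continuous fun x : E3 × Param => ‖x - c‖ ^ 1 := by fun_prop
      simpa using hcont.tendsto c
    have h4 := h3.mul_isBigO (isBigO_refl (fun x : E3 × Param => ‖x - c‖) (𝓝 c))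
    simp only [one_mul] at h4
    exact h4.trans_isBigO (isBigO_norm_left.2 (isBigO_refl _ _))

end ext0

end Hadamard
end

noncomputable section
namespace Hadamard

/-! ### Radial cutoffs -/

/-- A smooth cutoff, equal to `1` up to `ε` and to `0` from `2 ε` on. -/
def cut (ε r : ℝ) : ℝ := Real.smoothTransition (2 - r / ε)

variable {ε : ℝ}

lemma cut_one (hε : 0 < ε) {r : ℝ} (h : r ≤ ε) : cut ε r = 1 :=
  Real.smoothTransition.one_of_one_le (by have := (div_le_one hε).2 h; linarith)

lemma cut_zero (hε : 0 < ε) {r : ℝ} (h : 2 * ε ≤ r) : cut ε r = 0 :=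
  Real.smoothTransition.zero_of_nonpos (by have := (le_div_iff₀ hε).2 h; linarith)

lemma contDiff_cut (ε : ℝ) : ContDiff ℝ ∞ (cut ε) :=
  Real.smoothTransition.contDiff.comp (by fun_prop)

lemma hasDerivAt_cut (ε r : ℝ) : HasDerivAt (cut ε) (deriv (cut ε) r) r :=
  ((contDiff_cut ε).differentiable (by simp) r).hasDerivAt

lemma continuous_deriv_cut (ε : ℝ) : Continuous (deriv (cut ε)) :=
  (contDiff_cut ε).continuous_deriv (by simp)

lemma deriv_cut_left (hε : 0 < ε) {r : ℝ} (hr : r ≤ ε) : deriv (cut ε) r = 0 := by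
  have h1 : HasDerivWithinAt (cut ε) 0 (Iic r) r :=
    (hasDerivWithinAt_const r (Iic r) (1 : ℝ)).congr (fun y hy => cut_one hε (le_trans hy hr))
      (cut_one hε hr)
  exact (uniqueDiffOn_Iic r r self_mem_Iic).eq_deriv _ (hasDerivAt_cut ε r).hasDerivWithinAt h1

lemma deriv_cut_right (hε : 0 < ε) {r : ℝ} (hr : 2 * ε ≤ r) : deriv (cut ε) r = 0 := by
  have h1 : HasDerivWithinAt (cut ε) 0 (Ici r) r :=
    (hasDerivWithinAt_const r (Ici r) (0 : ℝ)).congr (fun y hy => cut_zero hε (le_trans hr hy))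
      (cut_zero hε hr)
  exact (uniqueDiffOn_Ici r r self_mem_Ici).eq_deriv _ (hasDerivAt_cut ε r).hasDerivWithinAt h1

/-- `∫ χ'(r) r ^ n dr`. -/
def cutJ (ε : ℝ) (n : ℤ) : ℝ := ∫ r in Ioi (0 : ℝ), deriv (cut ε) r * r ^ n

/-- The finite part of `∫ χ(r) r ^ n dr`. -/
def cutC (ε : ℝ) (n : ℤ) : ℝ :=
  if n = -1 then -∫ r in Ioi (0 : ℝ), deriv (cut ε) r * Real.log r
  else -(cutJ ε (n + 1) / (n + 1))

lemma continuousOn_zpow_Ici {ρ : ℝ} (hρ : 0 < ρ) (n : ℤ) : ContinuousOn (fun r : ℝ => r ^ n) (Ici ρ) :=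
  continuousOn_id.zpow₀ n fun _ hr => Or.inl (ne_of_gt (hρ.trans_le hr))

lemma integrableOn_cut {ρ : ℝ} (hε : 0 < ε) (hρ : 0 < ρ) (n : ℤ) :
    IntegrableOn (fun r => cut ε r * r ^ n) (Ioi ρ) :=
  integrableOn_Ioi_of_zero (M := 2 * ε)
    ((contDiff_cut ε).continuous.continuousOn.mul (continuousOn_zpow_Ici hρ n))
    fun r hr => by rw [cut_zero hε (le_of_lt hr), zero_mul]

lemma integrableOn_deriv_cut_mul {ρ : ℝ} (hε : 0 < ε) {g : ℝ → ℝ} (hg : ContinuousOn g (Ici ρ)) :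
    IntegrableOn (fun r => deriv (cut ε) r * g r) (Ioi ρ) :=
  integrableOn_Ioi_of_zero (M := 2 * ε) ((continuous_deriv_cut ε).continuousOn.mul hg)
    fun r hr => by rw [deriv_cut_right hε (le_of_lt hr), zero_mul]

lemma integrableOn_deriv_cut (hε : 0 < ε) (n : ℤ) :
    IntegrableOn (fun r => deriv (cut ε) r * r ^ n) (Ioi 0) := by
  have h1 := integrableOn_deriv_cut_mul hε (continuousOn_zpow_Ici hε n)
  have h2 : IntegrableOn (fun r => deriv (cut ε) r * r ^ n) (Ioc 0 ε) :=
    (integrableOn_congr_fun (g := fun _ => (0 : ℝ))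
      (fun r hr => by simp [deriv_cut_left hε hr.2]) measurableSet_Ioc).2 integrableOn_zero
  refine (h2.union h1).mono_set fun r hr => ?_
  by_cases h : r ≤ ε
  · exact Or.inl ⟨hr, h⟩
  · exact Or.inr (not_le.1 h)

lemma integral_deriv_cut_restrict {ρ : ℝ} (hε : 0 < ε) (hρ : 0 < ρ) (hρε : ρ ≤ ε) (g : ℝ → ℝ) :
    ∫ r in Ioi 0, deriv (cut ε) r * g r = ∫ r in Ioi ρ, deriv (cut ε) r * g r :=
  integral_Ioi_restrict hρ.le fun r hr => by rw [deriv_cut_left hε (hr.trans hρε), zero_mul]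

/-- Integration by parts; the boundary term at `ρ` is exactly what the Hadamard counterterm cancels,
and `cutC` is the rest, independent of `ρ`. -/
lemma integral_cut {ρ : ℝ} (hε : 0 < ε) (hρ : 0 < ρ) (hρε : ρ ≤ ε) {n : ℤ} (hn : n ≠ -1) :
    ∫ r in Ioi ρ, cut ε r * r ^ n = cutC ε n - ρ ^ (n + 1) / (n + 1) := by
  have hn' : (n : ℝ) + 1 ≠ 0 := by
    have : n + 1 ≠ 0 := by omega
    exact_mod_cast this
  have h1 := integrableOn_cut hε hρ n
  have h2 := integrableOn_deriv_cut_mul hε (continuousOn_zpow_Ici hρ (n + 1))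
  have h3 := integral_Ioi_deriv (M := 2 * ε) (ε := ρ)
    (q := fun r => cut ε r * (r ^ (n + 1) / (n + 1)))
    (q' := fun r => cut ε r * r ^ n + deriv (cut ε) r * r ^ (n + 1) / (n + 1))
    (fun r hr => by
      have hr0 : r ≠ 0 := ne_of_gt (hρ.trans_le hr)
      have hd := (hasDerivAt_cut ε r).mul
        ((hasDerivAt_zpow (n + 1) r (Or.inl hr0)).div_const ((n : ℝ) + 1))
      refine hd.congr_deriv ?_
      push_cast
      rw [add_sub_cancel_right]
      field_simp
      ring)
    (h1.add (h2.div_const _)) (fun r hr => by rw [cut_zero hε hr, zero_mul])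
  rw [integral_add h1 (h2.div_const _), integral_div, ← integral_deriv_cut_restrict hε hρ hρε,
    cut_one hε hρε] at h3
  rw [cutC, if_neg hn, cutJ]
  linarith

lemma integral_cut_inv {ρ : ℝ} (hε : 0 < ε) (hρ : 0 < ρ) (hρε : ρ ≤ ε) :
    ∫ r in Ioi ρ, cut ε r * r ^ (-1 : ℤ) = cutC ε (-1) - Real.log ρ := by
  have h1 := integrableOn_cut hε hρ (-1)
  have hlog : ContinuousOn Real.log (Ici ρ) := fun r hr =>
    (Real.continuousAt_log (ne_of_gt (hρ.trans_le hr))).continuousWithinAt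
  have h2 := integrableOn_deriv_cut_mul hε hlog
  have h3 := integral_Ioi_deriv (M := 2 * ε) (ε := ρ) (q := fun r => cut ε r * Real.log r)
    (q' := fun r => cut ε r * r ^ (-1 : ℤ) + deriv (cut ε) r * Real.log r)
    (fun r hr => by
      have hr0 : r ≠ 0 := ne_of_gt (hρ.trans_le hr)
      refine ((hasDerivAt_cut ε r).mul (Real.hasDerivAt_log hr0)).congr_deriv ?_
      rw [zpow_neg_one]; ring)
    (h1.add h2) (fun r hr => by rw [cut_zero hε hr, zero_mul])
  rw [integral_add h1 h2, ← integral_deriv_cut_restrict hε hρ hρε, cut_one hε hρε] at h3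
  rw [cutC, if_pos rfl]
  linarith

/-- The total drop of the cutoff. The surface terms at the source points originate from this value.
-/
lemma cutJ_zero (hε : 0 < ε) : cutJ ε 0 = -1 := by
  have h2 := integrableOn_deriv_cut_mul hε (continuousOn_const (c := (1 : ℝ)) (s := Ici ε))
  have h3 := integral_Ioi_deriv (M := 2 * ε) (ε := ε) (q := cut ε)
    (q' := fun r => deriv (cut ε) r * 1)
    (fun r _ => by rw [mul_one]; exact hasDerivAt_cut ε r) h2 (fun r hr => cut_zero hε hr)
  rw [cut_one hε le_rfl, ← integral_deriv_cut_restrict hε hε le_rfl] at h3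
  simpa [cutJ] using h3

/-- For nonnegative powers the finite part is the integral. -/
lemma integrableOn_cut_zero (hε : 0 < ε) (n : ℕ) :
    IntegrableOn (fun r => cut ε r * r ^ (n : ℤ)) (Ioi 0) := by
  refine integrableOn_Ioi_of_zero (M := 2 * ε) ?_ fun r hr => by
    rw [cut_zero hε (le_of_lt hr), zero_mul]
  simp only [zpow_natCast]
  exact ((contDiff_cut ε).continuous.mul (continuous_pow n)).continuousOn

lemma integral_cut_zero (hε : 0 < ε) (n : ℕ) :
    ∫ r in Ioi (0 : ℝ), cut ε r * r ^ (n : ℤ) = cutC ε n := by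
  have hn : (n : ℤ) ≠ -1 := by omega
  have h1 : Tendsto (fun ρ => ∫ r in Ioi ρ, cut ε r * r ^ (n : ℤ)) (𝓝[>] 0)
      (𝓝 (∫ r in Ioi (0 : ℝ), cut ε r * r ^ (n : ℤ))) := by
    have hi := integrableOn_cut_zero hε n
    have e : ∀ ρ ∈ Ioi (0 : ℝ), ∫ r in Ioi ρ, cut ε r * r ^ (n : ℤ) =
        ∫ r in Ioi 0, (Ioi ρ).indicator (fun r => cut ε r * r ^ (n : ℤ)) r := fun ρ hρ => by
      rw [setIntegral_indicator measurableSet_Ioi, Ioi_inter_Ioi,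
        max_eq_right (le_of_lt (show (0 : ℝ) < ρ from hρ))]
    refine Tendsto.congr' (eventually_nhdsWithin_of_forall fun ρ hρ => (e ρ hρ).symm) ?_
    refine tendsto_integral_filter_of_dominated_convergence
      (fun r => ‖cut ε r * r ^ (n : ℤ)‖) (Eventually.of_forall fun ρ =>
        hi.aestronglyMeasurable.indicator measurableSet_Ioi)
      (Eventually.of_forall fun ρ => Eventually.of_forall fun r => norm_indicator_le_norm_self _ _)
      hi.norm ?_
    filter_upwards [ae_restrict_mem measurableSet_Ioi] with r hr
    refine tendsto_const_nhds.congr' ?_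
    filter_upwards [Ioo_mem_nhdsGT (show (0 : ℝ) < r from hr)] with ρ hρ
    rw [indicator_of_mem (show r ∈ Ioi ρ from hρ.2)]
  have h2 : Tendsto (fun ρ : ℝ => cutC ε n - ρ ^ ((n : ℤ) + 1) / ((n : ℤ) + 1)) (𝓝[>] 0)
      (𝓝 (cutC ε n)) := by
    have hc : Continuous fun ρ : ℝ => cutC ε n - ρ ^ (n + 1) / ((n : ℤ) + 1) := by fun_prop
    have := (hc.tendsto 0).mono_left (nhdsWithin_le_nhds (s := Ioi (0 : ℝ)))
    simp only [ne_eq, Nat.add_eq_zero_iff, one_ne_zero, and_false, not_false_eq_true, zero_pow,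
      zero_div, sub_zero] at this
    exact_mod_cast this
  refine tendsto_nhds_unique h1 (h2.congr' ?_)
  filter_upwards [Ioo_mem_nhdsGT hε] with ρ hρ
  rw [integral_cut hε hρ.1 hρ.2.le hn]

end Hadamard
end

noncomputable section
namespace Hadamard

/-! ### Subtraction of the singular parts -/

/-- Parameters with source points at a distance larger than `4 ε`. -/
def Sep (ε : ℝ) : Set Param := {p | 4 * ε < ‖pos 0 p - pos 1 p‖}

lemma isOpen_Sep (ε : ℝ) : IsOpen (Sep ε) := by
  unfold Sep
  simp only [← posL_apply]
  exact isOpen_lt continuous_const ((posL 0).continuous.sub (posL 1).continuous).norm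

variable {ε : ℝ}

lemma Sep_subset (hε : 0 < ε) : Sep ε ⊆ Par := fun p hp h => by
  have : 4 * ε < ‖pos 0 p - pos 1 p‖ := hp
  rw [h, sub_self, norm_zero] at this
  linarith

lemma exists_mem_Sep {p : Param} (hp : p ∈ Par) : ∃ ε > 0, p ∈ Sep ε := by
  have h : 0 < ‖pos 0 p - pos 1 p‖ := norm_pos_iff.2 (sub_ne_zero.2 hp)
  exact ⟨‖pos 0 p - pos 1 p‖ / 8, by positivity,
    show 4 * (‖pos 0 p - pos 1 p‖ / 8) < ‖pos 0 p - pos 1 p‖ by linarith⟩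

/-- No point of space lies within `2 ε` of both sources, so the two cutoffs, which vanish from `2 ε`
on, never interact. -/
lemma lt_rad_add_rad {p : Param} (hp : p ∈ Sep ε) {i j : Fin 2} (hij : i ≠ j) (x : E3) :
    4 * ε < rad i (x, p) + rad j (x, p) := by
  have h1 : 4 * ε < ‖pos 0 p - pos 1 p‖ := hp
  have h2 : ‖pos 0 p - pos 1 p‖ ≤ rad 0 (x, p) + rad 1 (x, p) := by
    have : pos 0 p - pos 1 p = (x - pos 1 p) - (x - pos 0 p) := by abel
    rw [this]
    refine (norm_sub_le _ _).trans ?_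
    simp only [rad]; linarith
  have h3 : rad i (x, p) + rad j (x, p) = rad 0 (x, p) + rad 1 (x, p) := by
    fin_cases i <;> fin_cases j <;> simp_all [add_comm]
  linarith

/-- The terms of an expansion up to the order `N`. -/
def trc (u : ℤ → E3 × Param → ℝ) (b N : ℤ) (c : E3 × Param) : ℝ := ∑ a ∈ Finset.Icc b N, u a c

/-- The remainder after subtraction of the localized singular parts. -/
def remn (ε : ℝ) (u : Fin 2 → ℤ → E3 × Param → ℝ) (b N : ℤ) (H : Fun) : Fun := fun c =>
  H c - ∑ j, cut ε (rad j c) * trc (u j) b N (relL j c)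

variable {u : Fin 2 → ℤ → E3 × Param → ℝ} {b : ℤ} {H : Fun}

lemma contDiffOn_rad (j : Fin 2) : ContDiffOn ℝ ∞ (rad j) Reg := by
  have : rad j = fun c => ‖(relL j c).1‖ := by ext; simp [rad]
  rw [this]
  exact ((relL j).contDiff.contDiffOn.fst).norm ℝ fun c hc => by
    rw [relL_apply]; exact sub_ne_zero.2 (hc.2 j)

lemma contDiffOn_remn (hH : ∀ j, HExp j H (u j)) (N : ℤ) :
    ContDiffOn ℝ ∞ (remn ε u b N H) Reg :=
  (hH 0).smooth.sub (ContDiffOn.sum fun j _ =>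
    ((contDiff_cut ε).comp_contDiffOn (contDiffOn_rad j)).mul
      (ContDiffOn.sum fun a _ => (((hH j).homog a).symb j).1))

/-- Within `ε` of `y_j` the own cutoff is 1 and the other one is 0, so the global remainder inherits
the estimates of the local expansion. -/
lemma remn_near (hε : 0 < ε) (N : ℤ) (j : Fin 2) {p : Param} (hp : p ∈ Sep ε) :
    ∀ᶠ c in 𝓝 (pos j p, p), remn ε u b N H c = H c - trc (u j) b N (relL j c) := by
  have h1 : ∀ᶠ c in 𝓝 (pos j p, p), rad j c < ε :=
    (continuous_rad j).continuousAt.eventually_lt continuousAt_const (by simpa [rad] using hε)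
  have h2 : ∀ᶠ c : E3 × Param in 𝓝 (pos j p, p), c.2 ∈ Sep ε :=
    continuous_snd.continuousAt.eventually ((isOpen_Sep ε).mem_nhds hp)
  filter_upwards [h1, h2] with c hc hc2
  rw [remn, Finset.sum_eq_single j, cut_one hε hc.le, one_mul]
  · intro i _ hij
    have := lt_rad_add_rad hc2 hij c.1
    rw [cut_zero hε (by change 2 * ε ≤ rad i (c.1, c.2); change rad j (c.1, c.2) < ε at hc; linarith),
      zero_mul]
  · simp

lemma remn_isBigO (hε : 0 < ε) (hH : ∀ j, HExp j H (u j)) (hb : ∀ j, ∀ a < b, ∀ c, u j a c = 0)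
    (N : ℤ) (j : Fin 2) {p : Param} (hp : p ∈ Sep ε) (m : ℕ) :
    (fun c => iteratedFDeriv ℝ m (remn ε u b N H) c) =O[nh j p] fun c => rad j c ^ (N + 1 - m) := by
  refine ((((hH j).rem b (hb j) N).2 m p (Sep_subset hε hp)).congr' ?_ EventuallyEq.rfl)
  filter_upwards [(remn_near hε N j hp).eventually_nhds.filter_mono nhdsWithin_le_nhds] with c hc
  refine (Filter.EventuallyEq.iteratedFDeriv (𝕜 := ℝ) ?_ m).eq_of_nhds
  filter_upwards [hc] with x hx
  rw [hx, trc]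

lemma remn_isBigO_zero (hε : 0 < ε) (hH : ∀ j, HExp j H (u j))
    (hb : ∀ j, ∀ a < b, ∀ c, u j a c = 0) (n : ℕ) (j : Fin 2) {p : Param} (hp : p ∈ Sep ε) :
    remn ε u b n H =O[nh j p] fun c => rad j c ^ (n + 1) := by
  have := (remn_isBigO hε hH hb n j hp 0).norm_left
  simp only [norm_iteratedFDeriv_zero] at this
  refine this.of_norm_left.congr_right fun c => ?_
  rw [← zpow_natCast]; congr 1

lemma remn_isBigO_one (hε : 0 < ε) (hH : ∀ j, HExp j H (u j))
    (hb : ∀ j, ∀ a < b, ∀ c, u j a c = 0) (n : ℕ) (j : Fin 2) {p : Param} (hp : p ∈ Sep ε) :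
    fderiv ℝ (remn ε u b n H) =O[nh j p] fun c => rad j c ^ n := by
  have := (remn_isBigO hε hH hb n j hp 1).norm_left
  simp only [norm_iteratedFDeriv_one] at this
  refine this.of_norm_left.congr_right fun c => ?_
  rw [← zpow_natCast]; congr 1; push_cast; ring

lemma eventually_far (ε : ℝ) (p₀ : Param) : ∃ R : ℝ, ∀ᶠ p in 𝓝 p₀, ∀ x : E3, R ≤ ‖x‖ →
    ∀ j, 2 * ε < rad j (x, p) := by
  refine ⟨2 * ε + 1 + ‖pos 0 p₀‖ + ‖pos 1 p₀‖, ?_⟩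
  have hlt : ∀ j, ∀ᶠ p in 𝓝 p₀, ‖pos j p‖ < ‖pos j p₀‖ + 1 := fun j => by
    have hc : Continuous fun p => ‖pos j p‖ := by
      simp only [← posL_apply]; exact (posL j).continuous.norm
    exact hc.continuousAt.eventually_lt continuousAt_const (by simp)
  filter_upwards [hlt 0, hlt 1] with p h0 h1 x hx j
  have h2 : ‖x‖ - ‖pos j p‖ ≤ rad j (x, p) := norm_sub_norm_le _ _
  have h3 : ‖pos j p‖ < ‖pos 0 p₀‖ + ‖pos 1 p₀‖ + 1 := by
    fin_cases j
    · have := norm_nonneg (pos 1 p₀); simp only [Fin.zero_eta]; linarith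
    · have := norm_nonneg (pos 0 p₀); simp only [Fin.mk_one]; linarith
  linarith

lemma Decays.congr_far {V : Type} [NormedAddCommGroup V] [NormedSpace ℝ V] {f g : E3 × Param → V}
    (hf : Decays f) (h : ∀ p₀ ∈ Par, ∃ R : ℝ, ∀ᶠ p in 𝓝 p₀, ∀ x : E3, R ≤ ‖x‖ →
      g (x, p) = f (x, p)) : Decays g := by
  intro p₀ hp₀
  obtain ⟨ε, hε, C, R, h1⟩ := hf p₀ hp₀
  obtain ⟨S, h2⟩ := h p₀ hp₀
  refine ⟨ε, hε, C, max R S, ?_⟩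
  filter_upwards [h1, h2] with p h1 h2 x hx
  rw [h2 x ((le_max_right _ _).trans hx)]
  exact h1 x ((le_max_left _ _).trans hx)

lemma mem_Reg_of_far (hε : 0 < ε) {p : Param} (hp : p ∈ Par) {x : E3}
    (h : ∀ j, 2 * ε < rad j (x, p)) : (x, p) ∈ Reg :=
  ⟨hp, fun j hj => by
    have := h j
    change x = pos j p at hj
    rw [rad, hj, sub_self, norm_zero] at this
    linarith⟩

lemma remn_far (hε : 0 < ε) (N : ℤ) {c : E3 × Param} (h : ∀ j, 2 * ε < rad j c) :
    remn ε u b N H c = H c := by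
  rw [remn, Finset.sum_eq_zero, sub_zero]
  intro j _
  rw [cut_zero hε (h j).le, zero_mul]

lemma decays_ext0_remn (hε : 0 < ε) (N : ℤ) (hd : Decays H) :
    Decays (ext0 (remn ε u b N H)) := by
  refine hd.congr_far fun p₀ hp₀ => ?_
  obtain ⟨R, hR⟩ := eventually_far ε p₀
  refine ⟨R, ?_⟩
  filter_upwards [hR, isOpen_Par.mem_nhds hp₀] with p hp hP x hx
  rw [ext0, indicator_of_mem (mem_Reg_of_far hε hP (hp x hx)), remn_far hε N (hp x hx)]

lemma decays_ext0_fderiv_remn (hε : 0 < ε) (N : ℤ) (hd : Decays (fderiv ℝ H)) :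
    Decays (ext0 (fderiv ℝ (remn ε u b N H))) := by
  refine hd.congr_far fun p₀ hp₀ => ?_
  obtain ⟨R, hR⟩ := eventually_far ε p₀
  refine ⟨R, ?_⟩
  filter_upwards [hR, isOpen_Par.mem_nhds hp₀] with p hp hP x hx
  rw [ext0, indicator_of_mem (mem_Reg_of_far hε hP (hp x hx))]
  refine Filter.EventuallyEq.fderiv_eq ?_
  have h1 : ∀ᶠ c in 𝓝 (x, p), ∀ j, 2 * ε < rad j c := eventually_all.2 fun j =>
    continuousAt_const.eventually_lt (continuous_rad j).continuousAt (hp x hx j)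
  filter_upwards [h1] with c hc using remn_far hε N hc

lemma continuousOn_ext0_remn (hε : 0 < ε) (hH : ∀ j, HExp j H (u j))
    (hb : ∀ j, ∀ a < b, ∀ c, u j a c = 0) (n : ℕ) :
    ContinuousOn (ext0 (remn ε u b n H)) (univ ×ˢ Sep ε) := fun c hc =>
  (continuousAt_ext0 (contDiffOn_remn hH _).continuousOn (Sep_subset hε hc.2) fun j =>
    (remn_isBigO_zero hε hH hb n j hc.2).trans (by
      have := zpow_rad_isBigO j c.2 (show ((1 : ℕ) : ℤ) ≤ ((n + 1 : ℕ) : ℤ) by push_cast; omega)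
      simpa only [zpow_natCast] using this)).continuousWithinAt

lemma integrable_ext0_remn (hε : 0 < ε) (hH : ∀ j, HExp j H (u j))
    (hb : ∀ j, ∀ a < b, ∀ c, u j a c = 0) (n : ℕ) (hd : Decays H) {p : Param} (hp : p ∈ Sep ε) :
    Integrable fun x => ext0 (remn ε u b n H) (x, p) :=
  (decays_ext0_remn hε n hd).integrable (isOpen_Sep ε) (Sep_subset hε)
    (continuousOn_ext0_remn hε hH hb n) hp

/-! ### The partie finie integral -/

/-- The integral of a coefficient over the sphere. -/
def angU (u : ℤ → E3 × Param → ℝ) (a : ℤ) (p : Param) : ℝ := angInt fun n : S2 => u a (n, p)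

/-- The space without the balls of radius `ρ` around the source points. -/
def holed (ρ : ℝ) (p : Param) : Set E3 := {x | ∀ j, ρ < rad j (x, p)}

lemma measurableSet_holed (ρ : ℝ) (p : Param) : MeasurableSet (holed ρ p) := by
  have : holed ρ p = ⋂ j : Fin 2, {x | ρ < rad j (x, p)} := by ext; simp [holed]
  rw [this]
  refine MeasurableSet.iInter fun j => (isOpen_lt continuous_const ?_).measurableSet
  exact (continuous_rad j).comp (by fun_prop)

/-- On the support of the cutoff around `y_j` the ball removed around the other source is absent.
The domain is then just the exterior of one ball, and the integrand is radial times homogeneous. -/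
lemma indicator_holed_cut (hε : 0 < ε) {ρ : ℝ} (hρε : ρ ≤ ε) {p : Param} (hp : p ∈ Sep ε)
    (j : Fin 2) (f : E3 → ℝ) (x : E3) :
    (holed ρ p).indicator (fun x => cut ε (rad j (x, p)) * f (x - pos j p)) x =
      (fun z => (Ioi ρ).indicator (cut ε) ‖z‖ * f z) (x - pos j p) := by
  have hr : rad j (x, p) = ‖x - pos j p‖ := rfl
  by_cases h1 : x ∈ holed ρ p
  · rw [indicator_of_mem h1]
    simp only
    rw [indicator_of_mem (show ‖x - pos j p‖ ∈ Ioi ρ from h1 j), hr]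
  · rw [indicator_of_notMem h1]
    simp only
    by_cases h2 : ρ < ‖x - pos j p‖
    · rw [indicator_of_mem (show ‖x - pos j p‖ ∈ Ioi ρ from h2)]
      have h3 : ∃ i, rad i (x, p) ≤ ρ := by
        unfold holed at h1
        simpa only [Set.mem_ofPred_eq, not_forall, not_lt] using h1
      obtain ⟨i, hi⟩ := h3
      have hij : i ≠ j := by rintro rfl; exact absurd h2 (not_lt.2 hi)
      have := lt_rad_add_rad hp hij x
      rw [← hr, cut_zero hε (by linarith), zero_mul]
    · rw [indicator_of_notMem (by simpa using h2), zero_mul]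

lemma integrable_singular (hε : 0 < ε) {ρ : ℝ} (hρ : 0 < ρ) (hρε : ρ ≤ ε) {p : Param}
    (hp : p ∈ Sep ε) (j : Fin 2) {a : ℤ} {h : E3 → ℝ} (hh : Hom1 a h) :
    Integrable ((holed ρ p).indicator fun x => cut ε (rad j (x, p)) * h (x - pos j p)) ∧
    ∫ x, (holed ρ p).indicator (fun x => cut ε (rad j (x, p)) * h (x - pos j p)) x =
      (∫ r in Ioi ρ, cut ε r * r ^ (a + 2)) * angInt fun n => h n := by
  have e : ((holed ρ p).indicator fun x => cut ε (rad j (x, p)) * h (x - pos j p)) =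
      fun x => (fun z => (Ioi ρ).indicator (cut ε) ‖z‖ * h z) (x - pos j p) :=
    funext fun x => indicator_holed_cut hε hρε hp j h x
  have e2 : ∀ r, (Ioi ρ).indicator (cut ε) r * r ^ (a + 2) =
      (Ioi ρ).indicator (fun r => cut ε r * r ^ (a + 2)) r := fun r => by
    by_cases hr : r ∈ Ioi ρ <;> simp [hr]
  have hs : Ioi ρ ∩ Ioi 0 = Ioi ρ := inter_eq_left.2 (Ioi_subset_Ioi hρ.le)
  rw [e]
  constructor
  · refine (integrable_radial_mul hh ?_).comp_sub_right _
    simp only [e2]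
    refine (IntegrableOn.integrable_indicator ?_ measurableSet_Ioi).integrableOn
    exact integrableOn_cut hε hρ _
  · rw [integral_sub_right_eq_self (fun z => (Ioi ρ).indicator (cut ε) ‖z‖ * h z),
      integral_radial_mul hh]
    congr 1
    simp only [e2]
    rw [setIntegral_indicator measurableSet_Ioi, inter_comm, hs]

lemma tendsto_holed {f : E3 → ℝ} (hf : Integrable f) (p : Param) :
    Tendsto (fun ρ => ∫ x in holed ρ p, f x) (𝓝[>] (0 : ℝ)) (𝓝 (∫ x, f x)) := by
  simp only [← integral_indicator (measurableSet_holed _ p)]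
  refine tendsto_integral_filter_of_dominated_convergence (fun x => ‖f x‖)
    (Eventually.of_forall fun ρ => hf.aestronglyMeasurable.indicator (measurableSet_holed ρ p))
    (Eventually.of_forall fun ρ => Eventually.of_forall fun x => norm_indicator_le_norm_self _ _)
    hf.norm ?_
  have h0 : ∀ j : Fin 2, ∀ᵐ x : E3, x ≠ pos j p := fun j => by
    rw [ae_iff]; simp
  filter_upwards [h0 0, h0 1] with x hx0 hx1
  refine tendsto_const_nhds.congr' ?_
  have hpos : ∀ j, 0 < rad j (x, p) := fun j => by
    refine norm_pos_iff.2 (sub_ne_zero.2 ?_)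
    fin_cases j
    · exact hx0
    · exact hx1
  filter_upwards [Ioo_mem_nhdsGT (hpos 0), Ioo_mem_nhdsGT (hpos 1)] with ρ h1 h2
  rw [indicator_of_mem]
  intro j
  fin_cases j
  · exact h1.2
  · exact h2.2

/-- The counterterms cancel the divergent part of the integrals of the singular terms. -/
lemma tendsto_singular (hε : 0 < ε) {σ : ℝ} (hσ : 0 < σ) {b : ℤ} {A : ℤ → ℝ}
    (hA : ∀ a < b, A a = 0) (n : ℕ) :
    Tendsto (fun ρ : ℝ => ∑ a ∈ Finset.Icc b n, (∫ r in Ioi ρ, cut ε r * r ^ (a + 2)) * A a +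
      ((∑ᶠ (a : ℤ) (_ : a + 3 < 0), ρ ^ (a + 3) / ((a : ℝ) + 3) * A a) +
        Real.log (ρ / σ) * A (-3))) (𝓝[>] 0)
      (𝓝 (∑ a ∈ Finset.Icc b n, cutC ε (a + 2) * A a - Real.log σ * A (-3))) := by
  have e1 : ∀ ρ : ℝ, (∑ᶠ (a : ℤ) (_ : a + 3 < 0), ρ ^ (a + 3) / ((a : ℝ) + 3) * A a) =
      ∑ a ∈ Finset.Icc b n, if a + 3 < 0 then ρ ^ (a + 3) / ((a : ℝ) + 3) * A a else 0 := by
    intro ρ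
    rw [← finsum_eq_sum_of_support_subset]
    · congr 1; ext a; exact finsum_eq_if
    · intro a ha
      have h1 : a + 3 < 0 := by by_contra h; simp [h] at ha
      have h2 : ¬ a < b := fun h => ha (by simp [hA a h])
      simp only [Finset.coe_Icc, mem_Icc]; omega
  have e2 : ∀ r : ℝ, r * A (-3) = ∑ a ∈ Finset.Icc b n, if a = -3 then r * A a else 0 := by
    intro r
    rw [Finset.sum_ite_eq']
    split_ifs with h
    · rfl
    · have h3 : (-3 : ℤ) < b := by simp only [Finset.mem_Icc] at h; omega
      rw [hA _ h3, mul_zero]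
  simp only [e1]
  simp only [e2 (Real.log _)]
  simp only [← Finset.sum_add_distrib, ← Finset.sum_sub_distrib]
  refine tendsto_finsetSum _ fun a _ => ?_
  -- For `a < -3` the power divergence cancels exactly once `ρ < ε`. For `a = -3` the logarithms
  -- cancel up to `log σ`. For `a > -3` there is no counterterm and the integral converges.
  rcases lt_trichotomy a (-3) with h | rfl | h
  · refine tendsto_const_nhds.congr' ?_
    filter_upwards [Ioo_mem_nhdsGT hε] with ρ hρ
    have h1 := integral_cut hε hρ.1 hρ.2.le (show a + 2 ≠ -1 by omega)
    have n1 : a + 3 < 0 := by omega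
    have n2 : a ≠ -3 := by omega
    simp only [h1, if_pos n1, if_neg n2, show a + 2 + 1 = a + 3 by ring]
    push_cast
    rw [show (a : ℝ) + 2 + 1 = a + 3 by ring]; ring
  · refine tendsto_const_nhds.congr' ?_
    filter_upwards [Ioo_mem_nhdsGT hε] with ρ hρ
    have h1 := integral_cut_inv hε hρ.1 hρ.2.le
    have n1 : ¬ ((-3 : ℤ) + 3 < 0) := by norm_num
    simp only [show (-3 : ℤ) + 2 = -1 by norm_num, h1, if_neg n1, if_true,
      Real.log_div hρ.1.ne' hσ.ne']
    ring
  · have h2 : Tendsto (fun ρ : ℝ => (cutC ε (a + 2) - ρ ^ (a + 3) / ((a : ℝ) + 3)) * A a) (𝓝[>] 0)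
        (𝓝 (cutC ε (a + 2) * A a)) := by
      obtain ⟨k, hk⟩ := Int.eq_ofNat_of_zero_le (show 0 ≤ a + 2 by omega)
      have hk3 : a + 3 = ((k + 1 : ℕ) : ℤ) := by push_cast; omega
      have hc : Continuous fun ρ : ℝ => (cutC ε (a + 2) - ρ ^ (k + 1) / ((a : ℝ) + 3)) * A a := by
        fun_prop
      have := (hc.tendsto 0).mono_left (nhdsWithin_le_nhds (s := Ioi (0 : ℝ)))
      simp only [hk3, zpow_natCast]
      simpa using this
    rw [if_neg (by omega), sub_zero]
    refine h2.congr' ?_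
    filter_upwards [Ioo_mem_nhdsGT hε] with ρ hρ
    have h1 := integral_cut hε hρ.1 hρ.2.le (show a + 2 ≠ -1 by omega)
    rw [h1, if_neg (by omega), if_neg (by omega), show a + 2 + 1 = a + 3 by ring]
    push_cast
    rw [show (a : ℝ) + 2 + 1 = a + 3 by ring]; ring

/-- The partie finie integral in terms of the coefficients and of the remainder. -/
lemma pfInt_eq {s : Fin 2 → ℝ} (hs : ∀ j, 0 < s j) (hε : 0 < ε) (hH : ∀ j, HExp j H (u j))
    (hb : ∀ j, ∀ a < b, ∀ c, u j a c = 0) (n : ℕ) (hd : Decays H) {p : Param} (hp : p ∈ Sep ε) :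
    pfInt s H p = ∑ j, (∑ a ∈ Finset.Icc b n, cutC ε (a + 2) * angU (u j) a p -
      Real.log (s j) * angU (u j) (-3) p) + ∫ x, ext0 (remn ε u b n H) (x, p) := by
  have hP := Sep_subset hε hp
  have hcoef : ∀ j a, angInt (coef j H a p) = angU (u j) a p := fun j a => by
    unfold angU; congr 1; ext n'; exact coef_eq (hH j) a hP n'
  have hi := integrable_ext0_remn hε hH hb n hd hp
  have hA : ∀ j, ∀ a < b, angU (u j) a p = 0 := fun j a ha => by
    simp [angU, hb j a ha, angInt]
  have h1 := (tendsto_finsetSum Finset.univ fun j (_ : j ∈ Finset.univ) =>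
    tendsto_singular hε (hs j) (hA j) n).add (tendsto_holed hi p)
  refine Tendsto.limUnder_eq (h1.congr' ?_)
  filter_upwards [Ioo_mem_nhdsGT hε] with ρ hρ
  simp only [hcoef]
  rw [Finset.sum_add_distrib, add_right_comm]
  congr 1
  have hS : ∀ j a, Integrable ((holed ρ p).indicator
        fun x => cut ε (rad j (x, p)) * u j a (x - pos j p, p)) ∧
      ∫ x, (holed ρ p).indicator (fun x => cut ε (rad j (x, p)) * u j a (x - pos j p, p)) x =
      (∫ r in Ioi ρ, cut ε r * r ^ (a + 2)) * angU (u j) a p := fun j a =>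
    integrable_singular hε hρ.1 hρ.2.le hp j (((hH j).homog a).slice hP)
  have hsum : (holed ρ p).indicator (fun x => H (x, p)) = fun x =>
      (∑ j, ∑ a ∈ Finset.Icc b n, (holed ρ p).indicator
        (fun x => cut ε (rad j (x, p)) * u j a (x - pos j p, p)) x) +
        (holed ρ p).indicator (fun x => ext0 (remn ε u b n H) (x, p)) x := by
    ext x
    by_cases hx : x ∈ holed ρ p
    · have hR : (x, p) ∈ Reg := ⟨hP, fun j hj => by
        have := hx j
        change x = pos j p at hj
        rw [rad, hj, sub_self, norm_zero] at this
        exact absurd this (not_lt.2 hρ.1.le)⟩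
      simp only [indicator_of_mem hx]
      rw [ext0, indicator_of_mem hR, remn]
      simp only [trc, relL_apply, ← Finset.mul_sum]
      ring
    · simp [indicator_of_notMem hx]
  change _ = ∫ x in holed ρ p, H (x, p)
  have e3 : ∫ x in holed ρ p, H (x, p) = ∫ x, (holed ρ p).indicator (fun x => H (x, p)) x :=
    (integral_indicator (measurableSet_holed ρ p)).symm
  rw [e3, hsum, integral_add, integral_finsetSum, integral_indicator (measurableSet_holed ρ p)]
  · congr 1
    refine Finset.sum_congr rfl fun j _ => ?_
    rw [integral_finsetSum _ fun a _ => (hS j a).1]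
    exact Finset.sum_congr rfl fun a _ => (hS j a).2.symm
  · exact fun j _ => integrable_finsetSum _ fun a _ => (hS j a).1
  · exact integrable_finsetSum _ fun j _ => integrable_finsetSum _ fun a _ => (hS j a).1
  · exact hi.indicator (measurableSet_holed ρ p)

end Hadamard
end

noncomputable section
namespace Hadamard

/-! ### Derivative of the partie finie integral -/

variable {ε : ℝ} {u : Fin 2 → ℤ → E3 × Param → ℝ} {b : ℤ} {H : Fun} {v : Fin 2 → ℝ → E3}

lemma sum_ex (z : E3) : z = ∑ i, z i • ex i := by
  ext k; simp [ex, Pi.single_apply]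

lemma Decays.norm {V : Type} [NormedAddCommGroup V] [NormedSpace ℝ V] {f : E3 × Param → V}
    (hf : Decays f) : Decays fun c => ‖f c‖ :=
  hf.mono fun c _ => by simp

/-- The letters span all directions: the explicit time derivative is the total one minus `v_j ·
_j∂`, with continuous coefficients. Decay of the elementary derivatives thus bounds the full
differential. -/
lemma decays_fderiv (hv : ∀ j, ContDiff ℝ ∞ (v j)) (hd : ∀ a, Decays (pd v a H)) :
    Decays (fderiv ℝ H) := by
  set T : Fun := fun c => pd v .t H c + (∑ i, (-(v 0 c.2.1 i)) • pd v (.y 0 i) H c +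
    ∑ i, (-(v 1 c.2.1 i)) • pd v (.y 1 i) H c) with hT
  have hcv : ∀ j i, Continuous fun p : Param => -(v j p.1 i) := fun j i => by
    have := (hv j).continuous
    fun_prop
  have hTd : Decays T := (hd _).add ((Decays.sum _ fun i _ => (hd (.y 0 i)).smul_param (hcv 0 i)).add
    (Decays.sum _ fun i _ => (hd (.y 1 i)).smul_param (hcv 1 i)))
  have hTe : ∀ c, T c = fderiv ℝ H c (0, 1, 0, 0) := by
    intro c
    simp only [hT, pd, Letter.fieldDir, Letter.paramDir, if_true, one_ne_zero, if_false]
    simp only [← map_smul, ← map_sum, ← map_add]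
    congr 1
    have h0 := sum_ex (v 0 c.2.1)
    have h1 := sum_ex (v 1 c.2.1)
    refine Prod.ext ?_ (Prod.ext ?_ (Prod.ext ?_ ?_))
    · simp [Prod.fst_sum]
    · simp [Prod.fst_sum, Prod.snd_sum]
    · simp only [Prod.snd_add, Prod.fst_add, Prod.snd_sum, Prod.fst_sum, Prod.smul_snd,
        Prod.smul_fst, smul_zero, Finset.sum_const_zero, add_zero]
      simp only [neg_smul, Finset.sum_neg_distrib]
      rw [← h0, add_neg_cancel]
    · simp only [Prod.snd_add, Prod.snd_sum, Prod.smul_snd, smul_zero,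
        Finset.sum_const_zero, zero_add]
      simp only [neg_smul, Finset.sum_neg_distrib]
      rw [← h1, add_neg_cancel]
  have hS : Decays fun c => (∑ i, ‖pd v (.x i) H c‖ + ∑ i, ‖pd v (.y 0 i) H c‖) +
      (∑ i, ‖pd v (.y 1 i) H c‖ + ‖T c‖) :=
    ((Decays.sum _ fun i _ => (hd (.x i)).norm).add (Decays.sum _ fun i _ => (hd (.y 0 i)).norm)).add
      ((Decays.sum _ fun i _ => (hd (.y 1 i)).norm).add hTd.norm)
  refine hS.mono fun c _ => ?_
  rw [Real.norm_of_nonneg (by positivity)]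
  refine ContinuousLinearMap.opNorm_le_bound _ (by positivity) fun e => ?_
  obtain ⟨x, t, y, z⟩ := e
  set N := ‖((x, t, y, z) : E3 × Param)‖
  have hx : ‖x‖ ≤ N := norm_fst_le (x, t, y, z)
  have ht : ‖t‖ ≤ N := (norm_fst_le (t, y, z)).trans (norm_snd_le (x, t, y, z))
  have hyz : ‖(y, z)‖ ≤ N := (norm_snd_le (t, y, z)).trans (norm_snd_le (x, t, y, z))
  have hy : ‖y‖ ≤ N := (norm_fst_le (y, z)).trans hyz
  have hz : ‖z‖ ≤ N := (norm_snd_le (y, z)).trans hyz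
  have hco : ∀ (w : E3) i, ‖w‖ ≤ N → ‖w i‖ ≤ N := fun w i hw =>
    (PiLp.norm_apply_le w i).trans hw
  have key : ∀ (w : E3) (ι : E3 →L[ℝ] E3 × Param) (g : Fin 3 → ℝ), ‖w‖ ≤ N →
      (∀ i, fderiv ℝ H c (ι (ex i)) = g i) → ‖fderiv ℝ H c (ι w)‖ ≤ (∑ i, ‖g i‖) * N := by
    intro w ι g hw hg
    have e : fderiv ℝ H c (ι w) = ∑ i, w i * g i := by
      conv_lhs => rw [sum_ex w]
      simp only [map_sum, map_smul, hg, smul_eq_mul]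
    rw [e, Finset.sum_mul]
    refine norm_sum_le_of_le _ fun i _ => ?_
    rw [norm_mul, mul_comm]
    exact mul_le_mul_of_nonneg_left (hco w i hw) (norm_nonneg _)
  have k1 := key x (ContinuousLinearMap.inl ℝ E3 Param) (fun i => pd v (.x i) H c) hx fun i => rfl
  have k2 := key y ((ContinuousLinearMap.inr ℝ E3 Param).comp
    ((ContinuousLinearMap.inr ℝ ℝ (E3 × E3)).comp (ContinuousLinearMap.inl ℝ E3 E3)))
    (fun i => pd v (.y 0 i) H c) hy fun i => rfl
  have k3 := key z ((ContinuousLinearMap.inr ℝ E3 Param).comp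
    ((ContinuousLinearMap.inr ℝ ℝ (E3 × E3)).comp (ContinuousLinearMap.inr ℝ E3 E3)))
    (fun i => pd v (.y 1 i) H c) hz fun i => rfl
  have k4 : ‖fderiv ℝ H c (0, t, 0, 0)‖ ≤ ‖T c‖ * N := by
    have : ((0, t, 0, 0) : E3 × Param) = t • (0, 1, 0, 0) := by simp
    rw [this, map_smul, ← hTe, norm_smul, mul_comm]
    exact mul_le_mul_of_nonneg_left ht (norm_nonneg _)
  have hsplit : ((x, t, y, z) : E3 × Param) = (x, 0, 0, 0) + (0, 0, y, 0) + ((0, 0, 0, z) +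
      (0, t, 0, 0)) := by simp
  rw [hsplit, map_add, map_add, map_add]
  refine (norm_add_le _ _).trans ?_
  rw [add_mul, add_mul, add_mul]
  exact add_le_add ((norm_add_le _ _).trans (add_le_add k1 k2))
    ((norm_add_le _ _).trans (add_le_add k3 k4))

lemma angU_eq_avg {w : ℤ → E3 × Param → ℝ} {a : ℤ} (hw : ContDiffOn ℝ ∞ (w a) Dom) {p : Param}
    (hp : p ∈ Par) : angU w a p = 4 * Real.pi * avg (fam (w a) p) := by
  have e : (fun n : S2 => w a (n, p)) = fam (w a) p := by
    ext n; exact (fam_apply hw.continuousOn hp n).symm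
  rw [avg_apply, angMean, angU, e]
  field_simp

lemma hasFDerivAt_angU {w : ℤ → E3 × Param → ℝ} {a : ℤ} (hw : ContDiffOn ℝ ∞ (w a) Dom)
    {p : Param} (hp : p ∈ Par) :
    HasFDerivAt (angU w a) ((4 * Real.pi) • avg.comp (famDeriv hw hp)) p := by
  have h1 := (avg.hasFDerivAt.comp p (hasFDerivAt_fam hw hp)).const_mul (4 * Real.pi)
  refine h1.congr_of_eventuallyEq ?_
  filter_upwards [isOpen_Par.mem_nhds hp] with q hq using angU_eq_avg hw hq

/-- Flux of the displacement through the sphere. -/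
def flux (d : E3) (f : E3 × Param → ℝ) (p : Param) : ℝ :=
  angInt fun n : S2 => (∑ i, d i * (n : E3) i) * f (n, p)

lemma hom1_flux {a : ℤ} {f : E3 → ℝ} (hf : Hom1 a f) (d : E3) :
    Hom1 (a + 1) fun z => (∑ i, d i * z i) * f z :=
  ((Hom1.sum Finset.univ fun i _ => (hom1_coord i).const_mul (d i)).mul hf).cast (by ring)

lemma angInt_sum {ι : Type*} (s : Finset ι) {f : ι → S2 → ℝ} (hf : ∀ i ∈ s, Continuous (f i)) :
    angInt (fun n => ∑ i ∈ s, f i n) = ∑ i ∈ s, angInt (f i) :=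
  integral_finsetSum _ fun i hi => integrable_sphere (hf i hi)

lemma angInt_mul (r : ℝ) (f : S2 → ℝ) : angInt (fun n => r * f n) = r * angInt f :=
  integral_const_mul _ _

lemma angInt_add {f g : S2 → ℝ} (hf : Continuous f) (hg : Continuous g) :
    angInt (fun n => f n + g n) = angInt f + angInt g :=
  integral_add (integrable_sphere hf) (integrable_sphere hg)

lemma dz_sum {w : E3 × Param → ℝ} (c : E3 × Param) (d : E3) :
    dz w c d = ∑ i, d i * dz w c (ex i) := by
  conv_lhs => rw [sum_ex d]
  simp

lemma angInt_dz {a : ℤ} {w : E3 × Param → ℝ} (hw : Homog a w) (d : E3) {p : Param} (hp : p ∈ Par) :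
    (angInt fun n : S2 => dz w (n, p) d) = (a + 2) * flux d w p := by
  have hs := hw.slice hp
  have e : ∀ n : S2, dz w (n, p) d = ∑ i, d i * pdx i (fun z => w (z, p)) n := fun n => by
    rw [dz_sum]
    exact Finset.sum_congr rfl fun i _ => by rw [dz_eq_pdx hw.smooth (S2_ne_zero n) hp]
  have hc1 : ∀ i ∈ Finset.univ, Continuous fun n : S2 => d i * pdx i (fun z => w (z, p)) n :=
    fun i _ => ((hs.pdx i).const_mul _).continuous
  have hc2 : ∀ i ∈ Finset.univ, Continuous fun n : S2 => d i * ((n : E3) i * w (n, p)) :=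
    fun i _ => (((hom1_coord i).mul hs).const_mul _).continuous
  have e2 : ∀ n : S2, (∑ i, d i * (n : E3) i) * w (n, p) = ∑ i, d i * ((n : E3) i * w (n, p)) :=
    fun n => by rw [Finset.sum_mul]; exact Finset.sum_congr rfl fun i _ => by ring
  simp only [e, flux, e2]
  rw [angInt_sum _ hc1, angInt_sum _ hc2, Finset.mul_sum]
  refine Finset.sum_congr rfl fun i _ => ?_
  have hdiv := hs.divergence i
  rw [angInt_mul, angInt_mul, hdiv]; ring

lemma angU_cpd {w : ℤ → E3 × Param → ℝ} (hw : ∀ a, Homog a (w a)) (a : Letter) (j : Fin 2) (m : ℤ)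
    {p : Param} (hp : p ∈ Par) :
    angU (cpd v a j w) m p = (angInt fun n : S2 => dp (w m) (n, p) (a.paramDir v p)) +
      (m + 3) * flux (a.disp v j p) (w (m + 1)) p := by
  have h1 := angInt_dz (hw (m + 1)) (a.disp v j p) hp
  push_cast at h1
  rw [show (m : ℝ) + 3 = m + 1 + 2 by ring, ← h1]
  refine angInt_add ?_ ?_
  · exact continuous_slice (contDiffOn_dp_apply (hw m).smooth (a.paramDir v p)).continuousOn hp
  · have : ContDiffOn ℝ ∞ (fun c => dz (w (m + 1)) c (a.disp v j p)) Dom :=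
      ((hw (m + 1)).dz_apply (X := fun _ => a.disp v j p) contDiffOn_const).smooth
    exact continuous_slice this.continuousOn hp

/-- Away from `m = -2` this is the definition of `cutC`. At `m = -2` the factor `m + 2` kills the
logarithmic `cutC` and only `cutJ ε 0 = -1` survives: order `-2` alone leaves a flux. -/
lemma cutC_rec (hε : 0 < ε) (m : ℤ) :
    cutC ε (m + 1) * (m + 2) + cutJ ε (m + 2) = if m = -2 then -1 else 0 := by
  split_ifs with h
  · subst h; rw [show (-2 : ℤ) + 2 = 0 by norm_num, cutJ_zero hε]; norm_num
  · rw [cutC, if_neg (by omega)]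
    have : ((m : ℝ) + 2) ≠ 0 := by
      have : m + 2 ≠ 0 := by omega
      exact_mod_cast this
    rw [show m + 1 + 1 = m + 2 by ring]
    push_cast
    rw [show (m : ℝ) + 1 + 1 = m + 2 by ring]
    field_simp
    ring

/-- The algebraic identity between the finite parts. -/
lemma sum_cutC_rec (hε : 0 < ε) {b : ℤ} {A B : ℤ → ℝ} (hA : ∀ a < b, A a = 0)
    (hB : ∀ a < b, B a = 0) :
    ∑ m ∈ Finset.Icc b 1, cutC ε (m + 2) * A m -
      ∑ m ∈ Finset.Icc (b - 1) 0, cutC ε (m + 2) * (A m + (m + 3) * B (m + 1)) -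
      (∑ m ∈ Finset.Icc b 1, cutJ ε (m + 2) * B m + cutC ε 3 * A 1) = B (-2) := by
  have e1 : ∑ m ∈ Finset.Icc b 1, cutC ε (m + 2) * A m =
      ∑ m ∈ Finset.Icc b 0, cutC ε (m + 2) * A m + cutC ε 3 * A 1 := by
    have := sum_Icc_top (g := fun m => cutC ε (m + 2) * A m) (b := b)
      (fun a ha => by simp [hA a ha]) 0
    simpa using this
  have e2 : ∑ m ∈ Finset.Icc (b - 1) 0, cutC ε (m + 2) * A m =
      ∑ m ∈ Finset.Icc b 0, cutC ε (m + 2) * A m :=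
    sum_Icc_lower (fun a ha => by simp [hA a ha]) (by omega) 0
  have e3 : ∑ m ∈ Finset.Icc (b - 1) 0, cutC ε (m + 2) * ((m + 3) * B (m + 1)) =
      ∑ m ∈ Finset.Icc b 1, cutC ε (m + 1) * ((m + 2) * B m) := by
    have := sum_Icc_shift (fun m : ℤ => cutC ε (m + 1) * (((m : ℝ) + 2) * B m)) b 0
    rw [zero_add] at this
    rw [this]
    refine Finset.sum_congr rfl fun m _ => ?_
    push_cast
    rw [show m + 1 + 1 = m + 2 by ring, show (m : ℝ) + 1 + 2 = m + 3 by ring]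
  -- Flux terms come from the divergence formula and from the derivative of the cutoff; by
  -- `cutC_rec` they cancel at every order except `-2`.
  have e4 : ∑ m ∈ Finset.Icc b 1, cutC ε (m + 1) * ((m + 2) * B m) +
      ∑ m ∈ Finset.Icc b 1, cutJ ε (m + 2) * B m = -B (-2) := by
    rw [← Finset.sum_add_distrib]
    have : ∀ m ∈ Finset.Icc b 1, cutC ε (m + 1) * ((m + 2) * B m) + cutJ ε (m + 2) * B m =
        if m = -2 then -B m else 0 := fun m _ => by
      have := cutC_rec hε m
      split_ifs at this ⊢ <;> linear_combination B m * this
    rw [Finset.sum_congr rfl this, Finset.sum_ite_eq']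
    split_ifs with h
    · rfl
    · rw [hB _ (by simp only [Finset.mem_Icc] at h; omega), neg_zero]
  have e5 : ∑ m ∈ Finset.Icc (b - 1) 0, cutC ε (m + 2) * (A m + (m + 3) * B (m + 1)) =
      ∑ m ∈ Finset.Icc (b - 1) 0, cutC ε (m + 2) * A m +
        ∑ m ∈ Finset.Icc (b - 1) 0, cutC ε (m + 2) * ((m + 3) * B (m + 1)) := by
    rw [← Finset.sum_add_distrib]
    exact Finset.sum_congr rfl fun m _ => by ring
  rw [e5, e1, e2, e3]
  linarith

lemma ext0_apply {V : Type} [Zero V] {R : E3 × Param → V} {c : E3 × Param} (hc : c ∈ Reg) :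
    ext0 R c = R c := indicator_of_mem hc R

lemma ae_mem_Reg {p : Param} (hp : p ∈ Par) : ∀ᵐ x : E3, (x, p) ∈ Reg := by
  have h0 : ∀ j : Fin 2, ∀ᵐ x : E3, x ≠ pos j p := fun j => by rw [ae_iff]; simp
  filter_upwards [h0 0, h0 1] with x hx0 hx1
  refine ⟨hp, fun j => ?_⟩
  fin_cases j
  · exact hx0
  · exact hx1

/-- Derivative of the cutoff singular part. -/
lemma pd_cut_trc {w : ℤ → E3 × Param → ℝ} (hw : ∀ a, Homog a (w a)) (N : ℤ)
    (a : Letter) (j : Fin 2) {c : E3 × Param} (hc : c ∈ Reg) :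
    pd v a (fun c => cut ε (rad j c) * trc w b N (relL j c)) c =
      (deriv (cut ε) (rad j c) * (rad j c)⁻¹) *
        ((∑ i, a.disp v j c.2 i * (relL j c).1 i) * trc w b N (relL j c)) +
      cut ε (rad j c) * ∑ m ∈ Finset.Icc b N,
        (dp (w m) (relL j c) (a.paramDir v c.2) + dz (w m) (relL j c) (a.disp v j c.2)) := by
  have hcut : ContDiffOn ℝ ∞ (fun c : E3 × Param => cut ε ‖c.1‖) Dom :=
    (contDiff_cut ε).comp_contDiffOn (contDiffOn_fst.norm ℝ fun c hc => (mem_Dom.1 hc).1)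
  have htr : ContDiffOn ℝ ∞ (fun c => trc w b N c) Dom := ContDiffOn.sum fun m _ => (hw m).smooth
  have hcD := relL_mem_Dom (j := j) hc
  have hz : (relL j c).1 ≠ 0 := (mem_Dom.1 hcD).1
  have e : (fun c => cut ε (rad j c) * trc w b N (relL j c)) =
      fun c => (fun c => cut ε ‖c.1‖ * trc w b N c) (relL j c) := by
    ext c; simp [rad]
  have hr : rad j c = ‖(relL j c).1‖ := by simp [rad]
  set q := relL j c with hq
  have hq2 : q.2 = c.2 := by simp [hq]
  have d1 := differentiableAt_of_Dom hcut hcD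
  have d2 := differentiableAt_of_Dom htr hcD
  have dn : HasFDerivAt (fun c : E3 × Param => cut ε ‖c.1‖)
      (deriv (cut ε) ‖q.1‖ • (fderiv ℝ (fun z : E3 => ‖z‖) q.1).comp
        (ContinuousLinearMap.fst ℝ E3 Param)) q := by
    have hn : HasFDerivAt (fun z : E3 => ‖z‖) (fderiv ℝ (fun z : E3 => ‖z‖) q.1) q.1 :=
      ((contDiffAt_norm ℝ (n := 1) hz).differentiableAt (by simp)).hasFDerivAt
    exact (hasDerivAt_cut ε _).comp_hasFDerivAt q (hn.comp q hasFDerivAt_fst)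
  have hnd : ∀ d : E3, fderiv ℝ (fun z : E3 => ‖z‖) q.1 d = ‖q.1‖⁻¹ * ∑ i, d i * q.1 i := by
    intro d
    conv_lhs => rw [sum_ex d]
    rw [map_sum, Finset.mul_sum]
    refine Finset.sum_congr rfl fun i _ => ?_
    have := pdx_norm hz i
    rw [pdx] at this
    rw [map_smul, this, smul_eq_mul]; ring
  have dtr : ∀ e : E3 × Param, fderiv ℝ (fun c => trc w b N c) q e =
      ∑ m ∈ Finset.Icc b N, (dp (w m) q e.2 + dz (w m) q e.1) := fun e => by
    have : (fun c => trc w b N c) = fun c => ∑ m ∈ Finset.Icc b N, w m c := rfl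
    rw [this, fderiv_fun_sum fun m _ => differentiableAt_of_Dom (hw m).smooth hcD]
    rw [sum_apply]
    exact Finset.sum_congr rfl fun m _ => by rw [fderiv_eq_dz_add_dp, add_comm]
  rw [e, pd_comp_relL a (hcut.mul htr) hc, add_comm, ← fderiv_eq_dz_add_dp (e := (_, _)),
    fderiv_fun_mul d1 d2, dn.fderiv]
  rw [_root_.add_apply, _root_.smul_apply, _root_.smul_apply, dtr]
  simp only [_root_.smul_apply, ContinuousLinearMap.comp_apply, ContinuousLinearMap.coe_fst',
    hnd, smul_eq_mul, hr]
  rw [add_comm]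
  congr 1
  ring

end Hadamard
end

noncomputable section
namespace Hadamard

variable {ε : ℝ} {u : Fin 2 → ℤ → E3 × Param → ℝ} {b : ℤ} {H : Fun} {v : Fin 2 → ℝ → E3}

lemma exists_common_bound (hH : ∀ j, HExp j H (u j)) :
    ∃ b : ℤ, ∀ j, ∀ a < b, ∀ c, u j a c = 0 := by
  obtain ⟨b₀, h₀⟩ := (hH 0).bdd
  obtain ⟨b₁, h₁⟩ := (hH 1).bdd
  refine ⟨min b₀ b₁, fun j a ha c => ?_⟩
  fin_cases j
  · exact h₀ a (ha.trans_le (min_le_left _ _)) c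
  · exact h₁ a (ha.trans_le (min_le_right _ _)) c

/-- A radial function times a homogeneous one, around a source point. -/
lemma integrable_radial_shift {a : ℤ} {h : E3 → ℝ} (hh : Hom1 a h) {g : ℝ → ℝ}
    (hg : IntegrableOn (fun r => g r * r ^ (a + 2)) (Ioi 0)) (y : E3) :
    Integrable (fun x : E3 => g ‖x - y‖ * h (x - y)) ∧
      ∫ x : E3, g ‖x - y‖ * h (x - y) =
        (∫ r in Ioi (0 : ℝ), g r * r ^ (a + 2)) * angInt fun n => h n :=
  ⟨(integrable_radial_mul hh hg).comp_sub_right y, by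
    rw [integral_sub_right_eq_self (fun z => g ‖z‖ * h z), integral_radial_mul hh]⟩

lemma cutJ_shift (hε : 0 < ε) (m : ℤ) :
    IntegrableOn (fun r => deriv (cut ε) r * r⁻¹ * r ^ (m + 1 + 2)) (Ioi 0) ∧
      ∫ r in Ioi (0 : ℝ), deriv (cut ε) r * r⁻¹ * r ^ (m + 1 + 2) = cutJ ε (m + 2) := by
  have e : ∀ r ∈ Ioi (0 : ℝ), deriv (cut ε) r * r⁻¹ * r ^ (m + 1 + 2) =
      deriv (cut ε) r * r ^ (m + 2) := fun r hr => by
    have hr0 : r ≠ 0 := ne_of_gt hr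
    rw [show m + 1 + 2 = (m + 2) + 1 by ring, zpow_add_one₀ hr0]
    field_simp
  exact ⟨(integrableOn_deriv_cut hε (m + 2)).congr_fun (fun r hr => (e r hr).symm)
    measurableSet_Ioi, setIntegral_congr_fun measurableSet_Ioi e⟩

/-- The defect between the derivative of the remainder and the remainder of the derivative. -/
lemma pd_remn_sub (hH : ∀ j, HExp j H (u j)) (hb : ∀ j, ∀ a < b, ∀ c, u j a c = 0)
    (a : Letter) {c : E3 × Param} (hc : c ∈ Reg) :
    pd v a (remn ε u b 1 H) c - remn ε (fun j => cpd v a j (u j)) (b - 1) 0 (pd v a H) c =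
      -∑ j, (∑ m ∈ Finset.Icc b 1, deriv (cut ε) (rad j c) * (rad j c)⁻¹ *
        ((∑ i, a.disp v j c.2 i * (relL j c).1 i) * u j m (relL j c)) +
        cut ε (rad j c) * dp (u j 1) (relL j c) (a.paramDir v c.2)) := by
  have h1 : pd v a (remn ε u b 1 H) c = pd v a H c -
      ∑ j, pd v a (fun c => cut ε (rad j c) * trc (u j) b 1 (relL j c)) c := by
    have d : ∀ j ∈ Finset.univ,
        DifferentiableAt ℝ (fun c => cut ε (rad j c) * trc (u j) b 1 (relL j c)) c := fun j _ =>
      differentiableAt_of_Reg (((contDiff_cut ε).comp_contDiffOn (contDiffOn_rad j)).mul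
        (ContDiffOn.sum fun m _ => (((hH j).homog m).symb j).1)) hc
    unfold remn
    simp only [pd]
    rw [fderiv_fun_sub (differentiableAt_of_Reg (hH 0).smooth hc) (DifferentiableAt.fun_sum d),
      fderiv_fun_sum d]
    simp
  rw [h1, remn, sub_sub_sub_cancel_left, ← Finset.sum_sub_distrib, ← Finset.sum_neg_distrib]
  refine Finset.sum_congr rfl fun j _ => ?_
  have hu0 : ∀ m < b, u j m = fun _ => 0 := fun m hm => funext (hb j m hm)
  have z1 : ∀ m < b, dp (u j m) (relL j c) (a.paramDir v c.2) = 0 := fun m hm => by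
    rw [hu0 m hm]; simp [dp]
  -- Truncating `H` at order 1 and its derivative at order 0 matches the `dz` terms after a shift of
  -- the index. Besides the derivative of the cutoff, only the parameter derivative of `u_1` is
  -- unmatched.
  have e1 := sum_Icc_top z1 0
  have e2 := sum_Icc_shift (fun m => dz (u j m) (relL j c) (a.disp v j c.2)) b 0
  have e3 := sum_Icc_lower (b' := b - 1) z1 (by omega) 0
  rw [zero_add] at e1 e2
  rw [pd_cut_trc (fun m => (hH j).homog m) 1 a j hc]
  simp only [trc, cpd, Finset.sum_add_distrib, Finset.mul_sum, relL_apply] at e1 e2 e3 ⊢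
  simp only [← Finset.mul_sum]
  rw [e1, e2, ← e3]
  ring

/-- The integral of the defect. -/
lemma integral_defect (hε : 0 < ε) (hH : ∀ j, HExp j H (u j)) (a : Letter) {p : Param}
    (hp : p ∈ Par) :
    ∫ x, -∑ j, (∑ m ∈ Finset.Icc b 1, deriv (cut ε) (rad j (x, p)) * (rad j (x, p))⁻¹ *
        ((∑ i, a.disp v j p i * (x - pos j p) i) * u j m (x - pos j p, p)) +
        cut ε (rad j (x, p)) * dp (u j 1) (x - pos j p, p) (a.paramDir v p)) =
      -∑ j, (∑ m ∈ Finset.Icc b 1, cutJ ε (m + 2) * flux (a.disp v j p) (u j m) p +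
        cutC ε 3 * angInt fun n : S2 => dp (u j 1) (n, p) (a.paramDir v p)) := by
  have h1 : ∀ j m, Integrable (fun x => deriv (cut ε) (rad j (x, p)) * (rad j (x, p))⁻¹ *
        ((∑ i, a.disp v j p i * (x - pos j p) i) * u j m (x - pos j p, p))) ∧
      ∫ x, deriv (cut ε) (rad j (x, p)) * (rad j (x, p))⁻¹ *
        ((∑ i, a.disp v j p i * (x - pos j p) i) * u j m (x - pos j p, p)) =
      cutJ ε (m + 2) * flux (a.disp v j p) (u j m) p := fun j m => by
    have hh := hom1_flux (((hH j).homog m).slice hp) (a.disp v j p)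
    have := integrable_radial_shift hh (g := fun r => deriv (cut ε) r * r⁻¹)
      (cutJ_shift hε m).1 (pos j p)
    rw [(cutJ_shift hε m).2] at this
    exact this
  have h2 : ∀ j, Integrable (fun x => cut ε (rad j (x, p)) *
        dp (u j 1) (x - pos j p, p) (a.paramDir v p)) ∧
      ∫ x, cut ε (rad j (x, p)) * dp (u j 1) (x - pos j p, p) (a.paramDir v p) =
      cutC ε 3 * angInt fun n : S2 => dp (u j 1) (n, p) (a.paramDir v p) := fun j => by
    have hh : Hom1 1 (fun z => dp (u j 1) (z, p) (a.paramDir v p)) :=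
      (((hH j).homog 1).dp_apply (X := fun _ => a.paramDir v p) contDiff_const).slice hp
    have hi := integrableOn_cut_zero hε 3
    have hC := integral_cut_zero hε 3
    have := integrable_radial_shift hh (g := cut ε) hi (pos j p)
    rw [show (1 : ℤ) + 2 = (3 : ℕ) by norm_num, hC] at this
    exact this
  rw [integral_neg, integral_finsetSum]
  · congr 1
    refine Finset.sum_congr rfl fun j _ => ?_
    rw [integral_add (integrable_finsetSum _ fun m _ => (h1 j m).1) (h2 j).1,
      integral_finsetSum _ fun m _ => (h1 j m).1, (h2 j).2]
    congr 1
    exact Finset.sum_congr rfl fun m _ => (h1 j m).2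
  · exact fun j _ => (integrable_finsetSum _ fun m _ => (h1 j m).1).add (h2 j).1

/-- The partie finie integral is differentiable; its derivative differs from the partie finie
integral of the derivative by surface terms. -/
theorem fderiv_pfInt {s : Fin 2 → ℝ} (hs : ∀ j, 0 < s j) (hv : ∀ j, ContDiff ℝ ∞ (v j))
    (hH : ∀ j, HExp j H (u j)) (hd : Decays H) (hd' : ∀ a, Decays (pd v a H)) {p : Param}
    (hp : p ∈ Par) :
    DifferentiableAt ℝ (pfInt s H) p ∧ ∀ a, pdParam v a (pfInt s H) p =
      pfInt s (pd v a H) p + ∑ j, flux (a.disp v j p) (u j (-2)) p := by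
  obtain ⟨b, hb⟩ := exists_common_bound hH
  obtain ⟨ε, hε, hpS⟩ := exists_mem_Sep hp
  have hdf := decays_fderiv hv hd'
  -- Subtraction up to order 1 leaves a remainder of order 2 and a differential of order 1. After
  -- extension by zero the remainder is therefore `C¹` through the source points.
  set f := ext0 (remn ε u b 1 H) with hf
  set f' := ext0 (fderiv ℝ (remn ε u b 1 H)) with hf'
  have hsm : ContDiffOn ℝ ∞ (remn ε u b 1 H) Reg := contDiffOn_remn hH 1
  have hff' : ∀ c : E3 × Param, c.2 ∈ Sep ε → HasFDerivAt f (f' c) c := fun c hc =>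
    hasFDerivAt_ext0 hsm (Sep_subset hε hc) fun j => remn_isBigO_zero hε hH hb 1 j hc
  have hcf' : ContinuousOn f' (univ ×ˢ Sep ε) := fun c hc =>
    (continuousAt_ext0 (hsm.continuousOn_fderiv_of_isOpen isOpen_Reg (by simp))
      (Sep_subset hε hc.2) fun j => remn_isBigO_one hε hH hb 1 j hc.2).continuousWithinAt
  have hdec : Decays f := decays_ext0_remn hε 1 hd
  have hdec' : Decays f' := decays_ext0_fderiv_remn hε 1 hdf
  have hI := hasFDerivAt_integral (isOpen_Sep ε) (Sep_subset hε) hff' hcf' hdec hdec' hpS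
  have hA : ∀ j a, HasFDerivAt (angU (u j) a) _ p := fun j a =>
    hasFDerivAt_angU (((hH j).homog a).smooth) hp
  have hAe : ∀ j a (e : Param), fderiv ℝ (angU (u j) a) p e =
      angInt fun n : S2 => dp (u j a) (n, p) e := fun j a e => by
    have hw := contDiffOn_dp_apply ((hH j).homog a).smooth e
    rw [(hA j a).fderiv]
    have := angU_eq_avg (w := fun a c => dp (u j a) c e) (a := a) hw hp
    rw [angU] at this
    rw [this]; rfl
  set S : Param → ℝ := fun q => ∑ j, (∑ a ∈ Finset.Icc b 1, cutC ε (a + 2) * angU (u j) a q -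
      Real.log (s j) * angU (u j) (-3) q) with hS
  have hSd : ∀ j a (r : ℝ), DifferentiableAt ℝ (fun q => r * angU (u j) a q) p := fun j a r =>
    (hA j a).differentiableAt.const_mul r
  have hSd1 : ∀ j, DifferentiableAt ℝ (fun q => ∑ a ∈ Finset.Icc b 1,
      cutC ε (a + 2) * angU (u j) a q) p := fun j => DifferentiableAt.fun_sum fun a _ => hSd j a _
  have hSdiff : DifferentiableAt ℝ S p := DifferentiableAt.fun_sum fun j _ =>
    (hSd1 j).sub (hSd j (-3) _)
  have hSe : ∀ e, fderiv ℝ S p e = ∑ j, (∑ a ∈ Finset.Icc b 1, cutC ε (a + 2) *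
      (angInt fun n : S2 => dp (u j a) (n, p) e) -
      Real.log (s j) * angInt fun n : S2 => dp (u j (-3)) (n, p) e) := fun e => by
    have d : ∀ j ∈ Finset.univ, DifferentiableAt ℝ (fun q => ∑ a ∈ Finset.Icc b 1,
        cutC ε (a + 2) * angU (u j) a q - Real.log (s j) * angU (u j) (-3) q) p := fun j _ =>
      (hSd1 j).sub (hSd j (-3) _)
    rw [hS, fderiv_fun_sum d, sum_apply]
    refine Finset.sum_congr rfl fun j _ => ?_
    rw [fderiv_fun_sub (hSd1 j) (hSd j (-3) _), fderiv_fun_sum fun a _ => hSd j a _, _root_.sub_apply,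
      sum_apply, fderiv_const_mul (hA j (-3)).differentiableAt, _root_.smul_apply, hAe, smul_eq_mul]
    congr 1
    refine Finset.sum_congr rfl fun a _ => ?_
    rw [fderiv_const_mul (hA j a).differentiableAt, _root_.smul_apply, hAe, smul_eq_mul]
  have hpf : pfInt s H =ᶠ[𝓝 p] fun q => S q + ∫ x, f (x, q) := by
    filter_upwards [(isOpen_Sep ε).mem_nhds hpS] with q hq using pfInt_eq hs hε hH hb 1 hd hq
  refine ⟨(hSdiff.add hI.differentiableAt).congr_of_eventuallyEq hpf, fun a => ?_⟩
  have hb' : ∀ j, ∀ m < b - 1, ∀ c, cpd v a j (u j) m c = 0 := fun j m hm c => by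
    have hu0 : ∀ m < b, u j m = fun _ => 0 := fun m hm => funext (hb j m hm)
    rw [cpd, hu0 m (by omega), hu0 (m + 1) (by omega)]
    simp [dp, dz]
  have hH' : ∀ j, HExp j (pd v a H) (cpd v a j (u j)) := fun j => (hH j).pd hv a
  have hpf' := pfInt_eq hs hε hH' hb' 0 (hd' a) hpS
  -- The field point is moved along with the parameters, so that the integrand is the full
  -- derivative along the letter.
  have hI' := fderiv_integral (isOpen_Sep ε) (Sep_subset hε) hff' hcf' hdec hdec' hpS
    (a.fieldDir, a.paramDir v p)
  have hi1 : Integrable fun x => f' (x, p) (a.fieldDir, a.paramDir v p) :=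
    (ContinuousLinearMap.apply ℝ ℝ (a.fieldDir, a.paramDir v p)).integrable_comp
      (hdec'.integrable (isOpen_Sep ε) (Sep_subset hε) hcf' hpS)
  have hi2 := integrable_ext0_remn hε hH' hb' 0 (hd' a) hpS
  have hdiff : (∫ x, f' (x, p) (a.fieldDir, a.paramDir v p)) -
      ∫ x, ext0 (remn ε (fun j => cpd v a j (u j)) (b - 1) ((0 : ℕ) : ℤ) (pd v a H)) (x, p) =
      -∑ j, (∑ m ∈ Finset.Icc b 1, cutJ ε (m + 2) * flux (a.disp v j p) (u j m) p +
        cutC ε 3 * angInt fun n : S2 => dp (u j 1) (n, p) (a.paramDir v p)) := by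
    rw [← integral_sub hi1 hi2, ← integral_defect hε hH a hp]
    refine integral_congr_ae ?_
    filter_upwards [ae_mem_Reg hp] with x hx
    rw [hf', ext0_apply hx, ext0_apply hx]
    have := pd_remn_sub (v := v) (ε := ε) hH hb a hx
    simp only [relL_apply] at this
    exact this
  -- The terms in `log s_j` drop out: the coefficient of order `-3` of the derivative contains the
  -- flux with the factor `m + 3 = 0`. The surface terms do not depend on the length scales.
  have hnum : ∀ j, (∑ m ∈ Finset.Icc b 1, cutC ε (m + 2) *
        (angInt fun n : S2 => dp (u j m) (n, p) (a.paramDir v p)) -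
      Real.log (s j) * angInt fun n : S2 => dp (u j (-3)) (n, p) (a.paramDir v p)) -
      (∑ m ∈ Finset.Icc (b - 1) 0, cutC ε (m + 2) * angU (cpd v a j (u j)) m p -
      Real.log (s j) * angU (cpd v a j (u j)) (-3) p) -
      (∑ m ∈ Finset.Icc b 1, cutJ ε (m + 2) * flux (a.disp v j p) (u j m) p +
        cutC ε 3 * angInt fun n : S2 => dp (u j 1) (n, p) (a.paramDir v p)) =
      flux (a.disp v j p) (u j (-2)) p := fun j => by
    have hu0 : ∀ m < b, u j m = fun _ => 0 := fun m hm => funext (hb j m hm)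
    have := sum_cutC_rec hε (b := b)
      (A := fun m => angInt fun n : S2 => dp (u j m) (n, p) (a.paramDir v p))
      (B := fun m => flux (a.disp v j p) (u j m) p)
      (fun m hm => by simp [hu0 m hm, dp, angInt]) (fun m hm => by simp [hu0 m hm, flux, angInt])
    simp only [angU_cpd (fun m => (hH j).homog m) a j _ hp]
    rw [← this]
    push_cast
    ring
  have hsum := Finset.sum_congr rfl fun j (_ : j ∈ Finset.univ) => hnum j
  simp only [Finset.sum_sub_distrib] at hsum
  rw [pdParam, hpf.fderiv_eq, fderiv_fun_add hSdiff hI.differentiableAt, _root_.add_apply, hSe,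
    hI', hpf']
  rw [Nat.cast_zero] at hdiff ⊢
  simp only [Finset.sum_sub_distrib]
  linarith

end Hadamard
end

/-! ### Integration by parts and commutation as conditions on distributional terms. -/

noncomputable section
namespace Hadamard

variable {v : Fin 2 → ℝ → E3} {F G H H' : Fun} {s : Fin 2 → ℝ} {p : Param}

lemma ext0_congr {V : Type} [Zero V] {R R' : E3 × Param → V} (h : ∀ c ∈ Reg, R c = R' c) :
    ext0 R = ext0 R' := by
  ext1 c
  by_cases hc : c ∈ Reg
  · rw [ext0_apply hc, ext0_apply hc, h c hc]
  · simp [ext0, hc]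

lemma pfInt_congr (hs : ∀ j, 0 < s j) (hH : InF H) (hd : Decays H) (h : ∀ c ∈ Reg, H' c = H c)
    (hp : p ∈ Par) : pfInt s H' p = pfInt s H p := by
  have h1 := fun j => hH.hExp j
  have h2 := fun j => (h1 j).congr h
  obtain ⟨b, hb⟩ := exists_common_bound h1
  obtain ⟨ε, hε, hpS⟩ := exists_mem_Sep hp
  rw [pfInt_eq hs hε h1 hb 0 hd hpS, pfInt_eq hs hε h2 hb 0 (hd.mono fun c hc => by rw [h c hc]) hpS]
  congr 2
  rw [ext0_congr]
  exact fun c hc => by simp [remn, h c hc]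

/-- The partie finie is a limit with counterterms, so additivity is read off the closed formula
`pfInt_eq`, with a common lower bound and a common cutoff radius for both functions. -/
lemma pfInt_add (hs : ∀ j, 0 < s j) (hH : InF H) (hH' : InF H') (hd : Decays H)
    (hd' : Decays H') (hp : p ∈ Par) :
    pfInt s (fun c => H c + H' c) p = pfInt s H p + pfInt s H' p := by
  have h1 := fun j => hH.hExp j
  have h2 := fun j => hH'.hExp j
  have h3 := fun j => (h1 j).add (h2 j)
  obtain ⟨b₁, hb₁⟩ := exists_common_bound h1
  obtain ⟨b₂, hb₂⟩ := exists_common_bound h2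
  have k1 : ∀ j, ∀ a < min b₁ b₂, ∀ c, hcoef j H a c = 0 := fun j a ha =>
    hb₁ j a (ha.trans_le (min_le_left _ _))
  have k2 : ∀ j, ∀ a < min b₁ b₂, ∀ c, hcoef j H' a c = 0 := fun j a ha =>
    hb₂ j a (ha.trans_le (min_le_right _ _))
  have k3 : ∀ j, ∀ a < min b₁ b₂, ∀ c, hcoef j H a c + hcoef j H' a c = 0 := fun j a ha c => by
    rw [k1 j a ha, k2 j a ha, add_zero]
  obtain ⟨ε, hε, hpS⟩ := exists_mem_Sep hp
  rw [pfInt_eq hs hε h1 k1 0 hd hpS, pfInt_eq hs hε h2 k2 0 hd' hpS,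
    pfInt_eq hs hε h3 k3 0 (hd.add hd') hpS]
  have hang : ∀ j a, angU (fun a c => hcoef j H a c + hcoef j H' a c) a p =
      angU (hcoef j H) a p + angU (hcoef j H') a p := fun j a =>
    angInt_add (continuous_slice ((h1 j).homog a).smooth.continuousOn hp)
      (continuous_slice ((h2 j).homog a).smooth.continuousOn hp)
  have hint : ∫ x, ext0 (remn ε (fun j a c => hcoef j H a c + hcoef j H' a c) (min b₁ b₂)
      ((0 : ℕ) : ℤ) fun c => H c + H' c) (x, p) =
      (∫ x, ext0 (remn ε (fun j => hcoef j H) (min b₁ b₂) ((0 : ℕ) : ℤ) H) (x, p)) +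
      ∫ x, ext0 (remn ε (fun j => hcoef j H') (min b₁ b₂) ((0 : ℕ) : ℤ) H') (x, p) := by
    rw [← integral_add (integrable_ext0_remn hε h1 k1 0 hd hpS)
      (integrable_ext0_remn hε h2 k2 0 hd' hpS)]
    refine integral_congr_ae ?_
    filter_upwards [ae_mem_Reg hp] with x hx
    rw [ext0_apply hx, ext0_apply hx, ext0_apply hx]
    simp only [remn, trc, Finset.sum_add_distrib, mul_add]
    ring
  rw [hint]
  simp only [hang, mul_add, Finset.sum_add_distrib, Finset.sum_sub_distrib]
  ring

/-! ### Closure of the class of functions -/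

lemma InF.pd (hv : ∀ j, ContDiff ℝ ∞ (v j)) (a : Letter) (h : InF F) : InF (pd v a F) :=
  InF.of_hExp fun j => (h.hExp j).pd hv a

lemma InF.pds (hv : ∀ j, ContDiff ℝ ∞ (v j)) (L : List Letter) (h : InF F) : InF (pds v L F) := by
  induction L with
  | nil => exact h
  | cons a L ih => exact ih.pd hv a

lemma InF.mul (h : InF F) (h' : InF G) : InF (F * G) :=
  InF.of_hExp fun j => (h.hExp j).mul (h'.hExp j)

lemma InF.differentiableAt (h : InF F) {c : E3 × Param} (hc : c ∈ Reg) : DifferentiableAt ℝ F c :=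
  differentiableAt_of_Reg h.1 hc

lemma pd_mul (a : Letter) (h : InF F) (h' : InF G) {c : E3 × Param} (hc : c ∈ Reg) :
    pd v a (F * G) c = (pd v a F * G) c + (F * pd v a G) c := by
  simp only [Hadamard.pd, Pi.mul_apply]
  rw [show F * G = fun c => F c * G c from rfl,
    fderiv_fun_mul (h.differentiableAt hc) (h'.differentiableAt hc)]
  simp
  ring

lemma pd_congr (a : Letter) (e : ∀ c ∈ Reg, G c = F c) : ∀ c ∈ Reg, pd v a G c = pd v a F c :=
  fun c hc => by
    have : G =ᶠ[𝓝 c] F := by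
      filter_upwards [isOpen_Reg.mem_nhds hc] with q hq using e q hq
    simp only [pd, this.fderiv_eq]

lemma pds_append (L M : List Letter) (F : Fun) : pds v (L ++ M) F = pds v L (pds v M F) := by
  simp [pds]

lemma DecayPair.symm (h : DecayPair v F G) : DecayPair v G F := fun L M p₀ hp₀ => by
  obtain ⟨ε, hε, C, R, h1⟩ := h M L p₀ hp₀
  exact ⟨ε, hε, C, R, h1.mono fun p hp x hx => by rw [mul_comm]; exact hp x hx⟩

lemma DecayPair.pds_left (h : DecayPair v F G) (L : List Letter) : DecayPair v (pds v L F) G :=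
  fun L' M => by rw [← pds_append]; exact h _ M

lemma DecayPair.pds_right (h : DecayPair v F G) (L : List Letter) : DecayPair v F (pds v L G) :=
  (h.symm.pds_left L).symm

lemma DecayPair.pd_left (h : DecayPair v F G) (a : Letter) : DecayPair v (pd v a F) G :=
  h.pds_left [a]

lemma DecayPair.pd_right (h : DecayPair v F G) (a : Letter) : DecayPair v F (pd v a G) :=
  h.pds_right [a]

lemma DecayPair.decays (h : DecayPair v F G) : Decays (F * G) := h [] []

lemma DecayPair.decays_pd (h : DecayPair v F G) (hF : InF F) (hG : InF G) (a : Letter) :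
    Decays (pd v a (F * G)) :=
  ((h.pd_left a).decays.add (h.pd_right a).decays).mono fun c hc => by rw [pd_mul a hF hG hc]

/-! ### The rule of integration by parts for the first derivatives -/

/-- The surface terms around the source points of the divergence of a product. -/
def surf (v : Fin 2 → ℝ → E3) (a : Letter) (F G : Fun) (p : Param) : ℝ :=
  ∑ j, flux (a.disp v j p) (cmul (hcoef j F) (hcoef j G) (-2)) p

/-- The ordinary derivatives violate the rule of integration by parts exactly by `surf`; this is the
defect that the distributional terms must compensate. -/
lemma pfInt_leibniz (hs : ∀ j, 0 < s j) (hv : ∀ j, ContDiff ℝ ∞ (v j)) (hF : InF F) (hG : InF G)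
    (h : DecayPair v F G) (hp : p ∈ Par) :
    DifferentiableAt ℝ (pfInt s (F * G)) p ∧ ∀ a, pdParam v a (pfInt s (F * G)) p =
      pfInt s (pd v a F * G) p + pfInt s (F * pd v a G) p + surf v a F G p := by
  obtain ⟨h1, h2⟩ := fderiv_pfInt hs hv (H := F * G) (fun j => (hF.hExp j).mul (hG.hExp j))
    h.decays (h.decays_pd hF hG) hp
  refine ⟨h1, fun a => ?_⟩
  have hF' := hF.pd hv a
  have hG' := hG.pd hv a
  have e := pfInt_add hs (hF'.mul hG) (hF.mul hG') (h.pd_left a).decays (h.pd_right a).decays hp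
  rw [h2 a, surf, ← e]
  congr 1
  refine pfInt_congr hs ?_ ((h.pd_left a).decays.add (h.pd_right a).decays)
    (fun c hc => pd_mul a hF hG hc) hp
  exact InF.of_hExp fun j => ((hF'.mul hG).hExp j).add ((hF.mul hG').hExp j)

variable {A : Set Letter} {D : DistTerms}

lemma pdParam_add {f g : Param → ℝ} (a : Letter) (hf : DifferentiableAt ℝ f p)
    (hg : DifferentiableAt ℝ g p) :
    pdParam v a (fun q => f q + g q) p = pdParam v a f p + pdParam v a g p := by
  simp only [pdParam]
  rw [fderiv_fun_add hf hg]; rfl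

lemma pdParam_sub {f g : Param → ℝ} (a : Letter) (hf : DifferentiableAt ℝ f p)
    (hg : DifferentiableAt ℝ g p) :
    pdParam v a (fun q => f q - g q) p = pdParam v a f p - pdParam v a g p := by
  simp only [pdParam]
  rw [fderiv_fun_sub hf hg]; rfl

/-- The rule of integration by parts as a rule on the distributional terms. -/
lemma byParts_iff (hs : ∀ j, 0 < s j) (hv : ∀ j, ContDiff ℝ ∞ (v j)) (hF : InF F) (hG : InF G)
    (h : DecayPair v F G) (hp : p ∈ Par) (a : Letter) (L : List Letter) :
    (DifferentiableAt ℝ (bracket s v D L F G) p ∧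
        bracket s v D (a :: L) F G p + bracket₂ s v D L F a G p =
          pdParam v a (bracket s v D L F G) p) ↔
    DifferentiableAt ℝ (D L F G) p ∧ D (a :: L) F G p + D L F (pd v a G) p +
      D [a] G (pds v L F) p = surf v a (pds v L F) G p + pdParam v a (D L F G) p := by
  obtain ⟨h1, h2⟩ := pfInt_leibniz hs hv (hF.pds hv L) hG (h.pds_left L) hp
  have hd : DifferentiableAt ℝ (bracket s v D L F G) p ↔ DifferentiableAt ℝ (D L F G) p := by
    refine ⟨fun hb => ?_, fun hD => h1.add hD⟩
    have := hb.sub h1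
    refine this.congr_of_eventuallyEq (Eventually.of_forall fun q => ?_)
    simp [bracket]
  rw [hd]
  refine and_congr_right fun hD => ?_
  have e : pdParam v a (bracket s v D L F G) p =
      pdParam v a (pfInt s (pds v L F * G)) p + pdParam v a (D L F G) p := pdParam_add a h1 hD
  rw [e, h2 a, bracket, bracket₂, show pds v (a :: L) F = pd v a (pds v L F) from rfl]
  constructor <;> intro h <;> linarith

/-- The rule for the empty word, where there is no distributional term to differentiate. It
prescribes the symmetric part of every first-order term. -/
lemma IsDerivativeSystem.add_swap (hD : IsDerivativeSystem s v A D) (hs : ∀ j, 0 < s j)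
    (hv : ∀ j, ContDiff ℝ ∞ (v j)) {a : Letter} (ha : a ∈ A) (hF : InF F) (hG : InF G)
    (h : DecayPair v F G) (hp : p ∈ Par) : D [a] F G p + D [a] G F p = surf v a F G p := by
  have := ((byParts_iff hs hv hF hG h hp a []).1 (hD.byParts a ha [] (by simp) F G hF hG h p hp)).2
  have e : D [] F G = fun _ => 0 := funext fun q => hD.nil F G q
  rw [e, hD.nil] at this
  simpa [pds, pdParam] using this

/-- The term in which `G` is differentiated is eliminated by `add_swap`. First-order terms therefore
determine all others, and the formula serves as the definition of `derivSystem`. -/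
lemma IsDerivativeSystem.cons_eq (hD : IsDerivativeSystem s v A D) (hs : ∀ j, 0 < s j)
    (hv : ∀ j, ContDiff ℝ ∞ (v j)) {a : Letter} (ha : a ∈ A) {L : List Letter}
    (hL : ∀ b ∈ L, b ∈ A) (hF : InF F) (hG : InF G) (h : DecayPair v F G) (hp : p ∈ Par) :
    D (a :: L) F G p = pdParam v a (D L F G) p - D L F (pd v a G) p + D [a] (pds v L F) G p := by
  have h1 := ((byParts_iff hs hv hF hG h hp a L).1 (hD.byParts a ha L hL F G hF hG h p hp)).2
  have h2 := hD.add_swap hs hv ha (hF.pds hv L) hG (h.pds_left L) hp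
  linarith

/-- The commutation of two derivatives as a rule on the first-order terms. -/
lemma IsDerivativeSystem.comm_two (hD : IsDerivativeSystem s v A D) (hs : ∀ j, 0 < s j)
    (hv : ∀ j, ContDiff ℝ ∞ (v j)) {a b : Letter} (ha : a ∈ A) (hb : b ∈ A) (hF : InF F)
    (hG : InF G) (h : DecayPair v F G) (hp : p ∈ Par) :
    pdParam v a (D [b] F G) p - D [b] F (pd v a G) p + D [a] (pd v b F) G p =
      pdParam v b (D [a] F G) p - D [a] F (pd v b G) p + D [b] (pd v a F) G p := by
  have h1 := hD.cons_eq hs hv ha (L := [b]) (by simpa using hb) hF hG h hp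
  have h2 := hD.cons_eq hs hv hb (L := [a]) (by simpa using ha) hF hG h hp
  have h3 := hD.comm [a, b] [b, a] (by simp [ha, hb]) (List.Perm.swap b a []) F G hF hG h p hp
  rw [h1, h2] at h3
  exact h3

end Hadamard
end

/-! ### The explicit terms as a bilinear form in the coefficients. -/

noncomputable section
namespace Hadamard

variable {v : Fin 2 → ℝ → E3} {K : ℝ} {U U' W W' : ℤ → CS} {u w : ℤ → E3 × Param → ℝ} {p : Param}

/-! ### The bilinear form of the explicit distributional terms -/

/-- `4π [∑_{k ≥ 0} ⟨n_i U_{-2-k} W_k⟩ + Q_i(U_{-1}, W_{-1})]`. -/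
def tform (K : ℝ) (i : Fin 3) (U W : ℤ → CS) : ℝ :=
  4 * Real.pi * (∑ᶠ k : ℕ, avg (coordC i * U (-2 - k) * W k) + Q K i (U (-1)) (W (-1)))

/-- Sequences of coefficients that vanish for low indices. -/
def Low (U : ℤ → CS) : Prop := ∃ b, ∀ a < b, U a = 0

lemma Low.exists_nat (h : Low U) : ∃ N₀ : ℕ, ∀ N : ℕ, N₀ ≤ N → ∀ a < -1 - (N : ℤ), U a = 0 := by
  obtain ⟨b, hb⟩ := h
  exact ⟨b.natAbs, fun N hN a ha => hb a (by omega)⟩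

lemma tform_eq {N : ℕ} (h : ∀ a < -1 - (N : ℤ), U a = 0) (K : ℝ) (i : Fin 3) (W : ℤ → CS) :
    tform K i U W = 4 * Real.pi * (∑ k ∈ Finset.range N, avg (coordC i * U (-2 - k) * W k) +
      Q K i (U (-1)) (W (-1))) := by
  rw [tform, finsum_eq_sum_of_support_subset]
  intro k hk
  simp only [Finset.coe_range, Set.mem_Iio]
  by_contra hkN
  exact hk (by simp only [h (-2 - (k : ℤ)) (by omega)]; simp)

lemma Q_add_left {g : CS} (hg : Rap g) (K : ℝ) (b : Fin 3) (f f' : CS) :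
    Q K b (f + f') g = Q K b f g + Q K b f' g :=
  hg.W_add_left (quad_Ccoef K) (quad_Ccoef K).one_sub b f f'

lemma Q_add_right {f : CS} (hf : Rap f) (K : ℝ) (b : Fin 3) (g g' : CS) :
    Q K b f (g + g') = Q K b f g + Q K b f g' :=
  hf.W_add_right (quad_Ccoef K) (quad_Ccoef K).one_sub b g g'

lemma tform_add_left (hU : Low U) (hU' : Low U') (hW : Rap (W (-1))) (K : ℝ) (i : Fin 3) :
    tform K i (U + U') W = tform K i U W + tform K i U' W := by
  obtain ⟨N, hN⟩ := hU.exists_nat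
  obtain ⟨N', hN'⟩ := hU'.exists_nat
  have h1 := hN (max N N') (le_max_left _ _)
  have h2 := hN' (max N N') (le_max_right _ _)
  rw [tform_eq h1, tform_eq h2, tform_eq (N := max N N') fun a ha => by
    rw [Pi.add_apply, h1 a ha, h2 a ha, add_zero]]
  simp only [Pi.add_apply, mul_add, add_mul, map_add, Finset.sum_add_distrib, Q_add_left hW]
  ring

lemma tform_add_right (hU : Low U) (hU' : Rap (U (-1))) (K : ℝ) (i : Fin 3) (W W' : ℤ → CS) :
    tform K i U (W + W') = tform K i U W + tform K i U W' := by
  obtain ⟨N, hN⟩ := hU.exists_nat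
  have h1 := hN N le_rfl
  rw [tform_eq h1, tform_eq h1, tform_eq h1]
  simp only [Pi.add_apply, mul_add, map_add, Finset.sum_add_distrib, Q_add_right hU']
  ring

lemma Low.smul (hU : Low U) (r : ℝ) : Low (r • U) := by
  obtain ⟨b, hb⟩ := hU
  exact ⟨b, fun a ha => by rw [Pi.smul_apply, hb a ha, smul_zero]⟩

lemma Low.add (hU : Low U) (hU' : Low U') : Low (U + U') := by
  obtain ⟨b, hb⟩ := hU
  obtain ⟨b', hb'⟩ := hU'
  exact ⟨min b b', fun a ha => by
    rw [Pi.add_apply, hb a (ha.trans_le (min_le_left _ _)), hb' a (ha.trans_le (min_le_right _ _)),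
      add_zero]⟩

lemma Low.zero : Low (0 : ℤ → CS) := ⟨0, fun _ _ => rfl⟩

lemma Low.sum {ι : Type*} (s : Finset ι) {V : ι → ℤ → CS} (h : ∀ i, Low (V i)) :
    Low (∑ i ∈ s, V i) := by
  classical
  induction s using Finset.induction_on with
  | empty => exact Low.zero
  | insert i s hi ih => rw [Finset.sum_insert hi]; exact (h i).add ih

lemma tform_smul_left (K : ℝ) (i : Fin 3) (r : ℝ) (U W : ℤ → CS) :
    tform K i (r • U) W = r * tform K i U W := by
  have e : (fun k : ℕ => avg (coordC i * (r • U) (-2 - k) * W k)) =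
      fun k : ℕ => r • avg (coordC i * U (-2 - k) * W k) := by
    ext k
    rw [Pi.smul_apply, mul_smul_comm, smul_mul_assoc, map_smul]
  rw [tform, tform, e, ← smul_finsum, Pi.smul_apply, Q, Q, W_smul_left, smul_eq_mul]
  ring

lemma tform_smul_right (K : ℝ) (i : Fin 3) (r : ℝ) (U W : ℤ → CS) :
    tform K i U (r • W) = r * tform K i U W := by
  have e : (fun k : ℕ => avg (coordC i * U (-2 - k) * (r • W) k)) =
      fun k : ℕ => r • avg (coordC i * U (-2 - k) * W k) := by
    ext k
    rw [Pi.smul_apply, mul_smul_comm, map_smul]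
  rw [tform, tform, e, ← smul_finsum, Pi.smul_apply, Q, Q, W_smul_right, smul_eq_mul]
  ring

lemma tform_zero_left (K : ℝ) (i : Fin 3) (W : ℤ → CS) : tform K i 0 W = 0 := by
  have := tform_smul_left K i 0 0 W
  simpa using this

lemma tform_zero_right (K : ℝ) (i : Fin 3) (U : ℤ → CS) : tform K i U 0 = 0 := by
  have := tform_smul_right K i 0 U 0
  simpa using this

lemma tform_sum_left {ι : Type*} (s : Finset ι) {V : ι → ℤ → CS} (h : ∀ i, Low (V i))
    (hW : Rap (W (-1))) (K : ℝ) (i : Fin 3) :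
    tform K i (∑ l ∈ s, V l) W = ∑ l ∈ s, tform K i (V l) W := by
  classical
  induction s using Finset.induction_on with
  | empty => simp [tform_zero_left]
  | insert l s hl ih =>
    rw [Finset.sum_insert hl, Finset.sum_insert hl, tform_add_left (h l) (Low.sum s h) hW, ih]

lemma tform_sum_right {ι : Type*} (s : Finset ι) (hU : Low U) (hU' : Rap (U (-1)))
    (V : ι → ℤ → CS) (K : ℝ) (i : Fin 3) :
    tform K i U (∑ l ∈ s, V l) = ∑ l ∈ s, tform K i U (V l) := by
  classical
  induction s using Finset.induction_on with
  | empty => simp [tform_zero_right]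
  | insert l s hl ih =>
    rw [Finset.sum_insert hl, Finset.sum_insert hl, tform_add_right hU hU', ih]

/-- Orders contributing to `-2` in a product are paired by `a ↦ -2 - a`, with fixed point `-1`; this
is the splitting into the `k`-sums of the two forms and the term of `Q`. -/
lemma sum_Icc_symm (f : ℤ → ℝ) (N : ℕ) : ∑ a ∈ Finset.Icc (-1 - (N : ℤ)) (N - 1), f a =
    ∑ k ∈ Finset.range N, f (-2 - k) + f (-1) + ∑ k ∈ Finset.range N, f k := by
  induction N with
  | zero => simp
  | succ N ih =>
    have e : Finset.Icc (-1 - ((N + 1 : ℕ) : ℤ)) ((N + 1 : ℕ) - 1) =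
        insert (-2 - (N : ℤ)) (insert (N : ℤ) (Finset.Icc (-1 - (N : ℤ)) (N - 1))) := by
      ext a; simp only [Finset.mem_insert, Finset.mem_Icc]; omega
    rw [e, Finset.sum_insert (by simp; omega), Finset.sum_insert (by simp), ih,
      Finset.sum_range_succ, Finset.sum_range_succ]
    ring

/-- The symmetric part of the form is the surface term. -/
lemma tform_add_swap {N : ℕ} (h1 : ∀ a < -1 - (N : ℤ), U a = 0) (h2 : ∀ a < -1 - (N : ℤ), W a = 0)
    (hU' : Rap (U (-1))) (K : ℝ) (i : Fin 3) :
    tform K i U W + tform K i W U = 4 * Real.pi *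
      ∑ a ∈ Finset.Icc (-1 - (N : ℤ)) (N - 1), avg (coordC i * U a * W (-2 - a)) := by
  rw [tform_eq h1, tform_eq h2, sum_Icc_symm, ← mul_add]
  congr 1
  have h3 := hU'.Q_add_swap K i (W (-1))
  have e1 : ∀ k : ℕ, avg (coordC i * U (-2 - k) * W (-2 - (-2 - (k : ℤ)))) =
      avg (coordC i * U (-2 - k) * W k) := fun k => by
    rw [show -2 - (-2 - (k : ℤ)) = k by ring]
  have e2 : ∀ k : ℕ, avg (coordC i * U k * W (-2 - (k : ℤ))) =
      avg (coordC i * W (-2 - k) * U k) := fun k => by congr 1; ring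
  simp only [e1, e2, show (-2 - (-1) : ℤ) = -1 by norm_num]
  linarith

/-! ### Smooth families -/

/-- The coefficients at fixed parameters, as functions on the sphere. -/
def fams (u : ℤ → E3 × Param → ℝ) (p : Param) : ℤ → CS := fun a => fam (u a) p

lemma low_fams (hu : ∃ b, ∀ a < b, ∀ c, u a c = 0) (p : Param) : Low (fams u p) := by
  obtain ⟨b, hb⟩ := hu
  refine ⟨b, fun a ha => ?_⟩
  have : u a = fun _ => 0 := funext (hb a ha)
  ext n
  rw [fams, this, fam, toC_apply continuous_const]; rfl

/-- The derivative of the coefficients in a direction of the parameters. -/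
def dps (u : ℤ → E3 × Param → ℝ) (e : Param) : ℤ → E3 × Param → ℝ := fun a c => dp (u a) c e

lemma dps_low (hu : ∃ b, ∀ a < b, ∀ c, u a c = 0) (e : Param) :
    ∃ b, ∀ a < b, ∀ c, dps u e a c = 0 := by
  obtain ⟨b, hb⟩ := hu
  refine ⟨b, fun a ha c => ?_⟩
  have : u a = fun _ => 0 := funext (hb a ha)
  rw [dps, this]; simp [dp]

lemma contDiffOn_avg_mul (f : CS) {u w : E3 × Param → ℝ} (hu : ContDiffOn ℝ ∞ u Dom)
    (hw : ContDiffOn ℝ ∞ w Dom) : ContDiffOn ℝ ∞ (fun p => avg (f * fam u p * fam w p)) Par :=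
  avg.contDiff.comp_contDiffOn ((contDiffOn_const.mul (contDiffOn_fam hu)).mul (contDiffOn_fam hw))

lemma fderiv_avg_mul (f : CS) {u w : E3 × Param → ℝ} (hu : ContDiffOn ℝ ∞ u Dom)
    (hw : ContDiffOn ℝ ∞ w Dom) (hp : p ∈ Par) (e : Param) :
    fderiv ℝ (fun p => avg (f * fam u p * fam w p)) p e =
      avg (f * fam (fun c => dp u c e) p * fam w p) +
        avg (f * fam u p * fam (fun c => dp w c e) p) := by
  have h1 := ((hasFDerivAt_fam hu hp).const_mul f).mul (hasFDerivAt_fam hw hp)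
  have h2 := avg.hasFDerivAt.comp p h1
  have h3 := h2.fderiv
  rw [show (fun p => avg (f * fam u p * fam w p)) = (avg ∘ ((fun y => f * fam u y) * fam w)) from rfl,
    h3, ← map_add]
  change avg _ = avg _
  congr 1
  have f1 := famDeriv_apply hu hp e
  have f2 := famDeriv_apply hw hp e
  change f * fam u p * famDeriv hw hp e + fam w p * (f * famDeriv hu hp e) = _
  rw [f1, f2]
  ring

lemma tform_fams_eq {N : ℕ} (hN : ∀ a < -1 - (N : ℤ), ∀ c, u a c = 0) (K : ℝ) (i : Fin 3)
    (W : ℤ → CS) (p : Param) : tform K i (fams u p) W = 4 * Real.pi *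
      (∑ k ∈ Finset.range N, avg (coordC i * fam (u (-2 - k)) p * W k) +
      Q K i (fam (u (-1)) p) (W (-1))) := by
  refine tform_eq (fun a ha => ?_) K i W
  have : u a = fun _ => 0 := funext (hN a ha)
  ext n
  rw [fams, this, fam, toC_apply continuous_const]; rfl

lemma exists_low_nat (hu : ∃ b, ∀ a < b, ∀ c, u a c = 0) :
    ∃ N : ℕ, ∀ a < -1 - (N : ℤ), ∀ c, u a c = 0 := by
  obtain ⟨b, hb⟩ := hu
  exact ⟨b.natAbs, fun a ha => hb a (by omega)⟩

/-- Only finitely many `k` occur, since the coefficients of `u` vanish below a fixed order for all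
parameters; the rest is the smoothness of averages and of `W`. -/
lemma contDiffOn_tform (hl : ∃ b, ∀ a < b, ∀ c, u a c = 0) (hu : ∀ a, ContDiffOn ℝ ∞ (u a) Dom)
    (hw : ∀ a, ContDiffOn ℝ ∞ (w a) Dom) (K : ℝ) (i : Fin 3) :
    ContDiffOn ℝ ∞ (fun p => tform K i (fams u p) (fams w p)) Par := by
  obtain ⟨N, hN⟩ := exists_low_nat hl
  simp only [tform_fams_eq hN]
  exact contDiffOn_const.mul ((ContDiffOn.sum fun k _ => contDiffOn_avg_mul _ (hu _) (hw _)).add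
    (contDiffOn_W (quad_Ccoef K) (quad_Ccoef K).one_sub i (hu _) (hw _)))

lemma fderiv_tform (hl : ∃ b, ∀ a < b, ∀ c, u a c = 0) (hu : ∀ a, ContDiffOn ℝ ∞ (u a) Dom)
    (hw : ∀ a, ContDiffOn ℝ ∞ (w a) Dom) (K : ℝ) (i : Fin 3) (hp : p ∈ Par) (e : Param) :
    fderiv ℝ (fun p => tform K i (fams u p) (fams w p)) p e =
      tform K i (fams (dps u e) p) (fams w p) + tform K i (fams u p) (fams (dps w e) p) := by
  obtain ⟨N, hN⟩ := exists_low_nat hl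
  have hN' : ∀ a < -1 - (N : ℤ), ∀ c, dps u e a c = 0 := fun a ha c => by
    have : u a = fun _ => 0 := funext (hN a ha)
    rw [dps, this]; simp [dp]
  have d1 : ∀ k ∈ Finset.range N, DifferentiableAt ℝ
      (fun p => avg (coordC i * fam (u (-2 - (k : ℤ))) p * fams w p k)) p := fun k _ =>
    ((contDiffOn_avg_mul (coordC i) (hu (-2 - k)) (hw k)).contDiffAt
      (isOpen_Par.mem_nhds hp)).differentiableAt (by simp)
  have d2 : DifferentiableAt ℝ (fun p => Q K i (fam (u (-1)) p) (fams w p (-1))) p :=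
    ((contDiffOn_W (quad_Ccoef K) (quad_Ccoef K).one_sub i (hu _) (hw _)).contDiffAt
      (isOpen_Par.mem_nhds hp)).differentiableAt (by simp)
  simp only [tform_fams_eq hN, tform_fams_eq hN']
  have d3 : DifferentiableAt ℝ (fun p => ∑ k ∈ Finset.range N,
      avg (coordC i * fam (u (-2 - (k : ℤ))) p * fams w p k)) p := DifferentiableAt.fun_sum d1
  have d4 : DifferentiableAt ℝ (fun p => ∑ k ∈ Finset.range N,
      avg (coordC i * fam (u (-2 - (k : ℤ))) p * fams w p k) +
        Q K i (fam (u (-1)) p) (fams w p (-1))) p := d3.add d2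
  rw [fderiv_const_mul d4, fderiv_fun_add d3 d2, fderiv_fun_sum d1, _root_.smul_apply,
    _root_.add_apply, sum_apply, smul_eq_mul, ← mul_add]
  have e1 : ∀ k ∈ Finset.range N,
      fderiv ℝ (fun p => avg (coordC i * fam (u (-2 - (k : ℤ))) p * fams w p k)) p e =
      avg (coordC i * fam (dps u e (-2 - k)) p * fams w p k) +
        avg (coordC i * fam (u (-2 - k)) p * fams (dps w e) p k) := fun k _ =>
    fderiv_avg_mul (coordC i) (hu _) (hw _) hp e
  have e2 : fderiv ℝ (fun p => Q K i (fam (u (-1)) p) (fams w p (-1))) p e =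
      Q K i (fam (dps u e (-1)) p) (fams w p (-1)) +
        Q K i (fam (u (-1)) p) (fams (dps w e) p (-1)) :=
    fderiv_W (quad_Ccoef K) (quad_Ccoef K).one_sub i (hu _) (hw _) hp e
  rw [Finset.sum_congr rfl e1, e2, Finset.sum_add_distrib]
  ring

/-! ### Gradients of the coefficients -/

/-- The gradients `∂_i u_{a+1}`, of degree `a`. -/
def grads (i : Fin 3) (u : ℤ → E3 × Param → ℝ) : ℤ → E3 × Param → ℝ :=
  fun a c => dz (u (a + 1)) c (ex i)

lemma grads_low (hu : ∃ b, ∀ a < b, ∀ c, u a c = 0) (i : Fin 3) :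
    ∃ b, ∀ a < b, ∀ c, grads i u a c = 0 := by
  obtain ⟨b, hb⟩ := hu
  refine ⟨b - 1, fun a ha c => ?_⟩
  have : u (a + 1) = fun _ => 0 := funext (hb _ (by omega))
  rw [grads, this]; simp [dz]

lemma grads_homog (hu : ∀ a, Homog a (u a)) (i : Fin 3) (a : ℤ) : Homog a (grads i u a) := by
  have := (hu (a + 1)).dz_apply (X := fun _ => ex i) contDiffOn_const
  exact this.cast (by ring)

lemma fam_grads (hu : ∀ a, Homog a (u a)) (hp : p ∈ Par) (i : Fin 3) (a : ℤ) :
    fam (grads i u a) p = gradC i fun z => u (a + 1) (z, p) := by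
  rw [fam, gradC]
  congr 1; ext n
  exact dz_eq_pdx (hu _).smooth (S2_ne_zero n) hp i

lemma avg_coord_mul_eq_mean (i : Fin 3) {f g : CS} {h h' : E3 → ℝ} (hf : ∀ n : S2, f n = h n)
    (hg : ∀ n : S2, g n = h' n) : avg (coordC i * f * g) = mean fun z => z i * h z * h' z := by
  rw [avg_apply, mean]; congr 1; ext n
  rw [ContinuousMap.mul_apply, ContinuousMap.mul_apply, coordC_apply, hf, hg]

/-- The identity behind the commutation of the derivatives. -/
lemma tform_grads_symm (hl : ∃ b, ∀ a < b, ∀ c, u a c = 0) (hu : ∀ a, Homog a (u a))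
    (hw : ∀ a, Homog a (w a)) (hp : p ∈ Par) (K : ℝ) (i l : Fin 3) :
    tform K i (fams (grads l u) p) (fams w p) - tform K l (fams u p) (fams (grads i w) p) =
      tform K l (fams (grads i u) p) (fams w p) - tform K i (fams u p) (fams (grads l w) p) := by
  obtain ⟨N, hN⟩ := exists_low_nat hl
  have hN' : ∀ i, ∀ a < -1 - ((N + 1 : ℕ) : ℤ), ∀ c, grads i u a c = 0 := fun i a ha c => by
    have : u (a + 1) = fun _ => 0 := funext (hN _ (by push_cast at ha; omega))
    rw [grads, this]; simp [dz]
  -- The gradient shifts the orders by one, so that both forms pair `u_{-1-k}` with `w_k`. The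
  -- missing term `k = 0` of the second form is supplied by exchanging the arguments of its `Q`.
  have key : ∀ i l, tform K i (fams (grads l u) p) (fams w p) -
      tform K l (fams u p) (fams (grads i w) p) = 4 * Real.pi *
      (∑ k ∈ Finset.range (N + 1), (avg (coordC i * fam (grads l u (-2 - k)) p * fam (w k) p) -
        avg (coordC l * fam (u (-1 - k)) p * fam (grads i w (k - 1)) p)) +
      (Q K i (fam (grads l u (-1)) p) (fam (w (-1)) p) +
        Q K l (fam (grads i w (-1)) p) (fam (u (-1)) p))) := fun i l => by
    rw [tform_fams_eq (hN' l), tform_fams_eq hN, Finset.sum_sub_distrib,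
      Finset.sum_range_succ' (fun k : ℕ => avg (coordC l * fam (u (-1 - k)) p * _))]
    have h1 := (rap_fam (hu (-1)).smooth hp).Q_add_swap K l (fam (grads i w (-1)) p)
    have e : ∀ k : ℕ, avg (coordC l * fam (u (-1 - ((k + 1 : ℕ) : ℤ))) p *
        fam (grads i w (((k + 1 : ℕ) : ℤ) - 1)) p) =
        avg (coordC l * fam (u (-2 - k)) p * fam (grads i w k) p) := fun k => by
      push_cast
      rw [show -1 - ((k : ℤ) + 1) = -2 - k by ring, show (k : ℤ) + 1 - 1 = k by ring]
    simp only [e, fams]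
    rw [show (-1 : ℤ) - ((0 : ℕ) : ℤ) = -1 by norm_num, show ((0 : ℕ) : ℤ) - 1 = -1 by norm_num]
    linear_combination (-4 * Real.pi) * h1
  rw [key, key]
  congr 1
  -- Here the gradients are those of `u_0` and `w_0`, of degree zero as `Rap.Q_grad_symm` requires.
  have hq1 : Q K i (fam (grads l u (-1)) p) (fam (w (-1)) p) =
      Q K l (fam (grads i u (-1)) p) (fam (w (-1)) p) := by
    rw [fam_grads hu hp, fam_grads hu hp]
    exact (rap_fam (hw (-1)).smooth hp).Q_grad_symm K ((hu 0).slice hp) l i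
  have hq2 : Q K l (fam (grads i w (-1)) p) (fam (u (-1)) p) =
      Q K i (fam (grads l w (-1)) p) (fam (u (-1)) p) := by
    rw [fam_grads hw hp, fam_grads hw hp]
    exact (rap_fam (hu (-1)).smooth hp).Q_grad_symm K ((hw 0).slice hp) i l
  rw [hq1, hq2]
  congr 1
  refine Finset.sum_congr rfl fun k _ => ?_
  have hu1 := (hu (-1 - k)).slice hp
  have hw1 := (hw k).slice hp
  -- For each `k` the degrees are `-1 - k` and `k`; the antisymmetric identity needs no relation
  -- between them.
  have h1 := mean_coord_pdx_antisymm hu1 hw1 i l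
  have e1 : ∀ i l, avg (coordC i * fam (grads l u (-2 - k)) p * fam (w k) p) =
      mean fun z => z i * pdx l (fun z => u (-1 - k) (z, p)) z * w k (z, p) := fun i l => by
    refine avg_coord_mul_eq_mean i (fun n => ?_) fun n => fam_apply (hw _).smooth.continuousOn hp n
    rw [fam_grads hu hp, show -2 - (k : ℤ) + 1 = -1 - k by ring, gradC_apply hu1]
  have e2 : ∀ i l, avg (coordC l * fam (u (-1 - k)) p * fam (grads i w (k - 1)) p) =
      mean fun z => z l * u (-1 - k) (z, p) * pdx i (fun z => w k (z, p)) z := fun i l => by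
    refine avg_coord_mul_eq_mean l (fun n => fam_apply (hu _).smooth.continuousOn hp n) fun n => ?_
    rw [fam_grads hw hp, show (k : ℤ) - 1 + 1 = k by ring, gradC_apply hw1]
  rw [e1, e1, e2, e2]
  linarith

end Hadamard
end

noncomputable section
namespace Hadamard

variable {j : Fin 2} {F G H : Fun} {u w : ℤ → E3 × Param → ℝ} {p : Param}

/-! ### The brackets with the distributions at a source point -/

lemma HExp.zero : HExp j (fun _ => 0) (fun _ _ => 0) := by
  have := HExp.of_homog (j := j) (Homog.zero (a := 0))
  simpa using this

lemma HExp.sum {ι : Type*} (t : Finset ι) {F : ι → Fun} {u : ι → ℤ → E3 × Param → ℝ}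
    (h : ∀ k ∈ t, HExp j (F k) (u k)) :
    HExp j (fun c => ∑ k ∈ t, F k c) (fun a c => ∑ k ∈ t, u k a c) := by
  classical
  induction t using Finset.induction_on with
  | empty => simpa using HExp.zero
  | insert k t hk ih =>
    have h1 := (h k (Finset.mem_insert_self _ _)).add
      (ih fun i hi => h i (Finset.mem_insert_of_mem hi))
    simpa only [Finset.sum_insert hk] using h1

lemma cmul_single (h : E3 × Param → ℝ) (w : ℤ → E3 × Param → ℝ) (m a : ℤ) (c : E3 × Param) :
    cmul (fun a c => if a = m then h c else 0) w a c = h c * w (a - m) c := by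
  rw [cmul, finsum_eq_single _ m fun b hb => by simp [hb]]
  simp

/-- The bracket of a distribution at a source point. -/
lemma deltaPf_eq {ι : Type*} (t : Finset ι) {A : ι → E3 × Param → ℝ} {m : ι → ℤ}
    (hA : ∀ k ∈ t, ContDiffOn ℝ ∞ (A k) Dom)
    (hH : ∀ c ∈ Reg, H c = ∑ k ∈ t, A k (dir j c, c.2) * rad j c ^ m k) (hG : HExp j G w)
    (hp : p ∈ Par) :
    deltaPf j H G p = ∑ k ∈ t, angMean fun n => A k (n, p) * w (-m k) (n, p) := by
  have h1 : HExp j (H * G) (fun a c => ∑ k ∈ t, cmul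
      (fun a c => if a = m k then homogExt (fun _ => A k) (m k) c else 0) w a c) := by
    refine (HExp.sum t fun k hk => (HExp.of_homog (homog_homogExt (m k) (hA k hk))).mul hG).congr
      fun c hc => ?_
    rw [Pi.mul_apply, hH c hc, Finset.sum_mul]
    refine Finset.sum_congr rfl fun k _ => ?_
    rw [mul_comm (A k _)]
    simp only [relL_apply, rad, dir]
  rw [deltaPf, pfValue]
  have e : coef j (H * G) 0 p = fun n : S2 => ∑ k ∈ t, A k (n, p) * w (-m k) (n, p) := by
    ext n
    rw [coef_eq h1 0 hp n]
    refine Finset.sum_congr rfl fun k _ => ?_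
    rw [cmul_single, zero_sub]
    congr 1
    simp [homogExt]
  rw [e]
  exact angMean_sum t fun k hk => (continuous_slice (hA k hk).continuousOn hp).mul
    (continuous_slice (hG.homog _).smooth.continuousOn hp)

lemma fHat_eq (hF : HExp j F u) (hp : p ∈ Par) (a : ℤ) (l : ℕ) (L : Fin l → Fin 3) :
    fHat j F a p l L = hat l (fam (u a) p) L := by
  rw [fHat]
  change _ = _ * _
  congr 2; ext n
  rw [coef_eq hF a hp, fam_apply (hF.homog a).smooth.continuousOn hp]

lemma contDiffOn_hat {u : E3 × Param → ℝ} (hu : ContDiffOn ℝ ∞ u Dom) (l : ℕ)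
    (L : Fin l → Fin 3) : ContDiffOn ℝ ∞ (fun p => hat l (fam u p) L) Par := by
  simp only [hat_apply_eq]
  exact contDiffOn_const.mul (avg.contDiff.comp_contDiffOn
    (contDiffOn_const.mul (contDiffOn_fam hu)))

lemma nHat_eq_uT (l : ℕ) (L : Fin l → Fin 3) (z : E3) :
    nHat l z L = uT l (stfProj l (EuclideanSpace.single L 1)) z := by
  rw [stfProj, ← dotT_nHat, dotT, Finset.sum_eq_single L] <;> simp +contextual

lemma contDiff_nHat (l : ℕ) (L : Fin l → Fin 3) : ContDiff ℝ ∞ fun z : E3 => nHat l z L := by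
  simp only [nHat_eq_uT]; exact contDiff_uT _ _

lemma contDiff_nTensor (l : ℕ) (L : Fin l → Fin 3) : ContDiff ℝ ∞ fun z : E3 => nTensor l z L := by
  simp only [nTensor]
  exact contDiff_prod fun k _ => contDiff_coord _

lemma contDiffOn_tensor_sum {l m : ℕ} {h : (Fin l → Fin 3) → E3 → ℝ} (hh : ∀ L, ContDiff ℝ ∞ (h L))
    {u : E3 × Param → ℝ} (hu : ContDiffOn ℝ ∞ u Dom) (M : (Fin l → Fin 3) → Fin m → Fin 3) :
    ContDiffOn ℝ ∞ (fun c : E3 × Param => ∑ L, h L c.1 * hat m (fam u c.2) (M L)) Dom :=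
  ContDiffOn.sum fun L _ => ((hh L).comp contDiff_fst).contDiffOn.mul
    ((contDiffOn_hat hu m (M L)).comp contDiff_snd.contDiffOn fun _ hc => (mem_Dom.1 hc).2)

lemma sum_nTensor_cons (i : Fin 3) (l : ℕ) (T : Tensor l) (z : E3) :
    ∑ L, nTensor (l + 1) z (Fin.cons i L) * T L = z i * uT l T z := by
  rw [uT, Finset.mul_sum]
  refine Finset.sum_congr rfl fun L _ => ?_
  simp only [nTensor, Fin.prod_univ_succ, Fin.cons_zero, Fin.cons_succ]
  ring

lemma sum_nTensor_contr (i : Fin 3) (l : ℕ) (T : Tensor (l + 1)) (z : E3) :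
    ∑ L, nTensor l z L * T (Fin.cons i L) = uT l (contr i T) z := by
  rw [uT]
  exact Finset.sum_congr rfl fun L _ => mul_comm _ _

lemma angMean_comb (r t : ℝ) {f g : S2 → ℝ} (hf : Continuous f) (hg : Continuous g) :
    angMean (fun n => r * f n + t * g n) = r * angMean f + t * angMean g := by
  rw [← angMean_mul, ← angMean_mul]
  exact angMean_add (continuous_const.mul hf) (continuous_const.mul hg)

/-- The bracket of the isotropic terms. -/
lemma deltaPf_isoFun (hF : HExp j F u) (hG : HExp j G w) (hp : p ∈ Par) (α β : ℝ) (i : Fin 3)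
    (k l : ℕ) : deltaPf j (isoFun α β j i k l F) G p =
      α * X i l (fam (u (-1 - k)) p) (fam (w (k - 1)) p) +
      β * ((2 * l + 3) / (l + 1)) * X i l (fam (w (k - 1)) p) (fam (u (-1 - k)) p) := by
  have hu := (hF.homog (-1 - k)).smooth
  have hw := (hG.homog (k - 1)).smooth
  have s1 := contDiffOn_tensor_sum (fun L => contDiff_nHat (l + 1) (Fin.cons i L)) hu
    (fun L : Fin l → Fin 3 => L)
  have s2 := contDiffOn_tensor_sum (fun L => contDiff_nTensor l L) hu
    (fun L : Fin l → Fin 3 => (Fin.cons i L : Fin (l + 1) → Fin 3))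
  have h := deltaPf_eq (j := j) (H := isoFun α β j i k l F) (G := G) (w := w) (p := p)
    (Finset.univ : Finset (Fin 1)) (m := fun _ => 1 - k)
    (A := fun _ c => α * ∑ L : Fin l → Fin 3, nHat (l + 1) c.1 (Fin.cons i L) *
        hat l (fam (u (-1 - k)) c.2) L +
      β * ∑ L : Fin l → Fin 3, nTensor l c.1 L * hat (l + 1) (fam (u (-1 - k)) c.2) (Fin.cons i L))
    (fun _ _ => (contDiffOn_const.mul s1).add (contDiffOn_const.mul s2))
    (fun c hc => by simp [isoFun, fHat_eq hF hc.1]) hG hp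
  rw [h, Fin.sum_univ_one, show -(1 - (k : ℤ)) = k - 1 by ring]
  have hg : ∀ n : S2, w (k - 1) (n, p) = fam (w (k - 1)) p n := fun n =>
    (fam_apply hw.continuousOn hp n).symm
  have c1 : Continuous fun n : S2 => (∑ L : Fin l → Fin 3, nHat (l + 1) n (Fin.cons i L) *
        hat l (fam (u (-1 - k)) p) L) * fam (w (k - 1)) p n :=
    Continuous.mul (continuous_finsetSum _ fun L _ =>
      Continuous.mul (continuous_nHat_apply _ _) continuous_const) (fam (w (k - 1)) p).continuous
  have c2 : Continuous fun n : S2 => (∑ L : Fin l → Fin 3, nTensor l n L *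
        hat (l + 1) (fam (u (-1 - k)) p) (Fin.cons i L)) * fam (w (k - 1)) p n := by
    refine Continuous.mul (continuous_finsetSum _ fun L _ => ?_) (fam (w (k - 1)) p).continuous
    exact ((contDiff_nTensor l L).continuous.comp continuous_subtype_val).mul continuous_const
  have e : (fun n : S2 => (α * ∑ L : Fin l → Fin 3, nHat (l + 1) n (Fin.cons i L) *
        hat l (fam (u (-1 - k)) p) L +
      β * ∑ L : Fin l → Fin 3, nTensor l n L * hat (l + 1) (fam (u (-1 - k)) p) (Fin.cons i L)) *
        w (k - 1) (n, p)) = fun n : S2 => α * ((∑ L : Fin l → Fin 3, nHat (l + 1) n (Fin.cons i L) *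
        hat l (fam (u (-1 - k)) p) L) * fam (w (k - 1)) p n) + β * ((∑ L : Fin l → Fin 3,
        nTensor l n L * hat (l + 1) (fam (u (-1 - k)) p) (Fin.cons i L)) * fam (w (k - 1)) p n) := by
    ext n; rw [hg]; ring
  change angMean (fun n : S2 => (α * ∑ L : Fin l → Fin 3, nHat (l + 1) n (Fin.cons i L) *
        hat l (fam (u (-1 - k)) p) L +
      β * ∑ L : Fin l → Fin 3, nTensor l n L * hat (l + 1) (fam (u (-1 - k)) p) (Fin.cons i L)) *
        w (k - 1) (n, p)) = _
  -- The first term sees the component of degree `l + 1` of `g`, the second one its component of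
  -- degree `l`, with the factor of `avg_contr`.
  rw [e, angMean_comb α β c1 c2,
    angMean_nHat_cons i (hat_mem l _), mul_assoc β, ← avg_contr, avg_apply]
  simp only [sum_nTensor_contr]
  rfl

/-- The bracket of the explicit terms. -/
lemma deltaPf_pointFun (hF : HExp j F u) (hG : HExp j G w) (hp : p ∈ Par) {N : ℕ}
    (hN : ∀ a < -1 - (N : ℤ), ∀ c, u a c = 0) (K : ℝ) (i : Fin 3) (l : ℕ) :
    deltaPf j (pointFun K j i l F) G p =
      Ccoef K l * (avg (coordC i * pr l (fam (u (-1)) p) * fam (w (-1)) p) -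
        avg (harm l (contr i (hat (l + 1) (fam (u (-1)) p))) * fam (w (-1)) p)) +
      ∑ k ∈ Finset.range N, avg (coordC i * pr l (fam (u (-2 - k)) p) * fam (w k) p) := by
  -- `none` is the term in `r_j`, of order 1, and `some k` the term in `r_j ^ (-k)`. Only `k < N`
  -- matter because `f_{-2-k}` vanishes beyond.
  let A : Option ℕ → E3 × Param → ℝ := fun o => match o with
    | none => fun c => Ccoef K l *
        (∑ L : Fin l → Fin 3, nTensor (l + 1) c.1 (Fin.cons i L) * hat l (fam (u (-1)) c.2) L -
        ∑ L : Fin l → Fin 3, nTensor l c.1 L * hat (l + 1) (fam (u (-1)) c.2) (Fin.cons i L))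
    | some k => fun c => ∑ L : Fin l → Fin 3,
        nTensor (l + 1) c.1 (Fin.cons i L) * hat l (fam (u (-2 - k)) c.2) L
  let m : Option ℕ → ℤ := fun o => match o with
    | none => 1
    | some k => -k
  have hA : ∀ o, ContDiffOn ℝ ∞ (A o) Dom := fun o => match o with
    | none => contDiffOn_const.mul ((contDiffOn_tensor_sum
        (fun L => contDiff_nTensor (l + 1) (Fin.cons i L)) (hF.homog (-1)).smooth
        (fun L : Fin l → Fin 3 => L)).sub (contDiffOn_tensor_sum (fun L => contDiff_nTensor l L)
        (hF.homog (-1)).smooth (fun L : Fin l → Fin 3 => (Fin.cons i L : Fin (l + 1) → Fin 3))))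
    | some k => contDiffOn_tensor_sum
        (fun L => contDiff_nTensor (l + 1) (Fin.cons i L)) (hF.homog (-2 - k)).smooth
        (fun L : Fin l → Fin 3 => L)
  have h := deltaPf_eq (j := j) (H := pointFun K j i l F) (G := G) (w := w) (p := p)
    (Finset.insertNone (Finset.range N)) (A := A) (m := m) (fun o _ => hA o) (fun c hc => by
      rw [Finset.sum_insertNone, pointFun]
      simp only [fHat_eq hF hc.1, A, m, zpow_one]
      congr 1
      refine finsum_eq_sum_of_support_subset _ fun k hk => ?_
      simp only [Finset.coe_range, Set.mem_Iio]
      by_contra hkN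
      refine hk ?_
      have e : fam (u (-2 - (k : ℤ))) c.2 = (0 : ℝ) • fam (u (-2 - (k : ℤ))) c.2 := by
        have : u (-2 - (k : ℤ)) = fun _ => 0 := funext (hN _ (by omega))
        rw [this, zero_smul, fam]
        ext n; rw [toC_apply continuous_const]; rfl
      have e2 : ∀ L, hat l (fam (u (-2 - (k : ℤ))) c.2) L = 0 := fun L => by
        rw [e, hat_smul, zero_smul]; rfl
      simp [e2]) hG hp
  rw [h, Finset.sum_insertNone]
  have hg : ∀ a (n : S2), w a (n, p) = fam (w a) p n := fun a n =>
    (fam_apply (hG.homog a).smooth.continuousOn hp n).symm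
  congr 1
  · rw [← map_sub, ← smul_eq_mul, ← map_smul, avg_apply]
    congr 1; ext n
    simp only [A, m, hg, sum_nTensor_cons, sum_nTensor_contr]
    simp [pr]
    ring
  · refine Finset.sum_congr rfl fun k _ => ?_
    rw [avg_apply]
    congr 1; ext n
    simp only [A, m, hg, sum_nTensor_cons, neg_neg]
    simp [pr]

lemma Quad.mul_bdd {A B : ℕ → ℝ} (hA : Quad A) {r : ℝ} (hB : ∀ l, |B l| ≤ r) :
    Quad fun l => A l * B l := by
  obtain ⟨c, hc⟩ := hA
  refine ⟨c * r, fun l => ?_⟩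
  rw [abs_mul, mul_right_comm]
  exact mul_le_mul (hc l) (hB l) (abs_nonneg _) ((abs_nonneg _).trans (hc l))

lemma abs_ratio_le (l : ℕ) : |((2 * l + 3) / (l + 1) : ℝ)| ≤ 3 := by
  rw [abs_of_pos (by positivity), div_le_iff₀ (by positivity)]
  linarith [(Nat.cast_nonneg l : (0 : ℝ) ≤ l)]

/-- The sum over the multipoles of the contribution of order `k = 0`. -/
lemma Rap.hasSum_Q' {ψ : CS} (hψ : Rap ψ) (K : ℝ) (b : Fin 3) (f : CS) :
    HasSum (fun l => Ccoef K l * (avg (coordC b * pr l ψ * f) -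
      avg (harm l (contr b (hat (l + 1) ψ)) * f))) (Q K b ψ f) := by
  have h := hψ.hasSum_Q K b f
  -- The two halves must be summable separately, because the index is shifted in the first one only.
  have hB : Summable fun l => Ccoef K l * avg (harm l (contr b (hat (l + 1) ψ)) * f) := by
    have := hψ.summable_right ((quad_Ccoef K).mul_bdd abs_ratio_le) b f
    refine this.congr fun l => ?_
    rw [avg_contr]; ring
  have hA : Summable fun l => Ccoef K (l + 1) * avg (coordC b * pr (l + 1) ψ * f) := by
    refine (h.summable.add hB).congr fun l => ?_
    ring
  have h1 := (hasSum_nat_add_iff (f := fun l => Ccoef K l * avg (coordC b * pr l ψ * f)) 1).1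
    hA.hasSum
  rw [Finset.sum_range_one] at h1
  have h2 := h.unique (hA.hasSum.sub hB.hasSum)
  have h3 := h1.sub hB.hasSum
  have e : (∑' l, Ccoef K (l + 1) * avg (coordC b * pr (l + 1) ψ * f)) +
      Ccoef K 0 * avg (coordC b * pr 0 ψ * f) -
      ∑' l, Ccoef K l * avg (harm l (contr b (hat (l + 1) ψ)) * f) = Q K b ψ f := by linarith
  rw [e] at h3
  have e2 : (fun l => Ccoef K l * (avg (coordC b * pr l ψ * f) -
      avg (harm l (contr b (hat (l + 1) ψ)) * f))) = fun l =>
      Ccoef K l * avg (coordC b * pr l ψ * f) -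
      Ccoef K l * avg (harm l (contr b (hat (l + 1) ψ)) * f) := by ext l; ring
  rw [e2]
  exact h3

lemma hasSum_deltaPf_pointFun (hF : HExp j F u) (hG : HExp j G w) (hp : p ∈ Par) {N : ℕ}
    (hN : ∀ a < -1 - (N : ℤ), ∀ c, u a c = 0) (K : ℝ) (i : Fin 3) :
    HasSum (fun l => deltaPf j (pointFun K j i l F) G p)
      (Q K i (fam (u (-1)) p) (fam (w (-1)) p) +
        ∑ k ∈ Finset.range N, avg (coordC i * fam (u (-2 - k)) p * fam (w k) p)) := by
  have h1 := (rap_fam (hF.homog (-1)).smooth hp).hasSum_Q' K i (fam (w (-1)) p)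
  have h2 : ∀ k ∈ Finset.range N, HasSum (fun l => avg (coordC i * pr l (fam (u (-2 - k)) p) *
      fam (w k) p)) (avg (coordC i * fam (u (-2 - k)) p * fam (w k) p)) := fun k _ => by
    have h := hasSum_avg_pr (fam (u (-2 - k)) p) (coordC i * fam (w k) p)
    have e : ∀ f : CS, f * (coordC i * fam (w k) p) = coordC i * f * fam (w k) p := fun f => by ring
    simpa only [e] using h
  have h3 := h1.add (hasSum_sum h2)
  have e : (fun l => deltaPf j (pointFun K j i l F) G p) = fun l =>
      Ccoef K l * (avg (coordC i * pr l (fam (u (-1)) p) * fam (w (-1)) p) -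
        avg (harm l (contr i (hat (l + 1) (fam (u (-1)) p))) * fam (w (-1)) p)) +
      ∑ k ∈ Finset.range N, avg (coordC i * pr l (fam (u (-2 - k)) p) * fam (w k) p) :=
    funext fun l => deltaPf_pointFun hF hG hp hN K i l
  rw [e]
  exact h3

lemma summable_deltaPf_pointFun (hF : InF F) (hG : InF G) (hp : p ∈ Par) (K : ℝ) (j : Fin 2)
    (i : Fin 3) : Summable fun l => deltaPf j (pointFun K j i l F) G p := by
  obtain ⟨N, hN⟩ := exists_low_nat (hF.hExp j).bdd
  exact (hasSum_deltaPf_pointFun (hF.hExp j) (hG.hExp j) hp hN K i).summable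

/-- Parseval sums the multipoles of `f_{-2-k}` to the plain average `⟨n_i f_{-2-k} g_k⟩`, and those
of `f_{-1}` give `Q`. From here on only `tform` is manipulated. -/
lemma pointTerm_eq (hF : HExp j F u) (hG : HExp j G w) (hp : p ∈ Par) (K : ℝ) (i : Fin 3) :
    pointTerm K j i F G p = tform K i (fams u p) (fams w p) := by
  obtain ⟨N, hN⟩ := exists_low_nat hF.bdd
  rw [pointTerm, (hasSum_deltaPf_pointFun hF hG hp hN K i).tsum_eq, tform_fams_eq hN, add_comm]
  rfl

end Hadamard
end

noncomputable section
namespace Hadamard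

variable {v : Fin 2 → ℝ → E3} {j : Fin 2} {F G F' G' H : Fun} {u w : ℤ → E3 × Param → ℝ} {p : Param}
  {K : Fin 2 → ℝ}

/-! ### Structure of the explicit terms -/

/-- The weights of `X_l(f_{-1-k}, g_{k-1})` in the explicit terms, divided by `4π`. -/
def isoA (K : ℝ) (k l : ℕ) : ℝ := if k = 0 then Ccoef K l else 1

/-- The weights of `X_l(g_{k-1}, f_{-1-k})` in the explicit terms, divided by `4π`. -/
def isoB (K : ℝ) (k l : ℕ) : ℝ := if k = 0 then 1 - Ccoef K l else 1

lemma quad_isoA (K : ℝ) (k : ℕ) : Quad (isoA K k) := by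
  by_cases hk : k = 0
  · have : isoA K k = Ccoef K := by ext l; simp [isoA, hk]
    rw [this]; exact quad_Ccoef K
  · have : isoA K k = fun _ => 1 := by ext l; simp [isoA, hk]
    rw [this]; exact quad_one

lemma quad_isoB (K : ℝ) (k : ℕ) : Quad (isoB K k) := by
  by_cases hk : k = 0
  · have : isoB K k = fun l => 1 - Ccoef K l := by ext l; simp [isoB, hk]
    rw [this]; exact (quad_Ccoef K).one_sub
  · have : isoB K k = fun _ => 1 := by ext l; simp [isoB, hk]
    rw [this]; exact quad_one

lemma W_iso_zero (K : ℝ) (i : Fin 3) (f g : CS) : W (isoA K 0) (isoB K 0) i f g = Q K i f g := by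
  simp [W, Q, isoA, isoB]

lemma Rap.W_iso_succ {f : CS} (hf : Rap f) (K : ℝ) (i : Fin 3) (k : ℕ) (g : CS) :
    W (isoA K (k + 1)) (isoB K (k + 1)) i f g = avg (coordC i * f * g) := by
  have s1 : Summable fun l => X i l f g := by simpa using hf.summable_left quad_one i g
  have s2 : Summable fun l => X i l g f := by simpa using hf.summable_right quad_one i g
  rw [hf.avg_coord_mul, ← s1.tsum_add s2]
  simp [W, isoA, isoB]

/-- Both parts of the form take one shape when `f_{-1-k}` is paired with `g_{k-1}`: order `k = 0` is
`Q`, and for `k ≥ 1` both weights are 1, which is the full average of `n_i f g`. -/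
lemma tform_eq_finsum (hF : HExp j F u) (hp : p ∈ Par) (K : ℝ) (i : Fin 3) (W' : ℤ → CS) :
    (∃ N : ℕ, ∀ k, N ≤ k → W (isoA K k) (isoB K k) i (fam (u (-1 - k)) p) (W' (k - 1)) = 0) ∧
    tform K i (fams u p) W' = 4 * Real.pi *
      ∑ᶠ k : ℕ, W (isoA K k) (isoB K k) i (fam (u (-1 - k)) p) (W' (k - 1)) := by
  obtain ⟨N, hN⟩ := exists_low_nat hF.bdd
  have hz : ∀ k, N + 1 ≤ k →
      W (isoA K k) (isoB K k) i (fam (u (-1 - k)) p) (W' (k - 1)) = 0 := fun k hk => by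
    have e : fam (u (-1 - (k : ℤ))) p = (0 : ℝ) • fam (u (-1 - (k : ℤ))) p := by
      have : u (-1 - (k : ℤ)) = fun _ => 0 := funext (hN _ (by omega))
      rw [this, zero_smul, fam]
      ext n; rw [toC_apply continuous_const]; rfl
    rw [e, W_smul_left, zero_mul]
  refine ⟨⟨N + 1, hz⟩, ?_⟩
  rw [finsum_eq_sum_of_support_subset (s := Finset.range (N + 1)), Finset.sum_range_succ',
    tform_fams_eq hN]
  · have e : ∀ k : ℕ, W (isoA K (k + 1)) (isoB K (k + 1)) i
        (fam (u (-1 - ((k + 1 : ℕ) : ℤ))) p) (W' (((k + 1 : ℕ) : ℤ) - 1)) =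
        avg (coordC i * fam (u (-2 - k)) p * W' k) := fun k => by
      rw [(rap_fam (hF.homog _).smooth hp).W_iso_succ]
      push_cast
      rw [show -1 - ((k : ℤ) + 1) = -2 - k by ring, show (k : ℤ) + 1 - 1 = k by ring]
    simp only [e]
    rw [W_iso_zero]
    simp
  · intro k hk
    simp only [Finset.coe_range, Set.mem_Iio]
    by_contra hkN
    exact hk (hz k (by omega))

/-- The explicit terms use `n^{iL}`, the isotropic ones `n̂^{iL}`. Both become weighted sums of
`X_l`, and the factor `(l+1)/(2l+3)` in the second family of coefficients compensates the one in
`deltaPf_isoFun`. -/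
lemma isotropicForm_pointTerm (J : Finset (Fin 2)) (σ : ℝ) (K : Fin 2 → ℝ)
    {T : Fin 3 → Fun → Fun → Param → ℝ} (hT : ∀ i F G, InF F → InF G → ∀ p ∈ Par,
      T i F G p = ∑ j ∈ J, σ * pointTerm (K j) j i F G p) : IsotropicForm J T := by
  refine ⟨fun j k l => σ * (4 * Real.pi) * isoA (K j) k l,
    fun j k l => σ * (4 * Real.pi) * isoB (K j) k l * ((l + 1) / (2 * l + 3)),
    fun i F G hF hG p hp => ?_⟩
  have key : ∀ j k, HasSum (fun l => deltaPf j (isoFun (σ * (4 * Real.pi) * isoA (K j) k l)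
      (σ * (4 * Real.pi) * isoB (K j) k l * ((l + 1) / (2 * l + 3))) j i k l F) G p)
      (σ * (4 * Real.pi) * W (isoA (K j) k) (isoB (K j) k) i (fam (hcoef j F (-1 - k)) p)
        (fam (hcoef j G (k - 1)) p)) := fun j k => by
    have h := ((rap_fam ((hF.hExp j).homog (-1 - k)).smooth hp).summable_W (quad_isoA (K j) k)
      (quad_isoB (K j) k) i (fam (hcoef j G (k - 1)) p)).hasSum.mul_left (σ * (4 * Real.pi))
    have e : (fun l => deltaPf j (isoFun (σ * (4 * Real.pi) * isoA (K j) k l)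
        (σ * (4 * Real.pi) * isoB (K j) k l * ((l + 1) / (2 * l + 3))) j i k l F) G p) = fun l =>
        σ * (4 * Real.pi) * (isoA (K j) k l * X i l (fam (hcoef j F (-1 - k)) p)
          (fam (hcoef j G (k - 1)) p) + isoB (K j) k l * X i l (fam (hcoef j G (k - 1)) p)
          (fam (hcoef j F (-1 - k)) p)) := by
      ext l
      rw [deltaPf_isoFun (hF.hExp j) (hG.hExp j) hp]
      have h1 : (l : ℝ) + 1 ≠ 0 := by positivity
      have h2 : 2 * (l : ℝ) + 3 ≠ 0 := by positivity
      field_simp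
    rw [e]
    exact h
  refine ⟨fun j _ k => (key j k).summable, ?_⟩
  rw [hT i F G hF hG p hp]
  refine Finset.sum_congr rfl fun j _ => ?_
  simp only [(key j _).tsum_eq]
  rw [pointTerm_eq (hF.hExp j) (hG.hExp j) hp,
    (tform_eq_finsum (hF.hExp j) hp (K j) i (fams (hcoef j G) p)).2, ← mul_assoc, ← smul_eq_mul,
    smul_finsum]
  rfl

/-- The functions on the sphere with rapidly decreasing harmonic components. -/
def rapSub : Submodule ℝ CS where
  carrier := {f | Rap f}
  add_mem' hf hg := Rap.add hf hg
  zero_mem' := ⟨0, fun l => by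
    have : pr l 0 = 0 := (prL l).map_zero
    rw [this, smul_zero]⟩
  smul_mem' r _ hf := Rap.smul hf r

/-- A linear extension to all functions of the identity of `rapSub`. -/
lemma exists_rapProj : ∃ P : (S2 → ℝ) →ₗ[ℝ] rapSub, ∀ f : rapSub, P (f : CS) = f := by
  let ι : rapSub →ₗ[ℝ] (S2 → ℝ) :=
    { toFun := fun f => (f : CS)
      map_add' := fun f g => rfl
      map_smul' := fun r f => rfl }
  have hι : LinearMap.ker ι = ⊥ := by
    rw [LinearMap.ker_eq_bot]
    intro f g h
    ext n
    exact congrFun h n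
  obtain ⟨P, hP⟩ := ι.exists_leftInverse_of_injective hι
  exact ⟨P, fun f => LinearMap.congr_fun hP f⟩

lemma coef_eq_fam {u : ℤ → E3 × Param → ℝ} (h : HExp j F u) (a : ℤ) (hp : p ∈ Par) :
    coef j F a p = fam (u a) p := by
  ext n
  rw [coef_eq h a hp, fam_apply (h.homog a).smooth.continuousOn hp]

/-- The series is additive where it converges, whereas a singular form asks for linear maps on all
functions. The form is therefore built on `rapSub` and composed with a linear left inverse of its
inclusion; the coefficients of the class lie in `rapSub`, where nothing is changed. -/
lemma singularForm_pointTerm (K : Fin 2 → ℝ) (d : Fin 2 → Fin 3 → Param → ℝ)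
    {T : Fun → Fun → Param → ℝ} (hT : ∀ F G, InF F → InF G → ∀ p ∈ Par,
      T F G p = ∑ j, ∑ i, d j i p * pointTerm (K j) j i F G p) : SingularForm T := by
  obtain ⟨P, hP⟩ := exists_rapProj
  let B : Fin 2 → ℕ → Param → rapSub →ₗ[ℝ] rapSub →ₗ[ℝ] ℝ := fun j k p =>
    LinearMap.mk₂ ℝ (fun f g => ∑ i, d j i p * (4 * Real.pi *
      W (isoA (K j) k) (isoB (K j) k) i (f : CS) (g : CS)))
      (fun f f' g => by
        rw [← Finset.sum_add_distrib]
        refine Finset.sum_congr rfl fun i _ => ?_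
        rw [Submodule.coe_add, Rap.W_add_left g.2 (quad_isoA _ _) (quad_isoB _ _)]; ring)
      (fun r f g => by
        rw [smul_eq_mul, Finset.mul_sum]
        refine Finset.sum_congr rfl fun i _ => ?_
        rw [Submodule.coe_smul, W_smul_left]; ring)
      (fun f g g' => by
        rw [← Finset.sum_add_distrib]
        refine Finset.sum_congr rfl fun i _ => ?_
        rw [Submodule.coe_add, Rap.W_add_right f.2 (quad_isoA _ _) (quad_isoB _ _)]; ring)
      (fun r f g => by
        rw [smul_eq_mul, Finset.mul_sum]
        refine Finset.sum_congr rfl fun i _ => ?_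
        rw [Submodule.coe_smul, W_smul_right]; ring)
  refine ⟨fun j k p => (B j k p).compl₁₂ P P, fun F G hF hG p hp => ?_⟩
  rw [hT F G hF hG p hp]
  refine Finset.sum_congr rfl fun j _ => ?_
  have e : ∀ k : ℕ, (B j k p).compl₁₂ P P (coef j F (-1 - k) p) (coef j G (k - 1) p) =
      ∑ i, d j i p * (4 * Real.pi * W (isoA (K j) k) (isoB (K j) k) i
        (fam (hcoef j F (-1 - k)) p) (fams (hcoef j G) p (k - 1))) := fun k => by
    rw [coef_eq_fam (hF.hExp j) _ hp, coef_eq_fam (hG.hExp j) _ hp, LinearMap.compl₁₂_apply,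
      hP ⟨_, rap_fam ((hF.hExp j).homog _).smooth hp⟩, hP ⟨_, rap_fam ((hG.hExp j).homog _).smooth hp⟩]
    rfl
  simp only [e]
  have hN := fun i => (tform_eq_finsum (hF.hExp j) hp (K j) i (fams (hcoef j G) p)).1
  choose N hN using hN
  rw [finsum_sum_comm]
  · refine Finset.sum_congr rfl fun i _ => ?_
    rw [pointTerm_eq (hF.hExp j) (hG.hExp j) hp,
      (tform_eq_finsum (hF.hExp j) hp (K j) i (fams (hcoef j G) p)).2]
    rw [← smul_eq_mul, ← smul_eq_mul (4 * Real.pi), smul_finsum, smul_finsum]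
    rfl
  · intro i _
    refine (Set.finite_Iio (N i)).subset fun k hk => ?_
    by_contra hkN
    refine hk ?_
    simp only [hN i k (not_lt.1 hkN)]; simp

end Hadamard
end

/-! ### Existence: the family generated by the explicit first-order terms. -/

noncomputable section
namespace Hadamard

variable {v : Fin 2 → ℝ → E3} {j : Fin 2} {F G F' G' H : Fun} {u w : ℤ → E3 × Param → ℝ} {p : Param}
  {K : Fin 2 → ℝ} {s : Fin 2 → ℝ}

/-! ### Commutation of the ordinary derivatives -/

/-- Two directional derivatives commute when the second differential is symmetric and the vector
fields have zero Lie bracket, which is the last hypothesis. -/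
lemma fderiv_fderiv_comm {E : Type*} [NormedAddCommGroup E] [NormedSpace ℝ E] {S : Set E}
    (hS : IsOpen S) {f : E → ℝ} (hf : ContDiffOn ℝ ∞ f S) {X Y : E → E} (hX : ContDiff ℝ ∞ X)
    (hY : ContDiff ℝ ∞ Y) {p : E} (hp : p ∈ S) (h : fderiv ℝ X p (Y p) = fderiv ℝ Y p (X p)) :
    fderiv ℝ (fun q => fderiv ℝ f q (Y q)) p (X p) =
      fderiv ℝ (fun q => fderiv ℝ f q (X q)) p (Y p) := by
  have hfp := hf.contDiffAt (hS.mem_nhds hp)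
  have hd : DifferentiableAt ℝ (fderiv ℝ f) p :=
    ((hfp.fderiv_right (m := ∞) (by simp)).differentiableAt (by simp))
  have key : ∀ Z : E → E, ContDiff ℝ ∞ Z → ∀ e, fderiv ℝ (fun q => fderiv ℝ f q (Z q)) p e =
      fderiv ℝ f p (fderiv ℝ Z p e) + fderiv ℝ (fderiv ℝ f) p e (Z p) := fun Z hZ e => by
    rw [(hd.hasFDerivAt.clm_apply (hZ.differentiable (by simp) p).hasFDerivAt).fderiv]
    simp
  have hs : IsSymmSndFDerivAt ℝ f p := hfp.isSymmSndFDerivAt (by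
    rw [minSmoothness_of_isRCLikeNormedField]; exact WithTop.coe_le_coe.2 (le_top (a := (2 : ℕ∞))))
  rw [key Y hY, key X hX, h, hs (X p) (Y p)]

/-- Only the field of `∂_t` varies, it depends on the time alone, and no other letter moves the
time. -/
lemma fderiv_paramDir_comm (hv : ∀ j, ContDiff ℝ ∞ (v j)) (a b : Letter) (p : Param) :
    fderiv ℝ (a.paramDir v) p (b.paramDir v p) = fderiv ℝ (b.paramDir v) p (a.paramDir v p) := by
  have h0 : ∀ a : Letter, a ≠ .t → fderiv ℝ (a.paramDir v) p = 0 ∧ (a.paramDir v p).1 = 0 := by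
    intro a ha
    cases a with
    | x i =>
      have : (Letter.x i).paramDir v = fun _ => 0 := rfl
      rw [this]; simp
    | y j i =>
      have : (Letter.y j i).paramDir v = fun _ => if j = 0 then (0, ex i, 0) else (0, 0, ex i) := rfl
      rw [this]; refine ⟨by simp, ?_⟩
      dsimp only; split_ifs <;> rfl
    | t => exact absurd rfl ha
  have ht : ∀ e : Param, e.1 = 0 → fderiv ℝ (Letter.t.paramDir v) p e = 0 := fun e he => by
    have h1 : ∀ j, HasFDerivAt (fun q : Param => v j q.1)
        ((fderiv ℝ (v j) p.1).comp (ContinuousLinearMap.fst ℝ ℝ (E3 × E3))) p := fun j =>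
      (((hv j).differentiable (by simp) p.1).hasFDerivAt).comp p hasFDerivAt_fst
    have h2 := (hasFDerivAt_const (1 : ℝ) p).prodMk ((h1 0).prodMk (h1 1))
    have h3 : fderiv ℝ (Letter.t.paramDir v) p = _ := h2.fderiv
    rw [h3]
    simp [he]
  by_cases ha : a = .t <;> by_cases hb : b = .t
  · rw [ha, hb]
  · rw [ha, ht _ (h0 b hb).2, (h0 b hb).1]; rfl
  · rw [hb, ht _ (h0 a ha).2, (h0 a ha).1]; rfl
  · rw [(h0 b hb).1, (h0 a ha).1]; rfl

lemma pdParam_comm (hv : ∀ j, ContDiff ℝ ∞ (v j)) {f : Param → ℝ} (hf : ContDiffOn ℝ ∞ f Par)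
    (a b : Letter) (hp : p ∈ Par) :
    pdParam v a (pdParam v b f) p = pdParam v b (pdParam v a f) p :=
  fderiv_fderiv_comm isOpen_Par hf (paramDir_contDiff hv a) (paramDir_contDiff hv b) hp
    (fderiv_paramDir_comm hv a b p)

lemma contDiffOn_pdParam (hv : ∀ j, ContDiff ℝ ∞ (v j)) {f : Param → ℝ} (hf : ContDiffOn ℝ ∞ f Par)
    (a : Letter) : ContDiffOn ℝ ∞ (pdParam v a f) Par :=
  (hf.fderiv_of_isOpen isOpen_Par (by simp)).clm_apply (paramDir_contDiff hv a).contDiffOn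

lemma pdParam_congr {f g : Param → ℝ} (h : ∀ q ∈ Par, f q = g q) (a : Letter) (hp : p ∈ Par) :
    pdParam v a f p = pdParam v a g p := by
  have : f =ᶠ[𝓝 p] g := by filter_upwards [isOpen_Par.mem_nhds hp] with q hq using h q hq
  rw [pdParam, pdParam, this.fderiv_eq]

lemma pd_comm (hv : ∀ j, ContDiff ℝ ∞ (v j)) (hF : InF F) (a b : Letter) {c : E3 × Param}
    (hc : c ∈ Reg) : pd v a (pd v b F) c = pd v b (pd v a F) c := by
  have hX : ∀ a : Letter, ContDiff ℝ ∞ fun c : E3 × Param => (a.fieldDir, a.paramDir v c.2) :=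
    fun a => contDiff_const.prodMk ((paramDir_contDiff hv a).comp contDiff_snd)
  have hd : ∀ (a : Letter) (e : E3 × Param),
      fderiv ℝ (fun c : E3 × Param => (a.fieldDir, a.paramDir v c.2)) c e =
        (0, fderiv ℝ (a.paramDir v) c.2 e.2) := fun a e => by
    have h1 : HasFDerivAt (a.paramDir v) _ c.2 :=
      ((paramDir_contDiff hv a).differentiable (by simp) c.2).hasFDerivAt
    have h2 : HasFDerivAt (fun c : E3 × Param => a.paramDir v c.2) _ c := h1.comp c hasFDerivAt_snd
    have h3 := (hasFDerivAt_const a.fieldDir c).prodMk h2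
    rw [h3.fderiv]; rfl
  refine fderiv_fderiv_comm isOpen_Reg hF.1 (hX a) (hX b) hc ?_
  rw [hd, hd]
  exact Prod.ext rfl (fderiv_paramDir_comm hv a b c.2)

lemma pds_perm (hv : ∀ j, ContDiff ℝ ∞ (v j)) {L L' : List Letter} (h : L.Perm L') (hF : InF F) :
    ∀ c ∈ Reg, pds v L F c = pds v L' F c := by
  induction h with
  | nil => exact fun _ _ => rfl
  | cons a _ ih => exact pd_congr a ih
  | swap a b L => exact fun c hc => pd_comm hv (hF.pds hv L) b a hc
  | trans _ _ ih ih' => exact fun c hc => (ih c hc).trans (ih' c hc)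

/-! ### The explicit first-order terms -/

/-- The first-order terms with the constants `K`. -/
def firstTerm (v : Fin 2 → ℝ → E3) (K : Fin 2 → ℝ) (a : Letter) (F G : Fun) (p : Param) : ℝ :=
  ∑ j, ∑ i, a.disp v j p i * pointTerm (K j) j i F G p

lemma pointTerm_congr (hF : InF F) (hG : InF G) (hF' : ∀ c ∈ Reg, F' c = F c)
    (hG' : ∀ c ∈ Reg, G' c = G c) (hp : p ∈ Par) (K : ℝ) (j : Fin 2) (i : Fin 3) :
    pointTerm K j i F' G' p = pointTerm K j i F G p := by
  rw [pointTerm_eq (hF.hExp j) (hG.hExp j) hp,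
    pointTerm_eq ((hF.hExp j).congr hF') ((hG.hExp j).congr hG') hp]

lemma firstTerm_congr (hF : InF F) (hG : InF G) (hF' : ∀ c ∈ Reg, F' c = F c)
    (hG' : ∀ c ∈ Reg, G' c = G c) (hp : p ∈ Par) (K : Fin 2 → ℝ) (a : Letter) :
    firstTerm v K a F' G' p = firstTerm v K a F G p :=
  Finset.sum_congr rfl fun j _ => Finset.sum_congr rfl fun i _ => by
    rw [pointTerm_congr hF hG hF' hG' hp]

lemma contDiffOn_pointTerm (hF : InF F) (hG : InF G) (K : ℝ) (j : Fin 2) (i : Fin 3) :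
    ContDiffOn ℝ ∞ (pointTerm K j i F G) Par :=
  (contDiffOn_tform (hF.hExp j).bdd (fun a => ((hF.hExp j).homog a).smooth)
    (fun a => ((hG.hExp j).homog a).smooth) K i).congr fun _ hp =>
      pointTerm_eq (hF.hExp j) (hG.hExp j) hp K i

lemma contDiff_disp_apply (hv : ∀ j, ContDiff ℝ ∞ (v j)) (a : Letter) (j : Fin 2) (i : Fin 3) :
    ContDiff ℝ ∞ fun p => a.disp v j p i := (contDiff_coord i).comp (disp_contDiff hv a j)

lemma contDiffOn_firstTerm (hv : ∀ j, ContDiff ℝ ∞ (v j)) (hF : InF F) (hG : InF G)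
    (K : Fin 2 → ℝ) (a : Letter) : ContDiffOn ℝ ∞ (firstTerm v K a F G) Par :=
  ContDiffOn.sum fun j _ => ContDiffOn.sum fun i _ =>
    (contDiff_disp_apply hv a j i).contDiffOn.mul (contDiffOn_pointTerm hF hG (K j) j i)

/-- First-order terms and fluxes are linear in the displacement, so this is the symmetric part of
`tform` component by component; the constants drop out there. -/
lemma firstTerm_add_swap (hF : InF F) (hG : InF G) (hp : p ∈ Par) (K : Fin 2 → ℝ) (a : Letter) :
    firstTerm v K a F G p + firstTerm v K a G F p = surf v a F G p := by
  rw [firstTerm, firstTerm, surf, ← Finset.sum_add_distrib]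
  refine Finset.sum_congr rfl fun j _ => ?_
  have hu := hF.hExp j
  have hw := hG.hExp j
  obtain ⟨N, hN⟩ := exists_low_nat hu.bdd
  obtain ⟨N', hN'⟩ := exists_low_nat hw.bdd
  set M := max N N'
  have h1 : ∀ a < -1 - (M : ℤ), ∀ c, hcoef j F a c = 0 := fun a ha => hN a (by omega)
  have h2 : ∀ a < -1 - (M : ℤ), ∀ c, hcoef j G a c = 0 := fun a ha => hN' a (by omega)
  have z : ∀ {u : ℤ → E3 × Param → ℝ}, (∀ a < -1 - (M : ℤ), ∀ c, u a c = 0) →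
      ∀ a < -1 - (M : ℤ), fams u p a = 0 := fun {u} h a ha => by
    have : u a = fun _ => 0 := funext (h a ha)
    ext n
    rw [fams, this, fam, toC_apply continuous_const]; rfl
  have e1 : ∀ i, pointTerm (K j) j i F G p + pointTerm (K j) j i G F p =
      4 * Real.pi * avg (coordC i * ∑ m ∈ Finset.Icc (-1 - (M : ℤ)) (M - 1),
        fam (hcoef j F m) p * fam (hcoef j G (-2 - m)) p) := fun i => by
    rw [pointTerm_eq hu hw hp, pointTerm_eq hw hu hp,
      tform_add_swap (z h1) (z h2) (rap_fam (hu.homog (-1)).smooth hp)]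
    congr 1
    rw [Finset.mul_sum, map_sum]
    simp only [mul_assoc, fams]
  have e2 : flux (a.disp v j p) (cmul (hcoef j F) (hcoef j G) (-2)) p =
      4 * Real.pi * avg (∑ i, a.disp v j p i • (coordC i * ∑ m ∈ Finset.Icc (-1 - (M : ℤ)) (M - 1),
        fam (hcoef j F m) p * fam (hcoef j G (-2 - m)) p)) := by
    rw [avg_apply, angMean, ← mul_assoc, mul_inv_cancel₀ (by positivity), one_mul, flux]
    congr 1; ext n
    rw [cmul_eq_sum h1 h2 (-2) _ (N := M - 1) (by omega), Finset.sum_mul]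
    simp only [ContinuousMap.coe_sum, Finset.sum_apply, ContinuousMap.smul_apply,
      ContinuousMap.mul_apply, coordC_apply, smul_eq_mul, fun m =>
      fam_apply (hu.homog m).smooth.continuousOn hp n, fun m =>
      fam_apply (hw.homog m).smooth.continuousOn hp n]
    refine Finset.sum_congr rfl fun i _ => ?_
    ring
  rw [e2, map_sum, Finset.mul_sum, ← Finset.sum_add_distrib]
  refine Finset.sum_congr rfl fun i _ => ?_
  rw [← mul_add, e1, map_smul, smul_eq_mul]
  ring

/-- Separates the action of a letter into a parameter derivative, common to all orders, and a
displacement contracted with gradients; commutation is checked on the two parts independently. -/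
lemma fams_cpd (hu : ∀ a, Homog a (u a)) (a : Letter) (j : Fin 2) (hp : p ∈ Par) :
    fams (cpd v a j u) p = fams (dps u (a.paramDir v p)) p +
      ∑ l, a.disp v j p l • fams (grads l u) p := by
  ext m n
  have h1 : Continuous fun n : S2 => dp (u m) (n, p) (a.paramDir v p) :=
    continuous_slice (contDiffOn_dp_apply (hu m).smooth _).continuousOn hp
  have h2 : ∀ l, Continuous fun n : S2 => dz (u (m + 1)) (n, p) (ex l) := fun l =>
    continuous_slice (grads_homog hu l m).smooth.continuousOn hp
  have e : ∀ n : S2, cpd v a j u m (n, p) = dp (u m) (n, p) (a.paramDir v p) +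
      ∑ l, a.disp v j p l * dz (u (m + 1)) (n, p) (ex l) := fun n => by
    rw [cpd, dz_sum]
  have h3 : Continuous fun n : S2 => dp (u m) (n, p) (a.paramDir v p) +
      ∑ l, a.disp v j p l * dz (u (m + 1)) (n, p) (ex l) :=
    h1.add (continuous_finsetSum _ fun l _ => continuous_const.mul (h2 l))
  have e' : (fun n : S2 => cpd v a j u m (n, p)) = fun n : S2 => dp (u m) (n, p) (a.paramDir v p) +
      ∑ l, a.disp v j p l * dz (u (m + 1)) (n, p) (ex l) := funext e
  rw [fams, fam, e', toC_apply h3]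
  simp only [Pi.add_apply, Finset.sum_apply, Pi.smul_apply, ContinuousMap.add_apply,
    ContinuousMap.coe_sum, ContinuousMap.smul_apply, fams, smul_eq_mul]
  congr 1
  · exact (toC_apply h1 n).symm
  · exact Finset.sum_congr rfl fun l _ => by
      rw [← toC_apply (h2 l) n]; rfl

/-- The explicit first-order terms satisfy the commutation rule. -/
lemma firstTerm_comm (hv : ∀ j, ContDiff ℝ ∞ (v j)) (hF : InF F) (hG : InF G) (hp : p ∈ Par)
    (K : Fin 2 → ℝ) (a b : Letter) :
    pdParam v a (firstTerm v K b F G) p - firstTerm v K b F (pd v a G) p +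
        firstTerm v K a (pd v b F) G p =
      pdParam v b (firstTerm v K a F G) p - firstTerm v K a F (pd v b G) p +
        firstTerm v K b (pd v a F) G p := by
  have hu := fun j => hF.hExp j
  have hw := fun j => hG.hExp j
  have T1 : ∀ a b : Letter, pdParam v a (firstTerm v K b F G) p = ∑ j, ∑ i,
      (fderiv ℝ (b.disp v j) p (a.paramDir v p) i * pointTerm (K j) j i F G p +
      b.disp v j p i * (tform (K j) i (fams (dps (hcoef j F) (a.paramDir v p)) p)
        (fams (hcoef j G) p) + tform (K j) i (fams (hcoef j F) p)
        (fams (dps (hcoef j G) (a.paramDir v p)) p))) := fun a b => by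
    have d1 : ∀ j i, HasFDerivAt (fun p => b.disp v j p i)
        ((EuclideanSpace.proj i : E3 →L[ℝ] ℝ).comp (fderiv ℝ (b.disp v j) p)) p := fun j i =>
      (EuclideanSpace.proj i : E3 →L[ℝ] ℝ).hasFDerivAt.comp p
        ((disp_contDiff hv b j).differentiable (by simp) p).hasFDerivAt
    have d2 : ∀ j i, DifferentiableAt ℝ (pointTerm (K j) j i F G) p := fun j i =>
      ((contDiffOn_pointTerm hF hG (K j) j i).contDiffAt
        (isOpen_Par.mem_nhds hp)).differentiableAt (by simp)
    have d3 : ∀ j i, fderiv ℝ (pointTerm (K j) j i F G) p (a.paramDir v p) =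
        tform (K j) i (fams (dps (hcoef j F) (a.paramDir v p)) p) (fams (hcoef j G) p) +
        tform (K j) i (fams (hcoef j F) p) (fams (dps (hcoef j G) (a.paramDir v p)) p) :=
      fun j i => by
        rw [← fderiv_tform (hu j).bdd (fun a => ((hu j).homog a).smooth)
          (fun a => ((hw j).homog a).smooth) (K j) i hp]
        have : pointTerm (K j) j i F G =ᶠ[𝓝 p]
            fun p => tform (K j) i (fams (hcoef j F) p) (fams (hcoef j G) p) := by
          filter_upwards [isOpen_Par.mem_nhds hp] with q hq using pointTerm_eq (hu j) (hw j) hq _ i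
        rw [this.fderiv_eq]
    have d4 : HasFDerivAt (firstTerm v K b F G) _ p := HasFDerivAt.fun_sum fun j _ =>
      HasFDerivAt.fun_sum fun i _ => (d1 j i).mul (d2 j i).hasFDerivAt
    rw [pdParam, d4.fderiv]
    simp only [sum_apply, _root_.add_apply, _root_.smul_apply, smul_eq_mul, d3]
    refine Finset.sum_congr rfl fun j _ => Finset.sum_congr rfl fun i _ => ?_
    rw [add_comm, mul_comm (pointTerm _ _ _ _ _ _)]
    rfl
  have T2 : ∀ a b : Letter, firstTerm v K b F (pd v a G) p = ∑ j, ∑ i, b.disp v j p i *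
      (tform (K j) i (fams (hcoef j F) p) (fams (dps (hcoef j G) (a.paramDir v p)) p) +
      ∑ l, a.disp v j p l * tform (K j) i (fams (hcoef j F) p) (fams (grads l (hcoef j G)) p)) :=
    fun a b => Finset.sum_congr rfl fun j _ => Finset.sum_congr rfl fun i _ => by
      have hl := low_fams (hu j).bdd p
      have hr : Rap (fams (hcoef j F) p (-1)) := rap_fam ((hu j).homog (-1)).smooth hp
      rw [pointTerm_eq (hu j) ((hw j).pd hv a) hp, fams_cpd (hw j).homog a j hp,
        tform_add_right hl hr, tform_sum_right _ hl hr]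
      simp only [tform_smul_right]
  have T3 : ∀ a b : Letter, firstTerm v K a (pd v b F) G p = ∑ j, ∑ i, a.disp v j p i *
      (tform (K j) i (fams (dps (hcoef j F) (b.paramDir v p)) p) (fams (hcoef j G) p) +
      ∑ l, b.disp v j p l * tform (K j) i (fams (grads l (hcoef j F)) p) (fams (hcoef j G) p)) :=
    fun a b => Finset.sum_congr rfl fun j _ => Finset.sum_congr rfl fun i _ => by
      have hr : Rap (fams (hcoef j G) p (-1)) := rap_fam ((hw j).homog (-1)).smooth hp
      have hl : ∀ l, Low (b.disp v j p l • fams (grads l (hcoef j F)) p) := fun l =>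
        (low_fams (grads_low (hu j).bdd l) p).smul _
      rw [pointTerm_eq ((hu j).pd hv b) (hw j) hp, fams_cpd (hu j).homog b j hp,
        tform_add_left (low_fams (dps_low (hu j).bdd _) p) (Low.sum _ hl) hr,
        tform_sum_left _ hl hr]
      simp only [tform_smul_left]
  -- The derivatives of the displacements themselves match because the letters commute as vector
  -- fields.
  have hdisp : ∀ j, fderiv ℝ (b.disp v j) p (a.paramDir v p) =
      fderiv ℝ (a.disp v j) p (b.paramDir v p) := fun j => by
    have e : ∀ (b : Letter) (e : Param), fderiv ℝ (b.disp v j) p e =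
        -posL j (fderiv ℝ (b.paramDir v) p e) := fun b e => by
      have h1 : HasFDerivAt (b.paramDir v) _ p :=
        ((paramDir_contDiff hv b).differentiable (by simp) p).hasFDerivAt
      have h2 := ((posL j).hasFDerivAt.comp p h1).const_sub b.fieldDir
      have h3 : b.disp v j = fun q => b.fieldDir - (posL j ∘ b.paramDir v) q := by
        ext1 q; simp [Letter.disp]
      rw [h3, h2.fderiv]; rfl
    rw [e, e, fderiv_paramDir_comm hv a b p]
  rw [T1, T1, T2, T2, T3, T3]
  simp only [← Finset.sum_sub_distrib, ← Finset.sum_add_distrib, hdisp]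
  refine Finset.sum_congr rfl fun j _ => ?_
  -- The parameter derivatives match by the Leibniz rule. The remaining difference is antisymmetric
  -- in the two displacements, so its coefficients `A_i B_l - A_l B_i` multiply the identities of
  -- `tform_grads_symm`.
  have hS : ∀ i l, tform (K j) i (fams (grads l (hcoef j F)) p) (fams (hcoef j G) p) -
      tform (K j) l (fams (hcoef j F) p) (fams (grads i (hcoef j G)) p) =
      tform (K j) l (fams (grads i (hcoef j F)) p) (fams (hcoef j G) p) -
      tform (K j) i (fams (hcoef j F) p) (fams (grads l (hcoef j G)) p) := fun i l =>
    tform_grads_symm (hu j).bdd (hu j).homog (hw j).homog hp (K j) i l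
  have h01 := hS 0 1
  have h02 := hS 0 2
  have h12 := hS 1 2
  simp only [Fin.sum_univ_three]
  generalize a.disp v j p = A at *
  generalize b.disp v j p = B at *
  linear_combination (A 0 * B 1 - A 1 * B 0) * h01 + (A 0 * B 2 - A 2 * B 0) * h02 +
    (A 1 * B 2 - A 2 * B 1) * h12

/-! ### The family of multi-derivatives -/

/-- The distributional terms of the multi-derivatives generated by the explicit first-order terms. -/
def derivSystem (v : Fin 2 → ℝ → E3) (K : Fin 2 → ℝ) : DistTerms
  | [] => fun _ _ _ => 0
  | a :: L => fun F G p => pdParam v a (derivSystem v K L F G) p -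
      derivSystem v K L F (pd v a G) p + firstTerm v K a (pds v L F) G p

lemma derivSystem_cons (a : Letter) (L : List Letter) (F G : Fun) (p : Param) :
    derivSystem v K (a :: L) F G p = pdParam v a (derivSystem v K L F G) p -
      derivSystem v K L F (pd v a G) p + firstTerm v K a (pds v L F) G p := rfl

lemma derivSystem_one (a : Letter) (F G : Fun) (p : Param) :
    derivSystem v K [a] F G p = firstTerm v K a F G p := by
  simp [derivSystem, pds, pdParam, show (fun _ => 0 : Param → ℝ) = 0 from rfl]

lemma contDiffOn_derivSystem (hv : ∀ j, ContDiff ℝ ∞ (v j)) (L : List Letter) (hF : InF F)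
    (hG : InF G) : ContDiffOn ℝ ∞ (derivSystem v K L F G) Par := by
  induction L generalizing G with
  | nil => exact contDiffOn_const
  | cons a L ih =>
    exact ((contDiffOn_pdParam hv (ih hG) a).sub (ih (hG.pd hv a))).add
      (contDiffOn_firstTerm hv (hF.pds hv L) hG K a)

lemma derivSystem_congr (hv : ∀ j, ContDiff ℝ ∞ (v j)) (L : List Letter) (hF : InF F)
    (hG : InF G) (hG' : ∀ c ∈ Reg, G' c = G c) :
    ∀ p ∈ Par, derivSystem v K L F G' p = derivSystem v K L F G p := by
  induction L generalizing G G' with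
  | nil => exact fun _ _ => rfl
  | cons a L ih =>
    intro p hp
    simp only [derivSystem]
    rw [pdParam_congr (ih hG hG') a hp, ih (hG.pd hv a) (pd_congr a hG') p hp,
      firstTerm_congr (hF.pds hv L) hG (fun _ _ => rfl) hG' hp]

/-- Unfolding two steps leaves derivatives of the term of `L`, symmetric because ordinary
derivatives commute, and the first-order expression for `∂_L F`, symmetric by `firstTerm_comm`. -/
lemma derivSystem_swap (hv : ∀ j, ContDiff ℝ ∞ (v j)) (a b : Letter) (L : List Letter)
    (hF : InF F) (hG : InF G) (hp : p ∈ Par) :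
    derivSystem v K (a :: b :: L) F G p = derivSystem v K (b :: a :: L) F G p := by
  have hH := hF.pds hv L
  have d : ∀ {f : Param → ℝ}, ContDiffOn ℝ ∞ f Par → DifferentiableAt ℝ f p := fun h =>
    (h.contDiffAt (isOpen_Par.mem_nhds hp)).differentiableAt (by simp)
  have key : ∀ a b : Letter, derivSystem v K (a :: b :: L) F G p =
      pdParam v a (pdParam v b (derivSystem v K L F G)) p -
        pdParam v a (derivSystem v K L F (pd v b G)) p -
        pdParam v b (derivSystem v K L F (pd v a G)) p +
        derivSystem v K L F (pd v b (pd v a G)) p +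
      (pdParam v a (firstTerm v K b (pds v L F) G) p -
        firstTerm v K b (pds v L F) (pd v a G) p +
        firstTerm v K a (pd v b (pds v L F)) G p) := fun a b => by
    have e1 := d (contDiffOn_pdParam hv (contDiffOn_derivSystem (K := K) hv L hF hG) b)
    have e2 := d (contDiffOn_derivSystem (K := K) hv L hF (hG.pd hv b))
    have e3 := d (contDiffOn_firstTerm hv hH hG K b)
    have e4 : pdParam v a (derivSystem v K (b :: L) F G) p =
        pdParam v a (pdParam v b (derivSystem v K L F G)) p -
        pdParam v a (derivSystem v K L F (pd v b G)) p +
        pdParam v a (firstTerm v K b (pds v L F) G) p := by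
      rw [← pdParam_sub a e1 e2]
      exact pdParam_add a (e1.sub e2) e3
    rw [derivSystem_cons, e4, derivSystem_cons, show pds v (b :: L) F = pd v b (pds v L F) from rfl]
    ring
  rw [key, key, firstTerm_comm hv hH hG hp, pdParam_comm hv (contDiffOn_derivSystem hv L hF hG) a b hp,
    derivSystem_congr hv L hF ((hG.pd hv b).pd hv a) (fun c hc => pd_comm hv hG b a hc) p hp]
  ring

lemma derivSystem_perm (hv : ∀ j, ContDiff ℝ ∞ (v j)) {L L' : List Letter} (h : L.Perm L')
    (hF : InF F) (hG : InF G) :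
    ∀ p ∈ Par, derivSystem v K L F G p = derivSystem v K L' F G p := by
  induction h generalizing G with
  | nil => exact fun _ _ => rfl
  | @cons a L L' h ih =>
    intro p hp
    simp only [derivSystem]
    rw [pdParam_congr (ih hG) a hp, ih (hG.pd hv a) p hp,
      firstTerm_congr (hF.pds hv L') hG (pds_perm hv h hF) (fun _ _ => rfl) hp]
  | swap a b L => exact fun p hp => derivSystem_swap hv b a L hF hG hp
  | trans _ _ ih ih' => exact fun p hp => (ih hG p hp).trans (ih' hG p hp)

/-- The recursion is the rule of integration by parts with one first-order term exchanged, so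
`firstTerm_add_swap` turns it back into the rule. -/
theorem isDerivativeSystem_derivSystem (hs : ∀ j, 0 < s j) (hv : ∀ j, ContDiff ℝ ∞ (v j))
    (A : Set Letter) (K : Fin 2 → ℝ) : IsDerivativeSystem s v A (derivSystem v K) where
  nil _ _ _ := rfl
  byParts a _ L _ F G hF hG h p hp := by
    refine (byParts_iff hs hv hF hG h hp a L).2 ⟨((contDiffOn_derivSystem hv L hF hG).contDiffAt
      (isOpen_Par.mem_nhds hp)).differentiableAt (by simp), ?_⟩
    have h1 := firstTerm_add_swap (v := v) (hF.pds hv L) hG hp K a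
    rw [derivSystem_one, derivSystem]
    linarith
  comm L L' _ h F G hF hG _ p hp := derivSystem_perm hv h hF hG p hp

/-! ### The displacements -/

lemma disp_x (i : Fin 3) (j : Fin 2) (p : Param) : (Letter.x i).disp v j p = ex i := by
  fin_cases j <;> simp [Letter.disp, Letter.fieldDir, Letter.paramDir, pos]

lemma disp_y (i : Fin 3) (j j' : Fin 2) (p : Param) :
    (Letter.y j i).disp v j' p = if j' = j then -ex i else 0 := by
  fin_cases j <;> fin_cases j' <;> simp [Letter.disp, Letter.fieldDir, Letter.paramDir, pos]

lemma disp_t (j : Fin 2) (p : Param) : Letter.t.disp v j p = -v j p.1 := by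
  fin_cases j <;> simp [Letter.disp, Letter.fieldDir, Letter.paramDir, pos]

lemma sum_ex_mul (i : Fin 3) (f : Fin 3 → ℝ) : ∑ l, ex i l * f l = f i := by
  rw [Finset.sum_eq_single i] <;> simp +contextual [ex]

lemma firstTerm_x (i : Fin 3) (F G : Fun) (p : Param) :
    firstTerm v K (.x i) F G p = ∑ j, pointTerm (K j) j i F G p := by
  simp only [firstTerm, disp_x, sum_ex_mul]

lemma firstTerm_y (j : Fin 2) (i : Fin 3) (F G : Fun) (p : Param) :
    firstTerm v K (.y j i) F G p = -pointTerm (K j) j i F G p := by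
  rw [firstTerm, Finset.sum_eq_single j]
  · simp only [disp_y, if_true]
    simp only [PiLp.neg_apply, neg_mul, Finset.sum_neg_distrib, sum_ex_mul]
  · intro j' _ hj
    simp [disp_y, hj]
  · simp

lemma firstTerm_t (F G : Fun) (p : Param) : firstTerm v K .t F G p =
    ∑ j, ∑ i, v j p.1 i * firstTerm v K (.y j i) F G p := by
  simp only [firstTerm_y]
  rw [firstTerm]
  simp only [disp_t]
  simp

end Hadamard
end

/-! ### Uniqueness of isotropic terms: test functions and determination of the weights. -/

noncomputable section
namespace Hadamard

variable {v : Fin 2 → ℝ → E3} {j : Fin 2} {F G : Fun} {p : Param} {f g : E3 → ℝ} {m : ℤ}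

/-! ### Test functions -/

/-- The distance of the source points. -/
def sep (p : Param) : ℝ := ‖pos 0 p - pos 1 p‖

lemma sep_pos (hp : p ∈ Par) : 0 < sep p := norm_pos_iff.2 (sub_ne_zero.2 hp)

lemma continuous_sep : Continuous sep := by
  have : sep = fun p => ‖posL 0 p - posL 1 p‖ := by ext1 p; simp [sep]
  rw [this]; fun_prop

lemma contDiffOn_sep : ContDiffOn ℝ ∞ sep Par := by
  have : sep = fun p => ‖posL 0 p - posL 1 p‖ := by ext1 p; simp [sep]
  rw [this]
  exact (((posL 0).contDiff.sub (posL 1).contDiff).contDiffOn).norm ℝ fun p hp => by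
    simpa [sub_eq_zero] using (show pos 0 p ≠ pos 1 p from hp)

/-- The function that is equal to `f(x - y_j)` near the source point `j` and to `0` near the other
one. -/
def testFun (j : Fin 2) (f : E3 → ℝ) : Fun := fun c =>
  -- Dividing by the distance of the sources makes the cutoff vanish from half that distance on, so
  -- one formula serves all admissible parameters.
  cut (1 / 4) (rad j c / sep c.2) * f (c.1 - pos j c.2)

/-- The coefficients of a test function. -/
def testCoef (j : Fin 2) (m : ℤ) (f : E3 → ℝ) (j' : Fin 2) (a : ℤ) (c : E3 × Param) : ℝ :=
  if j' = j ∧ a = m then f c.1 else 0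

lemma testFun_smooth (hf : Hom1 m f) : ContDiffOn ℝ ∞ (testFun j f) Reg := by
  have h1 : ContDiffOn ℝ ∞ (fun c : E3 × Param => sep c.2) Reg :=
    contDiffOn_sep.comp contDiff_snd.contDiffOn fun c hc => hc.1
  have h2 : ContDiffOn ℝ ∞ (fun c : E3 × Param => rad j c / sep c.2) Reg :=
    (contDiffOn_rad j).div h1 fun c hc => (sep_pos hc.1).ne'
  have h3 : ContDiffOn ℝ ∞ (fun c : E3 × Param => f (c.1 - pos j c.2)) Reg :=
    (hf.homog.symb j).1.congr fun c _ => by rw [relL_apply]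
  exact ((contDiff_cut (1 / 4)).comp_contDiffOn h2).mul h3

/-- The configurations where the test functions vanish. -/
def farSet (j : Fin 2) : Set (E3 × Param) := {c | c.2 ∈ Par ∧ sep c.2 < 2 * rad j c}

lemma isOpen_farSet (j : Fin 2) : IsOpen (farSet j) :=
  (isOpen_Par.preimage continuous_snd).inter
    (isOpen_lt (continuous_sep.comp continuous_snd) (continuous_const.mul (continuous_rad j)))

lemma testFun_far {c : E3 × Param} (hc : c ∈ farSet j) : testFun j f c = 0 := by
  have h := sep_pos hc.1
  rw [testFun, cut_zero (by norm_num) (by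
    rw [le_div_iff₀ h]; linarith [hc.2]), zero_mul]

lemma pds_eq_zero {O : Set (E3 × Param)} (hO : IsOpen O) (h : ∀ c ∈ O, F c = 0) (L : List Letter) :
    ∀ c ∈ O, pds v L F c = 0 := by
  induction L with
  | nil => exact h
  | cons a L ih =>
    intro c hc
    have : pds v L F =ᶠ[𝓝 c] fun _ => 0 := by
      filter_upwards [hO.mem_nhds hc] with q hq using ih q hq
    change fderiv ℝ (pds v L F) c _ = 0
    rw [this.fderiv_eq]; simp

/-- Test functions vanish outside a ball that is locally uniform in the parameters, so they pair
with any `G`; this makes the decay hypothesis harmless in the uniqueness proofs. -/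
lemma decayPair_testFun : DecayPair v (testFun j f) G := by
  intro L M p₀ hp₀
  have hc : ∀ i, Continuous fun p => ‖pos i p‖ := fun i => by
    simp only [← posL_apply]; exact (posL i).continuous.norm
  set B := max ‖pos 0 p₀‖ ‖pos 1 p₀‖ + 1 with hB
  have hB0 : 0 < B := by
    have := (norm_nonneg (pos 0 p₀)).trans (le_max_left _ ‖pos 1 p₀‖)
    linarith
  have hlt : ∀ i, ∀ᶠ p in 𝓝 p₀, ‖pos i p‖ < B := fun i =>
    (hc i).continuousAt.eventually_lt continuousAt_const (by
      fin_cases i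
      · exact (le_max_left _ _).trans_lt (lt_add_one _)
      · exact (le_max_right _ _).trans_lt (lt_add_one _))
  refine ⟨1, one_pos, 0, 3 * B, ?_⟩
  filter_upwards [hlt 0, hlt 1, hlt j, isOpen_Par.mem_nhds hp₀] with p h0 h1 hj hp x hx
  have hfar : (x, p) ∈ farSet j := by
    refine ⟨hp, ?_⟩
    have e1 : sep p ≤ ‖pos 0 p‖ + ‖pos 1 p‖ := norm_sub_le _ _
    have e2 : ‖x‖ - ‖pos j p‖ ≤ rad j (x, p) := norm_sub_norm_le _ _
    change sep p < 2 * rad j (x, p)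
    linarith
  rw [pds_eq_zero (isOpen_farSet j) (fun c hc => testFun_far hc) L _ hfar]
  simp

/-- A test function has a single coefficient, at one point and of one order. Evaluating a form on
such functions thus isolates one pair `(j, k)`. -/
lemma hExp_testFun (hf : Hom1 m f) (j' : Fin 2) :
    HExp j' (testFun j f) (testCoef j m f j') := by
  by_cases hj : j' = j
  · subst hj
    have h := HExp.congr_near (HExp.of_homog (j := j') hf.homog) (testFun_smooth (j := j') hf)
      fun p hp => by
        have h1 : ∀ᶠ c in 𝓝 (pos j' p, p), 4 * rad j' c < sep c.2 :=
          (continuous_const.mul (continuous_rad j')).continuousAt.eventually_lt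
            (continuous_sep.comp continuous_snd).continuousAt (by simpa [rad] using sep_pos hp)
        filter_upwards [h1] with c hc hcR
        have := sep_pos hcR.1
        rw [testFun, cut_one (by norm_num) (by rw [div_le_iff₀ this]; linarith), one_mul, relL_apply]
    have e : testCoef j' m f j' = fun a (c : E3 × Param) => if a = m then f c.1 else 0 := by
      ext a c; simp [testCoef]
    rw [e]; exact h
  · have e : testCoef j m f j' = fun a (c : E3 × Param) => 0 := by
      ext a c; simp [testCoef, hj]
    rw [e]
    refine HExp.zero_near (testFun_smooth hf) fun p hp => ?_
    have hrad : rad j (pos j' p, p) = sep p := by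
      fin_cases j <;> fin_cases j' <;> simp [rad, sep, norm_sub_rev] at hj ⊢
    have hmem : (pos j' p, p) ∈ farSet j := ⟨hp, by
      change sep p < 2 * rad j (pos j' p, p)
      rw [hrad]; linarith [sep_pos hp]⟩
    filter_upwards [(isOpen_farSet j).mem_nhds hmem] with c hc _ using testFun_far hc

lemma inF_testFun (hf : Hom1 m f) : InF (testFun j f) := InF.of_hExp fun j' => hExp_testFun hf j'

lemma fam_testCoef_ne {j' : Fin 2} {a : ℤ} (h : ¬(j' = j ∧ a = m)) (p : Param) :
    fam (testCoef j m f j' a) p = 0 := by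
  have : testCoef j m f j' a = fun _ => 0 := by ext c; simp [testCoef, h]
  ext n
  rw [this, fam, toC_apply continuous_const]; rfl

/-- The restriction of a function of space to the sphere. -/
def onS (f : E3 → ℝ) : CS := toC fun n => f n

lemma onS_apply (hf : Hom1 m f) (n : S2) : onS f n = f n := toC_apply hf.continuous n

lemma fam_testCoef_self (p : Param) : fam (testCoef j m f j m) p = onS f := by
  simp [fam, onS, testCoef]

lemma coef_testFun (hf : Hom1 m f) (j' : Fin 2) (a : ℤ) (hp : p ∈ Par) :
    coef j' (testFun j f) a p = if j' = j ∧ a = m then fun n : S2 => f n else 0 := by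
  ext n
  rw [coef_eq (hExp_testFun hf j') a hp, testCoef]
  split_ifs <;> rfl

lemma exists_par : ∃ p : Param, p ∈ Par :=
  ⟨(0, 0, ex 0), by simp [Par, pos, ex, eq_comm]⟩

/-- The surface terms of a pair of test functions. -/
lemma surf_testFun {m' : ℤ} (hf : Hom1 m f) (hg : Hom1 m' g) (hm : m + m' = -2) (a : Letter)
    (hp : p ∈ Par) {σ : ℝ} {i : Fin 3} (hd : a.disp v j p = σ • ex i) :
    surf v a (testFun j f) (testFun j g) p =
      σ * (4 * Real.pi) * avg (coordC i * onS f * onS g) := by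
  have h1 : surf v a (testFun j f) (testFun j g) p =
      ∑ j', flux (a.disp v j' p) (cmul (testCoef j m f j') (testCoef j m' g j') (-2)) p := by
    unfold surf flux
    refine Finset.sum_congr rfl fun j' _ => ?_
    congr 1; ext n; congr 1
    refine HExp.unique (((inF_testFun hf).hExp j').mul ((inF_testFun hg).hExp j'))
      ((hExp_testFun hf j').mul (hExp_testFun hg j')) _ (mem_Dom.2 ⟨S2_ne_zero n, hp⟩)
  have hc : ∀ j' c, cmul (testCoef j m f j') (testCoef j m' g j') (-2) c =
      if j' = j then f c.1 * g c.1 else 0 := fun j' c => by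
    by_cases hj : j' = j
    · have e : testCoef j m f j' = fun a (c : E3 × Param) => if a = m then f c.1 else 0 := by
        ext a c; simp [testCoef, hj]
      rw [e, cmul_single (fun c => f c.1)]
      simp [testCoef, hj, show -2 - m = m' by omega]
    · rw [cmul, if_neg hj]
      simp [testCoef, hj]
  rw [h1, Finset.sum_eq_single j]
  · rw [hd, flux, avg_apply, angMean, mul_assoc, ← mul_assoc (4 * Real.pi), mul_inv_cancel₀
      (by positivity), one_mul, ← angInt_mul]
    congr 1; ext n
    rw [hc, if_pos rfl, ContinuousMap.mul_apply, ContinuousMap.mul_apply, onS_apply hf,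
      onS_apply hg, coordC_apply]
    have : ∑ l, (σ • ex i : E3) l * (n : E3) l = σ * (n : E3) i := by
      simp only [PiLp.smul_apply, smul_eq_mul, mul_assoc, ← Finset.mul_sum]
      rw [sum_ex_mul i fun l => (n : E3) l]
    rw [this]; ring
  · intro j' _ hj
    have : (fun n : S2 => (∑ l, a.disp v j' p l * (n : E3) l) *
        cmul (testCoef j m f j') (testCoef j m' g j') (-2) (n, p)) = fun n => 0 * (0 : ℝ) := by
      ext n; rw [hc, if_neg hj]; simp
    rw [flux, this, angInt_mul, zero_mul]
  · simp

end Hadamard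
end

noncomputable section
namespace Hadamard

/-! ### A pair of harmonic tensors -/

/-- The tensor of `(x + i y) ^ l`, with complex components. -/
def zetaT (l : ℕ) (L : Fin l → Fin 3) : ℂ := ∏ k, ![1, Complex.I, 0] (L k)

/-- The tensor of `Re (x + i y) ^ l`. -/
def reT (l : ℕ) : Tensor l := WithLp.toLp 2 fun L => (zetaT l L).re

/-- The tensor of `Im (x + i y) ^ l`. -/
def imT (l : ℕ) : Tensor l := WithLp.toLp 2 fun L => (zetaT l L).im

lemma zetaT_perm {l : ℕ} (σ : Equiv.Perm (Fin l)) (L : Fin l → Fin 3) :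
    zetaT l (L ∘ σ) = zetaT l L :=
  Equiv.prod_comp σ fun k => ![1, Complex.I, 0] (L k)

/-- The vector `(1, I, 0)` is isotropic: `1 + I² = 0`. -/
lemma zetaT_trace {l : ℕ} (a b : Fin l) (hab : a ≠ b) (L : Fin l → Fin 3) :
    ∑ i, zetaT l (Function.update (Function.update L a i) b i) = 0 := by
  have e : ∀ i, zetaT l (Function.update (Function.update L a i) b i) =
      (![1, Complex.I, 0] i * ![1, Complex.I, 0] i) *
        ∏ k ∈ (Finset.univ.erase a).erase b, ![1, Complex.I, 0] (L k) := fun i => by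
    rw [zetaT, ← Finset.mul_prod_erase _ _ (Finset.mem_univ a),
      ← Finset.mul_prod_erase _ _ (Finset.mem_erase.2 ⟨hab.symm, Finset.mem_univ b⟩)]
    rw [Function.update_of_ne hab, Function.update_self, Function.update_self, mul_assoc]
    congr 2
    refine Finset.prod_congr rfl fun k hk => ?_
    simp only [Finset.mem_erase, Finset.mem_univ, and_true] at hk
    rw [Function.update_of_ne hk.1, Function.update_of_ne hk.2]
  simp only [e, ← Finset.sum_mul]
  simp [Fin.sum_univ_three]

lemma reT_mem (l : ℕ) : reT l ∈ stf l := by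
  refine ⟨fun σ L => ?_, fun a b hab L => ?_⟩
  · simp only [reT, zetaT_perm]
  · simp only [reT, ← Complex.re_sum, zetaT_trace a b hab, Complex.zero_re]

lemma imT_mem (l : ℕ) : imT l ∈ stf l := by
  refine ⟨fun σ L => ?_, fun a b hab L => ?_⟩
  · simp only [imT, zetaT_perm]
  · simp only [imT, ← Complex.im_sum, zetaT_trace a b hab, Complex.zero_im]

lemma zetaT_cons (l : ℕ) (a : Fin 3) (L : Fin l → Fin 3) :
    zetaT (l + 1) (Fin.cons a L) = ![1, Complex.I, 0] a * zetaT l L := by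
  simp only [zetaT, Fin.prod_univ_succ, Fin.cons_zero, Fin.cons_succ]

lemma contr_zero_reT (l : ℕ) : contr 0 (reT (l + 1)) = reT l := by
  ext L; simp [contr, reT, zetaT_cons]

lemma contr_zero_imT (l : ℕ) : contr 0 (imT (l + 1)) = imT l := by
  ext L; simp [contr, imT, zetaT_cons]

lemma contr_one_reT (l : ℕ) : contr 1 (reT (l + 1)) = -imT l := by
  ext L; simp [contr, reT, imT, zetaT_cons]

lemma contr_one_imT (l : ℕ) : contr 1 (imT (l + 1)) = reT l := by
  ext L; simp [contr, reT, imT, zetaT_cons]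

lemma dotT_self_nonneg {l : ℕ} (T : Tensor l) : 0 ≤ dotT T T :=
  Finset.sum_nonneg fun _ _ => mul_self_nonneg _

lemma dotT_reT_pos (l : ℕ) : 0 < dotT (reT l) (reT l) := by
  refine Finset.sum_pos' (fun _ _ => mul_self_nonneg _) ⟨fun _ => 0, Finset.mem_univ _, ?_⟩
  simp [reT, zetaT]

/-! ### The forms on harmonics -/

lemma hat_harm_self {l : ℕ} {T : Tensor l} (hT : T ∈ stf l) : hat l (harm l T) = T := by
  ext L
  have h : avg (harm l (stfProj l (EuclideanSpace.single L 1)) * harm l T) = _ :=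
    mean_uT_mul (stfProj_mem l (EuclideanSpace.single L 1)) hT
  rw [hat_apply_eq, h, dotT_stfProj _ hT, dotT, Finset.sum_eq_single L]
  · have h1 : ((l ! : ℕ) : ℝ) ≠ 0 := by positivity
    have h2 : (((2 * l + 1)‼ : ℕ) : ℝ) ≠ 0 := by positivity
    simp
    field_simp
  · intro M _ hM; simp [hM]
  · simp

lemma pr_harm_self {l : ℕ} {T : Tensor l} (hT : T ∈ stf l) : pr l (harm l T) = harm l T := by
  rw [pr, hat_harm_self hT]

lemma pr_harm_ne {l m : ℕ} {T : Tensor m} (hT : T ∈ stf m) (h : l ≠ m) : pr l (harm m T) = 0 := by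
  have e : hat l (harm m T) = 0 := by
    ext L
    rw [hat_apply_eq, avg_harm_orth (stfProj_mem l _) hT h, mul_zero]; rfl
  rw [pr, e]
  exact (harmL l).map_zero

lemma X_harm_right {l : ℕ} {T : Tensor (l + 1)} (hT : T ∈ stf (l + 1)) (i : Fin 3) (f : CS) :
    X i l f (harm (l + 1) T) = (l + 1) / (2 * l + 3) * avg (harm l (contr i T) * f) := by
  have h := avg_contr i l (harm (l + 1) T) f
  rw [hat_harm_self hT] at h
  rw [h]
  have h1 : (l : ℝ) + 1 ≠ 0 := by positivity
  have h2 : 2 * (l : ℝ) + 3 ≠ 0 := by positivity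
  field_simp

lemma X_harm_left {l : ℕ} {T : Tensor (l + 1)} (hT : T ∈ stf (l + 1)) (i : Fin 3) (f : CS) :
    X i (l + 1) (harm (l + 1) T) f =
      avg (coordC i * harm (l + 1) T * f) - X i l f (harm (l + 1) T) := by
  have h := avg_coord_pr_succ i l (harm (l + 1) T) f
  rw [pr_harm_self hT] at h
  linarith

/-- A pure harmonic couples only to its two neighbouring degrees, so the series reduces to two terms
and exhibits one weight of each kind. -/
lemma W_harm_right (A B : ℕ → ℝ) {l : ℕ} {T : Tensor (l + 1)} (hT : T ∈ stf (l + 1)) (i : Fin 3)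
    (f : CS) : W A B i f (harm (l + 1) T) =
      A l * X i l f (harm (l + 1) T) + B (l + 1) * X i (l + 1) (harm (l + 1) T) f := by
  have z1 : ∀ k, k ≠ l → X i k f (harm (l + 1) T) = 0 := fun k hk => by
    rw [X, pr_harm_ne hT (by omega), mul_zero, map_zero]
  have z2 : ∀ k, k ≠ l + 1 → X i k (harm (l + 1) T) f = 0 := fun k hk => by
    rw [X, pr_harm_ne hT hk, mul_zero, zero_mul, map_zero]
  rw [W, tsum_eq_sum (s := {l, l + 1}), Finset.sum_pair (by omega), z1 (l + 1) (by omega),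
    z2 l (by omega)]
  · ring
  · intro k hk
    simp only [Finset.mem_insert, Finset.mem_singleton, not_or] at hk
    rw [z1 k hk.1, z2 k hk.2]; ring

lemma W_harm_harm (A B : ℕ → ℝ) {l : ℕ} {S : Tensor l} (hS : S ∈ stf l) {T : Tensor (l + 1)}
    (hT : T ∈ stf (l + 1)) (i : Fin 3) : W A B i (harm l S) (harm (l + 1) T) =
      A l * avg (coordC i * harm l S * harm (l + 1) T) := by
  rw [W_harm_right A B hT]
  have h1 : X i (l + 1) (harm (l + 1) T) (harm l S) = 0 := by
    rw [X, pr_harm_ne hS (by omega), mul_zero, map_zero]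
  rw [h1, X, pr_harm_self hS, pr_harm_self hT]
  ring

/-- A pair of adjacent harmonics on which `X_l` does not vanish, so that its weight can be cancelled
from an equation. -/
lemma avg_coord_reT_pos (l : ℕ) :
    0 < avg (coordC 0 * harm l (reT l) * harm (l + 1) (reT (l + 1))) := by
  have h := avg_coord_lower 0 (reT_mem (l + 1)) (reT_mem l)
  have h2 : avg (harm l (reT l) * harm l (reT l)) = _ := mean_uT_mul (reT_mem l) (reT_mem l)
  rw [contr_zero_reT, h2] at h
  have e : coordC 0 * harm l (reT l) * harm (l + 1) (reT (l + 1)) =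
      coordC 0 * harm (l + 1) (reT (l + 1)) * harm l (reT l) := by ring
  rw [e, h]
  have := dotT_reT_pos l
  positivity

/-- The gradient terms of the pair of harmonics do not commute. -/
lemma mean_contr_imT_pdx_ne {l : ℕ} {h : E3 → ℝ} (hh : Hom1 0 h)
    (he : ∀ n : S2, h n = uT (l + 1) (reT (l + 1)) n) :
    mean (fun z => uT l (contr 1 (imT (l + 1))) z * pdx 0 h z) -
      mean (fun z => uT l (contr 0 (imT (l + 1))) z * pdx 1 h z) ≠ 0 := by
  have hm := imT_mem (l + 1)
  have h1 := mean_pdx_mul (hom1_uT l (contr 1 (imT (l + 1)))) hh 0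
  have h2 := mean_pdx_mul (hom1_uT l (contr 0 (imT (l + 1)))) hh 1
  have h3 : mean (fun z => pdx 0 (uT l (contr 1 (imT (l + 1)))) z * h z) =
      mean (fun z => pdx 1 (uT l (contr 0 (imT (l + 1)))) z * h z) := by
    congr 1; ext z; rw [pdx_uT_contr_comm hm]
  have key : ∀ a b : Fin 3, mean (fun z => z a * (uT l (contr b (imT (l + 1))) z * h z)) =
      (l + 1) / (2 * l + 3) * ((l ! : ℝ) / ((2 * l + 1)‼ : ℝ) *
        dotT (contr a (reT (l + 1))) (contr b (imT (l + 1)))) := fun a b => by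
    have h4 := avg_coord_lower a (reT_mem (l + 1)) (contr_mem_stf hm b)
    have h5 : avg (harm l (contr a (reT (l + 1))) * harm l (contr b (imT (l + 1)))) = _ :=
      mean_uT_mul (contr_mem_stf (reT_mem (l + 1)) a) (contr_mem_stf hm b)
    rw [← h5, ← h4, avg_apply, mean]
    congr 1; ext n
    rw [ContinuousMap.mul_apply, ContinuousMap.mul_apply, coordC_apply, harm_apply, harm_apply, he]
    ring
  rw [key, contr_zero_reT, contr_one_imT] at h1
  rw [key, contr_one_reT, contr_zero_imT] at h2
  rw [contr_one_imT] at h3 ⊢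
  rw [contr_zero_imT] at h3 ⊢
  have h6 : dotT (-imT l) (imT l) = -dotT (imT l) (imT l) := by simp [dotT]
  rw [h6] at h2
  have p1 := dotT_reT_pos l
  have p2 := dotT_self_nonneg (imT l)
  -- The contractions of the real and imaginary parts are each other up to sign, so the two
  -- contributions add up to a sum of squares instead of cancelling.
  have e : mean (fun z => uT l (reT l) z * pdx 0 h z) - mean (fun z => uT l (imT l) z * pdx 1 h z) =
      (l + 2) * ((l + 1) / (2 * l + 3) * ((l ! : ℝ) / ((2 * l + 1)‼ : ℝ) *
        (dotT (reT l) (reT l) + dotT (imT l) (imT l)))) := by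
    push_cast at h1 h2
    linear_combination h1 - h2 - h3
  rw [e]
  have : 0 < dotT (reT l) (reT l) + dotT (imT l) (imT l) := by linarith
  positivity

/-- The values on the sphere and the degree of homogeneity are independent: a harmonic of degree `l`
can be the coefficient of any order. -/
lemma exists_hom1_harm (m : ℤ) {l : ℕ} (T : Tensor l) :
    ∃ f : E3 → ℝ, Hom1 m f ∧ (∀ n : S2, f n = uT l T n) ∧ onS f = harm l T := by
  obtain ⟨p, hp⟩ := exists_par
  have h0 : ContDiffOn ℝ ∞ (fun c : E3 × Param => uT l T c.1) Dom :=
    ((contDiff_uT l T).comp contDiff_fst).contDiffOn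
  have h := (homog_homogExt m h0).slice hp
  have e : ∀ n : S2, homogExt (fun _ (c : E3 × Param) => uT l T c.1) m ((n : E3), p) =
      uT l T n := fun n => by simp [homogExt]
  refine ⟨_, h, e, ?_⟩
  ext n
  rw [onS_apply h, harm_apply]
  exact e n

end Hadamard
end

noncomputable section
namespace Hadamard

variable {v : Fin 2 → ℝ → E3} {s : Fin 2 → ℝ} {A : Set Letter} {D : DistTerms} {J : Finset (Fin 2)}
  {T : Fin 3 → Fun → Fun → Param → ℝ} {j : Fin 2} {F G : Fun} {p : Param}

lemma fam_hcoef {u : ℤ → E3 × Param → ℝ} (h : HExp j F u) (hp : p ∈ Par) (a : ℤ) :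
    fam (hcoef j F a) p = fam (u a) p := by
  have h1 := coef_eq_fam h a hp
  rw [coef_eq_fam (hExp_hcoef h) a hp] at h1
  exact DFunLike.coe_injective h1

/-! ### Terms of isotropic form -/

/-- The terms with the weights `α`, `β`. -/
def IsoWeights (J : Finset (Fin 2)) (T : Fin 3 → Fun → Fun → Param → ℝ) (α β : Fin 2 → ℕ → ℕ → ℝ) :
    Prop :=
  ∀ i F G, InF F → InF G → ∀ p ∈ Par, T i F G p = ∑ j ∈ J, ∑ᶠ k : ℕ,
    W (α j k) (β j k) i (fam (hcoef j F (-1 - k)) p) (fam (hcoef j G (k - 1)) p)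

lemma IsotropicForm.exists_weights (h : IsotropicForm J T) : ∃ α β, IsoWeights J T α β := by
  obtain ⟨α, β, h⟩ := h
  refine ⟨α, fun j k l => β j k l * ((2 * l + 3) / (l + 1)), fun i F G hF hG p hp => ?_⟩
  rw [(h i F G hF hG p hp).2]
  refine Finset.sum_congr rfl fun j _ => ?_
  congr 1; ext k
  rw [W]
  congr 1; ext l
  exact deltaPf_isoFun (hF.hExp j) (hG.hExp j) hp _ _ i k l

variable {α β : Fin 2 → ℕ → ℕ → ℝ} {u w : Fin 2 → ℤ → E3 × Param → ℝ}

lemma IsoWeights.eq_single (h : IsoWeights J T α β) (hF : ∀ j, HExp j F (u j))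
    (hG : ∀ j, HExp j G (w j)) (hp : p ∈ Par) (hj : j ∈ J) (k : ℕ)
    (h0 : ∀ j' (k' : ℕ), ¬(j' = j ∧ k' = k) → fam (u j' (-1 - k')) p = 0) (i : Fin 3) :
    T i F G p = W (α j k) (β j k) i (fam (u j (-1 - k)) p) (fam (w j (k - 1)) p) := by
  rw [h i F G (InF.of_hExp hF) (InF.of_hExp hG) p hp]
  simp only [fun j => fam_hcoef (hF j) hp, fun j => fam_hcoef (hG j) hp]
  have hW : ∀ j' (k' : ℕ), ¬(j' = j ∧ k' = k) →
      W (α j' k') (β j' k') i (fam (u j' (-1 - k')) p) (fam (w j' (k' - 1)) p) = 0 :=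
    fun j' k' hjk => by
      rw [h0 j' k' hjk]
      have := W_smul_left (α j' k') (β j' k') i 0 0 (fam (w j' (k' - 1)) p)
      simpa using this
  rw [Finset.sum_eq_single_of_mem j hj, finsum_eq_single _ k]
  · exact fun k' hk => hW j k' fun h => hk h.2
  · intro j' _ hj'
    rw [finsum_eq_single _ 0 fun k' _ => hW j' k' fun h => hj' h.1]
    exact hW j' 0 fun h => hj' h.1

lemma IsoWeights.eq_zero (h : IsoWeights J T α β) (hF : ∀ j, HExp j F (u j)) (hG : InF G)
    (hp : p ∈ Par) (hj : j ∈ J) (h0 : ∀ j' (k' : ℕ), fam (u j' (-1 - k')) p = 0) (i : Fin 3) :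
    T i F G p = 0 := by
  rw [h.eq_single hF (fun j => hG.hExp j) hp hj 0 (fun j' k' _ => h0 j' k') i, h0]
  have := W_smul_left (α j 0) (β j 0) i 0 0 (fam (hcoef j G ((0 : ℕ) - 1)) p)
  simpa using this

lemma IsoWeights.testFun_left (h : IsoWeights J T α β) (hj : j ∈ J) {k : ℕ} {f g : E3 → ℝ}
    (hf : Hom1 (-1 - k) f) (hg : Hom1 (k - 1) g) (hp : p ∈ Par) (i : Fin 3) :
    T i (testFun j f) (testFun j g) p = W (α j k) (β j k) i (onS f) (onS g) := by
  rw [h.eq_single (hExp_testFun hf) (hExp_testFun hg) hp hj k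
    (fun j' k' hjk => fam_testCoef_ne (fun h => hjk ⟨h.1, by omega⟩) p) i,
    fam_testCoef_self, fam_testCoef_self]

lemma IsoWeights.testFun_regular (h : IsoWeights J T α β) (hj : j ∈ J) {m : ℤ} (hm : 0 ≤ m)
    {f : E3 → ℝ} (hf : Hom1 m f) (hG : InF G) (hp : p ∈ Par) (i : Fin 3) :
    T i (testFun j f) G p = 0 :=
  h.eq_zero (hExp_testFun hf) hG hp hj (fun j' k' => fam_testCoef_ne (fun h => by omega) p) i

/-- The singular coefficients of the derivative of a regular test function. -/
lemma fam_cpd_testCoef {f : E3 → ℝ} (hf : Hom1 0 f) (a : Letter) (hp : p ∈ Par) (j' : Fin 2) (k : ℕ) :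
    fam (cpd v a j' (testCoef j 0 f j') (-1 - k)) p =
      if j' = j ∧ k = 0 then ∑ l, a.disp v j p l • gradC l f else 0 := by
  have hu : ∀ m, Homog m (testCoef j 0 f j' m) := (hExp_testFun hf j').homog
  have h := congrFun (fams_cpd (v := v) hu a j' hp) (-1 - k)
  have e1 : fams (dps (testCoef j 0 f j') (a.paramDir v p)) p (-1 - k) = 0 := by
    have : testCoef j 0 f j' (-1 - k) = fun _ => 0 := by
      ext c; simp only [testCoef]; rw [if_neg]; omega
    have e0 : dps (testCoef j 0 f j') (a.paramDir v p) (-1 - k) = fun _ => 0 := by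
      ext c
      simp only [dps]
      rw [this]
      simp [dp]
    rw [fams, e0, fam]
    ext n
    rw [toC_apply continuous_const]
    rfl
  rw [fams] at h
  rw [h, Pi.add_apply, e1, zero_add, Finset.sum_apply]
  have e2 : ∀ l, fams (grads l (testCoef j 0 f j')) p (-1 - k) =
      if j' = j ∧ k = 0 then gradC l f else 0 := fun l => by
    rw [fams, fam_grads hu hp]
    split_ifs with hjk
    · obtain ⟨rfl, rfl⟩ := hjk
      simp [testCoef]
    · have : (fun z => testCoef j 0 f j' (-1 - k + 1) (z, p)) = fun _ => 0 := by
        ext z; simp only [testCoef]; rw [if_neg]; omega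
      rw [this]
      ext n
      rw [gradC_apply (hom1_const 0)]
      simp [pdx]
  simp only [Pi.smul_apply, e2]
  split_ifs with hjk
  · rw [hjk.1]
  · simp

variable {a : Fin 3 → Letter} {σ : ℝ}

/-- The weights of a system of derivatives. -/
lemma IsDerivativeSystem.weights (hD : IsDerivativeSystem s v A D) (hs : ∀ j, 0 < s j)
    (hv : ∀ j, ContDiff ℝ ∞ (v j)) (ha : ∀ i, a i ∈ A) (hσ : σ ≠ 0)
    (h : IsoWeights J (fun i => D [a i]) α β) (hj : j ∈ J)
    (hd : ∀ i p, (a i).disp v j p = σ • ex i) :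
    ∃ K : ℝ, ∀ k l, α j k l = σ * (4 * Real.pi) * isoA K k l ∧
      β j k l = σ * (4 * Real.pi) * isoB K k l := by
  obtain ⟨p, hp⟩ := exists_par
  -- the rule of integration by parts
  have hsym : ∀ (k : ℕ) {f g : E3 → ℝ}, Hom1 (-1 - k) f → Hom1 (k - 1) g →
      W (α j k) (β j k) 0 (onS f) (onS g) +
        (if k = 0 then W (α j k) (β j k) 0 (onS g) (onS f) else 0) =
      σ * (4 * Real.pi) * avg (coordC 0 * onS f * onS g) := fun k f g hf hg => by
    have h1 := hD.add_swap hs hv (ha 0) (inF_testFun (j := j) hf) (inF_testFun (j := j) hg)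
      decayPair_testFun hp
    rw [surf_testFun hf hg (by ring) (a 0) hp (hd 0 p)] at h1
    rw [← h1, ← h.testFun_left hj hf hg hp 0]
    congr 1
    -- For `k = 0` both functions have degree `-1` and the exchange stays within the same order. For
    -- `k ≥ 1` the degree `k - 1` of `g` is nonnegative, so the exchanged term has no singular
    -- coefficient to act on.
    split_ifs with hk
    · subst hk
      exact (h.testFun_left hj (k := 0) (hg.cast (by simp)) (hf.cast (by simp)) hp 0).symm
    · exact (h.testFun_regular hj (by omega) hg (inF_testFun hf) hp 0).symm
  have hX := avg_coord_reT_pos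
  -- Harmonics of degrees `l` and `l + 1` leave the single weight of `X_l(f, g)`; the opposite order
  -- isolates the other weight.
  have hAk : ∀ k l, k ≠ 0 → α j k l = σ * (4 * Real.pi) := fun k l hk => by
    obtain ⟨f, hf, -, ef⟩ := exists_hom1_harm (-1 - k) (reT l)
    obtain ⟨g, hg, -, eg⟩ := exists_hom1_harm (k - 1) (reT (l + 1))
    have h1 := hsym k hf hg
    rw [if_neg hk, ef, eg, W_harm_harm _ _ (reT_mem l) (reT_mem (l + 1)), add_zero] at h1
    exact mul_right_cancel₀ (hX l).ne' h1
  have hBk : ∀ k l, k ≠ 0 → β j k l = σ * (4 * Real.pi) := fun k l hk => by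
    obtain ⟨f, hf, -, ef⟩ := exists_hom1_harm (-1 - k) (reT (l + 1))
    obtain ⟨g, hg, -, eg⟩ := exists_hom1_harm (k - 1) (reT l)
    have h1 := hsym k hf hg
    rw [if_neg hk, ef, eg, W_swap, W_harm_harm _ _ (reT_mem l) (reT_mem (l + 1)), add_zero,
      show coordC 0 * harm (l + 1) (reT (l + 1)) * harm l (reT l) =
        coordC 0 * harm l (reT l) * harm (l + 1) (reT (l + 1)) by ring] at h1
    exact mul_right_cancel₀ (hX l).ne' h1
  -- At order `k = 0` integration by parts fixes only the sum of the two weights.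
  have hB0 : ∀ l, α j 0 l + β j 0 l = σ * (4 * Real.pi) := fun l => by
    obtain ⟨f, hf, -, ef⟩ := exists_hom1_harm (-1 - (0 : ℕ)) (reT l)
    obtain ⟨g, hg, -, eg⟩ := exists_hom1_harm ((0 : ℕ) - 1) (reT (l + 1))
    have h1 := hsym 0 hf hg
    rw [if_pos rfl, ef, eg, W_swap _ _ _ (harm (l + 1) _),
      W_harm_harm _ _ (reT_mem l) (reT_mem (l + 1)),
      W_harm_harm _ _ (reT_mem l) (reT_mem (l + 1)), ← add_mul] at h1
    exact mul_right_cancel₀ (hX l).ne' h1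
  -- the commutation of the derivatives
  have hcomm : ∀ {f g : E3 → ℝ}, Hom1 0 f → Hom1 (-1) g → ∀ i b,
      W (α j 0) (β j 0) i (gradC b f) (onS g) = W (α j 0) (β j 0) b (gradC i f) (onS g) :=
    fun {f g} hf hg i b => by
      have hF := inF_testFun (j := j) hf
      have hG := inF_testFun (j := j) hg
      have h1 := hD.comm_two hs hv (ha i) (ha b) hF hG decayPair_testFun hp
      -- `F` is regular and its terms vanish; only those survive in which a derivative acts on `F`
      -- and lowers its order to `-1`.
      have z1 : ∀ i b, pdParam v (a i) (D [a b] (testFun j f) (testFun j g)) p = 0 := fun i b => by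
        rw [pdParam_congr (g := fun _ => 0) (fun q hq =>
          h.testFun_regular hj le_rfl hf hG hq b) (a i) hp]
        simp [pdParam]
      have z2 : ∀ i b, D [a b] (testFun j f) (pd v (a i) (testFun j g)) p = 0 := fun i b =>
        h.testFun_regular hj le_rfl hf (hG.pd hv (a i)) hp b
      have z3 : ∀ i b, D [a i] (pd v (a b) (testFun j f)) (testFun j g) p =
          σ * W (α j 0) (β j 0) i (gradC b f) (onS g) := fun i b => by
        have e := h.eq_single (fun j' => (hExp_testFun (j := j) hf j').pd hv (a b))
          (hExp_testFun (j := j) hg) hp hj 0 (fun j' k' hjk => by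
            rw [fam_cpd_testCoef hf (a b) hp, if_neg hjk]) i
        have e1 : ∑ l, (σ • ex b : E3) l • gradC l f = σ • gradC b f := by
          rw [Finset.sum_eq_single b] <;> simp +contextual [ex]
        have e2 : fam (testCoef j (-1) g j (((0 : ℕ) : ℤ) - 1)) p = onS g := by
          rw [← fam_testCoef_self (j := j) (m := -1) p]; simp
        refine e.trans ?_
        rw [fam_cpd_testCoef hf (a b) hp, if_pos ⟨rfl, rfl⟩, hd, e1, e2, W_smul_left]
      rw [z1, z1, z2, z2, z3, z3] at h1
      simpa [hσ] using h1
  -- Commutation of two directions, tested with the real and imaginary harmonics of degree `l + 1`.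
  -- The two weights multiply the same antisymmetric quantity `P1 - P0`, which is nonzero.
  have hrec : ∀ l, (l + 2) * α j 0 l + (l + 1) * β j 0 (l + 1) = 0 := fun l => by
    obtain ⟨f, hf, ef, -⟩ := exists_hom1_harm 0 (reT (l + 1))
    obtain ⟨g, hg, -, eg⟩ := exists_hom1_harm (-1) (imT (l + 1))
    have h1 := hcomm hf hg 1 0
    have hm := imT_mem (l + 1)
    rw [eg, W_harm_right _ _ hm, W_harm_right _ _ hm, X_harm_left hm, X_harm_left hm,
      X_harm_right hm, X_harm_right hm, avg_harm_gradC hf, avg_harm_gradC hf,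
      avg_coord_harm_gradC hf, avg_coord_harm_gradC hf] at h1
    have h2 := mean_contr_pdx_antisymm hm hf 0 1
    have h3 := mean_contr_imT_pdx_ne hf ef
    set P1 := mean (fun z => uT l (contr 1 (imT (l + 1))) z * pdx 0 f z)
    set P0 := mean (fun z => uT l (contr 0 (imT (l + 1))) z * pdx 1 f z)
    have n1 : (l : ℝ) + 1 ≠ 0 := by positivity
    have n2 : (l : ℝ) + 2 ≠ 0 := by positivity
    have n3 : 2 * (l : ℝ) + 3 ≠ 0 := by positivity
    have n4 : P1 - P0 ≠ 0 := h3
    have h4 : (P1 - P0) * ((l + 1) * ((l + 2) * α j 0 l + (l + 1) * β j 0 (l + 1))) = 0 := by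
      field_simp at h1
      linear_combination (l + 2) * h1 + (2 * l + 3) * β j 0 (l + 1) * h2
    rcases mul_eq_zero.1 h4 with h5 | h5
    · exact absurd h5 n4
    · exact (mul_eq_zero.1 h5).resolve_left n1
  have hπ : σ * (4 * Real.pi) ≠ 0 := mul_ne_zero hσ (by positivity)
  set K := α j 0 0 / (σ * (4 * Real.pi)) with hK
  -- Eliminating `β_{l+1}` between the recursion and the sum rule gives the recursion of `Ccoef`,
  -- and `K` is defined by its initial value.
  have hA0 : ∀ l, α j 0 l = σ * (4 * Real.pi) * Ccoef K l := fun l => by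
    induction l with
    | zero => rw [Ccoef_zero, hK]; field_simp
    | succ l ih =>
      have h1 := hrec l
      have h2 := hB0 (l + 1)
      have n1 : (l : ℝ) + 1 ≠ 0 := by positivity
      rw [Ccoef_succ, mul_add, mul_one, mul_left_comm, ← ih]
      field_simp
      linear_combination (-1 : ℝ) * h1 + (l + 1) * h2
  refine ⟨K, fun k l => ?_⟩
  by_cases hk : k = 0
  · subst hk
    refine ⟨by rw [hA0, isoA, if_pos rfl], ?_⟩
    have := hB0 l
    rw [hA0] at this
    rw [isoB, if_pos rfl]
    linarith
  · rw [hAk k l hk, hBk k l hk, isoA, isoB, if_neg hk, if_neg hk]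
    simp

/-- Uniqueness of the isotropic first-order terms. -/
theorem IsDerivativeSystem.isotropic_unique (hD : IsDerivativeSystem s v A D) (hs : ∀ j, 0 < s j)
    (hv : ∀ j, ContDiff ℝ ∞ (v j)) (ha : ∀ i, a i ∈ A) (hσ : σ ≠ 0)
    (h : IsotropicForm J (fun i => D [a i])) (hd : ∀ j ∈ J, ∀ i p, (a i).disp v j p = σ • ex i) :
    ∃ K : Fin 2 → ℝ, ∀ i F G, InF F → InF G → ∀ p ∈ Par,
      D [a i] F G p = ∑ j ∈ J, σ * pointTerm (K j) j i F G p := by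
  obtain ⟨α, β, h⟩ := h.exists_weights
  have hK : ∀ j, ∃ K : ℝ, j ∈ J → ∀ k l, α j k l = σ * (4 * Real.pi) * isoA K k l ∧
      β j k l = σ * (4 * Real.pi) * isoB K k l := fun j => by
    by_cases hj : j ∈ J
    · obtain ⟨K, hK⟩ := hD.weights hs hv ha hσ h hj (hd j hj)
      exact ⟨K, fun _ => hK⟩
    · exact ⟨0, fun h => absurd h hj⟩
  choose K hK using hK
  refine ⟨K, fun i F G hF hG p hp => ?_⟩
  refine (h i F G hF hG p hp).trans ?_
  refine Finset.sum_congr rfl fun j hj => ?_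
  rw [pointTerm_eq (hF.hExp j) (hG.hExp j) hp,
    (tform_eq_finsum (hF.hExp j) hp (K j) i (fams (hcoef j G) p)).2, ← mul_assoc, ← smul_eq_mul,
    smul_finsum]
  congr 1; ext k
  rw [smul_eq_mul, W, W, ← tsum_mul_left]
  congr 1; ext l
  rw [(hK j hj k l).1, (hK j hj k l).2]
  simp only [fams]
  ring

end Hadamard
end

/-! ### Uniqueness of the source point and time derivatives. -/

noncomputable section
namespace Hadamard

variable {v : Fin 2 → ℝ → E3} {s : Fin 2 → ℝ} {A : Set Letter} {D : DistTerms}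
  {T T' : Fun → Fun → Param → ℝ} {j : Fin 2} {F G : Fun} {p : Param} {f g : E3 → ℝ}
  {b b' : Fin 2 → ℕ → Param → (S2 → ℝ) →ₗ[ℝ] (S2 → ℝ) →ₗ[ℝ] ℝ} {K : Fin 2 → ℝ}

/-! ### Terms of singular form -/

/-- The terms of singular form with given bilinear forms. -/
def SingularWeights (T : Fun → Fun → Param → ℝ)
    (b : Fin 2 → ℕ → Param → (S2 → ℝ) →ₗ[ℝ] (S2 → ℝ) →ₗ[ℝ] ℝ) : Prop :=
  ∀ F G, InF F → InF G → ∀ p ∈ Par,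
    T F G p = ∑ j, ∑ᶠ k : ℕ, b j k p (coef j F (-1 - k) p) (coef j G (k - 1) p)

lemma finite_support_singular (hF : InF F) (hp : p ∈ Par) (j : Fin 2) (g : ℕ → S2 → ℝ) :
    (Function.support fun k : ℕ => b j k p (coef j F (-1 - k) p) (g k)).Finite := by
  obtain ⟨N, hN⟩ := exists_low_nat (hF.hExp j).bdd
  refine (Set.finite_Iio (N + 1)).subset fun k hk => ?_
  by_contra h
  refine hk ?_
  have e : coef j F (-1 - (k : ℤ)) p = 0 := by
    ext n
    rw [coef_eq (hF.hExp j) _ hp, hN _ (by simp at h; omega)]; rfl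
  beta_reduce
  rw [e, map_zero, LinearMap.zero_apply]

lemma SingularWeights.sub (h : SingularWeights T b) (h' : SingularWeights T' b') :
    SingularWeights (fun F G p => T F G p - T' F G p) fun j k p => b j k p - b' j k p :=
  fun F G hF hG p hp => by
    simp only [h F G hF hG p hp, h' F G hF hG p hp, ← Finset.sum_sub_distrib, LinearMap.sub_apply]
    exact Finset.sum_congr rfl fun j _ => (finsum_sub_distrib (finite_support_singular hF hp j _)
      (finite_support_singular hF hp j _)).symm

lemma SingularWeights.eq_single (h : SingularWeights T b) (hF : InF F) (hG : InF G) (hp : p ∈ Par)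
    (j : Fin 2) (k : ℕ)
    (h0 : ∀ j' (k' : ℕ), ¬(j' = j ∧ k' = k) → coef j' F (-1 - k') p = 0) :
    T F G p = b j k p (coef j F (-1 - k) p) (coef j G (k - 1) p) := by
  have hz : ∀ j' (k' : ℕ), ¬(j' = j ∧ k' = k) →
      b j' k' p (coef j' F (-1 - k') p) (coef j' G (k' - 1) p) = 0 := fun j' k' hjk => by
    rw [h0 j' k' hjk, map_zero, LinearMap.zero_apply]
  rw [h F G hF hG p hp, Finset.sum_eq_single_of_mem j (Finset.mem_univ j), finsum_eq_single _ k]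
  · exact fun k' hk => hz j k' fun h => hk h.2
  · intro j' _ hj'
    rw [finsum_eq_single _ 0 fun k' _ => hz j' k' fun h => hj' h.1]
    exact hz j' 0 fun h => hj' h.1

lemma SingularWeights.testFun_left (h : SingularWeights T b) {k : ℕ} (hf : Hom1 (-1 - k) f)
    (hg : Hom1 (k - 1) g) (hp : p ∈ Par) (j : Fin 2) :
    T (testFun j f) (testFun j g) p = b j k p (fun n => f n) (fun n => g n) := by
  rw [h.eq_single (inF_testFun hf) (inF_testFun hg) hp j k (fun j' k' hjk => by
      rw [coef_testFun hf _ _ hp, if_neg fun h => hjk ⟨h.1, by omega⟩]),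
    coef_testFun hf _ _ hp, coef_testFun hg _ _ hp, if_pos ⟨rfl, rfl⟩, if_pos ⟨rfl, rfl⟩]

lemma SingularWeights.testFun_regular (h : SingularWeights T b) {m : ℤ} (hm : 0 ≤ m)
    (hf : Hom1 m f) (hG : InF G) (hp : p ∈ Par) (j : Fin 2) : T (testFun j f) G p = 0 := by
  have h0 : ∀ j' (k' : ℕ), coef j' (testFun j f) (-1 - k') p = 0 := fun j' k' => by
    rw [coef_testFun hf _ _ hp, if_neg fun h => by omega]
  rw [h.eq_single (inF_testFun hf) hG hp j 0 fun j' k' _ => h0 j' k', h0, map_zero,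
    LinearMap.zero_apply]

/-- A term of singular form that is antisymmetric with respect to the exchange and to the integration
by parts vanishes. -/
lemma SingularWeights.eq_zero (h : SingularWeights T b) (hv : ∀ j, ContDiff ℝ ∞ (v j))
    (hswap : ∀ F G, InF F → InF G → DecayPair v F G → ∀ p ∈ Par, T F G p = -T G F p)
    (hparts : ∀ i F G, InF F → InF G → DecayPair v F G → ∀ p ∈ Par,
      T (pd v (.x i) F) G p = -T F (pd v (.x i) G) p)
    (hF : InF F) (hG : InF G) (hp : p ∈ Par) : T F G p = 0 := by
  -- The exchange puts `g`, of degree `k - 1 ≥ 0`, into the slot where only singular coefficients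
  -- count.
  have hsucc : ∀ (j : Fin 2) (k : ℕ) {f g : E3 → ℝ}, k ≠ 0 → Hom1 (-1 - k) f → Hom1 (k - 1) g →
      b j k p (fun n => f n) (fun n => g n) = 0 := fun j k f g hk hf hg => by
    rw [← h.testFun_left hf hg hp j,
      hswap _ _ (inF_testFun hf) (inF_testFun hg) decayPair_testFun p hp,
      h.testFun_regular (by omega) hg (inF_testFun hf) hp, neg_zero]
  -- A gradient of a function of degree zero is a singular coefficient of order `-1` of the
  -- derivative of a regular test function. Moving the derivative to the other argument leaves a
  -- regular function in the first slot.
  have hpdx : ∀ (j : Fin 2) (i : Fin 3) {f g : E3 → ℝ}, Hom1 0 f → Hom1 (-1) g →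
      b j 0 p (fun n => pdx i f n) (fun n => g n) = 0 := fun j i f g hf hg => by
    have hF := inF_testFun (j := j) hf
    have hG := inF_testFun (j := j) hg
    have hc : ∀ j' (k : ℕ), coef j' (pd v (.x i) (testFun j f)) (-1 - k) p =
        if j' = j ∧ k = 0 then fun n : S2 => pdx i f n else 0 := fun j' k => by
      rw [coef_eq_fam ((hExp_testFun (j := j) hf j').pd hv (.x i)) _ hp,
        fam_cpd_testCoef hf (.x i) hp]
      split_ifs with hjk
      · ext n
        rw [disp_x, ← gradC_apply hf, ContinuousMap.sum_apply]
        exact sum_ex_mul i fun l => gradC l f n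
      · rfl
    have h1 := h.eq_single (hF.pd hv (.x i)) hG hp j 0 fun j' k' hjk => by rw [hc, if_neg hjk]
    rw [hc, if_pos ⟨rfl, rfl⟩, coef_testFun hg _ _ hp, if_pos ⟨rfl, by simp⟩] at h1
    rw [← h1, hparts i _ _ hF hG decayPair_testFun p hp,
      h.testFun_regular le_rfl hf (hG.pd hv _) hp, neg_zero]
  have hzero : ∀ (j : Fin 2) {f g : E3 → ℝ}, Hom1 (-1) f → Hom1 (-1) g →
      b j 0 p (fun n => f n) (fun n => g n) = 0 := fun j f g hf hg => by
    -- By Euler, `∑ ∂_i (x_i f) = 3 f - f = 2 f` in degree `-1`, and each `x_i f` has degree zero: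
    -- gradients exhaust the coefficients of order `-1`.
    have e : (fun n : S2 => f n) = (2⁻¹ : ℝ) • ∑ i, fun n : S2 => pdx i (fun z => z i * f z) n := by
      ext n
      have hn := S2_ne_zero n
      have h1 : ∀ i, pdx i (fun z => z i * f z) n = f n + (n : E3) i * pdx i f n := fun i => by
        rw [pdx_mul ((hom1_coord i).differentiableAt hn) (hf.differentiableAt hn), pdx_coord,
          if_pos rfl, one_mul]
      have h2 := hf.euler hn
      simp only [Pi.smul_apply, Finset.sum_apply, h1, Finset.sum_add_distrib, h2]
      simp
      ring
    rw [e, map_smul, map_sum, LinearMap.smul_apply, LinearMap.sum_apply,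
      Finset.sum_eq_zero fun i _ => hpdx j i (((hom1_coord i).mul hf).cast (by ring)) hg, smul_zero]
  have hall : ∀ (j : Fin 2) (k : ℕ) {f g : E3 → ℝ}, Hom1 (-1 - k) f → Hom1 (k - 1) g →
      b j k p (fun n => f n) (fun n => g n) = 0 := fun j k f g hf hg => by
    by_cases hk : k = 0
    · subst hk
      exact hzero j (hf.cast (by simp)) (hg.cast (by simp))
    · exact hsucc j k hk hf hg
  have hcoef : ∀ {F : Fun}, InF F → ∀ j a,
      coef j F a p = fun n : S2 => hcoef j F a ((n : E3), p) := fun hF j a => by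
    ext n
    exact coef_eq (hF.hExp j) a hp n
  rw [h F G hF hG p hp]
  refine Finset.sum_eq_zero fun j _ => ?_
  have : ∀ k : ℕ, b j k p (coef j F (-1 - k) p) (coef j G (k - 1) p) = 0 := fun k => by
    rw [hcoef hF, hcoef hG]
    exact hall j k (((hF.hExp j).homog _).slice hp) (((hG.hExp j).homog _).slice hp)
  simp [this]

/-- The space derivatives determine the other derivatives. -/
theorem IsDerivativeSystem.eq_firstTerm (hD : IsDerivativeSystem s v univ D) (hs : ∀ j, 0 < s j)
    (hv : ∀ j, ContDiff ℝ ∞ (v j))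
    (hx : ∀ i F G, InF F → InF G → ∀ p ∈ Par, D [.x i] F G p = firstTerm v K (.x i) F G p)
    {a : Letter} (ha : SingularForm (D [a])) (hF : InF F) (hG : InF G) (hp : p ∈ Par) :
    D [a] F G p = firstTerm v K a F G p := by
  obtain ⟨b, hb⟩ := ha
  obtain ⟨b', hb'⟩ := singularForm_pointTerm K (fun j i p => a.disp v j p i)
    (T := firstTerm v K a) fun F G _ _ p _ => rfl
  have h : SingularWeights (fun F G p => D [a] F G p - firstTerm v K a F G p) _ :=
    SingularWeights.sub (T := D [a]) hb hb'
  -- Both terms have the same surface terms, so their difference is antisymmetric under exchange.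
  refine sub_eq_zero.1 (h.eq_zero hv ?_ ?_ hF hG hp)
  · intro F G hF hG hd p hp
    have h1 := hD.add_swap hs hv (mem_univ a) hF hG hd hp
    have h2 := firstTerm_add_swap (v := v) hF hG hp K a
    linarith
  · intro i F G hF hG hd p hp
    -- Commutation with `∂_i` for both systems: the terms of `∂_i` agree and cancel, and `∂_i`
    -- annihilates functions of the parameters alone. What is left is integration by parts for the
    -- difference.
    have h1 := hD.comm_two hs hv (mem_univ a) (mem_univ (.x i)) hF hG hd hp
    have h2 := firstTerm_comm (K := K) hv hF hG hp a (.x i)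
    have z : ∀ g, pdParam v (.x i) g p = 0 := fun g => map_zero _
    rw [z, pdParam_congr (hx i F G hF hG) a hp, hx i F _ hF (hG.pd hv a) p hp,
      hx i _ G (hF.pd hv a) hG p hp] at h1
    rw [z] at h2
    linarith

end Hadamard
end

/-! ### Assembly of the theorem. -/

open Hadamard
open scoped ContDiff
theorem proposition6 (s : Fin 2 → ℝ) (hs : ∀ j, 0 < s j)
    (y : Fin 2 → ℝ → E3) (hy : ∀ j, ContDiff ℝ ∞ (y j)) :
    -- the series in the explicit distributional terms converge
    (∀ (K : ℝ) (j : Fin 2) (i : Fin 3) (F G : Fun), InF F → InF G → ∀ p ∈ Par,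
      Summable fun l => deltaPf j (pointFun K j i l F) G p) ∧
    -- the most general derivative with respect to one source point
    (∀ (j : Fin 2),
      (∀ D : DistTerms,
        IsDerivativeSystem s (fun j => deriv (y j)) (Set.range (Letter.y j)) D →
        IsotropicForm {j} (fun i => D [.y j i]) →
        ∃ K : ℝ, ∀ F G, InF F → InF G → ∀ p ∈ Par, ∀ i,
          D [.y j i] F G p = -pointTerm K j i F G p) ∧
      (∀ K : ℝ, ∃ D : DistTerms,
        IsDerivativeSystem s (fun j => deriv (y j)) (Set.range (Letter.y j)) D ∧
        IsotropicForm {j} (fun i => D [.y j i]) ∧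
        ∀ F G, InF F → InF G → ∀ p ∈ Par, ∀ i,
          D [.y j i] F G p = -pointTerm K j i F G p)) ∧
    -- the most general family of space, source point and time derivatives
    (∀ D : DistTerms,
      IsDerivativeSystem s (fun j => deriv (y j)) Set.univ D →
      IsotropicForm Finset.univ (fun i => D [.x i]) →
      (∀ j i, SingularForm (D [.y j i])) →
      SingularForm (D [.t]) →
      ∃ K : Fin 2 → ℝ, ∀ F G, InF F → InF G → ∀ p ∈ Par,
        (∀ i, D [.x i] F G p = ∑ j, pointTerm (K j) j i F G p) ∧
        (∀ j i, D [.y j i] F G p = -pointTerm (K j) j i F G p) ∧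
        D [.t] F G p = ∑ j, ∑ i, deriv (y j) p.1 i * D [.y j i] F G p) ∧
    (∀ K : Fin 2 → ℝ, ∃ D : DistTerms,
      IsDerivativeSystem s (fun j => deriv (y j)) Set.univ D ∧
      IsotropicForm Finset.univ (fun i => D [.x i]) ∧
      (∀ j i, SingularForm (D [.y j i])) ∧
      SingularForm (D [.t]) ∧
      ∀ F G, InF F → InF G → ∀ p ∈ Par,
        (∀ i, D [.x i] F G p = ∑ j, pointTerm (K j) j i F G p) ∧
        (∀ j i, D [.y j i] F G p = -pointTerm (K j) j i F G p) ∧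
        D [.t] F G p = ∑ j, ∑ i, deriv (y j) p.1 i * D [.y j i] F G p) := by
  have hv : ∀ j, ContDiff ℝ ∞ (deriv (y j)) := fun j => (contDiff_infty_iff_deriv.1 (hy j)).2
  refine ⟨fun K j i F G hF hG p hp => summable_deltaPf_pointFun hF hG hp K j i,
    fun j => ⟨fun D hD hiso => ?_, fun K => ?_⟩, fun D hD hiso hsing ht => ?_, fun K => ?_⟩
  -- For `_j∂_i` the relative displacement at the point `j` is `-e_i`, hence the sign `-1`.
  · obtain ⟨K, hK⟩ := hD.isotropic_unique (a := Letter.y j) (σ := -1) hs hv (fun i => ⟨i, rfl⟩)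
      (by norm_num) hiso fun j' hj' i p => by
        rw [disp_y, if_pos (Finset.mem_singleton.1 hj'), neg_one_smul]
    refine ⟨K j, fun F G hF hG p hp i => ?_⟩
    rw [hK i F G hF hG p hp, Finset.sum_singleton, neg_one_mul]
  -- The same constant is placed at both points; the letters `_j∂_i` displace the field point only
  -- relative to `y_j`, so the other point does not contribute.
  · refine ⟨derivSystem (fun j => deriv (y j)) fun _ => K,
      isDerivativeSystem_derivSystem hs hv _ _, ?_, fun F G _ _ p _ i => ?_⟩
    · refine isotropicForm_pointTerm {j} (-1) (fun _ => K) fun i F G _ _ p _ => ?_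
      rw [derivSystem_one, firstTerm_y, Finset.sum_singleton, neg_one_mul]
    · rw [derivSystem_one, firstTerm_y]
  -- The space derivatives displace the field point by `e_i` relative to both sources, so isotropy
  -- at the two points yields two independent constants. The other letters are then forced.
  · obtain ⟨K, hK⟩ := hD.isotropic_unique (a := Letter.x) (σ := 1) hs hv (fun i => mem_univ _)
      one_ne_zero hiso fun j _ i p => by rw [disp_x, one_smul]
    have hx : ∀ i F G, InF F → InF G → ∀ p ∈ Par,
        D [.x i] F G p = firstTerm (fun j => deriv (y j)) K (.x i) F G p :=
      fun i F G hF hG p hp => by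
        rw [hK i F G hF hG p hp, firstTerm_x]
        simp only [one_mul]
    refine ⟨K, fun F G hF hG p hp => ⟨fun i => ?_, fun j i => ?_, ?_⟩⟩
    · rw [hx i F G hF hG p hp, firstTerm_x]
    · rw [hD.eq_firstTerm hs hv hx (hsing j i) hF hG hp, firstTerm_y]
    · rw [hD.eq_firstTerm hs hv hx ht hF hG hp, firstTerm_t]
      simp only [fun j i => hD.eq_firstTerm hs hv hx (hsing j i) hF hG hp]
  · refine ⟨derivSystem (fun j => deriv (y j)) K, isDerivativeSystem_derivSystem hs hv _ _,
      isotropicForm_pointTerm _ 1 K fun i F G _ _ p _ => ?_,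
      fun j i => singularForm_pointTerm K (fun j' i' p => (Letter.y j i).disp _ j' p i')
        fun F G _ _ p _ => by rw [derivSystem_one, firstTerm],
      singularForm_pointTerm K (fun j' i' p => Letter.t.disp _ j' p i')
        fun F G _ _ p _ => by rw [derivSystem_one, firstTerm],
      fun F G _ _ p _ => ⟨fun i => ?_, fun j i => ?_, ?_⟩⟩
    · rw [derivSystem_one, firstTerm_x]
      simp only [one_mul]
    · rw [derivSystem_one, firstTerm_x]
    · rw [derivSystem_one, firstTerm_y]
    · simp only [derivSystem_one, firstTerm_t]
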